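/- **Setting.** Let $k\ge 1$ and $\alpha_1,\dots,\alpha_k,\beta_1,\dots,\beta_k>0$ with $\alpha_1\cdots\alpha_k=\beta_1\cdots\beta_k$. Put $$\Phi(z)=\frac{1}{(1-z^{-1})^k}\prod_{m=1}^k\begin{pmatrix}1&\alpha_m z^{-1}\\ \alpha_m^{-1}&1\end{pmatrix}\begin{pmatrix}1&\beta_m z^{-1}\\ \beta_m^{-1}&1\end{pmatrix}$$ (product ordered from left to right). Let $\rho_1(z),\rho_2(z)$ be the eigenvalues of $\Phi(z)$, ordered by $|\rho_2(z)|<|\rho_1(z)|$ for $z\in\mathbb C\setminus(-\infty,0]$, $z\ne 1$, and defined on $(-\infty,0]$ by continuity from the upper half plane. Let $E(z)$ be such that $\Phi(z)=E(z)\,\mathrm{diag}(\rho_1(z),\rho_2(z))\,E(z)^{-1}$ for all but finitely many $z$. All curves are piecewise $C^1$; closed curves are oriented counterclockwise unless stated otherwise. For even $N$, the correlation kernel of the $2\times k$-periodic Aztec diamond of size $kN\times kN$ is $$\big[K(2km,2\xi+i;2km',2\xi'+j)\big]_{i,j=0}^1=-\frac{\mathbb 1_{m>m'}}{2\pi i}\oint_{\gamma_{0,1}}\Phi(z)^{m-m'}z^{\xi'-\xi}\frac{dz}{z}$$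 $$+\frac1{(2\pi i)^2}\oint_{\gamma_1}\oint_{\gamma_{0,1}}\frac{w^{\xi'}}{z^{\xi+1}}\frac{(1-z^{-1})^{kN/2}}{(1-w^{-1})^{kN/2}}\rho_1(w)^{\frac N2-m'}E(w)\begin{pmatrix}1&0\\0&0\end{pmatrix}E(w)^{-1}\Phi(z)^{m-\frac N2}\frac{dz\,dw}{z-w},$$ where $\gamma_1$ is a simple closed curve around $1$ with $0$ in its exterior and $\gamma_{0,1}$ is a simple closed curve around $0$ and $\gamma_1$ (and hence around $1$), each meeting the real line in exactly two points. Let $p(z)=\big((z-1)^k\,\mathrm{Tr}\,\Phi(z)\big)^2-4(z-1)^{2k}$, a polynomial of degree $2k-1$ with real non-positive zeros of order at most two, and write $p=q^2p_0$ with $q,p_0$ having simple zeros and $q$ monic. Let $0=x_0>x_1>\dots>x_{2(k'-1)}$ be the zeros of $p_0$. Let $\mathcal R$ be the compact Riemann surface $\{w^2=p_0(z)\}$ together with its point at infinity, and let $C^+\subset\mathcal R$ consist of the point at infinity and the points $(z,w)$ with $z\in[0,\infty)$ or $z\in[x_{2\ell},x_{2\ell-1}]$ for some $1\le\ell\le k'-1$.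 Let $p_0(z)^{1/2}$ be the branch that is positive for $z>0$ and analytic off $(-\infty,x_{2(k'-1)}]\cup\bigcup_{\ell=0}^{k'-2}[x_{2\ell+1},x_{2\ell}]$, and let $\mathcal R_{12}\subset\mathcal R$ be the interior of the closure of $$\{(z,p_0(z)^{1/2}):\operatorname{Im}z>0\}\cup\{(z,-p_0(z)^{1/2}):\operatorname{Im}z<0\}.$$ On $\mathcal R$ let $\rho(z,w)=\tfrac12\mathrm{Tr}\,\Phi(z)+\frac{q(z)w}{2(z-1)^k}$, and for $(\chi,\eta)\in(-1,1)^2$ let $$F(z,w;\chi,\eta)=\tfrac k4(\eta+1)\log z-\tfrac k2\log(z-1)-\tfrac\chi2\log\rho(z,w)$$ (a multivalued function, whose critical points do not depend on the branches of the logarithms). The rough region $\mathcal G_R$ is the set of $(\chi,\eta)\in(-1,1)^2$ for which $F(\cdot;\chi,\eta)$ has a critical point in $\mathcal R\setminus C^+$; for such $(\chi,\eta)$ let $L(\chi,\eta)$ be the unique critical point of $F(\cdot;\chi,\eta)$ in $\mathcal R_{12}$ and let $z_1=z_1(\chi,\eta)$ be its first component. For $\kappa,\kappa',\zeta,\zeta'\in\mathbb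 Z$ put $$m=\tfrac N2(\chi+1)+e_\chi+\kappa,\quad m'=\tfrac N2(\chi+1)+e_\chi+\kappa',\quad \xi=\tfrac{kN}4(\eta-1)+e_\eta+\zeta,\quad \xi'=\tfrac{kN}4(\eta-1)+e_\eta+\zeta',$$ where $e_\chi,e_\eta\in[0,1)$ (depending on $N$) make these numbers integers. **Theorem.** Let $(\chi,\eta)\in\mathcal G_R$ and $\kappa,\kappa',\zeta,\zeta'\in\mathbb Z$. Then, as $N\to\infty$ through even integers, $$\big[K(2km,2\xi+i;2km',2\xi'+j)\big]_{i,j=0}^1\longrightarrow\big[K^{(\chi,\eta)}_{rough}(2k\kappa,2\zeta+i;2k\kappa',2\zeta'+j)\big]_{i,j=0}^1,$$ where $$\big[K^{(\chi,\eta)}_{rough}(2k\kappa,2\zeta+i;2k\kappa',2\zeta'+j)\big]_{i,j=0}^1=\frac{\mathbb 1_{\chi\le0}-\mathbb 1_{\kappa>\kappa'}}{2\pi i}\oint_{\gamma}\Phi(z)^{\kappa-\kappa'}z^{\zeta'-\zeta}\frac{dz}z$$ $$+\frac1{2\pi i}\int_{\gamma_{z_1}}z^{\zeta'-\zeta}\rho_{1+\mathbb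 1_{\chi\le0}}(z)^{\kappa-\kappa'}E(z)\begin{pmatrix}\mathbb 1_{\chi>0}&0\\0&\mathbb 1_{\chi\le0}\end{pmatrix}E(z)^{-1}\frac{dz}z.$$ Here $\gamma$ is any simple closed curve around $0$ and $1$, and $\gamma_{z_1}$ is any simple curve from $\overline{z_1}$ to $z_1$ which, apart from its end points, meets the real line only in $(1,\infty)$. If $z_1$ is real (which happens only for $\chi=0$, and then $z_1<0$), then $\gamma_{z_1}$ is a simple closed curve through $z_1$, traversed clockwise: it leaves $z_1$ into the upper half plane and returns from the lower half plane. -/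

import Mathlib

open Filter Topology Polynomial

noncomputable section

namespace Aztec

/-! ### Contours in the complex plane -/

/-- `γ : [0,1] → ℂ` is piecewise continuously differentiable. -/
def IsPiecewiseC1 (γ : ℝ → ℂ) : Prop :=
  ∃ (n : ℕ) (τ : ℕ → ℝ), Monotone τ ∧ τ 0 = 0 ∧ τ n = 1 ∧
    ∀ i < n, ContDiffOn ℝ 1 γ (Set.Icc (τ i) (τ (i + 1)))

/-- The contour integral `∫_γ f(z) dz`. -/
def pathIntegral (γ : ℝ → ℂ) (f : ℂ → ℂ) : ℂ :=
  ∫ t in (0 : ℝ)..1, f (γ t) * deriv γ t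

/-- A (piecewise `C¹`) simple closed curve. -/
structure IsSimpleClosed (γ : ℝ → ℂ) : Prop where
  piecewiseC1 : IsPiecewiseC1 γ
  closed : γ 0 = γ 1
  injOn : Set.InjOn γ (Set.Ico 0 1)

/-- The image of the curve `γ : [0,1] → ℂ`. -/
def curveImage (γ : ℝ → ℂ) : Set ℂ := γ '' Set.Icc 0 1

/-- The winding number of a closed curve about a point off the curve. -/
def windingNumber (γ : ℝ → ℂ) (a : ℂ) : ℂ :=
  (2 * Real.pi * Complex.I)⁻¹ * pathIntegral γ (fun z => (z - a)⁻¹)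

/-- `γ` goes once around `a` counterclockwise. -/
def Encircles (γ : ℝ → ℂ) (a : ℂ) : Prop := a ∉ curveImage γ ∧ windingNumber γ a = 1

/-- `a` lies in the exterior of the closed curve `γ`. -/
def HasInExterior (γ : ℝ → ℂ) (a : ℂ) : Prop := a ∉ curveImage γ ∧ windingNumber γ a = 0

/-- The curve meets the real line in exactly two points. -/
def MeetsRealLineTwice (γ : ℝ → ℂ) : Prop := (curveImage γ ∩ {z : ℂ | z.im = 0}).ncard = 2

/-- The inner contour: a simple closed curve around `1`, with `0` in its exterior, which
meets the real line in exactly two points. -/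
structure IsContourOne (γ : ℝ → ℂ) : Prop where
  simple : IsSimpleClosed γ
  around_one : Encircles γ 1
  zero_outside : HasInExterior γ 0
  meets_real : MeetsRealLineTwice γ

/-- The outer contour: a simple closed curve around `0` and the curve `γ₁` (together with the
point `1` which `γ₁` encloses), which meets the real line in exactly two points. -/
structure IsContourZeroOne (γ₁ γ : ℝ → ℂ) : Prop where
  simple : IsSimpleClosed γ
  around_zero : Encircles γ 0
  around_one : Encircles γ 1
  around_curve : ∀ w ∈ curveImage γ₁, Encircles γ w
  meets_real : MeetsRealLineTwice γ

/-- A simple curve from `conj z₁` to `z₁` which, apart from its end points, meets the real line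
only in `(1, ∞)`. If `z₁` is real then the curve is closed, and it is traversed clockwise: it
leaves `z₁` into the upper half plane and comes back to `z₁` from the lower half plane. -/
structure IsArc (z₁ : ℂ) (γ : ℝ → ℂ) : Prop where
  piecewiseC1 : IsPiecewiseC1 γ
  start : γ 0 = (starRingEnd ℂ) z₁
  finish : γ 1 = z₁
  injOn_left : Set.InjOn γ (Set.Ico 0 1)
  injOn_right : Set.InjOn γ (Set.Ioc 0 1)
  real_points : ∀ t ∈ Set.Ioo (0 : ℝ) 1, (γ t).im = 0 → 1 < (γ t).re
  clockwise : z₁.im = 0 →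
    (∀ᶠ t in 𝓝[>] (0 : ℝ), 0 < (γ t).im) ∧ (∀ᶠ t in 𝓝[<] (1 : ℝ), (γ t).im < 0)

/-! ### The matrix symbol, its eigenvalues and the finite kernel -/

variable {k : ℕ}

/-- `Φ(z) = (1 - z⁻¹)^{-k} ∏_{m=1}^{k} (1, α_m z⁻¹; α_m⁻¹, 1) (1, β_m z⁻¹; β_m⁻¹, 1)`,
the product being ordered from left to right. -/
def Phi (α β : Fin k → ℝ) (z : ℂ) : Matrix (Fin 2) (Fin 2) ℂ :=
  ((1 - z⁻¹) ^ k)⁻¹ •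
    (List.ofFn fun m : Fin k =>
      !![1, (α m : ℂ) * z⁻¹; (α m : ℂ)⁻¹, 1] * !![1, (β m : ℂ) * z⁻¹; (β m : ℂ)⁻¹, 1]).prod

/-- The two eigenvalues of a `2 × 2` matrix, by the quadratic formula; the one of larger modulus
comes first. -/
def eigenvaluesByModulus (M : Matrix (Fin 2) (Fin 2) ℂ) : ℂ × ℂ :=
  let s : ℂ := (M.trace ^ 2 - 4 * M.det) ^ (1 / 2 : ℂ)
  let a : ℂ := (M.trace + s) / 2
  let b : ℂ := (M.trace - s) / 2
  if ‖b‖ ≤ ‖a‖ then (a, b) else (b, a)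

open Classical in
/-- The eigenvalue `ρ₁` of `Φ`: the one of larger modulus for `z ∈ ℂ \ (-∞, 0]`, extended to
`(-∞, 0]` by continuity from the upper half plane. -/
def rho1 (α β : Fin k → ℝ) (z : ℂ) : ℂ :=
  if z ∈ Complex.slitPlane then (eigenvaluesByModulus (Phi α β z)).1
  else limUnder (𝓝[{u : ℂ | 0 < u.im}] z) fun u => (eigenvaluesByModulus (Phi α β u)).1

open Classical in
/-- The eigenvalue `ρ₂` of `Φ`: the one of smaller modulus for `z ∈ ℂ \ (-∞, 0]`, extended to
`(-∞, 0]` by continuity from the upper half plane. -/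
def rho2 (α β : Fin k → ℝ) (z : ℂ) : ℂ :=
  if z ∈ Complex.slitPlane then (eigenvaluesByModulus (Phi α β z)).2
  else limUnder (𝓝[{u : ℂ | 0 < u.im}] z) fun u => (eigenvaluesByModulus (Phi α β u)).2

/-- `E` diagonalizes `Φ`, with the eigenvalues in the order `ρ₁, ρ₂`, at all but finitely many
points. -/
def IsEigenvectorMatrix (α β : Fin k → ℝ) (E : ℂ → Matrix (Fin 2) (Fin 2) ℂ) : Prop :=
  {z : ℂ | ¬ (IsUnit (E z).det ∧
    Phi α β z = E z * Matrix.diagonal ![rho1 α β z, rho2 α β z] * (E z)⁻¹)}.Finite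

/-- The block `[K(2km, 2ξ+i; 2km', 2ξ'+j)]_{i,j=0,1}` of the correlation kernel of the
`2 × k`-periodic Aztec diamond of size `kN` with `N = 2n`, as a double contour integral. -/
def finiteKernel (α β : Fin k → ℝ) (E : ℂ → Matrix (Fin 2) (Fin 2) ℂ) (γ₁ γ₀₁ : ℝ → ℂ) (n : ℕ)
    (m ξ m' ξ' : ℤ) : Matrix (Fin 2) (Fin 2) ℂ :=
  Matrix.of fun i j =>
    -((if m' < m then 1 else 0) / (2 * Real.pi * Complex.I)) *
        pathIntegral γ₀₁ (fun z => (Phi α β z ^ (m - m')) i j * z ^ (ξ' - ξ) / z)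
      + 1 / (2 * Real.pi * Complex.I) ^ 2 *
        pathIntegral γ₁ (fun w => pathIntegral γ₀₁ (fun z =>
          w ^ ξ' / z ^ (ξ + 1) * ((1 - z⁻¹) ^ (k * n) / (1 - w⁻¹) ^ (k * n)) *
            rho1 α β w ^ ((n : ℤ) - m') *
            (E w * !![1, 0; 0, 0] * (E w)⁻¹ * Phi α β z ^ (m - (n : ℤ)) :
              Matrix (Fin 2) (Fin 2) ℂ) i j / (z - w)))

/-! ### The spectral curve -/

/-- The polynomial `(z - 1)^k Tr Φ(z)`. -/
def tracePoly (α β : Fin k → ℝ) : ℝ[X] :=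
  (List.ofFn fun m : Fin k =>
    (!![X + C (α m / β m), C (α m + β m);
        C ((α m)⁻¹ + (β m)⁻¹) * X, X + C (β m / α m)] : Matrix (Fin 2) (Fin 2) ℝ[X])).prod.trace

/-- On `ℂ \ {0, 1}` the polynomial `tracePoly` is indeed `(z - 1)^k Tr Φ(z)`. -/
theorem aeval_tracePoly (α β : Fin k → ℝ) (hα : ∀ m, α m ≠ 0) (hβ : ∀ m, β m ≠ 0) (z : ℂ)
    (hz0 : z ≠ 0) (hz1 : z ≠ 1) :
    aeval z (tracePoly α β) = (z - 1) ^ k * (Phi α β z).trace := by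
  have hsub : z - 1 ≠ 0 := sub_ne_zero.mpr hz1
  let φ : Matrix (Fin 2) (Fin 2) ℝ[X] →+* Matrix (Fin 2) (Fin 2) ℂ :=
    (aeval (R := ℝ) z).toRingHom.mapMatrix
  have htr : ∀ M : Matrix (Fin 2) (Fin 2) ℝ[X], aeval z M.trace = (φ M).trace := by
    intro M
    simp [φ, Matrix.trace_fin_two]
  have hscal : ∀ (l : List (Matrix (Fin 2) (Fin 2) ℂ)),
      (l.map fun M => z • M).prod = z ^ l.length • l.prod := by
    intro l
    induction l with
    | nil => simp
    | cons a l ih =>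
      simp only [List.map_cons, List.prod_cons, ih, List.length_cons, Matrix.smul_mul,
        Matrix.mul_smul, smul_smul, pow_succ]
  have hlist : (List.ofFn fun m : Fin k =>
      φ !![X + C (α m / β m), C (α m + β m);
        C ((α m)⁻¹ + (β m)⁻¹) * X, X + C (β m / α m)]) =
      (List.ofFn fun m : Fin k => !![1, (α m : ℂ) * z⁻¹; (α m : ℂ)⁻¹, 1] *
        !![1, (β m : ℂ) * z⁻¹; (β m : ℂ)⁻¹, 1]).map fun M => z • M := by
    rw [List.map_ofFn]
    congr 1
    funext m
    have h1 : (α m : ℂ) ≠ 0 := by exact_mod_cast hα m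
    have h2 : (β m : ℂ) ≠ 0 := by exact_mod_cast hβ m
    ext i j
    fin_cases i <;> fin_cases j <;>
      simp [φ] <;> field_simp <;> ring
  rw [tracePoly, htr, map_list_prod, List.map_ofFn]
  have hcomp : (⇑φ ∘ fun m : Fin k => (!![X + C (α m / β m), C (α m + β m);
        C ((α m)⁻¹ + (β m)⁻¹) * X, X + C (β m / α m)] : Matrix (Fin 2) (Fin 2) ℝ[X])) =
      fun m : Fin k => φ !![X + C (α m / β m), C (α m + β m);
        C ((α m)⁻¹ + (β m)⁻¹) * X, X + C (β m / α m)] := rfl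
  rw [hcomp, hlist, hscal, Phi, Matrix.trace_smul, Matrix.trace_smul, List.length_ofFn,
    smul_eq_mul, smul_eq_mul, ← mul_assoc]
  congr 1
  have : 1 - z⁻¹ = (z - 1) / z := by field_simp
  rw [this, div_pow]
  field_simp

/-- The discriminant `p(z) = ((z-1)^k Tr Φ(z))² - 4 (z-1)^{2k}`. -/
def discPoly (α β : Fin k → ℝ) : ℝ[X] := tracePoly α β ^ 2 - 4 * (X - 1) ^ (2 * k)

/-- The monic polynomial `q` in the factorization `p = q² p₀` (`q`, `p₀` with simple zeros; the
zeros of `p` are real and at most double). -/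
def qPoly (α β : Fin k → ℝ) : ℝ[X] :=
  ∏ x ∈ (discPoly α β).roots.toFinset, (X - C x) ^ ((discPoly α β).rootMultiplicity x / 2)

/-- The polynomial `p₀` in the factorization `p = q² p₀`. -/
def p0 (α β : Fin k → ℝ) : ℝ[X] := discPoly α β /ₘ (qPoly α β) ^ 2

/-- The factorization `p = q² p₀`. -/
theorem discPoly_eq (α β : Fin k → ℝ) : discPoly α β = qPoly α β ^ 2 * p0 α β := by
  have hm : (qPoly α β ^ 2).Monic :=
    (monic_prod_of_monic _ _ fun x _ => (monic_X_sub_C x).pow _).pow 2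
  have hd : qPoly α β ^ 2 ∣ discPoly α β := by
    refine dvd_trans ?_ (prod_multiset_X_sub_C_dvd (discPoly α β))
    rw [Finset.prod_multiset_map_count, qPoly, ← Finset.prod_pow]
    refine Finset.prod_dvd_prod_of_dvd _ _ fun x _ => ?_
    rw [← pow_mul, count_roots]
    exact pow_dvd_pow _ (Nat.div_mul_le_self _ _)
  rw [p0]
  have h := modByMonic_add_div (discPoly α β) (qPoly α β ^ 2)
  rw [(modByMonic_eq_zero_iff_dvd hm).mpr hd, zero_add] at h
  exact h.symm

/-- The zeros `x_0 > x_1 > ⋯ > x_{2(k'-1)}` of `p₀`, in decreasing order. -/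
def branchPoint (α β : Fin k → ℝ) (l : ℕ) : ℝ :=
  ((p0 α β).roots.sort (· ≥ ·)).getD l 0

/-- The number `k'`, where `p₀` has degree `2k' - 1`. -/
def kPrime (α β : Fin k → ℝ) : ℕ := ((p0 α β).natDegree + 1) / 2

/-- The affine part of the Riemann surface `w² = p₀(z)`. Its only further point, at infinity,
belongs to the real loop `C_0^+`. -/
def Curve (α β : Fin k → ℝ) : Set (ℂ × ℂ) := {P | P.2 ^ 2 = aeval P.1 (p0 α β)}

/-- The union `C^+` (without the point at infinity) of the loops of the surface which lie over
`[0, ∞)` and over `[x_{2ℓ}, x_{2ℓ-1}]`, `ℓ = 1, …, k'-1`. -/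
def realLoops (α β : Fin k → ℝ) : Set (ℂ × ℂ) :=
  {P | P ∈ Curve α β ∧ ∃ x : ℝ, P.1 = x ∧ (0 ≤ x ∨ ∃ l : ℕ, 1 ≤ l ∧ l + 1 ≤ kPrime α β ∧
    branchPoint α β (2 * l) ≤ x ∧ x ≤ branchPoint α β (2 * l - 1))}

/-- The branch `p₀(z)^{1/2}` which is positive for `z > 0`, analytic off the intervals
`(-∞, x_{2(k'-1)}]`, `[x_{2ℓ+1}, x_{2ℓ}]`, and on these the limit from the upper half plane.
(The zeros of `p₀` lie in `(-∞, 0]`, and the principal square root is on `(-∞, 0)` the limit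
from the upper half plane.) -/
def sqrtP0 (α β : Fin k → ℝ) (z : ℂ) : ℂ :=
  (Real.sqrt (p0 α β).leadingCoeff : ℂ) *
    ((p0 α β).roots.map fun x : ℝ => (z - (x : ℂ)) ^ (1 / 2 : ℂ)).prod

/-- `ℛ₁₂`: the interior, in the surface, of the closure of the union of the upper half plane of
the first sheet and the lower half plane of the second sheet. -/
def R12 (α β : Fin k → ℝ) : Set (ℂ × ℂ) :=
  Subtype.val '' interior (closure {P : Curve α β |
    (0 < P.1.1.im ∧ P.1.2 = sqrtP0 α β P.1.1) ∨ (P.1.1.im < 0 ∧ P.1.2 = -sqrtP0 α β P.1.1)})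

/-- The meromorphic function `ρ(z,w) = ½ Tr Φ(z) + q(z) w / (2 (z-1)^k)` on the surface. -/
def rhoCurve (α β : Fin k → ℝ) (P : ℂ × ℂ) : ℂ :=
  (Phi α β P.1).trace / 2 + aeval P.1 (qPoly α β) * P.2 / (2 * (P.1 - 1) ^ k)

/-- `P` is a critical point of the multivalued function
`F(z,w;χ,η) = (k/4)(η+1) log z - (k/2) log (z-1) - (χ/2) log ρ(z,w)` on the surface:
in a local holomorphic parametrization `t ↦ (u t, v t)` of the surface with `t = 0` at `P`,
the derivative at `t = 0` of (any branch of) `F (u t, v t)` vanishes. The points over `z = 0`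
and `z = 1` are singularities of `F`. -/
def IsCriticalPoint (α β : Fin k → ℝ) (χ η : ℝ) (P : ℂ × ℂ) : Prop :=
  P.1 ≠ 0 ∧ P.1 ≠ 1 ∧ ∃ u v : ℂ → ℂ,
    AnalyticAt ℂ u 0 ∧ AnalyticAt ℂ v 0 ∧ (u 0, v 0) = P ∧
    (deriv u 0 ≠ 0 ∨ deriv v 0 ≠ 0) ∧
    (∀ᶠ t in 𝓝 (0 : ℂ), (u t, v t) ∈ Curve α β) ∧
    (k : ℂ) / 4 * (η + 1) * logDeriv u 0 - (k : ℂ) / 2 * logDeriv (fun t => u t - 1) 0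
      - (χ : ℂ) / 2 * logDeriv (fun t => rhoCurve α β (u t, v t)) 0 = 0

/-- The rough region: `F(·;χ,η)` has a critical point off the real loops. -/
def roughRegion (α β : Fin k → ℝ) : Set (ℝ × ℝ) :=
  {c | c.1 ∈ Set.Ioo (-1) 1 ∧ c.2 ∈ Set.Ioo (-1) 1 ∧
    ∃ P ∈ Curve α β \ realLoops α β, IsCriticalPoint α β c.1 c.2 P}

/-- The map `L`: the (unique) critical point of `F(·;χ,η)` in `ℛ₁₂`, for `(χ,η)` in the rough
region. -/
def L (α β : Fin k → ℝ) (χ η : ℝ) : ℂ × ℂ :=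
  Classical.epsilon fun P : ℂ × ℂ => P ∈ R12 α β ∧ IsCriticalPoint α β χ η P

/-! ### Local coordinates and the limiting kernel -/

/-- `m = N(χ+1)/2 + e_χ + κ` for `N = 2n`, with `e_χ ∈ [0,1)` such that `m` is an integer. -/
def localTime (χ : ℝ) (n : ℕ) (κ : ℤ) : ℤ := ⌈(n : ℝ) * (χ + 1)⌉ + κ

/-- `ξ = kN(η-1)/4 + e_η + ζ` for `N = 2n`, with `e_η ∈ [0,1)` such that `ξ` is an integer. -/
def localHeight (k : ℕ) (η : ℝ) (n : ℕ) (ζ : ℤ) : ℤ := ⌈(k : ℝ) * n * (η - 1) / 2⌉ + ζ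

/-- The block `[K_rough(2kκ, 2ζ+i; 2kκ', 2ζ'+j)]_{i,j=0,1}`, where `γ` is a simple closed curve
around `0` and `1`, and `γz` is a curve from `conj z₁` to `z₁`. -/
def roughKernel (α β : Fin k → ℝ) (E : ℂ → Matrix (Fin 2) (Fin 2) ℂ) (γ γz : ℝ → ℂ) (χ : ℝ)
    (κ ζ κ' ζ' : ℤ) : Matrix (Fin 2) (Fin 2) ℂ :=
  Matrix.of fun i j =>
    ((if χ ≤ 0 then 1 else 0) - (if κ' < κ then 1 else 0)) / (2 * Real.pi * Complex.I) *
        pathIntegral γ (fun z => (Phi α β z ^ (κ - κ')) i j * z ^ (ζ' - ζ) / z)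
      + 1 / (2 * Real.pi * Complex.I) *
        pathIntegral γz (fun z =>
          z ^ (ζ' - ζ) * (if χ ≤ 0 then rho2 α β z else rho1 α β z) ^ (κ - κ') *
            (E z * !![if 0 < χ then 1 else 0, 0; 0, if χ ≤ 0 then 1 else 0] * (E z)⁻¹ :
              Matrix (Fin 2) (Fin 2) ℂ) i j / z)

end Aztec

end

noncomputable section

namespace Aztec

open MeasureTheory Set

/-! ### Calculus along curves -/

/-- A continuous curve on `[a, b]`, differentiable with bounded derivative off a finite set. -/
structure IsTame (γ : ℝ → ℂ) (a b : ℝ) : Prop where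
  continuousOn : ContinuousOn γ (Icc a b)
  bound : ∃ (s : Set ℝ) (C : ℝ), s.Finite ∧ ∀ t ∈ Ioo a b \ s,
    DifferentiableAt ℝ γ t ∧ ‖deriv γ t‖ ≤ C

theorem IsTame.refl (γ : ℝ → ℂ) (a : ℝ) : IsTame γ a a :=
  ⟨by simp, ∅, 0, finite_empty, by simp⟩

theorem IsTame.of_contDiffOn {γ : ℝ → ℂ} {a b : ℝ} (hγ : ContDiffOn ℝ 1 γ (Icc a b)) :
    IsTame γ a b := by
  refine ⟨hγ.continuousOn, ?_⟩
  rcases lt_or_ge a b with hab | hab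
  · obtain ⟨C, hC⟩ := isCompact_Icc.exists_bound_of_continuousOn
      (hγ.continuousOn_derivWithin (uniqueDiffOn_Icc hab) le_rfl)
    refine ⟨∅, C, finite_empty, fun t ht => ?_⟩
    have ht' : t ∈ Ioo a b := ht.1
    have hn : Icc a b ∈ 𝓝 t := Icc_mem_nhds ht'.1 ht'.2
    refine ⟨((hγ t (Ioo_subset_Icc_self ht')).contDiffAt hn).differentiableAt one_ne_zero, ?_⟩
    rw [← derivWithin_of_mem_nhds hn]
    exact hC t (Ioo_subset_Icc_self ht')
  · exact ⟨∅, 0, finite_empty, by simp [Ioo_eq_empty (not_lt.mpr hab)]⟩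

theorem IsTame.trans {γ : ℝ → ℂ} {a b c : ℝ} (hab : a ≤ b) (hbc : b ≤ c) (h₁ : IsTame γ a b)
    (h₂ : IsTame γ b c) : IsTame γ a c := by
  obtain ⟨s, C, hs, hC⟩ := h₁.bound
  obtain ⟨s', C', hs', hC'⟩ := h₂.bound
  refine ⟨?_, s ∪ s' ∪ {b}, max C C', (hs.union hs').union (finite_singleton b), ?_⟩
  · rw [← Icc_union_Icc_eq_Icc hab hbc]
    exact h₁.continuousOn.union_of_isClosed h₂.continuousOn isClosed_Icc isClosed_Icc
  · rintro t ⟨ht, hts⟩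
    simp only [mem_union, mem_singleton_iff, not_or] at hts
    rcases lt_or_gt_of_ne hts.2 with h | h
    · exact (hC t ⟨⟨ht.1, h⟩, hts.1.1⟩).imp_right fun h => h.trans (le_max_left _ _)
    · exact (hC' t ⟨⟨h, ht.2⟩, hts.1.2⟩).imp_right fun h => h.trans (le_max_right _ _)

theorem IsPiecewiseC1.isTame {γ : ℝ → ℂ} (hγ : IsPiecewiseC1 γ) : IsTame γ 0 1 := by
  obtain ⟨n, τ, hτ, h0, h1, h⟩ := hγ
  have key : ∀ m ≤ n, IsTame γ (τ 0) (τ m) := by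
    intro m
    induction m with
    | zero => exact fun _ => IsTame.refl _ _
    | succ m ih =>
      intro hm
      exact (ih (by omega)).trans (hτ (Nat.zero_le _)) (hτ (Nat.le_succ m))
        (IsTame.of_contDiffOn (h m (by omega)))
  simpa [h0, h1] using key n le_rfl

theorem IsTame.intervalIntegrable {γ : ℝ → ℂ} {a b : ℝ} (hab : a ≤ b) (hγ : IsTame γ a b)
    {g : ℝ → ℂ} (hg : ContinuousOn g (Ioo a b)) {M : ℝ} (hM : ∀ t ∈ Ioo a b, ‖g t‖ ≤ M) :
    IntervalIntegrable (fun t => g t * deriv γ t) volume a b := by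
  rw [intervalIntegrable_iff_integrableOn_Ioo_of_le hab]
  obtain ⟨s, C, hs, hC⟩ := hγ.bound
  have hm : AEStronglyMeasurable (fun t => g t * deriv γ t) (volume.restrict (Ioo a b)) :=
    (hg.aestronglyMeasurable measurableSet_Ioo).mul (measurable_deriv γ).aestronglyMeasurable
  refine Integrable.mono' (g := fun _ => M * C) (integrable_const _) hm ?_
  rw [ae_restrict_iff' measurableSet_Ioo]
  have : ∀ᵐ t ∂(volume : Measure ℝ), t ∉ s := hs.countable.ae_notMem volume
  filter_upwards [this] with t hts ht
  rw [norm_mul]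
  exact mul_le_mul (hM t ht) (hC t ⟨ht, hts⟩).2 (norm_nonneg _) ((norm_nonneg _).trans (hM t ht))

/-- Fundamental theorem of calculus along a curve, with limits at the end points. -/
theorem IsTame.integral_eq {γ : ℝ → ℂ} {a b : ℝ} (hab : a < b) (hγ : IsTame γ a b) {Ω : Set ℂ}
    {F f : ℂ → ℂ} (hF : ∀ z ∈ Ω, HasDerivAt F (f z) z) (hf : ContinuousOn f Ω)
    (hΩ : MapsTo γ (Ioo a b) Ω) {M : ℝ} (hM : ∀ t ∈ Ioo a b, ‖f (γ t)‖ ≤ M) {la lb : ℂ}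
    (hla : Tendsto (fun t => F (γ t)) (𝓝[>] a) (𝓝 la))
    (hlb : Tendsto (fun t => F (γ t)) (𝓝[<] b) (𝓝 lb)) :
    ∫ t in a..b, f (γ t) * deriv γ t = lb - la := by
  obtain ⟨s, C, hs, hC⟩ := hγ.bound
  have hint := hγ.intervalIntegrable hab.le (g := fun t => f (γ t))
    (hf.comp (hγ.continuousOn.mono Ioo_subset_Icc_self) hΩ) hM
  let φ : ℝ → ℂ := fun t => if t = a then la else if t = b then lb else F (γ t)
  have hφ : ∀ t ∈ Ioo a b, φ =ᶠ[𝓝 t] fun t => F (γ t) := by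
    intro t ht
    filter_upwards [Ioo_mem_nhds ht.1 ht.2] with u hu
    simp [φ, hu.1.ne', hu.2.ne]
  have hcont : ∀ t ∈ Ioo a b, ContinuousAt (fun t => F (γ t)) t := by
    intro t ht
    exact ContinuousAt.comp (g := F) (hF _ (hΩ ht)).continuousAt
      ((hγ.continuousOn t (Ioo_subset_Icc_self ht)).continuousAt (Icc_mem_nhds ht.1 ht.2))
  have hφc : ContinuousOn φ (Icc a b) := by
    intro t ht
    rcases eq_or_lt_of_le ht.1 with rfl | h1
    · have : ContinuousWithinAt φ (Ioi a) a := by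
        have : φ a = la := by simp [φ]
        rw [ContinuousWithinAt, this]
        refine hla.congr' ?_
        filter_upwards [Ioo_mem_nhdsGT hab] with u hu
        simp [φ, hu.1.ne', hu.2.ne]
      exact (continuousWithinAt_Ioi_iff_Ici.mp this).mono Icc_subset_Ici_self
    rcases eq_or_lt_of_le ht.2 with rfl | h2
    · have : ContinuousWithinAt φ (Iio t) t := by
        have : φ t = lb := by simp [φ, h1.ne']
        rw [ContinuousWithinAt, this]
        refine hlb.congr' ?_
        filter_upwards [Ioo_mem_nhdsLT hab] with u hu
        simp [φ, hu.1.ne', hu.2.ne]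
      exact (continuousWithinAt_Iio_iff_Iic.mp this).mono Icc_subset_Iic_self
    · exact ((hcont t ⟨h1, h2⟩).congr (hφ t ⟨h1, h2⟩).symm).continuousWithinAt
  have := MeasureTheory.integral_eq_of_hasDerivAt_off_countable φ
    (fun t => f (γ t) * deriv γ t) hs.countable (by rwa [uIcc_of_le hab.le]) (by
      rintro t ⟨ht, hts⟩
      rw [min_eq_left hab.le, max_eq_right hab.le] at ht
      have h1 := (hF _ (hΩ ht)).comp_of_eq t (hC t ⟨ht, hts⟩).1.hasDerivAt rfl
      exact h1.congr_of_eventuallyEq (hφ t ht)) hint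
  rw [this]
  simp [φ, hab.ne']

/-- A primitive on `Ω` has boundary values wherever its derivative is bounded near a point of
which the nearby part of `Ω` is convex. -/
theorem exists_tendsto_of_bounded_deriv {Ω : Set ℂ} {F f : ℂ → ℂ} {z₀ : ℂ} {ε M : ℝ} (hε : 0 < ε)
    (hconv : Convex ℝ (Ω ∩ Metric.ball z₀ ε)) (hF : ∀ z ∈ Ω, HasDerivAt F (f z) z)
    (hM : ∀ z ∈ Ω ∩ Metric.ball z₀ ε, ‖f z‖ ≤ M) (hz₀ : z₀ ∈ closure Ω) :
    ∃ l, Tendsto F (𝓝[Ω] z₀) (𝓝 l) := by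
  have hL : LipschitzOnWith (Real.toNNReal M) F (Ω ∩ Metric.ball z₀ ε) := by
    refine hconv.lipschitzOnWith_of_nnnorm_hasDerivWithin_le
      (fun z hz => (hF z hz.1).hasDerivWithinAt) fun z hz => ?_
    rw [← NNReal.coe_le_coe, coe_nnnorm]
    exact (hM z hz).trans (Real.le_coe_toNNReal M)
  have hne : (𝓝[Ω] z₀).NeBot := mem_closure_iff_nhdsWithin_neBot.mp hz₀
  have hc : Cauchy (map F (𝓝[Ω ∩ Metric.ball z₀ ε] z₀)) := by
    have : (𝓝[Ω ∩ Metric.ball z₀ ε] z₀).NeBot := by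
      rw [nhdsWithin_inter', inf_eq_left.mpr]
      · exact hne
      · exact le_principal_iff.mpr (nhdsWithin_le_nhds (Metric.ball_mem_nhds _ hε))
    exact Cauchy.map_of_le (cauchy_nhds.mono' this nhdsWithin_le_nhds) hL.uniformContinuousOn
      (le_principal_iff.mpr self_mem_nhdsWithin)
  obtain ⟨l, hl⟩ := CompleteSpace.complete hc
  refine ⟨l, ?_⟩
  have : 𝓝[Ω] z₀ ≤ 𝓝[Ω ∩ Metric.ball z₀ ε] z₀ := by
    rw [nhdsWithin_inter']
    exact le_inf le_rfl
      (le_principal_iff.mpr (nhdsWithin_le_nhds (Metric.ball_mem_nhds _ hε)))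
  exact (map_mono this).trans hl

/-- Holomorphic functions on star-shaped open sets have primitives. -/
theorem exists_primitive_of_starConvex {U : Set ℂ} (hU : IsOpen U) {z₀ : ℂ}
    (hs : StarConvex ℝ z₀ U) {f : ℂ → ℂ} (hf : DifferentiableOn ℂ f U) :
    ∃ F : ℂ → ℂ, ∀ z ∈ U, HasDerivAt F (f z) z := by
  let G : ℂ → ℝ → ℂ := fun z t => f (z₀ + t * (z - z₀))
  refine ⟨fun z => (z - z₀) * ∫ t in (0 : ℝ)..1, G z t, fun z₁ hz₁ => ?_⟩
  have hmem : ∀ z ∈ U, ∀ t ∈ Icc (0 : ℝ) 1, z₀ + t * (z - z₀) ∈ U := by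
    intro z hz t ht
    have := hs hz (sub_nonneg.mpr ht.2) ht.1 (by ring)
    convert this using 1
    simp only [Complex.real_smul]
    push_cast
    ring
  obtain ⟨ε, hε, hball⟩ := Metric.isOpen_iff.mp hU z₁ hz₁
  have hball' : Metric.closedBall z₁ (ε / 2) ⊆ U :=
    (Metric.closedBall_subset_ball (by linarith)).trans hball
  have hdf : DifferentiableOn ℂ (deriv f) U := hf.deriv hU
  have hcont : Continuous fun p : ℝ × ℂ => z₀ + (p.1 : ℂ) * (p.2 - z₀) := by fun_prop
  have hKc : IsCompact (Icc (0 : ℝ) 1 ×ˢ Metric.closedBall z₁ (ε / 2)) :=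
    isCompact_Icc.prod (isCompact_closedBall _ _)
  obtain ⟨C, hC⟩ := hKc.exists_bound_of_continuousOn
    (f := fun p : ℝ × ℂ => (p.1 : ℂ) * deriv f (z₀ + (p.1 : ℂ) * (p.2 - z₀))) (by
      refine ContinuousOn.mul (by fun_prop) (hdf.continuousOn.comp hcont.continuousOn ?_)
      rintro ⟨t, z⟩ ⟨ht, hz⟩
      exact hmem z (hball' hz) t ht)
  have hGc : ∀ z ∈ U, ContinuousOn (G z) (Icc 0 1) := by
    intro z hz
    refine hf.continuousOn.comp (by fun_prop) fun t ht => hmem z hz t ht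
  have hGi : ∀ z ∈ U, IntervalIntegrable (G z) volume 0 1 := fun z hz =>
    ContinuousOn.intervalIntegrable (by rw [uIcc_of_le zero_le_one]; exact hGc z hz)
  have hdc : ContinuousOn (fun t : ℝ => (t : ℂ) * deriv f (z₀ + (t : ℂ) * (z₁ - z₀)))
      (Icc 0 1) :=
    ContinuousOn.mul (by fun_prop)
      (hdf.continuousOn.comp (by fun_prop) fun t ht => hmem z₁ hz₁ t ht)
  have hd := (intervalIntegral.hasDerivAt_integral_of_dominated_loc_of_deriv_le (𝕜 := ℂ)
    (μ := volume) (a := 0) (b := 1) (F := G) (x₀ := z₁) (bound := fun _ => C)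
    (F' := fun z t => (t : ℂ) * deriv f (z₀ + (t : ℂ) * (z - z₀)))
    (s := Metric.closedBall z₁ (ε / 2)) (Metric.closedBall_mem_nhds _ (by linarith))
    (by
      filter_upwards [hU.mem_nhds hz₁] with z hz
      rw [uIoc_of_le zero_le_one]
      exact (hGi z hz).1.aestronglyMeasurable) (hGi z₁ hz₁)
    (by
      rw [uIoc_of_le zero_le_one]
      exact (hdc.mono Ioc_subset_Icc_self).aestronglyMeasurable measurableSet_Ioc)
    (by
      refine Eventually.of_forall fun t ht z hz => ?_
      rw [uIoc_of_le zero_le_one] at ht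
      exact hC (t, z) ⟨Ioc_subset_Icc_self ht, hz⟩) (by simp)
    (by
      refine Eventually.of_forall fun t ht z hz => ?_
      rw [uIoc_of_le zero_le_one] at ht
      have h1 : HasDerivAt (fun z => z₀ + (t : ℂ) * (z - z₀)) (t : ℂ) z := by
        simpa using ((((hasDerivAt_id z).sub_const z₀).const_mul (t : ℂ)).const_add z₀)
      have hm := hmem z (hball' hz) t (Ioc_subset_Icc_self ht)
      have h2 := ((hf.differentiableAt (hU.mem_nhds hm)).hasDerivAt).comp z h1
      rw [mul_comm] at h2
      exact h2)).2
  have hprod := ((hasDerivAt_id z₁).sub_const z₀).mul hd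
  refine hprod.congr_deriv ?_
  have hftc : ∫ t in (0 : ℝ)..1, (G z₁ t + (z₁ - z₀) *
      ((t : ℂ) * deriv f (z₀ + (t : ℂ) * (z₁ - z₀)))) = f z₁ := by
    have : ∀ t ∈ uIcc (0 : ℝ) 1, HasDerivAt (fun t : ℝ => (t : ℂ) * G z₁ t)
        (G z₁ t + (z₁ - z₀) * ((t : ℂ) * deriv f (z₀ + (t : ℂ) * (z₁ - z₀)))) t := by
      intro t ht
      rw [uIcc_of_le zero_le_one] at ht
      have ho : HasDerivAt (fun t : ℝ => (t : ℂ)) 1 t := Complex.ofRealCLM.hasDerivAt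
      have h1 : HasDerivAt (fun t : ℝ => z₀ + (t : ℂ) * (z₁ - z₀)) (z₁ - z₀) t := by
        simpa using (ho.mul_const (z₁ - z₀)).const_add z₀
      have hm := hmem z₁ hz₁ t ht
      have h2 := ((hf.differentiableAt (hU.mem_nhds hm)).hasDerivAt).comp_of_eq t h1 rfl
      refine (ho.mul h2).congr_deriv ?_
      simp only [G, one_mul, Function.comp]
      ring
    rw [intervalIntegral.integral_eq_sub_of_hasDerivAt this]
    · simp [G]
    · refine (hGi z₁ hz₁).add (ContinuousOn.intervalIntegrable ?_)
      rw [uIcc_of_le zero_le_one]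
      exact continuousOn_const.mul hdc
  rw [intervalIntegral.integral_add (hGi z₁ hz₁), intervalIntegral.integral_const_mul] at hftc
  · simp only [id, one_mul]
    exact hftc
  · refine ContinuousOn.intervalIntegrable ?_
    rw [uIcc_of_le zero_le_one]
    exact continuousOn_const.mul hdc

end Aztec
end

noncomputable section

namespace Aztec

open MeasureTheory Set

/-! ### Integrals over closed curves -/

/-- A closed tame curve on `[0, 1]`. -/
structure IsLoop (γ : ℝ → ℂ) : Prop where
  tame : IsTame γ 0 1
  closed : γ 0 = γ 1

theorem IsSimpleClosed.isLoop {γ : ℝ → ℂ} (hγ : IsSimpleClosed γ) : IsLoop γ :=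
  ⟨hγ.piecewiseC1.isTame, hγ.closed⟩

theorem IsTame.isCompact_curveImage {γ : ℝ → ℂ} (hγ : IsTame γ 0 1) : IsCompact (curveImage γ) :=
  isCompact_Icc.image_of_continuousOn hγ.continuousOn

theorem mem_curveImage {γ : ℝ → ℂ} {t : ℝ} (ht : t ∈ Icc (0 : ℝ) 1) : γ t ∈ curveImage γ :=
  mem_image_of_mem γ ht

theorem IsTame.pathIntegrable {γ : ℝ → ℂ} (hγ : IsTame γ 0 1) {f : ℂ → ℂ}
    (hf : ContinuousOn f (curveImage γ)) :
    IntervalIntegrable (fun t => f (γ t) * deriv γ t) volume 0 1 := by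
  obtain ⟨M, hM⟩ := hγ.isCompact_curveImage.exists_bound_of_continuousOn hf
  exact hγ.intervalIntegrable zero_le_one (g := fun t => f (γ t))
    (hf.comp (hγ.continuousOn.mono Ioo_subset_Icc_self)
      fun t ht => mem_curveImage (Ioo_subset_Icc_self ht))
    fun t ht => hM _ (mem_curveImage (Ioo_subset_Icc_self ht))

theorem pathIntegral_add {γ : ℝ → ℂ} (hγ : IsTame γ 0 1) {f g : ℂ → ℂ}
    (hf : ContinuousOn f (curveImage γ)) (hg : ContinuousOn g (curveImage γ)) :
    pathIntegral γ (fun z => f z + g z) = pathIntegral γ f + pathIntegral γ g := by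
  simp only [pathIntegral, add_mul]
  exact intervalIntegral.integral_add (hγ.pathIntegrable hf) (hγ.pathIntegrable hg)

theorem pathIntegral_const_mul (γ : ℝ → ℂ) (c : ℂ) (f : ℂ → ℂ) :
    pathIntegral γ (fun z => c * f z) = c * pathIntegral γ f := by
  simp only [pathIntegral, mul_assoc]
  exact intervalIntegral.integral_const_mul _ _

theorem pathIntegral_sum {ι : Type*} {γ : ℝ → ℂ} (hγ : IsTame γ 0 1) (s : Finset ι)
    {f : ι → ℂ → ℂ} (hf : ∀ i ∈ s, ContinuousOn (f i) (curveImage γ)) :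
    pathIntegral γ (fun z => ∑ i ∈ s, f i z) = ∑ i ∈ s, pathIntegral γ (f i) := by
  simp only [pathIntegral, Finset.sum_mul]
  exact intervalIntegral.integral_finsetSum fun i hi => hγ.pathIntegrable (hf i hi)

theorem pathIntegral_congr {γ : ℝ → ℂ} {f g : ℂ → ℂ} (h : ∀ z ∈ curveImage γ, f z = g z) :
    pathIntegral γ f = pathIntegral γ g := by
  refine intervalIntegral.integral_congr fun t ht => ?_
  rw [uIcc_of_le zero_le_one] at ht
  simp only [h _ (mem_curveImage ht)]

/-- The integral over a curve without self-intersections does not see finitely many points. -/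
theorem pathIntegral_congr_of_finite {γ : ℝ → ℂ} (hγ : InjOn γ (Ico 0 1)) {S : Set ℂ}
    (hS : S.Finite) {f g : ℂ → ℂ} (h : ∀ t ∈ Ioo (0 : ℝ) 1, γ t ∉ S → f (γ t) = g (γ t)) :
    pathIntegral γ f = pathIntegral γ g := by
  refine intervalIntegral.integral_congr_ae ?_
  have hfin : (Ico (0 : ℝ) 1 ∩ γ ⁻¹' S).Finite := by
    refine Set.Finite.of_finite_image (f := γ) (hS.subset ?_) (hγ.mono inter_subset_left)
    rintro _ ⟨t, ht, rfl⟩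
    exact ht.2
  have h1 : ∀ᵐ t ∂(volume : Measure ℝ), t ∉ Ico (0 : ℝ) 1 ∩ γ ⁻¹' S :=
    hfin.countable.ae_notMem volume
  have h2 : ∀ᵐ t ∂(volume : Measure ℝ), t ∉ ({1} : Set ℝ) :=
    (countable_singleton 1).ae_notMem volume
  filter_upwards [h1, h2] with t ht1 ht2 ht
  rw [uIoc_of_le zero_le_one] at ht
  have ht' : t ∈ Ioo (0 : ℝ) 1 := ⟨ht.1, lt_of_le_of_ne ht.2 ht2⟩
  rw [h t ht' fun hS => ht1 ⟨Ioo_subset_Ico_self ht', hS⟩]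

theorem IsLoop.integral_eq_zero {γ : ℝ → ℂ} (hγ : IsLoop γ) {F f : ℂ → ℂ}
    (hF : ∀ z ∈ curveImage γ, HasDerivAt F (f z) z) (hf : ContinuousOn f (curveImage γ)) :
    pathIntegral γ f = 0 := by
  obtain ⟨M, hM⟩ := hγ.tame.isCompact_curveImage.exists_bound_of_continuousOn hf
  have hc : ContinuousOn (fun t => F (γ t)) (Icc 0 1) :=
    ContinuousOn.comp (g := F) (fun z hz => (hF z hz).continuousAt.continuousWithinAt)
      hγ.tame.continuousOn fun t ht => mem_curveImage ht
  have h0 : Tendsto (fun t => F (γ t)) (𝓝[>] 0) (𝓝 (F (γ 0))) :=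
    ((hc 0 (left_mem_Icc.mpr zero_le_one)).mono_of_mem_nhdsWithin
      (Icc_mem_nhdsGT zero_lt_one)).tendsto
  have h1 : Tendsto (fun t => F (γ t)) (𝓝[<] 1) (𝓝 (F (γ 1))) :=
    ((hc 1 (right_mem_Icc.mpr zero_le_one)).mono_of_mem_nhdsWithin
      (Icc_mem_nhdsLT zero_lt_one)).tendsto
  rw [pathIntegral, hγ.tame.integral_eq zero_lt_one hF hf
    (fun t ht => mem_curveImage (Ioo_subset_Icc_self ht))
    (fun t ht => hM _ (mem_curveImage (Ioo_subset_Icc_self ht))) h0 h1, hγ.closed, sub_self]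

theorem pathIntegral_div_sub (γ : ℝ → ℂ) (c a : ℂ) :
    pathIntegral γ (fun z => c / (z - a)) = 2 * Real.pi * Complex.I * c * windingNumber γ a := by
  have h : (2 * Real.pi * Complex.I : ℂ) ≠ 0 := Complex.two_pi_I_ne_zero
  simp only [div_eq_mul_inv, pathIntegral_const_mul, windingNumber]
  field_simp

theorem continuousOn_div_sub {s : Set ℂ} {a : ℂ} (ha : a ∉ s) (c : ℂ) :
    ContinuousOn (fun z => c / (z - a)) s :=
  continuousOn_const.div (by fun_prop) fun z hz => sub_ne_zero.mpr fun h => ha (h ▸ hz)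

/-- The residue theorem for one pole. -/
theorem IsLoop.integral_eq_residue {γ : ℝ → ℂ} (hγ : IsLoop γ) {F f : ℂ → ℂ} {c p : ℂ}
    (hp : p ∉ curveImage γ) (hf : ContinuousOn f (curveImage γ))
    (hF : ∀ z ∈ curveImage γ, HasDerivAt F (f z - c / (z - p)) z) :
    pathIntegral γ f = 2 * Real.pi * Complex.I * c * windingNumber γ p := by
  have hfc : ContinuousOn (fun z => f z - c / (z - p)) (curveImage γ) :=
    hf.sub (continuousOn_div_sub hp c)
  have h1 := hγ.integral_eq_zero hF hfc
  have h2 : pathIntegral γ f = pathIntegral γ (fun z => (f z - c / (z - p)) + c / (z - p)) :=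
    pathIntegral_congr fun z _ => by ring
  rw [h2, pathIntegral_add hγ.tame hfc (continuousOn_div_sub hp c), h1, zero_add, pathIntegral_div_sub]

/-- The residue theorem for two poles. -/
theorem IsLoop.integral_eq_residue₂ {γ : ℝ → ℂ} (hγ : IsLoop γ) {F f : ℂ → ℂ} {c p c' p' : ℂ}
    (hp : p ∉ curveImage γ) (hp' : p' ∉ curveImage γ) (hf : ContinuousOn f (curveImage γ))
    (hF : ∀ z ∈ curveImage γ, HasDerivAt F (f z - c / (z - p) - c' / (z - p')) z) :
    pathIntegral γ f =
      2 * Real.pi * Complex.I * (c * windingNumber γ p + c' * windingNumber γ p') := by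
  have hfc : ContinuousOn (fun z => f z - c / (z - p)) (curveImage γ) :=
    hf.sub (continuousOn_div_sub hp c)
  have h1 := hγ.integral_eq_residue hp' hfc hF
  have h2 : pathIntegral γ f = pathIntegral γ (fun z => (f z - c / (z - p)) + c / (z - p)) :=
    pathIntegral_congr fun z _ => by ring
  rw [h2, pathIntegral_add hγ.tame hfc (continuousOn_div_sub hp c), h1, pathIntegral_div_sub]
  ring

/-! ### Primitives up to residues -/

theorem hasDerivAt_sub_zpow (p : ℂ) (j : ℤ) (hj : j ≠ -1) {z : ℂ} (hz : z ≠ p) :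
    HasDerivAt (fun z => (z - p) ^ (j + 1) / (j + 1)) ((z - p) ^ j) z := by
  have h1 : ((j : ℂ) + 1) ≠ 0 := by
    intro h
    apply hj
    have : ((j + 1 : ℤ) : ℂ) = 0 := by push_cast; exact h
    have := Int.cast_eq_zero.mp this
    omega
  have h2 := ((hasDerivAt_zpow (j + 1) (z - p) (Or.inl (sub_ne_zero.mpr hz))).comp z
    ((hasDerivAt_id z).sub_const p)).div_const ((j : ℂ) + 1)
  refine h2.congr_deriv ?_
  push_cast
  rw [add_sub_cancel_right]
  field_simp

/-- A function with a single pole in a star-shaped open set has a primitive after the polar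
term of order one has been removed. -/
theorem exists_residue_primitive {U : Set ℂ} (hU : IsOpen U) {z₀ : ℂ} (hs : StarConvex ℝ z₀ U)
    {p : ℂ} (hp : p ∈ U) (M : ℕ) {g : ℂ → ℂ} (hg : DifferentiableOn ℂ g U) :
    ∃ (c : ℂ) (F : ℂ → ℂ), ∀ z ∈ U, z ≠ p → HasDerivAt F (g z / (z - p) ^ M - c / (z - p)) z := by
  induction M generalizing g with
  | zero =>
    obtain ⟨F, hF⟩ := exists_primitive_of_starConvex hU hs hg
    exact ⟨0, F, fun z hz _ => by simpa using hF z hz⟩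
  | succ M ih =>
    obtain ⟨c, F, hF⟩ := ih ((Complex.differentiableOn_dslope (hU.mem_nhds hp)).mpr hg)
    have hsplit : ∀ z, z ≠ p → g z / (z - p) ^ (M + 1) =
        g p * (z - p) ^ (-((M : ℤ) + 1)) + dslope g p z / (z - p) ^ M := by
      intro z hz
      have hzp : z - p ≠ 0 := sub_ne_zero.mpr hz
      rw [dslope_of_ne _ hz, slope_def_field, zpow_neg]
      norm_cast
      field_simp
      ring
    rcases Nat.eq_zero_or_pos M with rfl | hM
    · refine ⟨g p + c, F, fun z hz hzp => (hF z hz hzp).congr_deriv ?_⟩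
      rw [hsplit z hzp]
      simp only [CharP.cast_eq_zero, zero_add, zpow_neg_one]
      ring
    · refine ⟨c, fun z => g p * ((z - p) ^ (-((M : ℤ) + 1) + 1) / ((-((M : ℤ) + 1) : ℤ) + 1)) +
        F z, fun z hz hzp => ?_⟩
      have h1 := ((hasDerivAt_sub_zpow p (-((M : ℤ) + 1)) (by omega) hzp).const_mul (g p)).add
        (hF z hz hzp)
      refine h1.congr_deriv ?_
      rw [hsplit z hzp]
      ring

/-- Partial fractions for two poles, up to a derivative. -/
theorem exists_residue_primitive₂ (P : ℂ[X]) {a b : ℂ} (hab : a ≠ b) (m n : ℕ) :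
    ∃ (c c' : ℂ) (F : ℂ → ℂ), ∀ z, z ≠ a → z ≠ b →
      HasDerivAt F (P.eval z / ((z - a) ^ m * (z - b) ^ n) - c / (z - a) - c' / (z - b)) z := by
  have hcop : IsCoprime ((X - C a) ^ m) ((X - C b) ^ n : ℂ[X]) :=
    (isCoprime_X_sub_C_of_isUnit_sub (sub_ne_zero.mpr hab).isUnit).pow
  obtain ⟨u, v, huv⟩ := hcop
  obtain ⟨c, F, hF⟩ := exists_residue_primitive isOpen_univ (z₀ := 0)
    ((convex_univ (𝕜 := ℝ)).starConvex (mem_univ _)) (mem_univ a) m (g := fun z => (P * v).eval z)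
    (P * v).differentiable.differentiableOn
  obtain ⟨c', F', hF'⟩ := exists_residue_primitive isOpen_univ (z₀ := 0)
    ((convex_univ (𝕜 := ℝ)).starConvex (mem_univ _)) (mem_univ b) n (g := fun z => (P * u).eval z)
    (P * u).differentiable.differentiableOn
  refine ⟨c, c', fun z => F z + F' z, fun z ha hb => ?_⟩
  refine ((hF z trivial ha).add (hF' z trivial hb)).congr_deriv ?_
  have h := congrArg (eval z) huv
  simp only [eval_add, eval_mul, eval_pow, eval_sub, eval_X, eval_C, eval_one] at h
  have ha' : (z - a) ^ m ≠ 0 := pow_ne_zero _ (sub_ne_zero.mpr ha)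
  have hb' : (z - b) ^ n ≠ 0 := pow_ne_zero _ (sub_ne_zero.mpr hb)
  have : P.eval z / ((z - a) ^ m * (z - b) ^ n) =
      (P * v).eval z / (z - a) ^ m + (P * u).eval z / (z - b) ^ n := by
    rw [div_add_div _ _ ha' hb', eval_mul, eval_mul]
    congr 1
    linear_combination (-P.eval z) * h
  rw [this]
  ring

/-- Rational functions with poles at two points have the same integral over all closed curves
which wind once around both of them. -/
theorem exists_integral_eq_of_two_poles (P : ℂ[X]) {a b : ℂ} (hab : a ≠ b) (m n : ℕ) :
    ∃ c c' : ℂ, ∀ γ : ℝ → ℂ, IsLoop γ → a ∉ curveImage γ → b ∉ curveImage γ →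
      pathIntegral γ (fun z => P.eval z / ((z - a) ^ m * (z - b) ^ n)) =
        2 * Real.pi * Complex.I * (c * windingNumber γ a + c' * windingNumber γ b) := by
  obtain ⟨c, c', F, hF⟩ := exists_residue_primitive₂ P hab m n
  refine ⟨c, c', fun γ hγ ha hb => hγ.integral_eq_residue₂ ha hb ?_
    fun z hz => hF z (fun h => ha (h ▸ hz)) fun h => hb (h ▸ hz)⟩
  refine P.continuous.continuousOn.div (by fun_prop) fun z hz => mul_ne_zero ?_ ?_
  · exact pow_ne_zero _ (sub_ne_zero.mpr fun h => ha (h ▸ hz))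
  · exact pow_ne_zero _ (sub_ne_zero.mpr fun h => hb (h ▸ hz))

theorem exists_primitive_zpow_div_sub {w : ℂ} (hw : w ≠ 0) (j : ℤ) :
    ∃ F : ℂ → ℂ, ∀ z, z ≠ 0 → z ≠ w → HasDerivAt F
      (z ^ j / (z - w) - w ^ j / (z - w) - (if j < 0 then -w ^ j else 0) / (z - 0)) z := by
  induction j using Int.induction_on with
  | zero => exact ⟨fun _ => 0, fun z _ _ => by simpa using hasDerivAt_const z (0 : ℂ)⟩
  | succ i ih =>
    obtain ⟨F, hF⟩ := ih
    refine ⟨fun z => (z - 0) ^ ((i : ℤ) + 1) / ((i : ℤ) + 1) + w * F z, fun z hz hzw => ?_⟩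
    refine ((hasDerivAt_sub_zpow 0 i (by omega) hz).add ((hF z hz hzw).const_mul w)).congr_deriv ?_
    have hzw' : z - w ≠ 0 := sub_ne_zero.mpr hzw
    rw [if_neg (by omega), if_neg (by omega), zpow_add_one₀ hz, zpow_add_one₀ hw, sub_zero]
    field_simp
    ring
  | pred i ih =>
    obtain ⟨F, hF⟩ := ih
    have hzw' : ∀ z, z ≠ w → z - w ≠ 0 := fun z hzw => sub_ne_zero.mpr hzw
    rcases Nat.eq_zero_or_pos i with rfl | hi
    · refine ⟨fun z => w⁻¹ * F z, fun z hz hzw => ((hF z hz hzw).const_mul w⁻¹).congr_deriv ?_⟩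
      have := hzw' z hzw
      simp
      field_simp
      ring
    · refine ⟨fun z => w⁻¹ * (F z - (z - 0) ^ (-(i : ℤ) - 1 + 1) / (((-(i : ℤ) - 1 : ℤ) : ℂ) + 1)),
        fun z hz hzw => ?_⟩
      refine (((hF z hz hzw).sub (hasDerivAt_sub_zpow 0 (-(i : ℤ) - 1) (by omega) hz)).const_mul
        w⁻¹).congr_deriv ?_
      have := hzw' z hzw
      rw [if_pos (by omega), if_pos (by omega), zpow_sub_one₀ hw, sub_zero, zpow_sub_one₀ hz]
      field_simp
      ring

/-- The Cauchy transform of a Laurent polynomial over a closed curve. -/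
theorem IsLoop.integral_laurent_div_sub {γ : ℝ → ℂ} (hγ : IsLoop γ) (h0 : (0 : ℂ) ∉ curveImage γ)
    {w : ℂ} (hw : w ≠ 0) (hwγ : w ∉ curveImage γ) (s : Finset ℤ) (c : ℤ → ℂ) :
    pathIntegral γ (fun z => (∑ j ∈ s, c j * z ^ j) / (z - w)) = 2 * Real.pi * Complex.I *
      ((∑ j ∈ s, c j * w ^ j) * windingNumber γ w -
        (∑ j ∈ s with j < 0, c j * w ^ j) * windingNumber γ 0) := by
  have hz0 : ∀ z ∈ curveImage γ, z ≠ 0 := fun z hz h => h0 (h ▸ hz)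
  have hc : ∀ j : ℤ, ContinuousOn (fun z => z ^ j / (z - w)) (curveImage γ) := fun j =>
    (continuousOn_id.zpow₀ j fun z hz => Or.inl (hz0 z hz)).div (by fun_prop)
      fun z hz => sub_ne_zero.mpr fun h => hwγ (h ▸ hz)
  have h1 : ∀ j : ℤ, pathIntegral γ (fun z => z ^ j / (z - w)) = 2 * Real.pi * Complex.I *
      (w ^ j * windingNumber γ w + (if j < 0 then -w ^ j else 0) * windingNumber γ 0) := by
    intro j
    obtain ⟨F, hF⟩ := exists_primitive_zpow_div_sub hw j
    exact hγ.integral_eq_residue₂ hwγ h0 (hc j)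
      fun z hz => hF z (hz0 z hz) fun h => hwγ (h ▸ hz)
  have h2 : pathIntegral γ (fun z => (∑ j ∈ s, c j * z ^ j) / (z - w)) =
      pathIntegral γ (fun z => ∑ j ∈ s, c j * (z ^ j / (z - w))) :=
    pathIntegral_congr fun z _ => by simp only [Finset.sum_div, mul_div_assoc]
  have hc' : ∀ j ∈ s, ContinuousOn (fun z => c j * (z ^ j / (z - w))) (curveImage γ) :=
    fun j _ => continuousOn_const.mul (hc j)
  rw [h2, pathIntegral_sum hγ.tame s hc']
  simp only [pathIntegral_const_mul, h1, Finset.sum_filter, Finset.sum_mul, Finset.mul_sum,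
    mul_sub]
  rw [← Finset.sum_sub_distrib]
  refine Finset.sum_congr rfl fun j _ => ?_
  split_ifs <;> ring

/-! ### Winding numbers -/

theorem windingNumber_eq_of_forall_notMem_segment {γ : ℝ → ℂ} (hγ : IsLoop γ) {a b : ℝ}
    (hab : a < b) (h : ∀ x ∈ Icc a b, (x : ℂ) ∉ curveImage γ) :
    windingNumber γ a = windingNumber γ b := by
  have ha : (a : ℂ) ∉ curveImage γ := h a ⟨le_rfl, hab.le⟩
  have hb : (b : ℂ) ∉ curveImage γ := h b ⟨hab.le, le_rfl⟩
  have hslit : ∀ z ∈ curveImage γ, (z - b) / (z - a) ∈ Complex.slitPlane := by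
    intro z hz
    have hza : z - a ≠ 0 := sub_ne_zero.mpr fun h => ha (h ▸ hz)
    rw [Complex.mem_slitPlane_iff_not_le_zero]
    intro hle
    obtain ⟨r, hr, hr0⟩ : ∃ r : ℝ, (z - b) / (z - a) = r ∧ r ≤ 0 := by
      obtain ⟨h1, h2⟩ := Complex.le_def.mp hle
      exact ⟨((z - b) / (z - a)).re, Complex.ext rfl (by simpa using h2), by simpa using h1⟩
    rw [div_eq_iff hza] at hr
    have h1 : (1 - (r : ℂ)) ≠ 0 := by
      have : (1 - r : ℝ) ≠ 0 := by linarith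
      exact_mod_cast this
    have hz' : z = (((b - r * a) / (1 - r) : ℝ) : ℂ) := by
      push_cast
      rw [eq_div_iff h1]
      linear_combination hr
    refine h ((b - r * a) / (1 - r)) ⟨?_, ?_⟩ (hz' ▸ hz)
    · rw [le_div_iff₀ (by linarith)]
      nlinarith
    · rw [div_le_iff₀ (by linarith)]
      nlinarith
  have hF : ∀ z ∈ curveImage γ, HasDerivAt (fun z => Complex.log ((z - b) / (z - a)))
      ((z - b)⁻¹ + -1 * (z - a)⁻¹) z := by
    intro z hz
    have hza : z - a ≠ 0 := sub_ne_zero.mpr fun h => ha (h ▸ hz)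
    have hzb : z - b ≠ 0 := sub_ne_zero.mpr fun h => hb (h ▸ hz)
    have h1 := (((hasDerivAt_id z).sub_const (b : ℂ)).div ((hasDerivAt_id z).sub_const (a : ℂ))
      hza).clog (hslit z hz)
    refine h1.congr_deriv ?_
    simp only [id, Pi.div_apply]
    field_simp
    ring
  have hca : ContinuousOn (fun z : ℂ => (z - a)⁻¹) (curveImage γ) := by
    simpa using continuousOn_div_sub ha 1
  have hcb : ContinuousOn (fun z : ℂ => (z - b)⁻¹) (curveImage γ) := by
    simpa using continuousOn_div_sub hb 1
  have hca' : ContinuousOn (fun z : ℂ => -1 * (z - a)⁻¹) (curveImage γ) :=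
    continuousOn_const.mul hca
  have h0 := hγ.integral_eq_zero hF (hcb.add hca')
  rw [pathIntegral_add hγ.tame hcb hca', pathIntegral_const_mul] at h0
  simp only [windingNumber]
  congr 1
  linear_combination -h0

theorem windingNumber_eq_zero_of_forall_notMem_ray {γ : ℝ → ℂ} (hγ : IsLoop γ) {a : ℝ}
    (h : ∀ x : ℝ, a ≤ x → (x : ℂ) ∉ curveImage γ) : windingNumber γ a = 0 := by
  have hF : ∀ z ∈ curveImage γ, HasDerivAt (fun z => Complex.log (a - z)) ((z - a)⁻¹) z := by
    intro z hz
    have hs : (a : ℂ) - z ∈ Complex.slitPlane := by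
      rw [Complex.mem_slitPlane_iff]
      by_contra hcon
      push Not at hcon
      have him : z.im = 0 := by simpa using hcon.2
      have hre : a ≤ z.re := by simpa using hcon.1
      exact h z.re hre (by
        have : z = (z.re : ℂ) := Complex.ext rfl (by simp [him])
        rwa [← this])
    have hne : (a : ℂ) - z ≠ 0 := Complex.slitPlane_ne_zero hs
    refine (((hasDerivAt_id z).const_sub (a : ℂ)).clog hs).congr_deriv ?_
    have : z - a ≠ 0 := by rw [← neg_sub]; exact neg_ne_zero.mpr hne
    simp only [id]
    rw [neg_div, ← div_neg, neg_sub, one_div]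
  have hca : ContinuousOn (fun z : ℂ => (z - a)⁻¹) (curveImage γ) := by
    simpa using continuousOn_div_sub (h a le_rfl) 1
  rw [windingNumber, hγ.integral_eq_zero hF hca, mul_zero]

/-- The inner contour does not meet the negative real axis. -/
theorem IsContourOne.subset_slitPlane {γ : ℝ → ℂ} (hγ : IsContourOne γ) :
    curveImage γ ⊆ Complex.slitPlane := by
  have hl := hγ.simple.isLoop
  intro w hw
  by_contra hs
  rw [Complex.mem_slitPlane_iff] at hs
  push Not at hs
  have h0 := hγ.zero_outside
  have h1 := hγ.around_one
  obtain ⟨x, hx, hxγ⟩ : ∃ x ∈ Icc (0 : ℝ) 1, (x : ℂ) ∈ curveImage γ := by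
    by_contra! hcon
    have := windingNumber_eq_of_forall_notMem_segment hl zero_lt_one hcon
    rw [Complex.ofReal_zero, Complex.ofReal_one, h0.2, h1.2] at this
    exact zero_ne_one this
  obtain ⟨y, hy, hyγ⟩ : ∃ y : ℝ, 1 ≤ y ∧ (y : ℂ) ∈ curveImage γ := by
    by_contra! hcon
    have := windingNumber_eq_zero_of_forall_notMem_ray hl hcon
    rw [Complex.ofReal_one, h1.2] at this
    exact one_ne_zero this
  have hx1 : x ≠ 1 := by rintro rfl; exact h1.1 (by simpa using hxγ)
  have hy1 : y ≠ 1 := by rintro rfl; exact h1.1 (by simpa using hyγ)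
  have hx0 : x ≠ 0 := by rintro rfl; exact h0.1 (by simpa using hxγ)
  have hxy : (x : ℂ) ≠ y := by
    intro h
    have := Complex.ofReal_injective h
    have := lt_of_le_of_ne hx.2 hx1
    linarith
  have hwx : w ≠ x := by
    rintro rfl
    have := lt_of_le_of_ne hx.1 hx0.symm
    have := hs.1
    simp at this
    linarith
  have hwy : w ≠ y := by
    rintro rfl
    have := hs.1
    simp at this
    linarith
  have hsub : ({w, (x : ℂ), (y : ℂ)} : Set ℂ) ⊆ curveImage γ ∩ {z : ℂ | z.im = 0} := by
    rintro z (rfl | rfl | rfl)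
    · exact ⟨hw, hs.2⟩
    · exact ⟨hxγ, by simp⟩
    · exact ⟨hyγ, by simp⟩
  have hm := hγ.meets_real
  rw [MeetsRealLineTwice] at hm
  have hfin : (curveImage γ ∩ {z : ℂ | z.im = 0}).Finite :=
    Set.finite_of_ncard_ne_zero (by omega)
  have := Set.ncard_le_ncard hsub hfin
  rw [Set.ncard_eq_three.mpr ⟨w, x, y, hwx, hwy, hxy, rfl⟩] at this
  omega

/-! ### Circles -/

/-- The circle of radius `r` around `0`, as a curve on `[0, 1]`. -/
def circ (r : ℝ) (t : ℝ) : ℂ := circleMap 0 r (2 * Real.pi * t)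

theorem pathIntegral_circ (r : ℝ) (f : ℂ → ℂ) :
    pathIntegral (circ r) f = ∮ z in C(0, r), f z := by
  have hd : ∀ t : ℝ, deriv (circ r) t = (2 * Real.pi : ℝ) • deriv (circleMap 0 r) (2 * Real.pi * t) := by
    intro t
    have := deriv_comp_mul_left (2 * Real.pi) (circleMap 0 r) t
    exact this
  have h := intervalIntegral.integral_comp_mul_left
    (fun θ => deriv (circleMap 0 r) θ • f (circleMap 0 r θ)) (a := 0) (b := 1)
    (c := 2 * Real.pi) (by positivity)
  rw [mul_zero, mul_one] at h
  have h2 : (2 * Real.pi : ℝ) ≠ 0 := by positivity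
  rw [eq_comm, inv_smul_eq_iff₀ h2] at h
  rw [circleIntegral, h, ← intervalIntegral.integral_smul, pathIntegral]
  refine intervalIntegral.integral_congr fun t _ => ?_
  simp only [hd, circ, smul_eq_mul, Complex.real_smul]
  ring

theorem isLoop_circ (r : ℝ) : IsLoop (circ r) := by
  refine ⟨IsTame.of_contDiffOn ?_, ?_⟩
  · exact ((contDiff_circleMap 0 r).comp (by fun_prop : ContDiff ℝ 1 fun t : ℝ => 2 * Real.pi * t)).contDiffOn
  · simp [circ, circleMap]

theorem norm_of_mem_curveImage_circ {r : ℝ} (hr : 0 ≤ r) {z : ℂ} (hz : z ∈ curveImage (circ r)) :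
    ‖z‖ = r := by
  obtain ⟨t, _, rfl⟩ := hz
  rw [circ, norm_circleMap_zero, abs_of_nonneg hr]

theorem windingNumber_circ_of_lt {r : ℝ} {a : ℂ} (h : ‖a‖ < r) :
    windingNumber (circ r) a = 1 := by
  rw [windingNumber, pathIntegral_circ, circleIntegral.integral_sub_inv_of_mem_ball (by simpa using h)]
  exact inv_mul_cancel₀ Complex.two_pi_I_ne_zero

theorem windingNumber_circ_of_gt {r : ℝ} (hr : 0 ≤ r) {a : ℂ} (h : r < ‖a‖) :
    windingNumber (circ r) a = 0 := by
  rw [windingNumber, pathIntegral_circ, Complex.circleIntegral_eq_zero_of_differentiable_on_off_countable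
    hr countable_empty, mul_zero]
  · refine ContinuousOn.inv₀ (by fun_prop) fun z hz => sub_ne_zero.mpr ?_
    rintro rfl
    simp at hz
    linarith
  · intro z hz
    refine DifferentiableAt.inv (by fun_prop) (sub_ne_zero.mpr ?_)
    rintro rfl
    have := hz.1
    simp at this
    linarith

end Aztec
end

noncomputable section

namespace Aztec

open Set

/-! ### The polynomial form of the symbol -/

/-- One period of the polynomial symbol. -/
def periodMatrix (a b : ℝ) : Matrix (Fin 2) (Fin 2) ℝ[X] :=
  !![X + C (a / b), C (a + b); C (a⁻¹ + b⁻¹) * X, X + C (b / a)]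

/-- The matrix `(z - 1)^k Φ(z)`, as a matrix of polynomials. -/
def symbolPoly {k : ℕ} (α β : Fin k → ℝ) : Matrix (Fin 2) (Fin 2) ℝ[X] :=
  (List.ofFn fun m => periodMatrix (α m) (β m)).prod

/-- Evaluation of a real polynomial matrix at a complex number. -/
def evalMatrix (z : ℂ) : Matrix (Fin 2) (Fin 2) ℝ[X] →+* Matrix (Fin 2) (Fin 2) ℂ :=
  (aeval (R := ℝ) z).toRingHom.mapMatrix

@[simp]
theorem evalMatrix_apply (z : ℂ) (M : Matrix (Fin 2) (Fin 2) ℝ[X]) (i j : Fin 2) :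
    evalMatrix z M i j = aeval z (M i j) := rfl

/-- The matrix `(z - 1)^k Φ(z)`. -/
def symbol {k : ℕ} (α β : Fin k → ℝ) (z : ℂ) : Matrix (Fin 2) (Fin 2) ℂ :=
  evalMatrix z (symbolPoly α β)

variable {k : ℕ} {α β : Fin k → ℝ}

theorem tracePoly_eq (α β : Fin k → ℝ) : tracePoly α β = (symbolPoly α β).trace := rfl

theorem trace_evalMatrix (z : ℂ) (M : Matrix (Fin 2) (Fin 2) ℝ[X]) :
    (evalMatrix z M).trace = aeval z M.trace := by
  simp [Matrix.trace_fin_two]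

theorem trace_symbol (z : ℂ) : (symbol α β z).trace = aeval z (tracePoly α β) := by
  rw [tracePoly_eq, ← trace_evalMatrix, symbol]

theorem det_evalMatrix (z : ℂ) (M : Matrix (Fin 2) (Fin 2) ℝ[X]) :
    (evalMatrix z M).det = aeval z M.det := by
  simp [Matrix.det_fin_two]

theorem det_periodMatrix {a b : ℝ} (ha : a ≠ 0) (hb : b ≠ 0) :
    (periodMatrix a b).det = (X - 1) ^ 2 := by
  simp only [periodMatrix, Matrix.det_fin_two_of]
  have h1 : (C (a / b) * C (b / a) : ℝ[X]) = 1 := by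
    rw [← C_mul, ← C_1]; congr 1; field_simp
  have h2 : (C (a + b) * C (a⁻¹ + b⁻¹) : ℝ[X]) = C (a / b) + C (b / a) + 2 := by
    rw [← C_mul, ← C_add, show (2 : ℝ[X]) = C 2 from rfl, ← C_add]
    congr 1; field_simp; ring
  linear_combination h1 - X * h2

theorem det_symbolPoly (hα : ∀ m, 0 < α m) (hβ : ∀ m, 0 < β m) :
    (symbolPoly α β).det = (X - 1) ^ (2 * k) := by
  have : ∀ l : List (Matrix (Fin 2) (Fin 2) ℝ[X]), (∀ M ∈ l, M.det = (X - 1) ^ 2) →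
      l.prod.det = (X - 1) ^ (2 * l.length) := by
    intro l
    induction l with
    | nil => simp
    | cons M l ih =>
      intro h
      rw [List.prod_cons, Matrix.det_mul, h M (by simp), ih fun N hN => h N (by simp [hN]),
        List.length_cons]
      ring
  rw [symbolPoly, this, List.length_ofFn]
  intro M hM
  obtain ⟨m, rfl⟩ := (List.mem_ofFn' _ _).mp hM
  exact det_periodMatrix (hα m).ne' (hβ m).ne'

theorem det_symbol (hα : ∀ m, 0 < α m) (hβ : ∀ m, 0 < β m) (z : ℂ) :
    (symbol α β z).det = (z - 1) ^ (2 * k) := by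
  rw [symbol, det_evalMatrix, det_symbolPoly hα hβ]
  simp

theorem Phi_eq (hα : ∀ m, 0 < α m) (hβ : ∀ m, 0 < β m) {z : ℂ} (hz0 : z ≠ 0) (hz1 : z ≠ 1) :
    Phi α β z = ((z - 1) ^ k)⁻¹ • symbol α β z := by
  have hscal : ∀ (l : List (Matrix (Fin 2) (Fin 2) ℂ)),
      (l.map fun M => z • M).prod = z ^ l.length • l.prod := by
    intro l
    induction l with
    | nil => simp
    | cons a l ih =>
      simp only [List.map_cons, List.prod_cons, ih, List.length_cons, Matrix.smul_mul,
        Matrix.mul_smul, smul_smul, pow_succ]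
  have hlist : (List.ofFn fun m : Fin k => evalMatrix z (periodMatrix (α m) (β m))) =
      (List.ofFn fun m : Fin k => !![1, (α m : ℂ) * z⁻¹; (α m : ℂ)⁻¹, 1] *
        !![1, (β m : ℂ) * z⁻¹; (β m : ℂ)⁻¹, 1]).map fun M => z • M := by
    rw [List.map_ofFn]
    congr 1
    funext m
    have h1 : (α m : ℂ) ≠ 0 := by exact_mod_cast (hα m).ne'
    have h2 : (β m : ℂ) ≠ 0 := by exact_mod_cast (hβ m).ne'
    ext i j
    fin_cases i <;> fin_cases j <;>
      simp [periodMatrix] <;> field_simp <;> ring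
  have hsym : symbol α β z = z ^ k • (List.ofFn fun m : Fin k =>
      !![1, (α m : ℂ) * z⁻¹; (α m : ℂ)⁻¹, 1] * !![1, (β m : ℂ) * z⁻¹; (β m : ℂ)⁻¹, 1]).prod := by
    have hcomp : (⇑(evalMatrix z) ∘ fun m : Fin k => periodMatrix (α m) (β m)) =
      fun m : Fin k => evalMatrix z (periodMatrix (α m) (β m)) := rfl
    rw [symbol, symbolPoly, map_list_prod, List.map_ofFn, hcomp, hlist, hscal, List.length_ofFn]
  rw [hsym, Phi, smul_smul]
  congr 1
  have : 1 - z⁻¹ = (z - 1) / z := by field_simp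
  rw [this, div_pow, inv_div, div_eq_inv_mul]

theorem symbol_conj (z : ℂ) (i j : Fin 2) :
    symbol α β ((starRingEnd ℂ) z) i j = (starRingEnd ℂ) (symbol α β z i j) := by
  simp only [symbol, evalMatrix_apply]
  exact Polynomial.aeval_conj _ _

/-! ### The indefinite form expanded by the symbol -/

/-- The indefinite Hermitian form `Re (y v₀ conj v₁)`. -/
def indefForm (y : ℂ) (v : Fin 2 → ℂ) : ℝ := (y * v 0 * (starRingEnd ℂ) (v 1)).re

theorem indefForm_halfStep {a : ℝ} (ha : 0 < a) {y : ℂ} (hy : 0 ≤ y.re) (u w : ℂ) :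
    ‖y ^ 2 - 1‖ * (u * (starRingEnd ℂ) w).re +
      y.re * ‖y - 1‖ / (1 + ‖y‖) * (‖u‖ ^ 2 / a + a * ‖w‖ ^ 2) ≤
    ((y * u + a * w) * (starRingEnd ℂ) (u / a + y * w)).re := by
  set J := (u * (starRingEnd ℂ) w).re with hJ
  set n := ‖u‖ ^ 2 / a + a * ‖w‖ ^ 2 with hn
  have hexp : ((y * u + a * w) * (starRingEnd ℂ) (u / a + y * w)).re =
      (1 + ‖y‖ ^ 2) * J + n * y.re := by
    simp only [hJ, hn, ← Complex.normSq_eq_norm_sq, Complex.normSq_apply, map_add, map_mul,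
      map_div₀, Complex.conj_ofReal, Complex.add_re, Complex.mul_re, Complex.add_im,
      Complex.mul_im, Complex.conj_re, Complex.conj_im, Complex.ofReal_re, Complex.ofReal_im,
      Complex.div_ofReal_re, Complex.div_ofReal_im]
    field_simp
    ring
  have hJn : |J| ≤ n / 2 := by
    have h1 : |J| ≤ ‖u‖ * ‖w‖ := by
      calc |J| ≤ ‖u * (starRingEnd ℂ) w‖ := Complex.abs_re_le_norm _
        _ = ‖u‖ * ‖w‖ := by rw [norm_mul, Complex.norm_conj]
    have h2 : ‖u‖ * ‖w‖ ≤ n / 2 := by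
      have : n / 2 - ‖u‖ * ‖w‖ = (‖u‖ - a * ‖w‖) ^ 2 / (2 * a) := by
        rw [hn]; field_simp; ring
      have h3 : 0 ≤ (‖u‖ - a * ‖w‖) ^ 2 / (2 * a) := by positivity
      linarith
    exact h1.trans h2
  have hn0 : 0 ≤ n := by positivity
  set A := ‖y + 1‖ with hA
  set D := ‖y - 1‖ with hD
  set N := 1 + ‖y‖ with hN
  have hN0 : 0 < N := by positivity
  have hAN : A ≤ N := by simpa [hN, add_comm] using norm_add_le y 1
  have hDN : D ≤ N := by simpa [hN, add_comm] using norm_sub_le y 1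
  have hA0 : 0 ≤ A := norm_nonneg _
  have hD0 : 0 ≤ D := norm_nonneg _
  have hAD : ‖y ^ 2 - 1‖ = A * D := by
    rw [hA, hD, ← norm_mul]; congr 1; ring
  have hA2 : A ^ 2 = 1 + ‖y‖ ^ 2 + 2 * y.re := by
    rw [hA, ← Complex.normSq_eq_norm_sq, ← Complex.normSq_eq_norm_sq, Complex.normSq_apply,
      Complex.normSq_apply]
    simp; ring
  have hD2 : D ^ 2 = 1 + ‖y‖ ^ 2 - 2 * y.re := by
    rw [hD, ← Complex.normSq_eq_norm_sq, ← Complex.normSq_eq_norm_sq, Complex.normSq_apply,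
      Complex.normSq_apply]
    simp; ring
  have hle : D ≤ A := by nlinarith
  rw [hexp, hAD]
  have hq : y.re * D / N ≤ y.re := by
    rw [div_le_iff₀ hN0]
    exact mul_le_mul_of_nonneg_left hDN hy
  have hgap : 0 ≤ 1 + ‖y‖ ^ 2 - A * D := by nlinarith [sq_nonneg (A - D)]
  have hkey : (1 + ‖y‖ ^ 2 - A * D) / 2 ≤ y.re - y.re * D / N := by
    have h4 : y.re * D / N ≤ D * (A - D) / 2 := by
      rw [div_le_iff₀ hN0]
      have h5 : y.re = (A - D) * (A + D) / 4 := by linarith [hA2, hD2]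
      have h6 : 0 ≤ (A - D) * D := mul_nonneg (by linarith) hD0
      rw [h5]
      nlinarith
    linarith
  have h7 := (abs_le.mp hJn).1
  have h8 : -(n / 2) * (1 + ‖y‖ ^ 2 - A * D) ≤ J * (1 + ‖y‖ ^ 2 - A * D) :=
    mul_le_mul_of_nonneg_right h7 hgap
  have h9 : n * ((1 + ‖y‖ ^ 2 - A * D) / 2) ≤ n * (y.re - y.re * D / N) :=
    mul_le_mul_of_nonneg_left hkey hn0
  linarith

theorem indefForm_period {a b : ℝ} (ha : 0 < a) (hb : 0 < b) {y : ℂ} (hy : 0 ≤ y.re)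
    (hy0 : y ≠ 0) (v : Fin 2 → ℂ) :
    ‖y ^ 2 - 1‖ ^ 2 * indefForm y v + ‖y ^ 2 - 1‖ * (min b b⁻¹ *
      (y.re * ‖y - 1‖ / (1 + ‖y‖)) * (‖y * v 0‖ ^ 2 + ‖v 1‖ ^ 2)) ≤
      indefForm y ((evalMatrix (y ^ 2) (periodMatrix a b)).mulVec v) := by
  have hac : (a : ℂ) ≠ 0 := by exact_mod_cast ha.ne'
  have hbc : (b : ℂ) ≠ 0 := by exact_mod_cast hb.ne'
  set g := y.re * ‖y - 1‖ / (1 + ‖y‖) with hg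
  have hg0 : 0 ≤ g := by positivity
  have h1 := indefForm_halfStep hb hy (y * v 0) (v 1)
  have h2 := indefForm_halfStep ha hy (y * (y * v 0) + b * v 1) (y * v 0 / b + y * v 1)
  have h3 : indefForm y ((evalMatrix (y ^ 2) (periodMatrix a b)).mulVec v) =
      ((y * (y * (y * v 0) + b * v 1) + a * (y * v 0 / b + y * v 1)) *
        (starRingEnd ℂ) ((y * (y * v 0) + b * v 1) / a + y * (y * v 0 / b + y * v 1))).re := by
    rw [indefForm]
    congr 2
    · simp only [periodMatrix, Matrix.mulVec, dotProduct, Fin.sum_univ_two, evalMatrix_apply,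
        Matrix.of_apply, Matrix.cons_val', Matrix.cons_val_zero, Matrix.cons_val_one, map_add,
        aeval_X, aeval_C, Complex.coe_algebraMap, Complex.ofReal_div]
      field_simp
      ring
    · congr 1
      simp only [periodMatrix, Matrix.mulVec, dotProduct, Fin.sum_univ_two, evalMatrix_apply,
        Matrix.of_apply, Matrix.cons_val', Matrix.cons_val_zero, Matrix.cons_val_one, map_add,
        map_mul, aeval_X, aeval_C, Complex.coe_algebraMap]
      push_cast
      field_simp
      ring
  rw [h3]
  have h4 : min b b⁻¹ * (‖y * v 0‖ ^ 2 + ‖v 1‖ ^ 2) ≤ ‖y * v 0‖ ^ 2 / b + b * ‖v 1‖ ^ 2 := by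
    have e1 : min b b⁻¹ * ‖y * v 0‖ ^ 2 ≤ b⁻¹ * ‖y * v 0‖ ^ 2 :=
      mul_le_mul_of_nonneg_right (min_le_right _ _) (by positivity)
    have e2 : min b b⁻¹ * ‖v 1‖ ^ 2 ≤ b * ‖v 1‖ ^ 2 :=
      mul_le_mul_of_nonneg_right (min_le_left _ _) (by positivity)
    rw [mul_add, div_eq_inv_mul]
    linarith
  have h5 := mul_le_mul_of_nonneg_left h4 hg0
  have h6 : 0 ≤ g * (‖y * (y * v 0) + b * v 1‖ ^ 2 / a + a * ‖y * v 0 / b + y * v 1‖ ^ 2) := by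
    positivity
  have h7 := mul_le_mul_of_nonneg_left h1 (norm_nonneg (y ^ 2 - 1))
  have h8 := mul_le_mul_of_nonneg_left h5 (norm_nonneg (y ^ 2 - 1))
  unfold indefForm
  nlinarith

theorem exists_indefForm_symbol (hk : 1 ≤ k) (hα : ∀ m, 0 < α m) (hβ : ∀ m, 0 < β m) :
    ∃ c > 0, ∀ y : ℂ, 0 ≤ y.re → y ≠ 0 → ∀ v : Fin 2 → ℂ,
      ‖y ^ 2 - 1‖ ^ (2 * k) * indefForm y v + ‖y ^ 2 - 1‖ ^ (2 * k - 1) * (c *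
        (y.re * ‖y - 1‖ / (1 + ‖y‖)) * (‖y * v 0‖ ^ 2 + ‖v 1‖ ^ 2)) ≤
        indefForm y ((symbol α β (y ^ 2)).mulVec v) := by
  have key : ∀ l : List (ℝ × ℝ), l ≠ [] → (∀ x ∈ l, 0 < x.1 ∧ 0 < x.2) →
      ∃ c > 0, ∀ y : ℂ, 0 ≤ y.re → y ≠ 0 → ∀ v : Fin 2 → ℂ,
        ‖y ^ 2 - 1‖ ^ (2 * l.length) * indefForm y v + ‖y ^ 2 - 1‖ ^ (2 * l.length - 1) * (c *
          (y.re * ‖y - 1‖ / (1 + ‖y‖)) * (‖y * v 0‖ ^ 2 + ‖v 1‖ ^ 2)) ≤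
          indefForm y ((evalMatrix (y ^ 2)
            (l.map fun x => periodMatrix x.1 x.2).prod).mulVec v) := by
    intro l hl
    induction l with
    | nil => exact absurd rfl hl
    | cons x l ih =>
      intro hpos
      obtain ⟨hx1, hx2⟩ := hpos x (by simp)
      rcases eq_or_ne l [] with rfl | hne
      · refine ⟨min x.2 x.2⁻¹, lt_min hx2 (inv_pos.mpr hx2), fun y hy hy0 v => ?_⟩
        simpa using indefForm_period hx1 hx2 hy hy0 v
      · obtain ⟨c, hc, h⟩ := ih hne fun x hx => hpos x (by simp [hx])
        refine ⟨c, hc, fun y hy hy0 v => ?_⟩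
        have h1 := indefForm_period hx1 hx2 hy hy0 ((evalMatrix (y ^ 2)
            (l.map fun x => periodMatrix x.1 x.2).prod).mulVec v)
        have h2 := mul_le_mul_of_nonneg_left (h y hy hy0 v) (sq_nonneg ‖y ^ 2 - 1‖)
        rw [List.map_cons, List.prod_cons, map_mul, ← Matrix.mulVec_mulVec]
        refine le_trans ?_ ((le_add_of_nonneg_right ?_).trans h1)
        · refine le_trans (le_of_eq ?_) h2
          have hlen : 1 ≤ l.length := List.length_pos_iff.mpr hne
          obtain ⟨n, hn⟩ := Nat.exists_eq_add_of_le hlen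
          rw [List.length_cons, hn, show 2 * (1 + n + 1) - 1 = 2 * (1 + n) - 1 + 2 by omega]
          ring
        · have : 0 < min x.2 x.2⁻¹ := lt_min hx2 (inv_pos.mpr hx2)
          positivity
  obtain ⟨c, hc, h⟩ := key (List.ofFn fun m => (α m, β m)) (by
      intro h
      have := congrArg List.length h
      simp at this
      omega) (by
      intro x hx
      obtain ⟨m, rfl⟩ := (List.mem_ofFn' _ _).mp hx
      exact ⟨hα m, hβ m⟩)
  refine ⟨c, hc, fun y hy hy0 v => ?_⟩
  have := h y hy hy0 v
  rw [List.length_ofFn, List.map_ofFn] at this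
  exact this

theorem exists_eigenvector {M : Matrix (Fin 2) (Fin 2) ℂ} {a b : ℂ} (h1 : a + b = M.trace)
    (h2 : a * b = M.det) : ∃ v : Fin 2 → ℂ, v ≠ 0 ∧ M.mulVec v = a • v := by
  have hdet : (M - a • (1 : Matrix (Fin 2) (Fin 2) ℂ)).det = 0 := by
    rw [Matrix.det_fin_two] at h2 ⊢
    rw [Matrix.trace_fin_two] at h1
    simp
    linear_combination a * h1 - h2
  obtain ⟨v, hv, h⟩ := Matrix.exists_mulVec_eq_zero_iff.mpr hdet
  refine ⟨v, hv, ?_⟩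
  rw [Matrix.sub_mulVec, Matrix.smul_mulVec, Matrix.one_mulVec, sub_eq_zero] at h
  exact h

theorem indefForm_smul (y a : ℂ) (v : Fin 2 → ℂ) :
    indefForm y (a • v) = ‖a‖ ^ 2 * indefForm y v := by
  rw [indefForm, indefForm, ← Complex.normSq_eq_norm_sq, ← Complex.re_ofReal_mul,
    Complex.normSq_eq_conj_mul_self]
  simp only [Pi.smul_apply, smul_eq_mul, map_mul]
  congr 1
  ring

end Aztec
end

noncomputable section

namespace Aztec

open Set

variable {k : ℕ} {α β : Fin k → ℝ}

/-! ### Coefficients of the trace polynomial -/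

theorem coeff_periodMatrix_prod (l : List (ℝ × ℝ)) (hpos : ∀ x ∈ l, 0 < x.1 ∧ 0 < x.2)
    {M : Matrix (Fin 2) (Fin 2) ℝ[X]} (hM : M = (l.map fun x => periodMatrix x.1 x.2).prod) :
    (∀ i j n, 0 ≤ (M i j).coeff n) ∧ (∀ i, (M i i).coeff l.length = 1) ∧
    (∀ i n, l.length < n → (M i i).coeff n = 0) ∧ (∀ n, l.length ≤ n → (M 0 1).coeff n = 0) ∧
    (∀ n, l.length < n → (M 1 0).coeff n = 0) ∧
    (M 0 0).coeff 0 = (l.map fun x => x.1 / x.2).prod ∧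
    (M 1 1).coeff 0 = (l.map fun x => x.2 / x.1).prod ∧ (M 1 0).coeff 0 = 0 := by
  induction l generalizing M with
  | nil =>
    subst hM
    simp only [List.map_nil, List.prod_nil, List.length_nil]
    refine ⟨?_, ?_, ?_, ?_, ?_, ?_, ?_, ?_⟩
    · intro i j n
      rw [Matrix.one_apply]
      split_ifs
      · rw [coeff_one]; split_ifs <;> norm_num
      · simp
    · simp
    · intro i n hn
      rw [Matrix.one_apply_eq, coeff_one, if_neg hn.ne']
    all_goals simp
  | cons x l ih =>
    obtain ⟨hx1, hx2⟩ := hpos x (by simp)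
    obtain ⟨h1, h2, h3, h4, h5, h6, h7, h8⟩ := ih (fun y hy => hpos y (by simp [hy])) rfl
    set N := (l.map fun x => periodMatrix x.1 x.2).prod with hN
    have hMN : M = periodMatrix x.1 x.2 * N := by rw [hM, List.map_cons, List.prod_cons]
    have e0 : ∀ j, M 0 j = X * N 0 j + C (x.1 / x.2) * N 0 j + C (x.1 + x.2) * N 1 j := by
      intro j
      rw [hMN, Matrix.mul_apply, Fin.sum_univ_two]
      simp [periodMatrix, add_mul]
    have e1 : ∀ j, M 1 j = C (x.1⁻¹ + x.2⁻¹) * (X * N 0 j) + X * N 1 j +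
        C (x.2 / x.1) * N 1 j := by
      intro j
      rw [hMN, Matrix.mul_apply, Fin.sum_univ_two]
      simp [periodMatrix, add_mul, mul_assoc]
      ring
    have hd1 : 0 < x.1 / x.2 := by positivity
    have hd2 : 0 < x.2 / x.1 := by positivity
    have hd3 : 0 < x.1 + x.2 := by positivity
    have hd4 : 0 < x.1⁻¹ + x.2⁻¹ := by positivity
    have c0 : ∀ j n, (M 0 j).coeff (n + 1) = (N 0 j).coeff n +
        (x.1 / x.2) * (N 0 j).coeff (n + 1) + (x.1 + x.2) * (N 1 j).coeff (n + 1) := by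
      intro j n
      rw [e0, coeff_add, coeff_add, coeff_C_mul, coeff_C_mul, coeff_X_mul]
    have c1 : ∀ j n, (M 1 j).coeff (n + 1) = (x.1⁻¹ + x.2⁻¹) * (N 0 j).coeff n +
        (N 1 j).coeff n + (x.2 / x.1) * (N 1 j).coeff (n + 1) := by
      intro j n
      rw [e1, coeff_add, coeff_add, coeff_C_mul, coeff_C_mul, coeff_X_mul, coeff_X_mul]
    have z0 : ∀ j, (M 0 j).coeff 0 =
        (x.1 / x.2) * (N 0 j).coeff 0 + (x.1 + x.2) * (N 1 j).coeff 0 := by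
      intro j
      rw [e0, coeff_add, coeff_add, coeff_C_mul, coeff_C_mul, coeff_X_mul_zero, zero_add]
    have z1 : ∀ j, (M 1 j).coeff 0 = (x.2 / x.1) * (N 1 j).coeff 0 := by
      intro j
      rw [e1, coeff_add, coeff_add, coeff_C_mul, coeff_C_mul, coeff_X_mul_zero,
        coeff_X_mul_zero, mul_zero, zero_add, zero_add]
    simp only [List.length_cons]
    refine ⟨?_, ?_, ?_, ?_, ?_, ?_, ?_, ?_⟩
    · intro i j n
      have a1 := h1 0 j
      have a2 := h1 1 j
      fin_cases i <;> rcases n with _ | n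
      · have := a1 0; have := a2 0
        simp only [Fin.zero_eta, z0]; positivity
      · have := a1 n; have := a1 (n + 1); have := a2 (n + 1)
        simp only [Fin.zero_eta, c0]; positivity
      · have := a2 0
        simp only [Fin.mk_one, z1]; positivity
      · have := a1 n; have := a2 n; have := a2 (n + 1)
        simp only [Fin.mk_one, c1]; positivity
    · intro i
      fin_cases i
      · simp only [Fin.zero_eta, c0, h2, h3 0 _ (Nat.lt_succ_self _), h5 _ (Nat.lt_succ_self _)]
        ring
      · simp only [Fin.mk_one, c1, h2, h3 1 _ (Nat.lt_succ_self _), h4 _ le_rfl]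
        ring
    · intro i n hn
      obtain ⟨n, rfl⟩ : ∃ m, n = m + 1 := ⟨n - 1, by omega⟩
      fin_cases i
      · simp only [Fin.zero_eta, c0, h3 0 n (by omega), h3 0 (n + 1) (by omega),
          h5 (n + 1) (by omega)]
        ring
      · simp only [Fin.mk_one, c1, h3 1 n (by omega), h3 1 (n + 1) (by omega), h4 n (by omega)]
        ring
    · intro n hn
      obtain ⟨n, rfl⟩ : ∃ m, n = m + 1 := ⟨n - 1, by omega⟩
      simp only [c0, h4 n (by omega), h4 (n + 1) (by omega), h3 1 (n + 1) (by omega)]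
      ring
    · intro n hn
      obtain ⟨n, rfl⟩ : ∃ m, n = m + 1 := ⟨n - 1, by omega⟩
      simp only [c1, h3 0 n (by omega), h5 n (by omega), h5 (n + 1) (by omega)]
      ring
    · rw [z0, h6, h8, List.map_cons, List.prod_cons]; ring
    · rw [z1, h7, List.map_cons, List.prod_cons]
    · rw [z1, h8]; ring

theorem coeff_tracePoly (hα : ∀ m, 0 < α m) (hβ : ∀ m, 0 < β m) (hαβ : ∏ m, α m = ∏ m, β m) :
    (∀ n, 0 ≤ (tracePoly α β).coeff n) ∧ (tracePoly α β).coeff k = 2 ∧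
    (∀ n, k < n → (tracePoly α β).coeff n = 0) ∧ (tracePoly α β).coeff 0 = 2 := by
  have hM : symbolPoly α β =
      ((List.ofFn fun m => (α m, β m)).map fun x => periodMatrix x.1 x.2).prod := by
    rw [List.map_ofFn]; rfl
  obtain ⟨h1, h2, h3, -, -, h6, h7, -⟩ := coeff_periodMatrix_prod _ (by
      intro x hx
      obtain ⟨m, rfl⟩ := (List.mem_ofFn' _ _).mp hx
      exact ⟨hα m, hβ m⟩) hM
  rw [List.length_ofFn] at h2 h3
  simp only [tracePoly_eq, Matrix.trace_fin_two, coeff_add]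
  refine ⟨fun n => add_nonneg (h1 _ _ _) (h1 _ _ _), ?_, fun n hn => ?_, ?_⟩
  · rw [h2, h2]; norm_num
  · rw [h3 0 n hn, h3 1 n hn, add_zero]
  · rw [h6, h7, List.map_ofFn, List.map_ofFn, List.prod_ofFn, List.prod_ofFn]
    simp only [Function.comp, Finset.prod_div_distrib, hαβ]
    have : (∏ m, β m) ≠ 0 := (Finset.prod_pos fun m _ => hβ m).ne'
    rw [div_self this]; norm_num

variable (hk : 1 ≤ k) (hα : ∀ m, 0 < α m) (hβ : ∀ m, 0 < β m) (hαβ : ∏ m, α m = ∏ m, β m)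
include hα hβ hαβ

theorem natDegree_tracePoly : (tracePoly α β).natDegree = k := by
  obtain ⟨-, h2, h3, -⟩ := coeff_tracePoly hα hβ hαβ
  refine natDegree_eq_of_le_of_coeff_ne_zero (natDegree_le_iff_coeff_eq_zero.mpr h3) ?_
  rw [h2]; norm_num

theorem eval_tracePoly_pos {x : ℝ} (hx : 0 < x) : 0 < (tracePoly α β).eval x := by
  obtain ⟨h1, h2, h3, h0⟩ := coeff_tracePoly hα hβ hαβ
  rw [eval_eq_sum_range]
  refine Finset.sum_pos' (fun i _ => mul_nonneg (h1 i) (by positivity)) ⟨0, by simp, ?_⟩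
  rw [h0]; norm_num

include hk

theorem natDegree_discPoly :
    (discPoly α β).natDegree = 2 * k - 1 ∧ 0 < (discPoly α β).leadingCoeff := by
  obtain ⟨h1, h2, h3, -⟩ := coeff_tracePoly hα hβ hαβ
  have hd := natDegree_tracePoly hα hβ hαβ
  have hfac : discPoly α β = (tracePoly α β - 2 * (X - 1) ^ k) *
      (tracePoly α β + 2 * (X - 1) ^ k) := by
    rw [discPoly, mul_comm 2 k, pow_mul]; ring
  have hX : ∀ n, ((X - 1 : ℝ[X]) ^ k).coeff n = (-1) ^ (k - n) * (k.choose n : ℝ) := by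
    intro n
    have := coeff_X_add_C_pow (-1 : ℝ) k n
    rwa [C_neg, C_1, ← sub_eq_add_neg] at this
  have h2X : ∀ n, (2 * (X - 1 : ℝ[X]) ^ k).coeff n = 2 * ((-1) ^ (k - n) * (k.choose n : ℝ)) := by
    intro n
    rw [show (2 : ℝ[X]) = C 2 from rfl, coeff_C_mul, hX]
  have hA : (tracePoly α β - 2 * (X - 1) ^ k).natDegree = k - 1 ∧
      0 < (tracePoly α β - 2 * (X - 1) ^ k).leadingCoeff := by
    have hc : 0 < (tracePoly α β - 2 * (X - 1) ^ k).coeff (k - 1) := by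
      rw [coeff_sub, h2X, show k - (k - 1) = 1 by omega]
      have e : k.choose (k - 1) = k := by
        rw [Nat.choose_symm (by omega : 1 ≤ k), Nat.choose_one_right]
      rw [e]
      have := h1 (k - 1)
      have : (1 : ℝ) ≤ k := by exact_mod_cast hk
      linarith
    have hdeg : (tracePoly α β - 2 * (X - 1) ^ k).natDegree = k - 1 := by
      refine natDegree_eq_of_le_of_coeff_ne_zero (natDegree_le_iff_coeff_eq_zero.mpr ?_) hc.ne'
      intro n hn
      rw [coeff_sub, h2X]
      rcases eq_or_lt_of_le (show k ≤ n by omega) with rfl | h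
      · rw [h2]; simp
      · rw [h3 n h, Nat.choose_eq_zero_of_lt h]; simp
    exact ⟨hdeg, by rw [leadingCoeff, hdeg]; exact hc⟩
  have hB : (tracePoly α β + 2 * (X - 1) ^ k).natDegree = k ∧
      0 < (tracePoly α β + 2 * (X - 1) ^ k).leadingCoeff := by
    have hc : 0 < (tracePoly α β + 2 * (X - 1) ^ k).coeff k := by
      rw [coeff_add, h2X, h2]; simp
    have hdeg : (tracePoly α β + 2 * (X - 1) ^ k).natDegree = k := by
      refine natDegree_eq_of_le_of_coeff_ne_zero (natDegree_le_iff_coeff_eq_zero.mpr ?_) hc.ne'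
      intro n hn
      rw [coeff_add, h2X, h3 n hn, Nat.choose_eq_zero_of_lt hn]; simp
    exact ⟨hdeg, by rw [leadingCoeff, hdeg]; exact hc⟩
  rw [hfac]
  refine ⟨?_, ?_⟩
  · rw [natDegree_mul (leadingCoeff_ne_zero.mp hA.2.ne') (leadingCoeff_ne_zero.mp hB.2.ne'),
      hA.1, hB.1]
    omega
  · rw [leadingCoeff_mul]; exact mul_pos hA.2 hB.2

theorem discPoly_ne_zero : discPoly α β ≠ 0 :=
  leadingCoeff_ne_zero.mp (natDegree_discPoly hk hα hβ hαβ).2.ne'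

theorem discPoly_zero : (discPoly α β).eval 0 = 0 ∧ (discPoly α β).derivative.eval 0 ≠ 0 := by
  obtain ⟨h1, -, -, h0⟩ := coeff_tracePoly hα hβ hαβ
  have ht : (tracePoly α β).eval 0 = 2 := by rw [← coeff_zero_eq_eval_zero, h0]
  have ht' : (tracePoly α β).derivative.eval 0 = (tracePoly α β).coeff 1 := by
    rw [← coeff_zero_eq_eval_zero, coeff_derivative]; simp
  have hodd : (-1 : ℝ) ^ (2 * k - 1) = -1 := Odd.neg_one_pow ⟨k - 1, by omega⟩
  constructor
  · simp [discPoly, ht, pow_mul]; norm_num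
  · have : (discPoly α β).derivative.eval 0 = 4 * (tracePoly α β).coeff 1 + 8 * k := by
      simp only [discPoly, derivative_sub, derivative_mul, derivative_pow, derivative_X,
        derivative_one, derivative_ofNat, eval_sub, eval_add, eval_mul, eval_pow, eval_X, eval_one,
        eval_ofNat, map_natCast, eval_natCast, ht, ht', eval_zero]
      rw [zero_sub, hodd]
      push_cast
      ring
    rw [this]
    have := h1 1
    have : (1 : ℝ) ≤ k := by exact_mod_cast hk
    positivity

/-! ### Eigenvalues have different moduli off the negative axis -/

theorem norm_ne_norm_of_mem_slitPlane {z : ℂ} (hz : z ∈ Complex.slitPlane) {a b : ℂ}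
    (h1 : a + b = aeval z (tracePoly α β)) (h2 : a * b = (z - 1) ^ (2 * k)) : ‖a‖ ≠ ‖b‖ := by
  intro hab
  rcases eq_or_ne z 1 with rfl | hz1
  · rw [sub_self, zero_pow (by omega)] at h2
    have ha : a = 0 := by
      rcases mul_eq_zero.mp h2 with h | h
      · exact h
      · rwa [h, norm_zero, norm_eq_zero] at hab
    have hb : b = 0 := by rwa [ha, norm_zero, eq_comm, norm_eq_zero] at hab
    have ht := eval_tracePoly_pos hα hβ hαβ one_pos
    rw [ha, hb, add_zero, show (1 : ℂ) = ((1 : ℝ) : ℂ) by simp, ← Complex.coe_algebraMap,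
      aeval_algebraMap_apply, Complex.coe_algebraMap, coe_aeval_eq_eval, eq_comm,
      Complex.ofReal_eq_zero] at h1
    exact ht.ne' h1
  · obtain ⟨c, hc, hJ⟩ := exists_indefForm_symbol hk hα hβ
    obtain ⟨v, hv, hvB⟩ := exists_eigenvector (M := symbol α β z) (h1.trans (trace_symbol z).symm)
      (h2.trans (det_symbol hα hβ z).symm)
    set y := z ^ (2⁻¹ : ℂ) with hy
    have hyz : y ^ 2 = z := Complex.cpow_ofNat_inv_pow z 2
    have hz0 : z ≠ 0 := Complex.slitPlane_ne_zero hz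
    have hy0 : y ≠ 0 := by rintro h; rw [h] at hyz; exact hz0 (by rw [← hyz]; simp)
    have hyre : 0 < y.re := by
      rw [hy, Complex.cpow_def_of_ne_zero hz0, Complex.exp_re]
      refine mul_pos (Real.exp_pos _) (Real.cos_pos_of_mem_Ioo ?_)
      have : (Complex.log z * 2⁻¹).im = z.arg / 2 := by
        rw [show (2⁻¹ : ℂ) = ((2⁻¹ : ℝ) : ℂ) by simp, Complex.im_mul_ofReal, Complex.log_im]
        ring
      rw [this]
      have h1 := Complex.neg_pi_lt_arg z
      have h2 := lt_of_le_of_ne (Complex.arg_le_pi z) (Complex.slitPlane_arg_ne_pi hz)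
      constructor <;> linarith
    have h := hJ y hyre.le hy0 v
    rw [hyz, hvB, indefForm_smul] at h
    have hnorm : ‖a‖ ^ 2 = ‖z - 1‖ ^ (2 * k) := by
      rw [sq]; nth_rewrite 2 [hab]; rw [← norm_mul, h2, norm_pow]
    rw [hnorm] at h
    have hz1' : 0 < ‖z - 1‖ := norm_pos_iff.mpr (sub_ne_zero.mpr hz1)
    have hy1 : 0 < ‖y - 1‖ := by
      refine norm_pos_iff.mpr (sub_ne_zero.mpr ?_)
      rintro h; rw [h, one_pow] at hyz; exact hz1 hyz.symm
    have hvpos : 0 < ‖y * v 0‖ ^ 2 + ‖v 1‖ ^ 2 := by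
      by_contra hcon
      have h3 : ‖y * v 0‖ ^ 2 = 0 := le_antisymm (by nlinarith [sq_nonneg ‖v 1‖]) (sq_nonneg _)
      have h4 : ‖v 1‖ ^ 2 = 0 := le_antisymm (by nlinarith [sq_nonneg ‖y * v 0‖]) (sq_nonneg _)
      apply hv
      ext i
      fin_cases i
      · simpa [hy0] using h3
      · simpa using h4
    have : 0 < ‖z - 1‖ ^ (2 * k - 1) * (c * (y.re * ‖y - 1‖ / (1 + ‖y‖)) *
        (‖y * v 0‖ ^ 2 + ‖v 1‖ ^ 2)) := by positivity
    linarith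

theorem discPoly_aeval_ne_zero {z : ℂ} (hz : z ∈ Complex.slitPlane) :
    aeval z (discPoly α β) ≠ 0 := by
  intro h
  refine norm_ne_norm_of_mem_slitPlane hk hα hβ hαβ hz (a := aeval z (tracePoly α β) / 2)
    (b := aeval z (tracePoly α β) / 2) (by ring) ?_ rfl
  have : aeval z (tracePoly α β) ^ 2 - 4 * (z - 1) ^ (2 * k) = 0 := by
    simpa [discPoly, map_ofNat] using h
  linear_combination this / 4

omit hk hα hβ hαβ in
/-- A real polynomial all of whose complex zeros lie on the closed negative axis splits. -/
theorem splits_of_forall_root {P : ℝ[X]} (h : ∀ z ∈ Complex.slitPlane, aeval z P ≠ 0) :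
    P.Splits ∧ ∀ x ∈ P.roots, x ≤ 0 := by
  refine ⟨Splits.of_splits_map (algebraMap ℝ ℂ) (IsAlgClosed.splits _) fun a ha => ?_,
    fun x hx => ?_⟩
  · have h0 : aeval a P = 0 := by
      have := (mem_roots'.mp ha).2
      rwa [IsRoot, eval_map_algebraMap] at this
    have hs : a ∉ Complex.slitPlane := fun hs => h a hs h0
    rw [Complex.mem_slitPlane_iff] at hs
    push Not at hs
    exact ⟨a.re, Complex.ext (by simp) (by simp [hs.2])⟩
  · by_contra hcon
    push Not at hcon
    refine h x (by simp [Complex.mem_slitPlane_iff, hcon]) ?_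
    rw [← Complex.coe_algebraMap, aeval_algebraMap_apply, coe_aeval_eq_eval,
      (mem_roots'.mp hx).2.eq_zero, map_zero]

/-! ### The square-free part of the discriminant -/

omit hk hα hβ hαβ in
theorem qPoly_monic : (qPoly α β).Monic :=
  monic_prod_of_monic _ _ fun x _ => (monic_X_sub_C x).pow _

theorem p0_ne_zero : p0 α β ≠ 0 := by
  intro h
  apply discPoly_ne_zero hk hα hβ hαβ
  rw [discPoly_eq, h, mul_zero]

theorem p0_aeval_ne_zero {z : ℂ} (hz : z ∈ Complex.slitPlane) : aeval z (p0 α β) ≠ 0 := by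
  intro h
  apply discPoly_aeval_ne_zero hk hα hβ hαβ hz
  rw [discPoly_eq, map_mul, h, mul_zero]

theorem p0_splits : (p0 α β).Splits ∧ ∀ x ∈ (p0 α β).roots, x ≤ 0 :=
  splits_of_forall_root fun _ hz => p0_aeval_ne_zero hk hα hβ hαβ hz

theorem p0_leadingCoeff_pos : 0 < (p0 α β).leadingCoeff := by
  have h := (natDegree_discPoly hk hα hβ hαβ).2
  rwa [discPoly_eq, leadingCoeff_mul, (qPoly_monic.pow 2).leadingCoeff, one_mul] at h

theorem p0_natDegree_odd : Odd (p0 α β).natDegree := by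
  have h := (natDegree_discPoly hk hα hβ hαβ).1
  rw [discPoly_eq, natDegree_mul (qPoly_monic.pow 2).ne_zero (p0_ne_zero hk hα hβ hαβ),
    natDegree_pow] at h
  rw [Nat.odd_iff]
  omega

omit hk hα hβ hαβ in
theorem rootMultiplicity_qPoly (x : ℝ) :
    (qPoly α β).rootMultiplicity x = (discPoly α β).rootMultiplicity x / 2 := by
  classical
  rw [← count_roots, qPoly, roots_prod _ _ (Finset.prod_ne_zero_iff.mpr fun y _ =>
    pow_ne_zero _ (X_sub_C_ne_zero y)), Multiset.count_bind]
  simp only [roots_pow, roots_X_sub_C, Multiset.count_nsmul, Multiset.count_singleton]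
  change ∑ y ∈ (discPoly α β).roots.toFinset, _ = _
  simp only [mul_ite, mul_one, mul_zero]
  rw [Finset.sum_ite_eq]
  split_ifs with h
  · rfl
  · rw [Multiset.mem_toFinset] at h
    rw [← count_roots, Multiset.count_eq_zero_of_notMem h, Nat.zero_div]

theorem zero_mem_roots_p0 : (0 : ℝ) ∈ (p0 α β).roots := by
  obtain ⟨h0, h1⟩ := discPoly_zero hk hα hβ hαβ
  have hne := discPoly_ne_zero hk hα hβ hαβ
  have hm : (discPoly α β).rootMultiplicity 0 ≤ 1 := by
    by_contra hcon
    push Not at hcon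
    exact h1 ((one_lt_rootMultiplicity_iff_isRoot hne).mp hcon).2
  have hq : (qPoly α β).eval 0 ≠ 0 := by
    intro hq
    have : 0 < (qPoly α β).rootMultiplicity 0 :=
      (rootMultiplicity_pos qPoly_monic.ne_zero).mpr hq
    rw [rootMultiplicity_qPoly] at this
    omega
  rw [mem_roots (p0_ne_zero hk hα hβ hαβ), IsRoot]
  rw [discPoly_eq, eval_mul, eval_pow] at h0
  exact (mul_eq_zero.mp h0).resolve_left (pow_ne_zero _ hq)

end Aztec
end

noncomputable section

namespace Aztec

open Set

variable {k : ℕ}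

/-- The standing assumptions on the weights. -/
structure Admissible (α β : Fin k → ℝ) : Prop where
  one_le : 1 ≤ k
  pos_left : ∀ m, 0 < α m
  pos_right : ∀ m, 0 < β m
  prod_eq : ∏ m, α m = ∏ m, β m

variable {α β : Fin k → ℝ}

/-! ### Square roots -/

theorem half_sq (z : ℂ) : (z ^ (1 / 2 : ℂ)) ^ 2 = z := by
  rw [one_div]; exact Complex.cpow_ofNat_inv_pow z 2

theorem half_conj {z : ℂ} (hz : z ∈ Complex.slitPlane) :
    (starRingEnd ℂ) z ^ (1 / 2 : ℂ) = (starRingEnd ℂ) (z ^ (1 / 2 : ℂ)) := by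
  rw [Complex.conj_cpow _ _ (Complex.slitPlane_arg_ne_pi hz)]
  simp [Complex.conj_ofNat]

theorem continuousOn_half : ContinuousOn (fun z : ℂ => z ^ (1 / 2 : ℂ)) {z | 0 ≤ z.im} := by
  intro z hz
  by_cases hs : z ∈ Complex.slitPlane
  · exact (continuousAt_cpow_const hs).continuousWithinAt
  rw [Complex.mem_slitPlane_iff] at hs
  push Not at hs
  rcases eq_or_ne z 0 with rfl | hz0
  · refine ContinuousAt.continuousWithinAt ?_
    exact Complex.continuousAt_cpow_const_of_re_pos (Or.inl (by simp)) (by norm_num)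
  · have hre : z.re < 0 := lt_of_le_of_ne hs.1 fun h => hz0 (Complex.ext h hs.2)
    have h1 := Complex.continuousWithinAt_log_of_re_neg_of_im_zero hre hs.2
    have h2 : ContinuousWithinAt (fun w : ℂ => Complex.exp (Complex.log w * (1 / 2 : ℂ)))
        {z | 0 ≤ z.im} z := (h1.mul continuousWithinAt_const).cexp
    refine h2.congr_of_eventuallyEq ?_ (Complex.cpow_def_of_ne_zero hz0 _)
    have : ∀ᶠ w in 𝓝[{z : ℂ | 0 ≤ z.im}] z, w ≠ 0 :=
      eventually_nhdsWithin_of_eventually_nhds (eventually_ne_nhds hz0)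
    filter_upwards [this] with w hw
    exact Complex.cpow_def_of_ne_zero hw _

theorem sub_mem_slitPlane {z : ℂ} (hz : z ∈ Complex.slitPlane) {x : ℝ} (hx : x ≤ 0) :
    z - x ∈ Complex.slitPlane := by
  rw [Complex.mem_slitPlane_iff] at hz ⊢
  rcases hz with h | h
  · left; simp; linarith
  · right; simpa using h

variable (hw : Admissible α β)
include hw

theorem Admissible.roots_nonpos {x : ℝ} (hx : x ∈ (p0 α β).roots) : x ≤ 0 :=
  (p0_splits hw.1 hw.2 hw.3 hw.4).2 x hx

theorem sqrtP0_sq (z : ℂ) : sqrtP0 α β z ^ 2 = aeval z (p0 α β) := by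
  have hs := (p0_splits hw.1 hw.2 hw.3 hw.4).1
  have h1 : aeval z (p0 α β) = ((p0 α β).leadingCoeff : ℂ) *
      ((p0 α β).roots.map fun x : ℝ => z - (x : ℂ)).prod := by
    conv_lhs => rw [hs.eq_prod_roots]
    rw [map_mul, aeval_C, Complex.coe_algebraMap, map_multiset_prod, Multiset.map_map]
    congr 2
    refine Multiset.map_congr rfl fun x _ => ?_
    simp
  rw [h1, sqrtP0, mul_pow, ← Multiset.prod_map_pow]
  congr 1
  · rw [← Complex.ofReal_pow, Real.sq_sqrt (p0_leadingCoeff_pos hw.1 hw.2 hw.3 hw.4).le]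
  · simp only [half_sq]

theorem sqrtP0_differentiableOn : DifferentiableOn ℂ (sqrtP0 α β) Complex.slitPlane := by
  have key : ∀ m : Multiset ℝ, (∀ x ∈ m, x ≤ 0) → DifferentiableOn ℂ
      (fun z : ℂ => (m.map fun x : ℝ => (z - (x : ℂ)) ^ (1 / 2 : ℂ)).prod) Complex.slitPlane := by
    intro m
    induction m using Multiset.induction with
    | empty => intro _; simp
    | cons x m ih =>
      intro h
      simp only [Multiset.map_cons, Multiset.prod_cons]
      refine DifferentiableOn.mul (fun z hz => ?_) (ih fun y hy => h y (by simp [hy]))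
      have hd : DifferentiableAt ℂ (fun z : ℂ => z - (x : ℂ)) z := by fun_prop
      exact (hd.cpow_const (sub_mem_slitPlane hz (h x (by simp)))).differentiableWithinAt
  exact (key _ fun x hx => hw.roots_nonpos hx).const_mul _

omit hw in
theorem sqrtP0_continuousOn : ContinuousOn (sqrtP0 α β) {z | 0 ≤ z.im} := by
  have key : ∀ m : Multiset ℝ, ContinuousOn
      (fun z : ℂ => (m.map fun x : ℝ => (z - (x : ℂ)) ^ (1 / 2 : ℂ)).prod) {z | 0 ≤ z.im} := by
    intro m
    induction m using Multiset.induction with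
    | empty => simpa using continuousOn_const
    | cons x m ih =>
      simp only [Multiset.map_cons, Multiset.prod_cons]
      exact (continuousOn_half.comp (f := fun z : ℂ => z - (x : ℂ)) (by fun_prop)
        fun z hz => by simpa using hz).mul ih
  exact continuousOn_const.mul (key _)

theorem sqrtP0_conj {z : ℂ} (hz : z ∈ Complex.slitPlane) :
    sqrtP0 α β ((starRingEnd ℂ) z) = (starRingEnd ℂ) (sqrtP0 α β z) := by
  rw [sqrtP0, sqrtP0, map_mul, Complex.conj_ofReal, map_multiset_prod, Multiset.map_map]
  congr 2
  refine Multiset.map_congr rfl fun x hx => ?_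
  rw [Function.comp, ← half_conj (sub_mem_slitPlane hz (hw.roots_nonpos hx))]
  simp

theorem sqrtP0_ofReal_pos {x : ℝ} (hx : 0 < x) : ∃ r > 0, sqrtP0 α β x = (r : ℝ) := by
  have key : ∀ m : Multiset ℝ, (∀ y ∈ m, y ≤ 0) → ∃ r > 0,
      (m.map fun y : ℝ => ((x : ℂ) - (y : ℂ)) ^ (1 / 2 : ℂ)).prod = (r : ℝ) := by
    intro m
    induction m using Multiset.induction with
    | empty => exact fun _ => ⟨1, one_pos, by simp⟩
    | cons y m ih =>
      intro h
      obtain ⟨r, hr, hr'⟩ := ih fun z hz => h z (by simp [hz])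
      have hy : 0 < x - y := by have := h y (by simp); linarith
      refine ⟨(x - y) ^ (1 / 2 : ℝ) * r, mul_pos (Real.rpow_pos_of_pos hy _) hr, ?_⟩
      rw [Multiset.map_cons, Multiset.prod_cons, hr', Complex.ofReal_mul,
        Complex.ofReal_cpow hy.le]
      push_cast
      rfl
  obtain ⟨r, hr, hr'⟩ := key _ fun y hy => hw.roots_nonpos hy
  refine ⟨Real.sqrt (p0 α β).leadingCoeff * r,
    mul_pos (Real.sqrt_pos.mpr (p0_leadingCoeff_pos hw.1 hw.2 hw.3 hw.4)) hr, ?_⟩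
  rw [sqrtP0, hr', Complex.ofReal_mul]

omit hw in
/-- The square root of the discriminant on the slit plane. -/
def discRoot (α β : Fin k → ℝ) (z : ℂ) : ℂ := aeval z (qPoly α β) * sqrtP0 α β z

theorem discRoot_sq (z : ℂ) :
    discRoot α β z ^ 2 = aeval z (tracePoly α β) ^ 2 - 4 * (z - 1) ^ (2 * k) := by
  have : aeval z (discPoly α β) = aeval z (tracePoly α β) ^ 2 - 4 * (z - 1) ^ (2 * k) := by
    simp [discPoly, map_ofNat]
  rw [← this, discPoly_eq, discRoot, mul_pow, sqrtP0_sq hw, map_mul, map_pow]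

theorem discRoot_ne_zero {z : ℂ} (hz : z ∈ Complex.slitPlane) : discRoot α β z ≠ 0 := by
  have h := discPoly_aeval_ne_zero hw.1 hw.2 hw.3 hw.4 hz
  intro h0
  apply h
  have := discRoot_sq hw z
  rw [h0] at this
  simpa [discPoly, map_ofNat] using this.symm

theorem discRoot_differentiableOn : DifferentiableOn ℂ (discRoot α β) Complex.slitPlane :=
  (Polynomial.differentiable_aeval _).differentiableOn.mul (sqrtP0_differentiableOn hw)

omit hw in
theorem ofReal_aeval (P : ℝ[X]) (x : ℝ) : aeval (x : ℂ) P = ((P.eval x : ℝ) : ℂ) := by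
  rw [← Complex.coe_algebraMap, aeval_algebraMap_apply, coe_aeval_eq_eval]

theorem discRoot_ofReal_pos {x : ℝ} (hx : 0 < x) : ∃ r > 0, discRoot α β x = (r : ℝ) := by
  obtain ⟨r, hr, h⟩ := sqrtP0_ofReal_pos hw hx
  refine ⟨(qPoly α β).eval x * r, mul_pos ?_ hr, by rw [discRoot, h, ofReal_aeval]; push_cast; rfl⟩
  rw [qPoly, eval_prod]
  refine Finset.prod_pos fun y hy => ?_
  rw [eval_pow, eval_sub, eval_X, eval_C]
  have hy' : y ≤ 0 := (splits_of_forall_root fun _ hz =>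
    discPoly_aeval_ne_zero hw.1 hw.2 hw.3 hw.4 hz).2 y (Multiset.mem_toFinset.mp hy)
  exact pow_pos (by linarith) _

omit hw in
/-- The two eigenvalues of `(z - 1)^k Φ(z)`; the one for `ε = 1` has the larger modulus. -/
def lam (α β : Fin k → ℝ) (ε : ℝ) (z : ℂ) : ℂ :=
  (aeval z (tracePoly α β) + ε * discRoot α β z) / 2

omit hw in
theorem lam_add (ε : ℝ) (z : ℂ) : lam α β ε z + lam α β (-ε) z = aeval z (tracePoly α β) := by
  simp only [lam]; push_cast; ring

theorem lam_mul {ε : ℝ} (hε : ε = 1 ∨ ε = -1) (z : ℂ) :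
    lam α β ε z * lam α β (-ε) z = (z - 1) ^ (2 * k) := by
  have h := discRoot_sq hw z
  rcases hε with rfl | rfl <;> (simp only [lam]; push_cast; linear_combination -h / 4)

omit hw in
theorem lam_sub (ε : ℝ) (z : ℂ) : lam α β ε z - lam α β (-ε) z = ε * discRoot α β z := by
  simp only [lam]; push_cast; ring

theorem lam_differentiableOn (ε : ℝ) : DifferentiableOn ℂ (lam α β ε) Complex.slitPlane :=
  ((Polynomial.differentiable_aeval _).differentiableOn.add
    ((discRoot_differentiableOn hw).const_mul _)).div_const _

theorem norm_lam_lt {z : ℂ} (hz : z ∈ Complex.slitPlane) :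
    ‖lam α β (-1) z‖ < ‖lam α β 1 z‖ := by
  have hpre : IsPreconnected Complex.slitPlane :=
    (Complex.starConvex_one_slitPlane.isPathConnected
      Complex.one_mem_slitPlane).isConnected.isPreconnected
  have hc : ContinuousOn (fun z => ‖lam α β 1 z‖ - ‖lam α β (-1) z‖) Complex.slitPlane :=
    (lam_differentiableOn hw 1).continuousOn.norm.sub
      (lam_differentiableOn hw (-1)).continuousOn.norm
  have hne : ∀ z ∈ Complex.slitPlane, ‖lam α β 1 z‖ - ‖lam α β (-1) z‖ ≠ 0 := fun z hz h =>
    norm_ne_norm_of_mem_slitPlane hw.1 hw.2 hw.3 hw.4 hz (lam_add 1 z)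
      (lam_mul hw (Or.inl rfl) z) (sub_eq_zero.mp h)
  have h1 : 0 < ‖lam α β 1 1‖ - ‖lam α β (-1) 1‖ := by
    obtain ⟨r, hr, h⟩ := discRoot_ofReal_pos hw one_pos
    have ht := eval_tracePoly_pos hw.2 hw.3 hw.4 one_pos
    have e1 : lam α β 1 1 = (((tracePoly α β).eval 1 + r) / 2 : ℝ) := by
      rw [lam]; rw [show (1 : ℂ) = ((1 : ℝ) : ℂ) by simp, ofReal_aeval, h]; push_cast; ring
    have e2 : lam α β (-1) 1 = (((tracePoly α β).eval 1 - r) / 2 : ℝ) := by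
      rw [lam]; rw [show (1 : ℂ) = ((1 : ℝ) : ℂ) by simp, ofReal_aeval, h]; push_cast; ring
    rw [e1, e2, Complex.norm_real, Complex.norm_real, Real.norm_eq_abs, Real.norm_eq_abs,
      abs_of_pos (by positivity), sub_pos, abs_lt]
    constructor <;> linarith
  by_contra hcon
  obtain ⟨w, hws, hw0⟩ := hpre.intermediate_value hz Complex.one_mem_slitPlane hc
    (show (0 : ℝ) ∈ Icc _ _ from ⟨by linarith, h1.le⟩)
  exact hne w hws hw0

theorem lam_ne_zero_of_ne {ε : ℝ} (hε : ε = 1 ∨ ε = -1) {z : ℂ} (hz1 : z ≠ 1) :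
    lam α β ε z ≠ 0 := by
  intro h
  have := lam_mul hw hε z
  rw [h, zero_mul] at this
  exact pow_ne_zero _ (sub_ne_zero.mpr hz1) this.symm

theorem lam_one_ne_zero {z : ℂ} (hz : z ∈ Complex.slitPlane) : lam α β 1 z ≠ 0 :=
  norm_pos_iff.mp ((norm_nonneg _).trans_lt (norm_lam_lt hw hz))

theorem discRoot_conj {z : ℂ} (hz : z ∈ Complex.slitPlane) :
    discRoot α β ((starRingEnd ℂ) z) = (starRingEnd ℂ) (discRoot α β z) := by
  rw [discRoot, discRoot, map_mul, sqrtP0_conj hw hz, Polynomial.aeval_conj]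

theorem lam_conj (ε : ℝ) {z : ℂ} (hz : z ∈ Complex.slitPlane) :
    lam α β ε ((starRingEnd ℂ) z) = (starRingEnd ℂ) (lam α β ε z) := by
  simp only [lam]
  rw [discRoot_conj hw hz, Polynomial.aeval_conj]
  simp [Complex.conj_ofNat]

omit hw in
/-- The eigenvalues of `Φ(z)`. -/
def rho (α β : Fin k → ℝ) (ε : ℝ) (z : ℂ) : ℂ := lam α β ε z / (z - 1) ^ k

theorem rho_mul {ε : ℝ} (hε : ε = 1 ∨ ε = -1) {z : ℂ} (hz1 : z ≠ 1) :
    rho α β ε z * rho α β (-ε) z = 1 := by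
  have : (z - 1) ^ k ≠ 0 := pow_ne_zero _ (sub_ne_zero.mpr hz1)
  rw [rho, rho, div_mul_div_comm, lam_mul hw hε, ← pow_add, ← two_mul, div_self]
  exact pow_ne_zero _ (sub_ne_zero.mpr hz1)

theorem rho_add (ε : ℝ) {z : ℂ} (hz0 : z ≠ 0) (hz1 : z ≠ 1) :
    rho α β ε z + rho α β (-ε) z = (Phi α β z).trace := by
  rw [rho, rho, ← add_div, lam_add, Phi_eq hw.2 hw.3 hz0 hz1, Matrix.trace_smul, trace_symbol,
    smul_eq_mul, div_eq_inv_mul]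

theorem det_Phi {z : ℂ} (hz0 : z ≠ 0) (hz1 : z ≠ 1) : (Phi α β z).det = 1 := by
  have : (z - 1) ^ k ≠ 0 := pow_ne_zero _ (sub_ne_zero.mpr hz1)
  rw [Phi_eq hw.2 hw.3 hz0 hz1, Matrix.det_smul, det_symbol hw.2 hw.3, Fintype.card_fin,
    mul_comm 2 k, pow_mul, inv_pow, inv_mul_cancel₀ (pow_ne_zero _ this)]

theorem rho_eq {z : ℂ} (hz : z ∈ Complex.slitPlane) (hz1 : z ≠ 1) :
    rho1 α β z = rho α β 1 z ∧ rho2 α β z = rho α β (-1) z := by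
  have hz0 : z ≠ 0 := Complex.slitPlane_ne_zero hz
  have hp : 0 < ‖(z - 1) ^ k‖ := norm_pos_iff.mpr (pow_ne_zero _ (sub_ne_zero.mpr hz1))
  have hlt : ‖rho α β (-1) z‖ < ‖rho α β 1 z‖ := by
    rw [rho, rho, norm_div, norm_div]
    exact div_lt_div_of_pos_right (norm_lam_lt hw hz) hp
  have hadd := rho_add hw 1 hz0 hz1
  have hmul := rho_mul hw (Or.inl rfl) hz1
  rw [← det_Phi hw hz0 hz1] at hmul
  rw [rho1, rho2, if_pos hz, if_pos hz]
  generalize hM : Phi α β z = M at *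
  have hs := half_sq (M.trace ^ 2 - 4 * M.det)
  have key : ∀ c d : ℂ, c + d = M.trace → c * d = M.det → ‖d‖ ≤ ‖c‖ →
      c = rho α β 1 z ∧ d = rho α β (-1) z := by
    intro c d h1 h2 h3
    have h4 : (c - rho α β 1 z) * (c - rho α β (-1) z) = 0 := by
      linear_combination (-c) * hadd + hmul + c * h1 - h2
    rcases mul_eq_zero.mp h4 with h | h
    · refine ⟨sub_eq_zero.mp h, ?_⟩
      linear_combination h1 - hadd - h
    · exfalso
      have e1 : c = rho α β (-1) z := sub_eq_zero.mp h
      have e2 : d = rho α β 1 z := by linear_combination h1 - hadd - h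
      rw [e1, e2] at h3
      exact absurd hlt (not_lt.mpr h3)
  simp only [eigenvaluesByModulus]
  split_ifs with hif
  · exact key _ _ (by ring) (by linear_combination -hs / 4) hif
  · exact key _ _ (by ring) (by linear_combination -hs / 4) (not_le.mp hif).le

theorem one_lt_norm_rho {z : ℂ} (hz : z ∈ Complex.slitPlane) (hz1 : z ≠ 1) :
    1 < ‖rho α β 1 z‖ := by
  have hp : 0 < ‖(z - 1) ^ k‖ := norm_pos_iff.mpr (pow_ne_zero _ (sub_ne_zero.mpr hz1))
  have hlt : ‖rho α β (-1) z‖ < ‖rho α β 1 z‖ := by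
    rw [rho, rho, norm_div, norm_div]
    exact div_lt_div_of_pos_right (norm_lam_lt hw hz) hp
  have := congrArg norm (rho_mul hw (Or.inl rfl) hz1)
  rw [norm_mul, norm_one] at this
  nlinarith [norm_nonneg (rho α β (-1) z)]

/-! ### Spectral projections -/

omit hw in
/-- The spectral projection of `Φ(z)` for the eigenvalue `rho ε z`. -/
def proj (α β : Fin k → ℝ) (ε : ℝ) (z : ℂ) : Matrix (Fin 2) (Fin 2) ℂ :=
  (ε * discRoot α β z)⁻¹ • (symbol α β z - lam α β (-ε) z • 1)

omit hw in
theorem zpow_eq_of_projections {M Q Q' : Matrix (Fin 2) (Fin 2) ℂ} {a b : ℂ} (ha : a ≠ 0)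
    (hb : b ≠ 0) (h1 : Q + Q' = 1) (h2 : Q * Q = Q) (hM : M = a • Q + b • Q') (j : ℤ) :
    M ^ j = a ^ j • Q + b ^ j • Q' := by
  have hQ' : Q' = 1 - Q := by rw [← h1]; abel
  have h3 : Q * Q' = 0 := by rw [hQ', mul_sub, mul_one, h2, sub_self]
  have h4 : Q' * Q = 0 := by rw [hQ', sub_mul, one_mul, h2, sub_self]
  have h5 : Q' * Q' = Q' := by
    nth_rewrite 2 [hQ']; rw [mul_sub, mul_one, h4, sub_zero]
  have hmul : ∀ x y x' y' : ℂ, (x • Q + y • Q') * (x' • Q + y' • Q') =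
      (x * x') • Q + (y * y') • Q' := by
    intro x y x' y'
    simp only [add_mul, mul_add, smul_mul_smul_comm, h2, h3, h4, h5, smul_zero, add_zero, zero_add]
  have hnat : ∀ n : ℕ, M ^ n = a ^ n • Q + b ^ n • Q' := by
    intro n
    induction n with
    | zero => simp [h1]
    | succ n ih => rw [pow_succ, ih, hM, hmul, pow_succ, pow_succ]
  rcases Int.eq_nat_or_neg j with ⟨n, rfl | rfl⟩
  · simpa using hnat n
  · rw [Matrix.zpow_neg_natCast, hnat n]
    refine Matrix.inv_eq_left_inv ?_
    rw [hmul, zpow_neg, zpow_neg, zpow_natCast, zpow_natCast, inv_mul_cancel₀ (pow_ne_zero _ ha),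
      inv_mul_cancel₀ (pow_ne_zero _ hb), one_smul, one_smul, h1]

omit hw in
theorem cayleyHamilton_two (M : Matrix (Fin 2) (Fin 2) ℂ) :
    M * M = M.trace • M - M.det • 1 := by
  ext i j
  fin_cases i <;> fin_cases j <;>
    simp [Matrix.mul_apply, Fin.sum_univ_two, Matrix.trace_fin_two, Matrix.det_fin_two] <;> ring

section Projections

variable {ε : ℝ} (hε : ε = 1 ∨ ε = -1) {z : ℂ} (hS : discRoot α β z ≠ 0)
include hε hS

omit hw in
theorem proj_add : proj α β ε z + proj α β (-ε) z = 1 := by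
  have hε0 : (ε : ℂ) ≠ 0 := by rcases hε with rfl | rfl <;> simp
  have h := lam_sub (α := α) (β := β) ε z
  simp only [proj, neg_neg, Complex.ofReal_neg, neg_mul, inv_neg, neg_smul]
  rw [← sub_eq_add_neg, ← smul_sub, sub_sub_sub_cancel_left, ← sub_smul, h, smul_smul,
    inv_mul_cancel₀ (mul_ne_zero hε0 hS), one_smul]

theorem proj_mul_self : proj α β ε z * proj α β ε z = proj α β ε z := by
  have hε0 : (ε : ℂ) ≠ 0 := by rcases hε with rfl | rfl <;> simp
  have h := lam_sub (α := α) (β := β) ε z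
  have hCH := cayleyHamilton_two (symbol α β z)
  rw [trace_symbol, det_symbol hw.2 hw.3, ← lam_add ε z, ← lam_mul hw hε z] at hCH
  have key : (symbol α β z - lam α β (-ε) z • 1) * (symbol α β z - lam α β (-ε) z • 1) =
      (lam α β ε z - lam α β (-ε) z) • (symbol α β z - lam α β (-ε) z • 1) := by
    simp only [sub_mul, mul_sub, hCH, smul_mul_assoc, mul_smul_comm, one_mul, mul_one, smul_sub,
      smul_smul, sub_smul, add_smul]
    abel
  rw [proj, smul_mul_smul_comm, key, h, smul_smul, mul_assoc,
    inv_mul_cancel₀ (mul_ne_zero hε0 hS), mul_one]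

theorem Phi_eq_proj (hz0 : z ≠ 0) (hz1 : z ≠ 1) :
    Phi α β z = rho α β ε z • proj α β ε z + rho α β (-ε) z • proj α β (-ε) z := by
  have hε0 : (ε : ℂ) ≠ 0 := by rcases hε with rfl | rfl <;> simp
  have h := lam_sub (α := α) (β := β) ε z
  have h1 : lam α β ε z • proj α β ε z + lam α β (-ε) z • proj α β (-ε) z = symbol α β z := by
    simp only [proj, neg_neg, Complex.ofReal_neg, neg_mul, inv_neg, neg_smul]
    calc _ = ((ε * discRoot α β z)⁻¹ * (lam α β ε z - lam α β (-ε) z)) • symbol α β z := by module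
      _ = symbol α β z := by rw [h, inv_mul_cancel₀ (mul_ne_zero hε0 hS), one_smul]
  rw [Phi_eq hw.2 hw.3 hz0 hz1]
  conv_lhs => rw [← h1]
  rw [smul_add, smul_smul, smul_smul, rho, rho, div_eq_inv_mul, div_eq_inv_mul]

theorem Phi_zpow (hz0 : z ≠ 0) (hz1 : z ≠ 1) (j : ℤ) :
    Phi α β z ^ j = rho α β ε z ^ j • proj α β ε z + rho α β (-ε) z ^ j • proj α β (-ε) z := by
  have hε' : -ε = 1 ∨ -ε = -1 := by rcases hε with rfl | rfl <;> simp
  have hr := rho_mul hw hε hz1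
  exact zpow_eq_of_projections (left_ne_zero_of_mul_eq_one hr) (right_ne_zero_of_mul_eq_one hr)
    (proj_add hε hS) (proj_mul_self hw hε hS) (Phi_eq_proj hw hε hS hz0 hz1) j

theorem proj_mul_Phi_zpow (hz0 : z ≠ 0) (hz1 : z ≠ 1) (j : ℤ) :
    proj α β ε z * Phi α β z ^ j = rho α β ε z ^ j • proj α β ε z := by
  have h2 := proj_mul_self hw hε hS
  have hQ' : proj α β (-ε) z = 1 - proj α β ε z := by rw [← proj_add hε hS]; abel
  rw [Phi_zpow hw hε hS hz0 hz1, mul_add, mul_smul_comm, mul_smul_comm, h2, hQ', mul_sub, mul_one,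
    h2, sub_self, smul_zero, add_zero]

end Projections

theorem eigenvectorMatrix_conj {E : ℂ → Matrix (Fin 2) (Fin 2) ℂ} {z : ℂ}
    (hz : z ∈ Complex.slitPlane) (hz1 : z ≠ 1) (hE : IsUnit (E z).det)
    (h : Phi α β z = E z * Matrix.diagonal ![rho1 α β z, rho2 α β z] * (E z)⁻¹) :
    E z * !![1, 0; 0, 0] * (E z)⁻¹ = proj α β 1 z ∧
      E z * !![0, 0; 0, 1] * (E z)⁻¹ = proj α β (-1) z := by
  have hz0 : z ≠ 0 := Complex.slitPlane_ne_zero hz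
  have hS := discRoot_ne_zero hw hz
  rw [(rho_eq hw hz hz1).1, (rho_eq hw hz hz1).2] at h
  set a := rho α β 1 z with ha
  set b := rho α β (-1) z with hb
  have hab : a - b ≠ 0 := by
    rw [ha, hb, rho, rho, ← sub_div, lam_sub]
    exact div_ne_zero (mul_ne_zero (by simp) hS) (pow_ne_zero _ (sub_ne_zero.mpr hz1))
  have hEE : E z * (E z)⁻¹ = 1 := Matrix.mul_nonsing_inv _ hE
  have hP : Phi α β z = a • proj α β 1 z + b • proj α β (-1) z :=
    Phi_eq_proj hw (Or.inl rfl) hS hz0 hz1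
  have hsum : E z * !![1, 0; 0, 0] * (E z)⁻¹ + E z * !![0, 0; 0, 1] * (E z)⁻¹ = 1 := by
    rw [← add_mul, ← mul_add, ← hEE]
    congr 1
    have : (!![1, 0; 0, 0] + !![0, 0; 0, 1] : Matrix (Fin 2) (Fin 2) ℂ) = 1 := by
      ext i j; fin_cases i <;> fin_cases j <;> simp
    rw [this, mul_one]
  have hcomb : a • (E z * !![1, 0; 0, 0] * (E z)⁻¹) + b • (E z * !![0, 0; 0, 1] * (E z)⁻¹) =
      Phi α β z := by
    have : (a • !![1, 0; 0, 0] + b • !![0, 0; 0, 1] : Matrix (Fin 2) (Fin 2) ℂ) =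
        Matrix.diagonal ![a, b] := by
      ext i j; fin_cases i <;> fin_cases j <;> simp
    rw [h, ← this, mul_add, add_mul, mul_smul_comm, mul_smul_comm, smul_mul_assoc, smul_mul_assoc]
  have hpsum : proj α β 1 z + proj α β (-1) z = 1 := proj_add (Or.inl rfl) hS
  generalize E z * !![1, 0; 0, 0] * (E z)⁻¹ = Q at *
  generalize E z * !![0, 0; 0, 1] * (E z)⁻¹ = Q' at *
  have e1 : Q' = 1 - Q := by rw [← hsum]; abel
  have e2 : proj α β (-1) z = 1 - proj α β 1 z := by rw [← hpsum]; abel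
  have e3 : (a - b) • Q = (a - b) • proj α β 1 z := by
    rw [hP, e1, e2] at hcomb
    calc (a - b) • Q = (a • Q + b • (1 - Q)) - b • 1 := by module
      _ = (a - b) • proj α β 1 z := by rw [hcomb]; module
  have e4 : Q = proj α β 1 z := smul_right_injective _ hab e3
  exact ⟨e4, by rw [e1, e2, e4]⟩

end Aztec
end

noncomputable section

namespace Aztec

open Set

variable {k : ℕ} {α β : Fin k → ℝ}

/-! ### Traces of powers of the symbol -/

/-- The polynomial `Tr ((z - 1)^k Φ(z))^n`. -/
def powerTrace (α β : Fin k → ℝ) (n : ℕ) : ℝ[X] := (symbolPoly α β ^ n).trace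

variable (hw : Admissible α β)
include hw

theorem aeval_powerTrace (n : ℕ) (z : ℂ) :
    aeval z (powerTrace α β n) = lam α β 1 z ^ n + lam α β (-1) z ^ n := by
  have h1 : aeval z (powerTrace α β n) = (symbol α β z ^ n).trace := by
    rw [powerTrace, ← trace_evalMatrix, map_pow, symbol]
  rw [h1]
  clear h1
  have hadd := lam_add (α := α) (β := β) 1 z
  have hmul := lam_mul hw (Or.inl rfl) z
  have hCH := cayleyHamilton_two (symbol α β z)
  rw [trace_symbol, det_symbol hw.2 hw.3, ← hadd, ← hmul] at hCH
  induction n using Nat.strong_induction_on with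
  | _ n ih =>
    rcases n with _ | _ | n
    · simp; norm_num
    · rw [zero_add, pow_one, trace_symbol, pow_one, pow_one, hadd]
    · have e : symbol α β z ^ (n + 2) = (lam α β 1 z + lam α β (-1) z) • symbol α β z ^ (n + 1) -
          (lam α β 1 z * lam α β (-1) z) • symbol α β z ^ n := by
        rw [pow_add, pow_two, hCH, mul_sub, mul_smul_comm, mul_smul_comm, mul_one, ← pow_succ]
      rw [e, Matrix.trace_sub, Matrix.trace_smul, Matrix.trace_smul, ih (n + 1) (by omega),
        ih n (by omega), smul_eq_mul, smul_eq_mul]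
      ring

theorem norm_lam_neg_pow_lt {n : ℕ} (hn : n ≠ 0) {z : ℂ} (hz : z ∈ Complex.slitPlane) :
    ‖lam α β (-1) z ^ n‖ < ‖lam α β 1 z ^ n‖ := by
  rw [norm_pow, norm_pow]
  exact pow_lt_pow_left₀ (norm_lam_lt hw hz) (norm_nonneg _) hn

theorem aeval_powerTrace_ne_zero (n : ℕ) {z : ℂ} (hz : z ∈ Complex.slitPlane) :
    aeval z (powerTrace α β n) ≠ 0 := by
  rw [aeval_powerTrace hw]
  rcases eq_or_ne n 0 with rfl | hn
  · norm_num
  · intro h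
    have h1 := norm_lam_neg_pow_lt hw hn hz
    rw [eq_neg_of_add_eq_zero_left h, norm_neg] at h1
    exact lt_irrefl _ h1

omit hw in
/-- The imaginary part of `z λ'(z) / λ(z)`, divided by that of `z`, for the larger eigenvalue. -/
def angularDensity (α β : Fin k → ℝ) (z : ℂ) : ℝ :=
  (z * (deriv (lam α β 1) z / lam α β 1 z)).im / z.im

omit hw in
theorem im_mul_derivative_div {P : ℝ[X]} (hP : ∀ z ∈ Complex.slitPlane, aeval z P ≠ 0) {z : ℂ}
    (hz : 0 < z.im) :
    (z * (aeval z (derivative P) / aeval z P)).im / z.im =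
      (P.roots.map fun x : ℝ => -x / ‖z - x‖ ^ 2).sum := by
  have hs : z ∈ Complex.slitPlane := Or.inr hz.ne'
  have hsp := (splits_of_forall_root hP).1
  have h1 : eval z (P.map (algebraMap ℝ ℂ)) ≠ 0 := by
    rw [eval_map_algebraMap]; exact hP z hs
  have h2 := (hsp.map (algebraMap ℝ ℂ)).eval_derivative_div_eval_of_ne_zero h1
  rw [derivative_map, eval_map_algebraMap, eval_map_algebraMap, hsp.roots_map,
    Multiset.map_map] at h2
  rw [h2]
  have key : ∀ m : Multiset ℝ, (z * (m.map ((fun w : ℂ => 1 / (z - w)) ∘ (algebraMap ℝ ℂ))).sum).im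
      / z.im = (m.map fun x : ℝ => -x / ‖z - x‖ ^ 2).sum := by
    intro m
    induction m using Multiset.induction with
    | empty => simp
    | cons x m ih =>
      rw [Multiset.map_cons, Multiset.sum_cons, Multiset.map_cons, Multiset.sum_cons, mul_add,
        Complex.add_im, add_div, ih]
      congr 1
      have hne : z - x ≠ 0 := by
        intro h
        have := congrArg Complex.im h
        simp at this
        exact hz.ne' this
      have hn : ‖z - x‖ ^ 2 ≠ 0 := pow_ne_zero _ (norm_ne_zero_iff.mpr hne)
      simp only [Function.comp, Complex.coe_algebraMap, mul_one_div]
      rw [Complex.div_im, Complex.normSq_eq_norm_sq]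
      simp only [Complex.sub_re, Complex.sub_im, Complex.ofReal_re, Complex.ofReal_im, sub_zero]
      field_simp
      ring
  exact key _

omit hw in
theorem sum_neg_div_norm_sq_mono {m : Multiset ℝ} (hm : ∀ x ∈ m, x ≤ 0) {z w : ℂ}
    (hzw : ‖z‖ = ‖w‖) (hre : w.re ≤ z.re) (hw0 : 0 < w.im) :
    0 ≤ (m.map fun x : ℝ => -x / ‖z - x‖ ^ 2).sum ∧
    (m.map fun x : ℝ => -x / ‖z - x‖ ^ 2).sum ≤ (m.map fun x : ℝ => -x / ‖w - x‖ ^ 2).sum := by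
  constructor
  · refine Multiset.sum_nonneg fun y hy => ?_
    obtain ⟨x, hx, rfl⟩ := Multiset.mem_map.mp hy
    have := hm x hx
    exact div_nonneg (by linarith) (sq_nonneg _)
  · refine Multiset.sum_map_le_sum_map _ _ fun x hx => ?_
    have hx0 := hm x hx
    have hexp : ∀ u : ℂ, ‖u - x‖ ^ 2 = ‖u‖ ^ 2 - 2 * x * u.re + x ^ 2 := by
      intro u
      rw [← Complex.normSq_eq_norm_sq, ← Complex.normSq_eq_norm_sq, Complex.normSq_apply,
        Complex.normSq_apply]
      simp; ring
    have hpos : 0 < ‖w - x‖ ^ 2 := by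
      refine pow_pos (norm_pos_iff.mpr fun h => ?_) 2
      have := congrArg Complex.im h
      simp at this
      exact hw0.ne' this
    refine div_le_div_of_nonneg_left (by linarith) hpos ?_
    rw [hexp, hexp, hzw]
    nlinarith

theorem tendsto_powerTrace_logDeriv {z : ℂ} (hz : 0 < z.im) :
    Tendsto (fun n : ℕ => (n : ℂ)⁻¹ * (aeval z (derivative (powerTrace α β n)) /
      aeval z (powerTrace α β n))) atTop (𝓝 (deriv (lam α β 1) z / lam α β 1 z)) := by
  have hs : z ∈ Complex.slitPlane := Or.inr hz.ne'
  have ho := Complex.isOpen_slitPlane.mem_nhds hs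
  have hd : ∀ ε : ℝ, HasDerivAt (lam α β ε) (deriv (lam α β ε) z) z := fun ε =>
    ((lam_differentiableOn hw ε).differentiableAt ho).hasDerivAt
  have hl0 := lam_one_ne_zero hw hs
  set l := lam α β 1 z with hl
  set l' := lam α β (-1) z with hl'
  set d := deriv (lam α β 1) z
  set d' := deriv (lam α β (-1)) z
  have hder : ∀ n : ℕ, aeval z (derivative (powerTrace α β n)) =
      n * l ^ (n - 1) * d + n * l' ^ (n - 1) * d' := by
    intro n
    have h1 := (powerTrace α β n).hasDerivAt_aeval z
    have h2 := ((hd 1).pow n).add ((hd (-1)).pow n)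
    refine h1.unique (h2.congr_of_eventuallyEq (Eventually.of_forall fun w => ?_))
    simpa using aeval_powerTrace hw n w
  have hq : ‖l' / l‖ < 1 := by
    rw [norm_div, div_lt_one (norm_pos_iff.mpr hl0)]
    exact norm_lam_lt hw hs
  have hqn := tendsto_pow_atTop_nhds_zero_of_norm_lt_one hq
  have hlim : Tendsto (fun n : ℕ => (d / l + (l' / l) ^ n * (d' / l)) / (1 + (l' / l) ^ (n + 1)))
      atTop (𝓝 (d / l)) := by
    have := (tendsto_const_nhds (x := d / l)).add (hqn.mul_const (d' / l))
    have h3 := this.div ((tendsto_const_nhds (x := (1 : ℂ))).add (hqn.comp (tendsto_add_atTop_nat 1)))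
      (by simp)
    simp only [zero_mul, add_zero, div_one] at h3
    exact h3
  rw [← tendsto_add_atTop_iff_nat 1]
  refine hlim.congr fun n => ?_
  have hT := aeval_powerTrace_ne_zero hw (n + 1) hs
  rw [aeval_powerTrace hw, ← hl, ← hl'] at hT
  rw [hder, aeval_powerTrace hw, ← hl, ← hl', Nat.add_sub_cancel]
  have hn : ((n + 1 : ℕ) : ℂ) ≠ 0 := by exact_mod_cast Nat.succ_ne_zero n
  have h5 : 1 + (l' / l) ^ (n + 1) ≠ 0 := by
    intro h
    apply hT
    rw [div_pow] at h
    field_simp at h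
    simpa using h
  rw [div_pow, div_pow] at *
  field_simp
  ring

theorem angularDensity_mono {z w : ℂ} (hz : 0 < z.im) (hw0 : 0 < w.im) (hzw : ‖z‖ = ‖w‖)
    (hre : w.re ≤ z.re) :
    0 ≤ angularDensity α β z ∧ angularDensity α β z ≤ angularDensity α β w := by
  have hlim : ∀ u : ℂ, 0 < u.im → Tendsto (fun n : ℕ => (n : ℝ)⁻¹ *
      ((powerTrace α β n).roots.map fun x : ℝ => -x / ‖u - x‖ ^ 2).sum) atTop
      (𝓝 (angularDensity α β u)) := by
    intro u hu
    have h1 := ((tendsto_powerTrace_logDeriv hw hu).const_mul u)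
    have h2 := ((Complex.continuous_im.tendsto _).comp h1).div_const u.im
    refine h2.congr fun n => ?_
    rw [← im_mul_derivative_div (fun v hv => aeval_powerTrace_ne_zero hw n hv) hu]
    simp only [Function.comp]
    rw [mul_left_comm, show ((n : ℂ)⁻¹) = (((n : ℝ)⁻¹ : ℝ) : ℂ) by push_cast; rfl,
      Complex.im_ofReal_mul, mul_div_assoc]
  have hroots : ∀ n, ∀ x ∈ (powerTrace α β n).roots, x ≤ 0 := fun n =>
    (splits_of_forall_root fun v hv => aeval_powerTrace_ne_zero hw n hv).2
  constructor
  · refine ge_of_tendsto' (hlim z hz) fun n => ?_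
    exact mul_nonneg (by positivity) (sum_neg_div_norm_sq_mono (hroots n) hzw hre hw0).1
  · refine le_of_tendsto_of_tendsto' (hlim z hz) (hlim w hw0) fun n => ?_
    exact mul_le_mul_of_nonneg_left (sum_neg_div_norm_sq_mono (hroots n) hzw hre hw0).2
      (by positivity)

/-! ### The height function and its angular monotonicity -/

omit hw in
/-- Twice the real part of the exponent `F(z; χ, η)` on the sheet of the larger eigenvalue. -/
def hgt (α β : Fin k → ℝ) (χ η : ℝ) (z : ℂ) : ℝ :=
  k * (η + 1) / 2 * Real.log ‖z‖ - (1 - χ) * k * Real.log ‖z - 1‖ - χ * Real.log ‖lam α β 1 z‖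

omit hw in
/-- Twice the derivative `z F'(z; χ, η)` on the sheet of the larger eigenvalue. -/
def hgtDeriv (α β : Fin k → ℝ) (χ η : ℝ) (z : ℂ) : ℂ :=
  k * (η + 1) / 2 - (1 - χ) * k * (z / (z - 1)) - χ * (z * (deriv (lam α β 1) z / lam α β 1 z))

omit hw in
theorem hasDerivAt_log_norm {f : ℝ → ℂ} {f' : ℂ} {t : ℝ} (hf : HasDerivAt f f' t) (h0 : f t ≠ 0) :
    HasDerivAt (fun s => Real.log ‖f s‖) (f' / f t).re t := by
  have h1 : HasDerivAt (fun s => f s / f t) (f' / f t) t := hf.div_const _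
  have h2 := h1.clog_real (by rw [div_self h0]; exact Complex.one_mem_slitPlane)
  rw [div_self h0, div_one] at h2
  have h3 := (Complex.reCLM.hasFDerivAt.comp_hasDerivAt t h2).add_const (Real.log ‖f t‖)
  refine (h3.congr_of_eventuallyEq ?_)
  filter_upwards [hf.continuousAt.eventually_ne h0] with s hs
  simp only [Function.comp, Complex.reCLM_apply, Complex.log_re, norm_div]
  rw [Real.log_div (norm_ne_zero_iff.mpr hs) (norm_ne_zero_iff.mpr h0)]
  ring

theorem hasDerivAt_hgt {χ η : ℝ} {u : ℝ → ℂ} {u' : ℂ} {t : ℝ} (hu : HasDerivAt u u' t)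
    (h1 : Complex.exp (u t) ≠ 1) (hs : Complex.exp (u t) ∈ Complex.slitPlane ∨ χ = 0) :
    HasDerivAt (fun s => hgt α β χ η (Complex.exp (u s)))
      (hgtDeriv α β χ η (Complex.exp (u t)) * u').re t := by
  have he : HasDerivAt (fun s => Complex.exp (u s)) (Complex.exp (u t) * u') t := hu.cexp
  have hne := Complex.exp_ne_zero (u t)
  have hd1 := (hasDerivAt_log_norm he hne).const_mul (k * (η + 1) / 2 : ℝ)
  have hd2 := (hasDerivAt_log_norm (he.sub_const 1) (sub_ne_zero.mpr h1)).const_mul ((1 - χ) * k)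
  set z := Complex.exp (u t) with hz
  rcases hs with hs | rfl
  · have hl : HasDerivAt (lam α β 1) (deriv (lam α β 1) z) z :=
      ((lam_differentiableOn hw 1).differentiableAt
        (Complex.isOpen_slitPlane.mem_nhds hs)).hasDerivAt
    have hl' := hl.comp_of_eq t he hz.symm
    have hd3 := (hasDerivAt_log_norm hl' (lam_one_ne_zero hw hs)).const_mul χ
    refine ((hd1.sub hd2).sub hd3).congr_deriv ?_
    rw [hgtDeriv, ← Complex.re_ofReal_mul, ← Complex.re_ofReal_mul, ← Complex.re_ofReal_mul,
      ← Complex.sub_re, ← Complex.sub_re, mul_div_cancel_left₀ _ hne]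
    congr 1
    simp only [Function.comp]
    push_cast
    ring
  · refine (hd1.sub hd2).congr_of_eventuallyEq (Eventually.of_forall fun s => by simp [hgt])
      |>.congr_deriv ?_
    rw [hgtDeriv, ← Complex.re_ofReal_mul, ← Complex.re_ofReal_mul,
      ← Complex.sub_re, mul_div_cancel_left₀ _ hne]
    congr 1
    push_cast
    ring

omit hw in
/-- The angular derivative of the height, divided by the imaginary part. -/
def angularSlope (α β : Fin k → ℝ) (χ : ℝ) (z : ℂ) : ℝ :=
  χ * angularDensity α β z - (1 - χ) * k / ‖z - 1‖ ^ 2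

omit hw in
theorem hgtDeriv_im {χ η : ℝ} {z : ℂ} (hz : 0 < z.im) :
    -(hgtDeriv α β χ η z).im = z.im * angularSlope α β χ z := by
  have hne : z - 1 ≠ 0 := by
    intro h
    have := congrArg Complex.im h
    simp at this
    exact hz.ne' this
  have hn : ‖z - 1‖ ^ 2 ≠ 0 := pow_ne_zero _ (norm_ne_zero_iff.mpr hne)
  have h1 : (z / (z - 1)).im = -z.im / ‖z - 1‖ ^ 2 := by
    rw [Complex.div_im, Complex.normSq_eq_norm_sq]
    simp only [Complex.sub_re, Complex.sub_im, Complex.one_re, Complex.one_im, sub_zero]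
    field_simp
    ring
  have h2 : (z * (deriv (lam α β 1) z / lam α β 1 z)).im = z.im * angularDensity α β z := by
    rw [angularDensity]; field_simp
  have h3 : hgtDeriv α β χ η z = ((k * (η + 1) / 2 : ℝ) : ℂ) -
      (((1 - χ) * k : ℝ) : ℂ) * (z / (z - 1)) -
      (χ : ℂ) * (z * (deriv (lam α β 1) z / lam α β 1 z)) := by
    rw [hgtDeriv]; push_cast; ring
  rw [h3, Complex.sub_im, Complex.sub_im, Complex.ofReal_im, Complex.im_ofReal_mul,
    Complex.im_ofReal_mul, h1, h2, angularSlope]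
  field_simp
  ring

/-- Points of the plane in logarithmic polar coordinates. -/
abbrev polar (x θ : ℝ) : ℂ := Complex.exp (x + θ * Complex.I)

omit hw in
theorem polar_im (x θ : ℝ) : (polar x θ).im = Real.exp x * Real.sin θ := by
  rw [polar, Complex.exp_im]; simp

omit hw in
theorem polar_re (x θ : ℝ) : (polar x θ).re = Real.exp x * Real.cos θ := by
  rw [polar, Complex.exp_re]; simp

omit hw in
theorem norm_polar (x θ : ℝ) : ‖polar x θ‖ = Real.exp x := by
  rw [polar, Complex.norm_exp]; simp

omit hw in
theorem polar_im_pos (x : ℝ) {θ : ℝ} (hθ : θ ∈ Ioo 0 Real.pi) : 0 < (polar x θ).im := by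
  rw [polar_im]
  exact mul_pos (Real.exp_pos _) (Real.sin_pos_of_pos_of_lt_pi hθ.1 hθ.2)

omit hw in
theorem ne_one_of_im_pos {z : ℂ} (hz : 0 < z.im) : z ≠ 1 := by
  rintro rfl; simp at hz

omit hw in
theorem mem_slitPlane_of_im_pos {z : ℂ} (hz : 0 < z.im) : z ∈ Complex.slitPlane := Or.inr hz.ne'

theorem angularSlope_strictMono {χ : ℝ} (h0 : 0 ≤ χ) (h1 : χ < 1) {z w : ℂ} (hz : 0 < z.im)
    (hw0 : 0 < w.im) (hzw : ‖z‖ = ‖w‖) (hre : w.re < z.re) :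
    (1 - χ) * k / ‖z - 1‖ ^ 2 - (1 - χ) * k / ‖w - 1‖ ^ 2 ≤
      angularSlope α β χ w - angularSlope α β χ z ∧
    angularSlope α β χ z < angularSlope α β χ w := by
  have hU := mul_le_mul_of_nonneg_left (angularDensity_mono hw hz hw0 hzw hre.le).2 h0
  have hk : (0 : ℝ) < k := by exact_mod_cast hw.1
  have hexp : ∀ u : ℂ, ‖u - 1‖ ^ 2 = ‖u‖ ^ 2 - 2 * u.re + 1 := by
    intro u
    rw [← Complex.normSq_eq_norm_sq, ← Complex.normSq_eq_norm_sq, Complex.normSq_apply,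
      Complex.normSq_apply]
    simp; ring
  have hpz : 0 < ‖z - 1‖ ^ 2 := pow_pos (norm_pos_iff.mpr (sub_ne_zero.mpr (ne_one_of_im_pos hz))) 2
  have hlt : ‖z - 1‖ ^ 2 < ‖w - 1‖ ^ 2 := by rw [hexp, hexp, hzw]; linarith
  have hlt' : (1 - χ) * k / ‖w - 1‖ ^ 2 < (1 - χ) * k / ‖z - 1‖ ^ 2 :=
    div_lt_div_of_pos_left (mul_pos (by linarith) hk) hpz hlt
  unfold angularSlope
  constructor <;> linarith

theorem hasDerivAt_hgt_polar {χ η x θ : ℝ} (hθ : θ ∈ Ioo 0 Real.pi) :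
    HasDerivAt (fun s : ℝ => hgt α β χ η (polar x s))
      ((polar x θ).im * angularSlope α β χ (polar x θ)) θ := by
  have hu : HasDerivAt (fun s : ℝ => (x : ℂ) + s * Complex.I) Complex.I θ := by
    simpa using ((Complex.ofRealCLM.hasDerivAt (x := θ)).mul_const Complex.I).const_add (x : ℂ)
  have him := polar_im_pos x hθ
  have := hasDerivAt_hgt hw (χ := χ) (η := η) hu (ne_one_of_im_pos him)
    (Or.inl (mem_slitPlane_of_im_pos him))
  refine this.congr_deriv ?_
  rw [← hgtDeriv_im (η := η) him, Complex.mul_I_re]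

omit hw in
theorem polar_re_lt {x θ θ' : ℝ} (hθ : 0 ≤ θ) (hθ' : θ' ≤ Real.pi) (h : θ < θ') :
    (polar x θ').re < (polar x θ).re := by
  rw [polar_re, polar_re]
  exact mul_lt_mul_of_pos_left (Real.cos_lt_cos_of_nonneg_of_le_pi hθ hθ' h) (Real.exp_pos _)

theorem angularSlope_polar_lt {χ x θ θ' : ℝ} (h0 : 0 ≤ χ) (h1 : χ < 1) (hθ : θ ∈ Ioo 0 Real.pi)
    (hθ' : θ' ∈ Ioo 0 Real.pi) (h : θ < θ') :
    angularSlope α β χ (polar x θ) < angularSlope α β χ (polar x θ') :=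
  (angularSlope_strictMono hw h0 h1 (polar_im_pos x hθ) (polar_im_pos x hθ')
    (by rw [norm_polar, norm_polar]) (polar_re_lt hθ.1.le hθ'.2.le h)).2

/-- The angular sublevel sets of the height are convex. -/
theorem convex_sublevel {χ η x c : ℝ} (h0 : 0 ≤ χ) (h1 : χ < 1) :
    Convex ℝ {θ : ℝ | θ ∈ Ioo 0 Real.pi ∧ hgt α β χ η (polar x θ) < c} := by
  refine Set.OrdConnected.convex ⟨fun a ha b hb t ht => ?_⟩
  have htI : t ∈ Ioo 0 Real.pi := ⟨ha.1.1.trans_le ht.1, ht.2.trans_lt hb.1.2⟩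
  refine ⟨htI, ?_⟩
  by_contra hcon
  push Not at hcon
  have hat : a < t := lt_of_le_of_ne ht.1 (by rintro rfl; exact absurd ha.2 (not_lt.mpr hcon))
  have htb : t < b := lt_of_le_of_ne ht.2 (by rintro rfl; exact absurd hb.2 (not_lt.mpr hcon))
  have hd : ∀ s ∈ Ioo 0 Real.pi, HasDerivAt (fun s : ℝ => hgt α β χ η (polar x s))
      ((polar x s).im * angularSlope α β χ (polar x s)) s := fun s hs => hasDerivAt_hgt_polar hw hs
  have hsub1 : ∀ s ∈ Icc a t, s ∈ Ioo 0 Real.pi := fun s hs =>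
    ⟨ha.1.1.trans_le hs.1, hs.2.trans_lt htI.2⟩
  have hsub2 : ∀ s ∈ Icc t b, s ∈ Ioo 0 Real.pi := fun s hs =>
    ⟨htI.1.trans_le hs.1, hs.2.trans_lt hb.1.2⟩
  obtain ⟨s1, hs1, e1⟩ := exists_hasDerivAt_eq_slope _ _ hat
    (fun s hs => (hd s (hsub1 s hs)).continuousAt.continuousWithinAt)
    (fun s hs => hd s (hsub1 s (Ioo_subset_Icc_self hs)))
  obtain ⟨s2, hs2, e2⟩ := exists_hasDerivAt_eq_slope _ _ htb
    (fun s hs => (hd s (hsub2 s hs)).continuousAt.continuousWithinAt)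
    (fun s hs => hd s (hsub2 s (Ioo_subset_Icc_self hs)))
  have hI1 := hsub1 s1 (Ioo_subset_Icc_self hs1)
  have hI2 := hsub2 s2 (Ioo_subset_Icc_self hs2)
  have hpos : 0 < angularSlope α β χ (polar x s1) := by
    have : 0 < (polar x s1).im * angularSlope α β χ (polar x s1) := by
      rw [e1]; exact div_pos (by linarith [ha.2]) (by linarith)
    exact (mul_pos_iff_of_pos_left (polar_im_pos x hI1)).mp this
  have hneg : angularSlope α β χ (polar x s2) < 0 := by
    have : (polar x s2).im * angularSlope α β χ (polar x s2) < 0 := by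
      rw [e2]; exact div_neg_of_neg_of_pos (by linarith [hb.2]) (by linarith)
    exact neg_of_mul_neg_right this (polar_im_pos x hI2).le
  have := angularSlope_polar_lt hw (x := x) h0 h1 hI1 hI2 (hs1.2.trans hs2.1)
  linarith

end Aztec
end

noncomputable section

namespace Aztec

open Set

variable {k : ℕ} {α β : Fin k → ℝ}

/-! ### Saddle points of the height function -/

/-- A critical point `exp (x₀ + i θ₀)` of the height function in the closed upper half plane. -/
structure IsSaddle (α β : Fin k → ℝ) (χ η x₀ θ₀ : ℝ) : Prop where
  nonneg : 0 ≤ χ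
  lt_one : χ < 1
  eta_gt : -1 < η
  eta_lt : η < 1
  theta_pos : 0 < θ₀
  theta_le : θ₀ ≤ Real.pi
  eq_zero_of_theta_eq : θ₀ = Real.pi → χ = 0
  critical : hgtDeriv α β χ η (polar x₀ θ₀) = 0

theorem polar_pi (x : ℝ) : polar x Real.pi = -(Real.exp x : ℝ) := by
  rw [polar, Complex.exp_add, Complex.exp_pi_mul_I]; simp

theorem polar_ne_one {x θ : ℝ} (h0 : 0 < θ) (h1 : θ ≤ Real.pi) : polar x θ ≠ 1 := by
  rcases h1.lt_or_eq with h | rfl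
  · exact ne_one_of_im_pos (polar_im_pos x ⟨h0, h⟩)
  · rw [polar_pi]
    intro h
    have := congrArg Complex.re h
    rw [Complex.neg_re, Complex.ofReal_re, Complex.one_re] at this
    linarith [Real.exp_pos x]

theorem polar_neg (x θ : ℝ) : polar x (-θ) = (starRingEnd ℂ) (polar x θ) := by
  rw [polar, polar, ← Complex.exp_conj]
  simp

theorem eq_polar {z : ℂ} {x : ℝ} (h : ‖z‖ = Real.exp x) : z = polar x z.arg := by
  rw [polar, Complex.exp_add, ← Complex.ofReal_exp, ← h, Complex.norm_mul_exp_arg_mul_I]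

section

variable (hw : Admissible α β)
include hw

theorem IsSaddle.eventually_hgt_lt {χ η x₀ θ₀ : ℝ} (hs : IsSaddle α β χ η x₀ θ₀) {d v : ℂ}
    (hd : HasDerivAt (fun u => hgtDeriv α β χ η (Complex.exp u)) d (x₀ + θ₀ * Complex.I))
    (hv : (d * v ^ 2).re < 0) :
    ∀ᶠ τ : ℝ in 𝓝[>] 0, hgt α β χ η (Complex.exp (x₀ + θ₀ * Complex.I + τ * v)) <
      hgt α β χ η (polar x₀ θ₀) := by
  set u₀ : ℂ := x₀ + θ₀ * Complex.I with hu₀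
  have hline : ∀ τ : ℝ, HasDerivAt (fun τ : ℝ => u₀ + τ * v) v τ := fun τ => by
    simpa using ((Complex.ofRealCLM.hasDerivAt (x := τ)).mul_const v).const_add u₀
  have hcont : Continuous fun τ : ℝ => Complex.exp (u₀ + τ * v) := by fun_prop
  have h1 : ∀ᶠ τ : ℝ in 𝓝 0, Complex.exp (u₀ + τ * v) ≠ 1 := by
    refine hcont.continuousAt.eventually_ne ?_
    simpa using polar_ne_one (x := x₀) hs.theta_pos hs.theta_le
  have h2 : ∀ᶠ τ : ℝ in 𝓝 0, Complex.exp (u₀ + τ * v) ∈ Complex.slitPlane ∨ χ = 0 := by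
    rcases hs.theta_le.lt_or_eq with h | h
    · have hm : Complex.exp (u₀ + (0 : ℝ) * v) ∈ Complex.slitPlane := by
        have := mem_slitPlane_of_im_pos (polar_im_pos x₀ ⟨hs.theta_pos, h⟩)
        simpa using this
      filter_upwards [hcont.continuousAt.preimage_mem_nhds (Complex.isOpen_slitPlane.mem_nhds hm)]
        with τ hτ using Or.inl hτ
    · exact Eventually.of_forall fun _ => Or.inr (hs.eq_zero_of_theta_eq h)
  have hder : ∀ᶠ τ : ℝ in 𝓝 0, HasDerivAt (fun s : ℝ => hgt α β χ η (Complex.exp (u₀ + s * v)))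
      (hgtDeriv α β χ η (Complex.exp (u₀ + τ * v)) * v).re τ := by
    filter_upwards [h1, h2] with τ ha hb using hasDerivAt_hgt hw (hline τ) ha hb
  have hsecond : HasDerivAt (fun τ : ℝ => (hgtDeriv α β χ η (Complex.exp (u₀ + τ * v)) * v).re)
      (d * v ^ 2).re 0 := by
    have h3 := (hd.comp_of_eq (0 : ℝ) (hline 0) (by simp)).mul_const v
    have h4 := Complex.reCLM.hasFDerivAt.comp_hasDerivAt (0 : ℝ) h3
    refine h4.congr_deriv ?_
    simp only [Complex.reCLM_apply]
    ring_nf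
  have hneg : ∀ᶠ τ : ℝ in 𝓝[>] 0, (hgtDeriv α β χ η (Complex.exp (u₀ + τ * v)) * v).re < 0 := by
    have h5 := (hasDerivAt_iff_tendsto_slope.mp hsecond).mono_left
      (nhdsWithin_mono (0 : ℝ) (fun t (ht : 0 < t) => ht.ne') : 𝓝[>] (0 : ℝ) ≤ 𝓝[≠] 0)
    filter_upwards [h5.eventually (gt_mem_nhds hv), self_mem_nhdsWithin] with τ hτ hpos
    have h0 : (hgtDeriv α β χ η (Complex.exp (u₀ + (0 : ℝ) * v)) * v).re = 0 := by
      have : hgtDeriv α β χ η (Complex.exp u₀) = 0 := hs.critical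
      simp [this]
    rw [slope_def_field, h0, sub_zero, sub_zero] at hτ
    exact (div_neg_iff.mp hτ).elim (fun h => absurd h.2 (not_lt.mpr (le_of_lt hpos))) (·.1)
  obtain ⟨ε, hε, hball⟩ := Metric.eventually_nhds_iff.mp hder
  obtain ⟨δ, hδ, hlt⟩ := mem_nhdsGT_iff_exists_Ioo_subset.mp hneg
  have hδ' : (0 : ℝ) < δ := hδ
  filter_upwards [Ioo_mem_nhdsGT (lt_min hε hδ')] with τ hτ
  have hle1 : τ < ε := hτ.2.trans_le (min_le_left _ _)
  have hle2 : τ < δ := hτ.2.trans_le (min_le_right _ _)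
  have hD : ∀ s ∈ Icc 0 τ, HasDerivAt (fun s : ℝ => hgt α β χ η (Complex.exp (u₀ + s * v)))
      (hgtDeriv α β χ η (Complex.exp (u₀ + s * v)) * v).re s := fun s hs' => by
    apply hball
    rw [Real.dist_eq, sub_zero, abs_of_nonneg hs'.1]
    exact hs'.2.trans_lt hle1
  have hanti := strictAntiOn_of_deriv_neg (convex_Icc 0 τ)
    (fun s hs' => (hD s hs').continuousAt.continuousWithinAt) (fun s hs' => by
      rw [interior_Icc] at hs'
      rw [(hD s (Ioo_subset_Icc_self hs')).deriv]
      exact hlt ⟨hs'.1, hs'.2.trans hle2⟩)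
  have := hanti (left_mem_Icc.mpr hτ.1.le) (right_mem_Icc.mpr hτ.1.le) hτ.1
  simpa [u₀] using this

theorem differentiableAt_hgtDeriv {χ η : ℝ} {z : ℂ} (h1 : z ≠ 1)
    (hs : z ∈ Complex.slitPlane ∨ χ = 0) : DifferentiableAt ℂ (hgtDeriv α β χ η) z := by
  have hsub : z - 1 ≠ 0 := sub_ne_zero.mpr h1
  have hA : DifferentiableAt ℂ (fun z : ℂ => k * (η + 1) / 2 - (1 - χ) * k * (z / (z - 1))) z := by
    fun_prop (disch := assumption)
  rcases hs with hs | rfl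
  · have ho := Complex.isOpen_slitPlane.mem_nhds hs
    have hl := (lam_differentiableOn hw 1).differentiableAt ho
    have hl' := ((lam_differentiableOn hw 1).deriv Complex.isOpen_slitPlane).differentiableAt ho
    have hB : DifferentiableAt ℂ (fun z : ℂ => (χ : ℂ) * (z * (deriv (lam α β 1) z /
        lam α β 1 z))) z :=
      (differentiableAt_id.mul (hl'.div hl (lam_one_ne_zero hw hs))).const_mul _
    exact hA.sub hB
  · refine hA.congr_of_eventuallyEq (Eventually.of_forall fun z => ?_)
    simp [hgtDeriv]

omit hw in
theorem norm_polar_sub_one_sq (x θ : ℝ) :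
    ‖polar x θ - 1‖ ^ 2 = Real.exp x ^ 2 - 2 * Real.exp x * Real.cos θ + 1 := by
  rw [← Complex.normSq_eq_norm_sq, Complex.normSq_apply, Complex.sub_re, Complex.sub_im,
    polar_re, polar_im]
  simp only [Complex.one_re, Complex.one_im, sub_zero]
  nlinarith [Real.sin_sq_add_cos_sq θ]

omit hw in
theorem IsSaddle.angularSlope_eq_zero {χ η x₀ θ₀ : ℝ} (hs : IsSaddle α β χ η x₀ θ₀)
    (h : θ₀ < Real.pi) : angularSlope α β χ (polar x₀ θ₀) = 0 := by
  have him := polar_im_pos x₀ ⟨hs.theta_pos, h⟩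
  have := hgtDeriv_im (α := α) (β := β) (χ := χ) (η := η) him
  rw [hs.critical, Complex.zero_im, neg_zero] at this
  exact (mul_eq_zero.mp this.symm).resolve_left him.ne'

theorem IsSaddle.re_deriv_neg {χ η x₀ θ₀ : ℝ} (hs : IsSaddle α β χ η x₀ θ₀)
    (h : θ₀ < Real.pi) {d : ℂ}
    (hd : HasDerivAt (fun u => hgtDeriv α β χ η (Complex.exp u)) d (x₀ + θ₀ * Complex.I)) :
    d.re < 0 := by
  have hθ : θ₀ ∈ Ioo 0 Real.pi := ⟨hs.theta_pos, h⟩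
  have him := polar_im_pos x₀ hθ
  have hB0 := hs.angularSlope_eq_zero h
  have hk : (0 : ℝ) < k := by exact_mod_cast hw.1
  have hline : HasDerivAt (fun s : ℝ => (x₀ : ℂ) + s * Complex.I) Complex.I θ₀ := by
    simpa using ((Complex.ofRealCLM.hasDerivAt (x := θ₀)).mul_const Complex.I).const_add (x₀ : ℂ)
  have hIm : HasDerivAt (fun s : ℝ => (hgtDeriv α β χ η (polar x₀ s)).im) d.re θ₀ := by
    have := Complex.imCLM.hasFDerivAt.comp_hasDerivAt θ₀ (hd.comp_of_eq θ₀ hline rfl)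
    refine this.congr_deriv ?_
    simp
  set g : ℝ → ℝ := fun s => (1 - χ) * k / ‖polar x₀ s - 1‖ ^ 2 with hg
  set N : ℝ := ‖polar x₀ θ₀ - 1‖ ^ 2 with hN
  have hNpos : 0 < N :=
    pow_pos (norm_pos_iff.mpr (sub_ne_zero.mpr (ne_one_of_im_pos him))) 2
  have hgd : HasDerivAt g (-((1 - χ) * k * (2 * Real.exp x₀ * Real.sin θ₀)) / N ^ 2) θ₀ := by
    have h1 : HasDerivAt (fun s : ℝ => Real.exp x₀ ^ 2 - 2 * Real.exp x₀ * Real.cos s + 1)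
        (2 * Real.exp x₀ * Real.sin θ₀) θ₀ := by
      have := (((Real.hasDerivAt_cos θ₀).const_mul (2 * Real.exp x₀)).const_sub
        (Real.exp x₀ ^ 2)).add_const 1
      exact this.congr_deriv (by ring)
    have h2 := ((hasDerivAt_const θ₀ ((1 - χ) * k)).div h1
      (by rw [← norm_polar_sub_one_sq]; exact hNpos.ne'))
    refine (h2.congr_of_eventuallyEq (Eventually.of_forall fun s => ?_)).congr_deriv ?_
    · simp only [hg, norm_polar_sub_one_sq, Pi.div_apply]
    · rw [← norm_polar_sub_one_sq]; ring
  have hsin : HasDerivAt (fun s : ℝ => (polar x₀ s).im) (Real.exp x₀ * Real.cos θ₀) θ₀ := by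
    have := (Real.hasDerivAt_sin θ₀).const_mul (Real.exp x₀)
    exact this.congr_of_eventuallyEq (Eventually.of_forall fun s => polar_im x₀ s)
  have hD : HasDerivAt (fun s : ℝ => (hgtDeriv α β χ η (polar x₀ s)).im +
      (polar x₀ s).im * (g θ₀ - g s))
      (d.re + ((Real.exp x₀ * Real.cos θ₀) * (g θ₀ - g θ₀) + (polar x₀ θ₀).im *
        (-(-((1 - χ) * k * (2 * Real.exp x₀ * Real.sin θ₀)) / N ^ 2)))) θ₀ :=
    hIm.add (hsin.mul (hgd.const_sub (g θ₀)))
  have hle : d.re + ((Real.exp x₀ * Real.cos θ₀) * (g θ₀ - g θ₀) + (polar x₀ θ₀).im *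
        (-(-((1 - χ) * k * (2 * Real.exp x₀ * Real.sin θ₀)) / N ^ 2))) ≤ 0 := by
    have hsl := (hasDerivAt_iff_tendsto_slope.mp hD).mono_left
      (nhdsWithin_mono θ₀ (fun t (ht : θ₀ < t) => ht.ne') : 𝓝[>] θ₀ ≤ 𝓝[≠] θ₀)
    refine le_of_tendsto hsl ?_
    filter_upwards [Ioo_mem_nhdsGT h] with s hs'
    have hsI : s ∈ Ioo 0 Real.pi := ⟨hs.theta_pos.trans hs'.1, hs'.2⟩
    have hims := polar_im_pos x₀ hsI
    have h3 := (angularSlope_strictMono hw hs.nonneg hs.lt_one him hims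
      (by rw [norm_polar, norm_polar]) (polar_re_lt hθ.1.le hs'.2.le hs'.1)).1
    rw [hB0, sub_zero] at h3
    have h4 := hgtDeriv_im (α := α) (β := β) (χ := χ) (η := η) hims
    rw [slope_def_field, sub_self, mul_zero, add_zero, hs.critical, Complex.zero_im, sub_zero]
    refine div_nonpos_of_nonpos_of_nonneg ?_ (by linarith [hs'.1])
    have h5 : g θ₀ - g s ≤ angularSlope α β χ (polar x₀ s) := h3
    nlinarith
  have hpos : 0 < (polar x₀ θ₀).im *
        (-(-((1 - χ) * k * (2 * Real.exp x₀ * Real.sin θ₀)) / N ^ 2)) := by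
    have := Real.sin_pos_of_pos_of_lt_pi hθ.1 hθ.2
    have h6 : 0 < 1 - χ := by linarith [hs.lt_one]
    rw [neg_div, neg_neg]
    positivity
  rw [sub_self, mul_zero, zero_add] at hle
  linarith

/-- The slope of the descending rays at a saddle point. -/
theorem IsSaddle.exists_descent {χ η x₀ θ₀ : ℝ} (hs : IsSaddle α β χ η x₀ θ₀) :
    ∃ s : ℝ, ∀ σ : ℝ, σ ^ 2 = 1 → ∀ᶠ τ : ℝ in 𝓝[>] 0, θ₀ - s * τ ∈ Ioo 0 Real.pi ∧
      hgt α β χ η (polar (x₀ + σ * τ) (θ₀ - s * τ)) < hgt α β χ η (polar x₀ θ₀) := by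
  have hne := polar_ne_one (x := x₀) hs.theta_pos hs.theta_le
  have hslit : polar x₀ θ₀ ∈ Complex.slitPlane ∨ χ = 0 := by
    rcases hs.theta_le.lt_or_eq with h | h
    · exact Or.inl (mem_slitPlane_of_im_pos (polar_im_pos x₀ ⟨hs.theta_pos, h⟩))
    · exact Or.inr (hs.eq_zero_of_theta_eq h)
  have hdiff := differentiableAt_hgtDeriv hw (η := η) hne hslit
  have hd := hdiff.hasDerivAt.comp ((x₀ : ℂ) + θ₀ * Complex.I)
    (Complex.hasDerivAt_exp ((x₀ : ℂ) + θ₀ * Complex.I))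
  set d := deriv (hgtDeriv α β χ η) (polar x₀ θ₀) * Complex.exp (x₀ + θ₀ * Complex.I) with hd'
  obtain ⟨s, hs0, hI, hre⟩ : ∃ s : ℝ, 0 ≤ s ∧ (∀ᶠ τ : ℝ in 𝓝[>] 0, θ₀ - s * τ ∈ Ioo 0 Real.pi) ∧
      ∀ σ : ℝ, σ ^ 2 = 1 → (d * (σ - s * Complex.I) ^ 2).re < 0 := by
    rcases hs.theta_le.lt_or_eq with h | h
    · refine ⟨0, le_rfl, Eventually.of_forall fun τ => by simpa using ⟨hs.theta_pos, h⟩,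
        fun σ hσ => ?_⟩
      have h1 : ((σ : ℂ) - (0 : ℝ) * Complex.I) ^ 2 = 1 := by
        have : (σ : ℂ) ^ 2 = 1 := by exact_mod_cast hσ
        simpa using this
      rw [h1, mul_one]
      exact hs.re_deriv_neg hw h hd
    · have hχ := hs.eq_zero_of_theta_eq h
      refine ⟨1 / 2, by norm_num, ?_, fun σ hσ => ?_⟩
      · filter_upwards [Ioo_mem_nhdsGT Real.pi_pos] with τ hτ
        rw [h]
        constructor <;> nlinarith [hτ.1, hτ.2]
      · have hz : polar x₀ θ₀ = ((-(Real.exp x₀) : ℝ) : ℂ) := by rw [h, polar_pi]; push_cast; rfl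
        have hk : (0 : ℝ) < k := by exact_mod_cast hw.1
        set r := Real.exp x₀ with hr
        have hrpos : 0 < r := Real.exp_pos _
        have hsub : polar x₀ θ₀ - 1 ≠ 0 := sub_ne_zero.mpr hne
        have hder : HasDerivAt (hgtDeriv α β χ η) (k * (1 / (polar x₀ θ₀ - 1) ^ 2))
            (polar x₀ θ₀) := by
          have h1 := (hasDerivAt_id (polar x₀ θ₀)).div
            ((hasDerivAt_id (polar x₀ θ₀)).sub_const 1) hsub
          have h2 := (h1.const_mul (k : ℂ)).const_sub ((k : ℂ) * (η + 1) / 2)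
          refine (h2.congr_of_eventuallyEq (Eventually.of_forall fun z => ?_)).congr_deriv ?_
          · simp [hgtDeriv, hχ]
          · simp; ring
        have hdval : d = ((-(k * r / (1 + r) ^ 2) : ℝ) : ℂ) := by
          rw [hd', hder.deriv, show Complex.exp (x₀ + θ₀ * Complex.I) = polar x₀ θ₀ from rfl, hz]
          have : ((-r : ℝ) : ℂ) - 1 = ((-(1 + r) : ℝ) : ℂ) := by push_cast; ring
          rw [this]
          push_cast
          ring
        have hsq : ((σ : ℂ) - ((1 / 2 : ℝ) : ℂ) * Complex.I) ^ 2 =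
            ((3 / 4 : ℝ) : ℂ) - (σ : ℂ) * Complex.I := by
          have : (σ : ℂ) ^ 2 = 1 := by exact_mod_cast hσ
          rw [sub_sq, mul_pow, Complex.I_sq, this]
          push_cast
          ring
        rw [hsq, hdval, Complex.re_ofReal_mul]
        have : 0 < k * r / (1 + r) ^ 2 := by positivity
        simp
        linarith
  refine ⟨s, fun σ hσ => ?_⟩
  filter_upwards [hI, hs.eventually_hgt_lt hw hd (hre σ hσ)] with τ h1 h2
  refine ⟨h1, ?_⟩
  have : (x₀ : ℂ) + θ₀ * Complex.I + τ * (σ - s * Complex.I) =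
      ((x₀ + σ * τ : ℝ) : ℂ) + ((θ₀ - s * τ : ℝ) : ℂ) * Complex.I := by push_cast; ring
  rw [this] at h2
  exact h2

theorem continuousAt_hgt_polar {χ η x θ : ℝ} (h0 : 0 < θ) (h1 : θ ≤ Real.pi)
    (h : θ = Real.pi → χ = 0) : ContinuousAt (fun s : ℝ => hgt α β χ η (polar x s)) θ := by
  have hu : HasDerivAt (fun s : ℝ => (x : ℂ) + s * Complex.I) Complex.I θ := by
    simpa using ((Complex.ofRealCLM.hasDerivAt (x := θ)).mul_const Complex.I).const_add (x : ℂ)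
  refine (hasDerivAt_hgt hw (χ := χ) (η := η) hu (polar_ne_one h0 h1) ?_).continuousAt
  rcases h1.lt_or_eq with h2 | h2
  · exact Or.inl (mem_slitPlane_of_im_pos (polar_im_pos x ⟨h0, h2⟩))
  · exact Or.inr (h h2)

theorem IsSaddle.angularSlope_neg {χ η x₀ θ₀ θ : ℝ} (hs : IsSaddle α β χ η x₀ θ₀)
    (h0 : 0 < θ) (h1 : θ < θ₀) : angularSlope α β χ (polar x₀ θ) < 0 := by
  have hθ : θ ∈ Ioo 0 Real.pi := ⟨h0, h1.trans_le hs.theta_le⟩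
  rcases hs.theta_le.lt_or_eq with h | h
  · rw [← hs.angularSlope_eq_zero h]
    exact angularSlope_polar_lt hw hs.nonneg hs.lt_one hθ ⟨hs.theta_pos, h⟩ h1
  · have hk : (0 : ℝ) < k := by exact_mod_cast hw.1
    have : 0 < ‖polar x₀ θ - 1‖ := norm_pos_iff.mpr (sub_ne_zero.mpr (polar_ne_one h0 hθ.2.le))
    rw [angularSlope, hs.eq_zero_of_theta_eq h]
    simp only [zero_mul, sub_zero, one_mul, zero_sub]
    have : 0 < (k : ℝ) / ‖polar x₀ θ - 1‖ ^ 2 := by positivity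
    linarith

theorem IsSaddle.strictAntiOn {χ η x₀ θ₀ : ℝ} (hs : IsSaddle α β χ η x₀ θ₀) :
    StrictAntiOn (fun θ : ℝ => hgt α β χ η (polar x₀ θ)) (Ioc 0 θ₀) := by
  refine strictAntiOn_of_deriv_neg (convex_Ioc 0 θ₀) (fun θ hθ => ?_) (fun θ hθ => ?_)
  · exact (continuousAt_hgt_polar hw hθ.1 (hθ.2.trans hs.theta_le) fun h =>
      hs.eq_zero_of_theta_eq (le_antisymm hs.theta_le (h ▸ hθ.2))).continuousWithinAt
  · rw [interior_Ioc] at hθ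
    have hI : θ ∈ Ioo 0 Real.pi := ⟨hθ.1, hθ.2.trans_le hs.theta_le⟩
    rw [(hasDerivAt_hgt_polar hw hI).deriv]
    exact mul_neg_of_pos_of_neg (polar_im_pos x₀ hI) (hs.angularSlope_neg hw hθ.1 hθ.2)

theorem IsSaddle.strictMonoOn {χ η x₀ θ₀ : ℝ} (hs : IsSaddle α β χ η x₀ θ₀) :
    StrictMonoOn (fun θ : ℝ => hgt α β χ η (polar x₀ θ)) (Ico θ₀ Real.pi) := by
  refine strictMonoOn_of_deriv_pos (convex_Ico θ₀ Real.pi) (fun θ hθ => ?_) (fun θ hθ => ?_)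
  · exact (continuousAt_hgt_polar hw (hs.theta_pos.trans_le hθ.1) hθ.2.le fun h =>
      absurd h hθ.2.ne).continuousWithinAt
  · rw [interior_Ico] at hθ
    have hI : θ ∈ Ioo 0 Real.pi := ⟨hs.theta_pos.trans hθ.1, hθ.2⟩
    rw [(hasDerivAt_hgt_polar hw hI).deriv]
    have hlt : θ₀ < Real.pi := hθ.1.trans hθ.2
    refine mul_pos (polar_im_pos x₀ hI) ?_
    rw [← hs.angularSlope_eq_zero hlt]
    exact angularSlope_polar_lt hw hs.nonneg hs.lt_one ⟨hs.theta_pos, hlt⟩ hI hθ.1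

theorem IsSaddle.lt_hgt {χ η x₀ θ₀ θ : ℝ} (hs : IsSaddle α β χ η x₀ θ₀)
    (hθ : θ ∈ Ioo 0 Real.pi) (hne : θ ≠ θ₀) :
    hgt α β χ η (polar x₀ θ₀) < hgt α β χ η (polar x₀ θ) := by
  rcases hne.lt_or_gt with h | h
  · exact hs.strictAntiOn hw ⟨hθ.1, h.le⟩ ⟨hs.theta_pos, le_rfl⟩ h
  · exact hs.strictMonoOn hw ⟨le_rfl, h.trans hθ.2⟩ ⟨h.le, hθ.2⟩ h

theorem IsSaddle.le_hgt {χ η x₀ θ₀ θ : ℝ} (hs : IsSaddle α β χ η x₀ θ₀)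
    (hθ : θ ∈ Ioo 0 Real.pi) : hgt α β χ η (polar x₀ θ₀) ≤ hgt α β χ η (polar x₀ θ) := by
  rcases eq_or_ne θ θ₀ with rfl | h
  · exact le_rfl
  · exact (hs.lt_hgt hw hθ h).le

theorem IsSaddle.exists_gap {χ η x₀ θ₀ ε : ℝ} (hs : IsSaddle α β χ η x₀ θ₀) (hε : 0 < ε) :
    ∃ δ > 0, ∀ θ ∈ Ioo 0 Real.pi, ε ≤ |θ - θ₀| →
      hgt α β χ η (polar x₀ θ₀) + δ ≤ hgt α β χ η (polar x₀ θ) := by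
  set H : ℝ → ℝ := fun θ => hgt α β χ η (polar x₀ θ) with hH
  have hL : ∃ δ > 0, ∀ θ ∈ Ioo 0 Real.pi, θ ≤ θ₀ - ε → H θ₀ + δ ≤ H θ := by
    rcases le_or_gt (θ₀ - ε) 0 with h | h
    · exact ⟨1, one_pos, fun θ hθ h' => absurd hθ.1 (not_lt.mpr (h'.trans h))⟩
    · have hlt : H θ₀ < H (θ₀ - ε) := hs.strictAntiOn hw ⟨h, by linarith⟩ ⟨hs.theta_pos, le_rfl⟩
        (by linarith)
      refine ⟨H (θ₀ - ε) - H θ₀, by linarith, fun θ hθ h' => ?_⟩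
      have : H (θ₀ - ε) ≤ H θ := (hs.strictAntiOn hw).antitoneOn ⟨hθ.1, by linarith⟩
        ⟨h, by linarith⟩ h'
      linarith
  have hR : ∃ δ > 0, ∀ θ ∈ Ioo 0 Real.pi, θ₀ + ε ≤ θ → H θ₀ + δ ≤ H θ := by
    rcases le_or_gt Real.pi (θ₀ + ε) with h | h
    · exact ⟨1, one_pos, fun θ hθ h' => absurd hθ.2 (not_lt.mpr (h.trans h'))⟩
    · have hlt : H θ₀ < H (θ₀ + ε) := hs.strictMonoOn hw ⟨le_rfl, by linarith⟩
        ⟨by linarith, h⟩ (by linarith)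
      refine ⟨H (θ₀ + ε) - H θ₀, by linarith, fun θ hθ h' => ?_⟩
      have : H (θ₀ + ε) ≤ H θ := (hs.strictMonoOn hw).monotoneOn ⟨by linarith, h⟩
        ⟨by linarith, hθ.2⟩ h'
      linarith
  obtain ⟨δ₁, h1, hL⟩ := hL
  obtain ⟨δ₂, h2, hR⟩ := hR
  refine ⟨min δ₁ δ₂, lt_min h1 h2, fun θ hθ h => ?_⟩
  rcases le_abs'.mp h with h' | h'
  · have := hL θ hθ (by linarith)
    have := min_le_left δ₁ δ₂
    simp only [hH] at *
    linarith
  · have := hR θ hθ (by linarith)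
    have := min_le_right δ₁ δ₂
    simp only [hH] at *
    linarith

end

end Aztec
end

noncomputable section

namespace Aztec

open Set

variable {k : ℕ} {α β : Fin k → ℝ}

/-! ### A minimum principle for the height function -/

theorem norm_le_of_forall_polar {f : ℂ → ℂ} {x K : ℝ} (hf : Continuous fun θ : ℝ => f (polar x θ))
    (hconj : ∀ z, ‖f ((starRingEnd ℂ) z)‖ = ‖f z‖)
    (h : ∀ θ ∈ Ioo 0 Real.pi, ‖f (polar x θ)‖ ≤ K) {z : ℂ} (hz : ‖z‖ = Real.exp x) : ‖f z‖ ≤ K := by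
  have hcl : ∀ θ ∈ Icc 0 Real.pi, ‖f (polar x θ)‖ ≤ K := by
    intro θ hθ
    rw [← closure_Ioo Real.pi_pos.ne] at hθ
    exact closure_minimal (s := Ioo 0 Real.pi) (t := {θ : ℝ | ‖f (polar x θ)‖ ≤ K}) h
      (isClosed_le hf.norm continuous_const) hθ
  rcases le_or_gt 0 z.arg with h0 | h0
  · rw [eq_polar hz]
    exact hcl _ ⟨h0, Complex.arg_le_pi z⟩
  · rw [← hconj, eq_polar hz, ← polar_neg]
    exact hcl _ ⟨by linarith, by linarith [Complex.neg_pi_lt_arg z]⟩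

variable (hw : Admissible α β)
include hw

theorem norm_sub_one_pow_lt {z : ℂ} (hz : z ∈ Complex.slitPlane) :
    ‖z - 1‖ ^ k < ‖lam α β 1 z‖ := by
  have h1 := congrArg norm (lam_mul hw (ε := 1) (Or.inl rfl) z)
  rw [norm_mul, norm_pow, pow_mul', sq] at h1
  have h2 := norm_lam_lt hw hz
  by_contra hcon
  push Not at hcon
  have h3 : (0 : ℝ) ≤ ‖lam α β (-1) z‖ := norm_nonneg _
  nlinarith [norm_nonneg (lam α β 1 z)]

theorem hgt_minimum_principle {χ η c x₁ x₂ : ℝ} (hχ0 : 0 ≤ χ) (hχ1 : χ ≤ 1) (hη : -1 ≤ η)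
    (h₁ : ∀ θ ∈ Ioo 0 Real.pi, c ≤ hgt α β χ η (polar x₁ θ))
    (h₂ : ∀ θ ∈ Ioo 0 Real.pi, c ≤ hgt α β χ η (polar x₂ θ))
    {x θ : ℝ} (hx : x ∈ Icc x₁ x₂) (hθ : θ ∈ Ioo 0 Real.pi) : c ≤ hgt α β χ η (polar x θ) := by
  set a : ℕ → ℕ := fun N => ⌊χ * N⌋₊ with ha
  set b : ℕ → ℕ := fun N => ⌊N * (k * (η + 1) / 2)⌋₊ with hb
  have hk : (0 : ℝ) < k := by exact_mod_cast hw.1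
  have haN : ∀ N, a N ≤ N := fun N => Nat.floor_le_of_le (by
    have : (0 : ℝ) ≤ N := N.cast_nonneg
    nlinarith)
  set f : ℕ → ℂ → ℂ := fun N z => (z - 1) ^ (k * (N - a N)) *
    aeval z (powerTrace α β (a N)) * (z ^ b N)⁻¹ with hf
  set A : ℕ → ℂ → ℝ := fun N z => ‖z - 1‖ ^ (k * (N - a N)) * ‖lam α β 1 z‖ ^ a N *
    (‖z‖ ^ b N)⁻¹ with hA
  have hAeq : ∀ (N : ℕ) (z : ℂ), 0 < z.im → ∃ e₁ ∈ Icc (0 : ℝ) 1, ∃ e₂ ∈ Icc (0 : ℝ) 1,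
      A N z = Real.exp (-(N * hgt α β χ η z) -
        e₁ * (Real.log ‖lam α β 1 z‖ - k * Real.log ‖z - 1‖) + e₂ * Real.log ‖z‖) := by
    intro N z hz
    have hz1 : 0 < ‖z - 1‖ := norm_pos_iff.mpr (sub_ne_zero.mpr (ne_one_of_im_pos hz))
    have hz0 : 0 < ‖z‖ := norm_pos_iff.mpr (by rintro rfl; simp at hz)
    have hl : 0 < ‖lam α β 1 z‖ :=
      norm_pos_iff.mpr (lam_one_ne_zero hw (mem_slitPlane_of_im_pos hz))
    have hp1 : 0 ≤ χ * N := by positivity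
    have hp2 : 0 ≤ N * (k * (η + 1) / 2) := by
      have : 0 ≤ η + 1 := by linarith
      positivity
    refine ⟨χ * N - a N, ⟨by linarith [Nat.floor_le hp1], by linarith [Nat.lt_floor_add_one (χ * N)]⟩,
      N * (k * (η + 1) / 2) - b N, ⟨by linarith [Nat.floor_le hp2],
        by linarith [Nat.lt_floor_add_one (N * (k * (η + 1) / 2))]⟩, ?_⟩
    have hApos : 0 < A N z := by positivity
    rw [← Real.exp_log hApos]
    congr 1
    simp only [hA]
    rw [Real.log_mul (by positivity) (by positivity), Real.log_mul (by positivity) (by positivity),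
      Real.log_inv, Real.log_pow, Real.log_pow, Real.log_pow, hgt]
    push_cast [Nat.cast_sub (haN N)]
    ring
  have hlogpos : ∀ z : ℂ, 0 < z.im → 0 ≤ Real.log ‖lam α β 1 z‖ - k * Real.log ‖z - 1‖ := by
    intro z hz
    have hz1 : 0 < ‖z - 1‖ := norm_pos_iff.mpr (sub_ne_zero.mpr (ne_one_of_im_pos hz))
    rw [← Real.log_pow, sub_nonneg]
    exact Real.log_le_log (by positivity) (norm_sub_one_pow_lt hw (mem_slitPlane_of_im_pos hz)).le
  have hnf : ∀ N z, ‖f N z‖ = ‖z - 1‖ ^ (k * (N - a N)) *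
      ‖lam α β 1 z ^ a N + lam α β (-1) z ^ a N‖ * (‖z‖ ^ b N)⁻¹ := fun N z => by
    simp only [hf, norm_mul, norm_inv, norm_pow]
    rw [aeval_powerTrace hw]
  have hconj : ∀ N z, ‖f N ((starRingEnd ℂ) z)‖ = ‖f N z‖ := fun N z => by
    have : f N ((starRingEnd ℂ) z) = (starRingEnd ℂ) (f N z) := by
      simp only [hf, Polynomial.aeval_conj, map_mul, map_inv₀, map_pow, map_sub, map_one]
    rw [this, RCLike.norm_conj]
  have hcontf : ∀ (N : ℕ) (x : ℝ), Continuous fun θ : ℝ => f N (polar x θ) := fun N x => by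
    have hP : Continuous fun θ : ℝ => polar x θ := by unfold polar; fun_prop
    refine ((hP.sub continuous_const).pow _ |>.mul ?_).mul
      ((hP.pow _).inv₀ fun θ => pow_ne_zero _ (Complex.exp_ne_zero _))
    exact (Polynomial.continuous_aeval _).comp hP
  have hbound : ∀ (N : ℕ) (y : ℝ), y ≤ x₂ → (∀ θ ∈ Ioo 0 Real.pi, c ≤ hgt α β χ η (polar y θ)) →
      ∀ z : ℂ, ‖z‖ = Real.exp y → ‖f N z‖ ≤ 2 * Real.exp (|x₂| - N * c) := by
    intro N y hy h z hz
    refine norm_le_of_forall_polar (hcontf N y) (hconj N) (fun φ hφ => ?_) hz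
    have him := polar_im_pos y hφ
    have hs := mem_slitPlane_of_im_pos him
    obtain ⟨e₁, he₁, e₂, he₂, heq⟩ := hAeq N _ him
    have hle : ‖f N (polar y φ)‖ ≤ 2 * A N (polar y φ) := by
      rw [hnf]
      simp only [hA]
      have h5 : ‖lam α β 1 (polar y φ) ^ a N + lam α β (-1) (polar y φ) ^ a N‖ ≤
          2 * ‖lam α β 1 (polar y φ)‖ ^ a N := by
        refine (norm_add_le _ _).trans ?_
        rw [norm_pow, norm_pow, two_mul]
        gcongr
        exact (norm_lam_lt hw hs).le
      calc _ ≤ ‖polar y φ - 1‖ ^ (k * (N - a N)) * (2 * ‖lam α β 1 (polar y φ)‖ ^ a N) *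
            (‖polar y φ‖ ^ b N)⁻¹ := by gcongr
        _ = _ := by ring
    refine hle.trans (mul_le_mul_of_nonneg_left ?_ zero_le_two)
    rw [heq, Real.exp_le_exp, norm_polar, Real.log_exp]
    have h6 := mul_nonneg he₁.1 (hlogpos _ him)
    have h7 : e₂ * y ≤ |x₂| := by
      have := le_abs_self x₂
      rcases le_or_gt y 0 with h | h <;> nlinarith [he₂.1, he₂.2, abs_nonneg x₂]
    have h8 := mul_le_mul_of_nonneg_left (h φ hφ) (Nat.cast_nonneg (α := ℝ) N)
    linarith
  set z := polar x θ with hz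
  have him : 0 < z.im := polar_im_pos x hθ
  have hs := mem_slitPlane_of_im_pos him
  have hmax : ∀ N : ℕ, ‖f N z‖ ≤ 2 * Real.exp (|x₂| - N * c) := by
    intro N
    rcases hx.1.eq_or_lt with h | hlt1
    · exact hbound N x₁ (hx.1.trans hx.2) h₁ z (by rw [hz, norm_polar, h])
    set U : Set ℂ := {z : ℂ | Real.exp x₁ < ‖z‖ ∧ ‖z‖ < Real.exp x₂} with hU
    have hcl : closure U ⊆ {z : ℂ | Real.exp x₁ ≤ ‖z‖ ∧ ‖z‖ ≤ Real.exp x₂} := by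
      refine closure_minimal (fun z hz => ⟨hz.1.le, hz.2.le⟩) ?_
      exact (isClosed_le continuous_const continuous_norm).inter
        (isClosed_le continuous_norm continuous_const)
    have hopen : IsOpen U := (isOpen_lt continuous_const continuous_norm).inter
      (isOpen_lt continuous_norm continuous_const)
    have hbdd : Bornology.IsBounded U :=
      Metric.isBounded_ball.subset (fun z hz => by
        rw [mem_ball_zero_iff]; exact hz.2 : U ⊆ Metric.ball 0 (Real.exp x₂))
    have hdiff : DiffContOnCl ℂ (f N) U := by
      refine DifferentiableOn.diffContOnCl fun z hz => ?_
      have hz0 : z ≠ 0 := norm_pos_iff.mp ((Real.exp_pos _).trans_le (hcl hz).1)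
      have h9 : z ^ b N ≠ 0 := pow_ne_zero _ hz0
      refine DifferentiableAt.differentiableWithinAt ?_
      have := (powerTrace α β (a N)).differentiable_aeval (𝕜 := ℂ) z
      exact (((differentiableAt_id.sub_const 1).pow _).mul this).mul
        ((differentiableAt_id.pow _).inv h9)
    rcases hx.2.eq_or_lt with h | hlt2
    · exact hbound N x₂ le_rfl h₂ z (by rw [hz, norm_polar, h])
    refine Complex.norm_le_of_forall_mem_frontier_norm_le hbdd hdiff (fun u hu => ?_)
      (subset_closure (⟨by rw [hz, norm_polar]; exact Real.exp_lt_exp.mpr hlt1,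
        by rw [hz, norm_polar]; exact Real.exp_lt_exp.mpr hlt2⟩ : z ∈ U))
    have h10 := hcl (frontier_subset_closure hu)
    have h11 : u ∉ U := by rw [hopen.frontier_eq] at hu; exact hu.2
    rcases h10.1.eq_or_lt with h | h
    · exact hbound N x₁ (hx.1.trans hx.2) h₁ u h.symm
    · rcases h10.2.eq_or_lt with h' | h'
      · exact hbound N x₂ le_rfl h₂ u h'
      · exact absurd ⟨h, h'⟩ h11
  set q := ‖lam α β (-1) z‖ / ‖lam α β 1 z‖ with hq
  have hl : 0 < ‖lam α β 1 z‖ := norm_pos_iff.mpr (lam_one_ne_zero hw hs)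
  have hq1 : q < 1 := (div_lt_one hl).mpr (norm_lam_lt hw hs)
  have hq0 : 0 ≤ q := by positivity
  set C₀ := (Real.log ‖lam α β 1 z‖ - k * Real.log ‖z - 1‖) + |x| with hC₀
  have hlow : ∀ N : ℕ, (1 - q) * Real.exp (-(N * hgt α β χ η z) - C₀) ≤ ‖f N z‖ := by
    intro N
    obtain ⟨e₁, he₁, e₂, he₂, heq⟩ := hAeq N _ him
    have h12 : (1 - q) * A N z ≤ ‖f N z‖ := by
      rw [hnf]
      have h13 : (1 - q) * ‖lam α β 1 z‖ ^ a N ≤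
          ‖lam α β 1 z ^ a N + lam α β (-1) z ^ a N‖ := by
        rcases Nat.eq_zero_or_pos (a N) with h0 | h0
        · rw [h0]; norm_num; linarith
        · have h14 := norm_sub_norm_le (lam α β 1 z ^ a N) (-lam α β (-1) z ^ a N)
          rw [sub_neg_eq_add, norm_neg, norm_pow, norm_pow] at h14
          have h15 : ‖lam α β (-1) z‖ ^ a N = q ^ a N * ‖lam α β 1 z‖ ^ a N := by
            rw [← mul_pow, hq, div_mul_cancel₀ _ hl.ne']
          have h16 : q ^ a N ≤ q := pow_le_of_le_one hq0 hq1.le h0.ne'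
          have : q ^ a N * ‖lam α β 1 z‖ ^ a N ≤ q * ‖lam α β 1 z‖ ^ a N := by gcongr
          linarith
      calc _ = ‖z - 1‖ ^ (k * (N - a N)) * ((1 - q) * ‖lam α β 1 z‖ ^ a N) *
            (‖z‖ ^ b N)⁻¹ := by simp only [hA]; ring
        _ ≤ _ := by gcongr
    refine le_trans (mul_le_mul_of_nonneg_left ?_ (by linarith)) h12
    rw [heq, Real.exp_le_exp]
    have h17 := hlogpos z him
    have h18 : -|x| ≤ e₂ * Real.log ‖z‖ := by
      rw [hz, norm_polar, Real.log_exp]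
      have := neg_abs_le x
      rcases le_or_gt x 0 with h | h <;> nlinarith [he₂.1, he₂.2, abs_nonneg x]
    nlinarith [he₁.1, he₁.2]
  by_contra hcon
  push Not at hcon
  have hC : 0 < 2 * Real.exp (|x₂| + C₀) / (1 - q) := by
    have : 0 < 1 - q := by linarith
    positivity
  have htend : Tendsto (fun N : ℕ => Real.exp (N * (c - hgt α β χ η z))) atTop atTop :=
    Real.tendsto_exp_atTop.comp
      (tendsto_natCast_atTop_atTop.atTop_mul_const (by linarith))
  obtain ⟨N, hN⟩ := (htend.eventually_gt_atTop (2 * Real.exp (|x₂| + C₀) / (1 - q))).exists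
  have h20 := (hlow N).trans (hmax N)
  rw [div_lt_iff₀ (by linarith)] at hN
  have e1 : Real.exp (-(N * hgt α β χ η z) - C₀) =
      Real.exp (N * (c - hgt α β χ η z)) * Real.exp (-(N * c) - C₀) := by
    rw [← Real.exp_add]; congr 1; ring
  have e2 : Real.exp (|x₂| - N * c) = Real.exp (|x₂| + C₀) * Real.exp (-(N * c) - C₀) := by
    rw [← Real.exp_add]; congr 1; ring
  rw [e1, e2] at h20
  have := mul_lt_mul_of_pos_right hN (Real.exp_pos (-(N * c) - C₀))
  linarith

/-! ### Descending angles -/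

theorem IsSaddle.exists_hgt_lt {χ η x₀ θ₀ : ℝ} (hs : IsSaddle α β χ η x₀ θ₀) {x : ℝ}
    (hx : x ≠ x₀) : ∃ θ ∈ Ioo 0 Real.pi, hgt α β χ η (polar x θ) < hgt α β χ η (polar x₀ θ₀) := by
  by_contra hcon
  push Not at hcon
  obtain ⟨s, hd⟩ := hs.exists_descent hw
  have h₀ : ∀ θ ∈ Ioo 0 Real.pi, hgt α β χ η (polar x₀ θ₀) ≤ hgt α β χ η (polar x₀ θ) :=
    fun θ hθ => hs.le_hgt hw hθ
  rcases hx.lt_or_gt with h | h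
  · obtain ⟨τ, ⟨h1, h2⟩, h3⟩ := ((hd (-1) (by norm_num)).and
      (Ioo_mem_nhdsGT (sub_pos.mpr h))).exists
    have := hgt_minimum_principle hw hs.nonneg hs.lt_one.le hs.eta_gt.le hcon h₀
      (x := x₀ + -1 * τ) ⟨by linarith [h3.2], by linarith [h3.1]⟩ h1
    linarith
  · obtain ⟨τ, ⟨h1, h2⟩, h3⟩ := ((hd 1 (by norm_num)).and
      (Ioo_mem_nhdsGT (sub_pos.mpr h))).exists
    have := hgt_minimum_principle hw hs.nonneg hs.lt_one.le hs.eta_gt.le h₀ hcon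
      (x := x₀ + 1 * τ) ⟨by linarith [h3.1], by linarith [h3.2]⟩ h1
    linarith

open scoped Manifold ContDiff in
/-- A smooth choice of descending angles on one side of a saddle point. -/
theorem IsSaddle.exists_angle {χ η x₀ θ₀ σ : ℝ} (hs : IsSaddle α β χ η x₀ θ₀) (hσ : σ ^ 2 = 1) :
    ∃ θ : ℝ → ℝ, ContDiff ℝ 1 θ ∧ θ 0 = θ₀ ∧ ∀ y > 0, θ y ∈ Ioo 0 Real.pi ∧
      hgt α β χ η (polar (x₀ + σ * y) (θ y)) < hgt α β χ η (polar x₀ θ₀) := by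
  obtain ⟨s, hd⟩ := hs.exists_descent hw
  obtain ⟨τ, hτ0, hτ⟩ := mem_nhdsGT_iff_exists_Ioo_subset.mp (hd σ hσ)
  have hτ0' : 0 < τ := hτ0
  set c := hgt α β χ η (polar x₀ θ₀) with hc
  set T : ℝ → Set ℝ := fun y => if y ≤ τ / 2 then {θ₀ - s * y} else
    {θ : ℝ | θ ∈ Ioo 0 Real.pi ∧ hgt α β χ η (polar (x₀ + σ * y) θ) < c} with hT
  have hconv : ∀ y, Convex ℝ (T y) := by
    intro y
    simp only [hT]
    split_ifs
    · exact convex_singleton _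
    · exact convex_sublevel hw hs.nonneg hs.lt_one
  have hσ0 : σ ≠ 0 := by rintro rfl; norm_num at hσ
  have hloc : ∀ y : ℝ, ∃ U ∈ 𝓝 y, ∃ g : ℝ → ℝ, ContMDiffOn 𝓘(ℝ, ℝ) 𝓘(ℝ, ℝ) 1 g U ∧
      ∀ u ∈ U, g u ∈ T u := by
    intro y
    rcases lt_or_ge y τ with hy | hy
    · refine ⟨Iio τ, Iio_mem_nhds hy, fun u => θ₀ - s * u, ?_, fun u hu => ?_⟩
      · rw [contMDiffOn_iff_contDiffOn]
        exact (contDiff_const.sub (contDiff_const.mul contDiff_id)).contDiffOn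
      · simp only [hT]
        split_ifs with h
        · rfl
        · exact hτ ⟨by linarith, hu⟩
    · have hx : x₀ + σ * y ≠ x₀ := by
        have : 0 < y := by linarith
        simpa using ⟨hσ0, this.ne'⟩
      obtain ⟨φ, hφ, hlt⟩ := hs.exists_hgt_lt hw hx
      have hcont : ContinuousAt (fun u : ℝ => hgt α β χ η (polar (x₀ + σ * u) φ)) y := by
        have hu : HasDerivAt (fun u : ℝ => ((x₀ + σ * u : ℝ) : ℂ) + φ * Complex.I) (σ : ℂ) y := by
          have h1 : HasDerivAt (fun u : ℝ => x₀ + σ * u) σ y := by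
            simpa using ((hasDerivAt_id y).const_mul σ).const_add x₀
          exact h1.ofReal_comp.add_const _
        have him := polar_im_pos (x₀ + σ * y) hφ
        exact (hasDerivAt_hgt hw (χ := χ) (η := η) hu (ne_one_of_im_pos him)
          (Or.inl (mem_slitPlane_of_im_pos him))).continuousAt
      refine ⟨Ioi (τ / 2) ∩ {u | hgt α β χ η (polar (x₀ + σ * u) φ) < c},
        inter_mem (Ioi_mem_nhds (by linarith)) (hcont.eventually (gt_mem_nhds hlt)), fun _ => φ,
        contMDiffOn_const, fun u hu => ?_⟩
      simp only [hT]
      rw [if_neg (not_le.mpr hu.1)]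
      exact ⟨hφ, hu.2⟩
  obtain ⟨g, hg⟩ := exists_contMDiffMap_forall_mem_convex_of_local 𝓘(ℝ, ℝ) hconv hloc
  refine ⟨g, contMDiff_iff_contDiff.mp g.contMDiff, ?_, fun y hy => ?_⟩
  · have := hg 0
    simp only [hT] at this
    rw [if_pos (by linarith)] at this
    simpa using this
  · have := hg y
    simp only [hT] at this
    split_ifs at this with h
    · rw [mem_singleton_iff] at this
      rw [this]
      exact hτ ⟨hy, by linarith⟩
    · exact this

/-- Far out and far in, the height function lies below any bound on whole circles. -/
theorem eventually_hgt_lt {χ η : ℝ} (hχ : 0 ≤ χ) (hη0 : -1 < η) (hη1 : η < 1) (c : ℝ) :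
    ∃ X : ℝ, ∀ x : ℝ, X ≤ |x| → ∀ θ ∈ Ioo (-Real.pi) Real.pi, hgt α β χ η (polar x θ) < c := by
  have hk : (0 : ℝ) < k := by exact_mod_cast hw.1
  set e := min (k * (1 + η) / 2) (k * (1 - η) / 2) with he
  have he0 : 0 < e := lt_min (by apply div_pos (mul_pos hk (by linarith)) two_pos)
    (by apply div_pos (mul_pos hk (by linarith)) two_pos)
  refine ⟨max 1 ((k * Real.log 2 - c) / e + 1), fun x hx θ hθ => ?_⟩
  have hx1 : 1 ≤ |x| := (le_max_left _ _).trans hx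
  have hx2 : (k * Real.log 2 - c) / e < |x| :=
    (lt_add_one _).trans_le ((le_max_right _ _).trans hx)
  rw [div_lt_iff₀ he0] at hx2
  have hslit : polar x θ ∈ Complex.slitPlane := by
    rw [Complex.mem_slitPlane_iff_arg, polar, Complex.exp_add, ← Complex.ofReal_exp]
    refine ⟨?_, mul_ne_zero (Complex.ofReal_ne_zero.mpr (Real.exp_ne_zero x))
      (Complex.exp_ne_zero _)⟩
    rw [Complex.arg_real_mul _ (Real.exp_pos _), Complex.arg_exp_mul_I,
      (toIocMod_eq_self Real.two_pi_pos).mpr ⟨hθ.1, by linarith [hθ.2]⟩]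
    exact hθ.2.ne
  have hlow : |Real.exp x - 1| ≤ ‖polar x θ - 1‖ := by
    have := abs_norm_sub_norm_le (polar x θ) 1
    rwa [norm_polar, norm_one] at this
  have hhalf : Real.exp (max x 0) / 2 ≤ |Real.exp x - 1| := by
    rcases le_or_gt 0 x with h | h
    · rw [abs_of_nonneg h] at hx1
      rw [max_eq_left h]
      have h2 : 2 ≤ Real.exp x := by
        have := Real.add_one_le_exp x; linarith
      rw [abs_of_nonneg (by linarith)]
      linarith
    · rw [abs_of_neg h] at hx1
      rw [max_eq_right h.le, Real.exp_zero]
      have h2 : Real.exp x ≤ 1 / 2 := by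
        have h3 : 2 ≤ Real.exp (-x) := by
          have := Real.add_one_le_exp (-x); linarith
        rw [Real.exp_neg] at h3
        have h4 := Real.exp_pos x
        have h5 : 2 * Real.exp x ≤ (Real.exp x)⁻¹ * Real.exp x := by gcongr
        rw [inv_mul_cancel₀ h4.ne'] at h5
        linarith
      rw [abs_of_nonpos (by linarith)]
      linarith
  have hpos : 0 < ‖polar x θ - 1‖ := by
    have := Real.exp_pos (max x 0); linarith
  have hlog : max x 0 - Real.log 2 ≤ Real.log ‖polar x θ - 1‖ := by
    have h3 := Real.log_le_log (by positivity) (hhalf.trans hlow)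
    rwa [Real.log_div (Real.exp_ne_zero _) two_ne_zero, Real.log_exp] at h3
  have hlam : k * Real.log ‖polar x θ - 1‖ ≤ Real.log ‖lam α β 1 (polar x θ)‖ := by
    rw [← Real.log_pow]
    exact Real.log_le_log (by positivity) (norm_sub_one_pow_lt hw hslit).le
  have h6 : hgt α β χ η (polar x θ) ≤ k * (η + 1) / 2 * x - k * (max x 0 - Real.log 2) := by
    rw [hgt, norm_polar, Real.log_exp]
    nlinarith
  refine h6.trans_lt ?_
  rcases le_or_gt 0 x with h | h
  · rw [abs_of_nonneg h] at hx2
    rw [max_eq_left h]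
    have := min_le_right (k * (1 + η) / 2) (k * (1 - η) / 2)
    nlinarith
  · rw [abs_of_neg h] at hx2
    rw [max_eq_right h.le]
    have := min_le_left (k * (1 + η) / 2) (k * (1 - η) / 2)
    nlinarith

end Aztec
end

noncomputable section

namespace Aztec

open Set

variable {k : ℕ} {α β : Fin k → ℝ}

/-! ### The spectral curve over the real line -/

theorem eventually_eq_of_sq_eq {X : Type*} {f g : X → ℂ} {l : Filter X} {a : ℂ}
    (hf : Tendsto f l (𝓝 a)) (hg : Tendsto g l (𝓝 a)) (ha : a ≠ 0)
    (h : ∀ᶠ x in l, f x ^ 2 = g x ^ 2) : ∀ᶠ x in l, f x = g x := by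
  have hsum : Tendsto (fun x => f x + g x) l (𝓝 (a + a)) := hf.add hg
  have hne : a + a ≠ 0 := by rw [← two_mul]; exact mul_ne_zero two_ne_zero ha
  filter_upwards [h, hsum.eventually_ne hne] with x h1 h2
  rcases sq_eq_sq_iff_eq_or_eq_neg.mp h1 with h3 | h3
  · exact h3
  · exact absurd (by rw [h3]; ring) h2

theorem list_prod_eq_prod_range {R : Type*} [CommMonoid R] (f : ℝ → R) (l : List ℝ) :
    (l.map f).prod = ∏ i ∈ Finset.range l.length, f (l.getD i 0) := by
  induction l with
  | nil => simp
  | cons a l ih =>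
    rw [List.map_cons, List.prod_cons, List.length_cons, Finset.prod_range_succ', ih, mul_comm]
    simp

theorem prod_range_odd {R : Type*} [CommMonoid R] (f : ℕ → R) (m : ℕ) :
    ∏ i ∈ Finset.range (2 * m + 1), f i =
      f 0 * ∏ l ∈ Finset.range m, (f (2 * l + 1) * f (2 * l + 2)) := by
  induction m with
  | zero => simp
  | succ m ih =>
    rw [show 2 * (m + 1) + 1 = (2 * m + 1) + 1 + 1 by ring, Finset.prod_range_succ,
      Finset.prod_range_succ, ih, Finset.prod_range_succ]
    simp only [mul_assoc]

section

variable (hw : Admissible α β)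
include hw

theorem p0_eval_neg {x : ℝ} (h0 : x < 0) (h : ∀ l : ℕ, 1 ≤ l → l + 1 ≤ kPrime α β →
    branchPoint α β (2 * l) ≤ x → ¬ x ≤ branchPoint α β (2 * l - 1)) :
    (p0 α β).eval x < 0 := by
  obtain ⟨m, hm⟩ := p0_natDegree_odd hw.1 hw.2 hw.3 hw.4
  have hs := (p0_splits hw.1 hw.2 hw.3 hw.4).1
  set s := (p0 α β).roots.sort (· ≥ ·) with hsdef
  have hcoe : (s : Multiset ℝ) = (p0 α β).roots := Multiset.sort_eq _ _
  have hlen : s.length = 2 * m + 1 := by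
    rw [← hm, hs.natDegree_eq_card_roots, ← hcoe, Multiset.coe_card]
  have hpw : s.Pairwise (· ≥ ·) := Multiset.pairwise_sort _ _
  have hanti : ∀ i j, i < j → j < s.length → s.getD j 0 ≤ s.getD i 0 := by
    intro i j hij hj
    rw [List.getD_eq_getElem _ _ hj, List.getD_eq_getElem _ _ (hij.trans hj)]
    exact List.pairwise_iff_getElem.mp hpw i j (hij.trans hj) hj hij
  have heval : (p0 α β).eval x = (p0 α β).leadingCoeff * ∏ i ∈ Finset.range s.length,
      (x - s.getD i 0) := by
    rw [← list_prod_eq_prod_range (fun y => x - y)]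
    conv_lhs => rw [hs.eq_prod_roots]
    rw [eval_mul, eval_C, ← hcoe, Multiset.map_coe, Multiset.prod_coe, eval_list_prod,
      List.map_map]
    congr 3
    funext y
    simp
  rw [heval, hlen, prod_range_odd]
  have hfirst : x - s.getD 0 0 < 0 := by
    have h1 : (0 : ℝ) ∈ s := by
      rw [← Multiset.mem_coe, hcoe]; exact zero_mem_roots_p0 hw.1 hw.2 hw.3 hw.4
    obtain ⟨i, hi, hi0⟩ := List.getElem_of_mem h1
    have h2 : 0 ≤ s.getD 0 0 := by
      rcases Nat.eq_zero_or_pos i with rfl | hpos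
      · rw [List.getD_eq_getElem _ _ hi, hi0]
      · have := hanti 0 i hpos hi
        rwa [List.getD_eq_getElem _ _ hi, hi0] at this
    linarith
  refine mul_neg_of_pos_of_neg (p0_leadingCoeff_pos hw.1 hw.2 hw.3 hw.4)
    (mul_neg_of_neg_of_pos hfirst (Finset.prod_pos fun l hl => ?_))
  rw [Finset.mem_range] at hl
  have h3 := h (l + 1) (by omega) (by rw [kPrime, hm]; omega)
  have h4 : branchPoint α β (2 * (l + 1)) = s.getD (2 * l + 2) 0 := rfl
  have h5 : branchPoint α β (2 * (l + 1) - 1) = s.getD (2 * l + 1) 0 := rfl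
  rw [h4, h5] at h3
  have h6 := hanti (2 * l + 1) (2 * l + 2) (by omega) (by omega)
  rcases lt_or_ge x (s.getD (2 * l + 2) 0) with h7 | h7
  · exact mul_pos_of_neg_of_neg (by linarith) (by linarith)
  · have := h3 h7
    push Not at this
    exact mul_pos (by linarith) (by linarith)

theorem p0_eval_nonneg {x : ℝ} (h0 : 0 ≤ x) : 0 ≤ (p0 α β).eval x := by
  obtain ⟨hs, hr⟩ := p0_splits hw.1 hw.2 hw.3 hw.4
  conv_rhs => rw [hs.eq_prod_roots]
  rw [eval_mul, eval_C, eval_multiset_prod, Multiset.map_map]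
  refine mul_nonneg (p0_leadingCoeff_pos hw.1 hw.2 hw.3 hw.4).le (Multiset.prod_nonneg ?_)
  intro y hy
  obtain ⟨r, hr', rfl⟩ := Multiset.mem_map.mp hy
  have := hr r hr'
  simp
  linarith

theorem p0_eval_neg_of_notMem_realLoops {P : ℂ × ℂ} (hP : P ∈ Curve α β \ realLoops α β) {x : ℝ}
    (hx : P.1 = x) : (p0 α β).eval x < 0 := by
  have hnot : ¬ (0 ≤ x ∨ ∃ l : ℕ, 1 ≤ l ∧ l + 1 ≤ kPrime α β ∧
    branchPoint α β (2 * l) ≤ x ∧ x ≤ branchPoint α β (2 * l - 1)) :=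
    fun h => hP.2 ⟨hP.1, x, hx, h⟩
  push Not at hnot
  exact p0_eval_neg hw hnot.1 fun l h1 h2 h3 => not_le.mpr (hnot.2 l h1 h2 h3)

theorem sqrtP0_ofReal_sq (x : ℝ) : sqrtP0 α β x ^ 2 = ((p0 α β).eval x : ℝ) := by
  rw [sqrtP0_sq hw, ofReal_aeval]

theorem sqrtP0_conj_of_neg {x : ℝ} (hx : (p0 α β).eval x < 0) :
    (starRingEnd ℂ) (sqrtP0 α β x) = -sqrtP0 α β x := by
  have h := sqrtP0_ofReal_sq hw x
  set w := sqrtP0 α β x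
  have him := congrArg Complex.im h
  have hre := congrArg Complex.re h
  simp only [sq, Complex.mul_im, Complex.mul_re, Complex.ofReal_im, Complex.ofReal_re] at him hre
  have hw0 : w.re = 0 := by
    by_contra hne
    have : w.im = 0 := by
      have : 2 * w.re * w.im = 0 := by linarith
      simpa [hne] using this
    rw [this] at hre
    nlinarith [mul_self_nonneg w.re]
  apply Complex.ext <;> simp [hw0]

theorem sqrtP0_conj_of_nonneg {x : ℝ} (hx : 0 ≤ (p0 α β).eval x) :
    (starRingEnd ℂ) (sqrtP0 α β x) = sqrtP0 α β x := by
  have h := sqrtP0_ofReal_sq hw x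
  set w := sqrtP0 α β x
  have him := congrArg Complex.im h
  have hre := congrArg Complex.re h
  simp only [sq, Complex.mul_im, Complex.mul_re, Complex.ofReal_im, Complex.ofReal_re] at him hre
  have hw0 : w.im = 0 := by
    by_contra hne
    have : w.re = 0 := by
      have : 2 * w.re * w.im = 0 := by linarith
      simpa [hne] using this
    rw [this] at hre
    have := mul_self_pos.mpr hne
    linarith
  apply Complex.ext <;> simp [hw0]

theorem p0_aeval_ne_zero_of_im {z : ℂ} (hz : z.im ≠ 0) : aeval z (p0 α β) ≠ 0 :=
  p0_aeval_ne_zero hw.1 hw.2 hw.3 hw.4 (Or.inr hz)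

theorem sqrtP0_tendsto_below {x : ℝ} : Tendsto (sqrtP0 α β) (𝓝[{z | z.im < 0}] (x : ℂ))
    (𝓝 ((starRingEnd ℂ) (sqrtP0 α β x))) := by
  have h1 : Tendsto (fun z : ℂ => (starRingEnd ℂ) z) (𝓝[{z | z.im < 0}] (x : ℂ))
      (𝓝[{z | 0 ≤ z.im}] (x : ℂ)) := by
    refine tendsto_nhdsWithin_iff.mpr ⟨?_, ?_⟩
    · have := (Complex.continuous_conj.tendsto (x : ℂ)).mono_left
        (nhdsWithin_le_nhds (s := {z : ℂ | z.im < 0}))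
      rwa [Complex.conj_ofReal] at this
    · filter_upwards [self_mem_nhdsWithin] with z hz
      have : z.im < 0 := hz
      show 0 ≤ ((starRingEnd ℂ) z).im
      rw [Complex.conj_im]
      linarith
  have h2 := (sqrtP0_continuousOn (α := α) (β := β)) (x : ℂ) (by simp)
  have h3 := (Complex.continuous_conj.tendsto _).comp (h2.tendsto.comp h1)
  refine h3.congr' ?_
  filter_upwards [self_mem_nhdsWithin] with z hz
  have hz' : z.im < 0 := hz
  simp only [Function.comp]
  rw [sqrtP0_conj hw (Or.inr hz'.ne), Complex.conj_conj]

omit hw in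
/-- The branch of `p₀^{1/2}` on `ℛ₁₂`. -/
def sheetRoot (α β : Fin k → ℝ) (z : ℂ) : ℂ :=
  if 0 ≤ z.im then sqrtP0 α β z else -sqrtP0 α β z

theorem sheetRoot_sq (z : ℂ) : sheetRoot α β z ^ 2 = aeval z (p0 α β) := by
  rw [sheetRoot]
  split_ifs
  · exact sqrtP0_sq hw z
  · rw [neg_sq]; exact sqrtP0_sq hw z

theorem sheetRoot_continuousAt {x : ℝ} (hx : (p0 α β).eval x < 0) :
    ContinuousAt (sheetRoot α β) (x : ℂ) := by
  have hval : sheetRoot α β (x : ℂ) = sqrtP0 α β x := by simp [sheetRoot]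
  rw [ContinuousAt, hval, ← nhdsWithin_univ,
    show (univ : Set ℂ) = {z : ℂ | 0 ≤ z.im} ∪ {z : ℂ | z.im < 0} by
      ext z; simp [le_or_gt], nhdsWithin_union]
  refine Tendsto.sup ?_ ?_
  · have h := (sqrtP0_continuousOn (α := α) (β := β)) (x : ℂ) (by simp)
    refine h.tendsto.congr' ?_
    filter_upwards [self_mem_nhdsWithin] with z hz
    rw [sheetRoot, if_pos hz]
  · have h := (sqrtP0_tendsto_below hw (x := x)).neg
    rw [sqrtP0_conj_of_neg hw hx, neg_neg] at h
    refine h.congr' ?_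
    filter_upwards [self_mem_nhdsWithin] with z hz
    rw [sheetRoot, if_neg (not_le.mpr hz)]

/-! ### The region `ℛ₁₂` -/

omit hw in
/-- The points of `ℛ₁₂` off the real line. -/
def sheetSet (α β : Fin k → ℝ) : Set (Curve α β) :=
  {P | (0 < P.1.1.im ∧ P.1.2 = sqrtP0 α β P.1.1) ∨ (P.1.1.im < 0 ∧ P.1.2 = -sqrtP0 α β P.1.1)}

omit hw in
theorem mem_sheetSet {P : Curve α β} :
    P ∈ sheetSet α β ↔ P.1.1.im ≠ 0 ∧ P.1.2 = sheetRoot α β P.1.1 := by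
  rw [sheetSet, mem_ofPred_eq, sheetRoot]
  rcases lt_trichotomy P.1.1.im 0 with h | h | h
  · simp [h, h.ne, not_le.mpr h, not_lt.mpr h.le]
  · simp [h]
  · simp [h, h.ne', h.le, not_lt.mpr h.le]

theorem sheetRoot_continuousAt_of_im {z : ℂ} (hz : z.im ≠ 0) :
    ContinuousAt (sheetRoot α β) z := by
  have hc : ContinuousAt (sqrtP0 α β) z :=
    ((sqrtP0_differentiableOn hw).differentiableAt
      (Complex.isOpen_slitPlane.mem_nhds (Or.inr hz))).continuousAt
  rcases hz.lt_or_gt with h | h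
  · refine hc.neg.congr ?_
    filter_upwards [(isOpen_lt Complex.continuous_im continuous_const).mem_nhds h] with u hu
    rw [sheetRoot, if_neg (not_le.mpr hu), Pi.neg_apply]
  · refine hc.congr ?_
    filter_upwards [(isOpen_lt continuous_const Complex.continuous_im).mem_nhds h] with u hu
    rw [sheetRoot, if_pos (le_of_lt hu)]

theorem eventually_eq_sheetRoot {P : Curve α β} {δ : ℂ} (hδ : δ ^ 2 = 1)
    (hc : ContinuousAt (sheetRoot α β) P.1.1) (h0 : aeval P.1.1 (p0 α β) ≠ 0)
    (h : P.1.2 = δ * sheetRoot α β P.1.1) :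
    ∀ᶠ Q : Curve α β in 𝓝 P, Q.1.2 = δ * sheetRoot α β Q.1.1 := by
  have hfst : Tendsto (fun Q : Curve α β => Q.1.1) (𝓝 P) (𝓝 P.1.1) :=
    (continuous_fst.comp continuous_subtype_val).tendsto P
  have hsnd : Tendsto (fun Q : Curve α β => Q.1.2) (𝓝 P) (𝓝 P.1.2) :=
    (continuous_snd.comp continuous_subtype_val).tendsto P
  have h1 : Tendsto (fun Q : Curve α β => δ * sheetRoot α β Q.1.1) (𝓝 P) (𝓝 P.1.2) := by
    rw [h]; exact (hc.tendsto.comp hfst).const_mul δ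
  refine eventually_eq_of_sq_eq hsnd h1 ?_ (Eventually.of_forall fun Q => ?_)
  · intro hP
    have : P.1.2 ^ 2 = aeval P.1.1 (p0 α β) := P.2
    rw [hP] at this
    exact h0 (by rw [← this]; simp)
  · rw [mul_pow, hδ, one_mul, sheetRoot_sq hw]
    exact Q.2

omit hw in
theorem R12_eq_image : R12 α β = Subtype.val '' interior (closure (sheetSet α β)) := rfl

theorem mem_R12_of_im {P : ℂ × ℂ} (hP : P ∈ Curve α β) (him : P.1.im ≠ 0)
    (h : P.2 = sheetRoot α β P.1) : P ∈ R12 α β := by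
  rw [R12_eq_image]
  refine ⟨⟨P, hP⟩, ?_, rfl⟩
  have h1 := eventually_eq_sheetRoot hw (P := ⟨P, hP⟩) (one_pow 2)
    (sheetRoot_continuousAt_of_im hw him) (p0_aeval_ne_zero_of_im hw him) (by simpa using h)
  have h2 : ∀ᶠ Q : Curve α β in 𝓝 ⟨P, hP⟩, Q.1.1.im ≠ 0 :=
    (Complex.continuous_im.comp
      (continuous_fst.comp continuous_subtype_val)).continuousAt.eventually_ne him
  rw [mem_interior_iff_mem_nhds]
  filter_upwards [h1, h2] with Q hQ1 hQ2
  exact subset_closure (mem_sheetSet.mpr ⟨hQ2, by simpa using hQ1⟩)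

omit hw in
/-- Points of the curve over the real line are limits of points off the real line. -/
theorem mem_closure_of_real {x : ℝ} {w : ℂ} (hP : ((x : ℂ), w) ∈ Curve α β) {S : Set (Curve α β)}
    {σ : ℝ} (hσ : σ ≠ 0) {f : ℂ → ℂ} (hf : ∀ z, f z ^ 2 = aeval z (p0 α β))
    (hc : Tendsto (fun τ : ℝ => f (x + (σ * τ : ℝ) * Complex.I)) (𝓝[>] 0) (𝓝 w))
    (hS : ∀ Q : Curve α β, 0 < σ * Q.1.1.im → Q.1.2 = f Q.1.1 → Q ∈ S) :
    (⟨((x : ℂ), w), hP⟩ : Curve α β) ∈ closure S := by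
  let g : ℝ → Curve α β := fun τ =>
    ⟨((x : ℂ) + (σ * τ : ℝ) * Complex.I, f (x + (σ * τ : ℝ) * Complex.I)), hf _⟩
  refine mem_closure_of_tendsto (f := g) (b := 𝓝[>] (0 : ℝ)) ?_ ?_
  · rw [tendsto_subtype_rng]
    refine Tendsto.prodMk_nhds ?_ hc
    have hcont : Continuous fun τ : ℝ => (x : ℂ) + (σ * τ : ℝ) * Complex.I := by fun_prop
    have := hcont.tendsto 0
    simp only [mul_zero, Complex.ofReal_zero, zero_mul, add_zero] at this
    exact this.mono_left nhdsWithin_le_nhds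
  · filter_upwards [self_mem_nhdsWithin] with τ hτ
    have hτ' : 0 < τ := hτ
    refine hS _ ?_ rfl
    simp only [g]
    have : 0 < σ * σ * τ := mul_pos (mul_self_pos.mpr hσ) hτ'
    simpa [mul_assoc] using this

omit hw in
theorem tendsto_line_within {x σ : ℝ} {s : Set ℂ}
    (hs : ∀ τ > 0, (x : ℂ) + (σ * τ : ℝ) * Complex.I ∈ s) :
    Tendsto (fun τ : ℝ => (x : ℂ) + (σ * τ : ℝ) * Complex.I) (𝓝[>] 0) (𝓝[s] (x : ℂ)) := by
  refine tendsto_nhdsWithin_iff.mpr ⟨?_, ?_⟩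
  · have hcont : Continuous fun τ : ℝ => (x : ℂ) + (σ * τ : ℝ) * Complex.I := by fun_prop
    have := hcont.tendsto 0
    simp only [mul_zero, Complex.ofReal_zero, zero_mul, add_zero] at this
    exact this.mono_left nhdsWithin_le_nhds
  · filter_upwards [self_mem_nhdsWithin] with τ hτ using hs τ hτ

theorem mem_R12_of_real {x : ℝ} {w : ℂ} (hP : ((x : ℂ), w) ∈ Curve α β)
    (hx : (p0 α β).eval x < 0) (h : w = sqrtP0 α β x) : ((x : ℂ), w) ∈ R12 α β := by
  rw [R12_eq_image]
  refine ⟨⟨((x : ℂ), w), hP⟩, ?_, rfl⟩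
  have h0 : aeval (x : ℂ) (p0 α β) ≠ 0 := by
    rw [ofReal_aeval]; exact_mod_cast hx.ne
  have h1 := eventually_eq_sheetRoot hw (P := ⟨((x : ℂ), w), hP⟩) (one_pow 2)
    (sheetRoot_continuousAt hw hx) h0 (by simp [sheetRoot, h])
  have hcontre : Continuous fun Q : Curve α β => (p0 α β).eval Q.1.1.re :=
    (p0 α β).continuous.comp (Complex.continuous_re.comp
      (continuous_fst.comp continuous_subtype_val))
  have h2 : ∀ᶠ Q : Curve α β in 𝓝 ⟨((x : ℂ), w), hP⟩, (p0 α β).eval Q.1.1.re < 0 :=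
    hcontre.continuousAt.eventually (gt_mem_nhds (by simpa using hx))
  rw [mem_interior_iff_mem_nhds]
  filter_upwards [h1, h2] with Q hQ1 hQ2
  rw [one_mul] at hQ1
  by_cases him : Q.1.1.im = 0
  · obtain ⟨⟨z, u⟩, hQ⟩ := Q
    simp only at him hQ1 hQ2
    have hz : z = (z.re : ℂ) := Complex.ext rfl (by simpa using him)
    obtain ⟨y, rfl⟩ : ∃ y : ℝ, z = y := ⟨z.re, hz⟩
    rw [Complex.ofReal_re] at hQ2
    refine mem_closure_of_real hQ (σ := 1) one_ne_zero (f := sheetRoot α β)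
      (fun z => sheetRoot_sq hw z) ?_ ?_
    · rw [hQ1]
      exact (sheetRoot_continuousAt hw hQ2).tendsto.comp
        ((tendsto_line_within (s := univ) fun _ _ => mem_univ _).mono_right
          nhdsWithin_le_nhds)
    · intro Q' h3 h4
      rw [one_mul] at h3
      exact mem_sheetSet.mpr ⟨h3.ne', h4⟩
  · exact subset_closure (mem_sheetSet.mpr ⟨him, hQ1⟩)

theorem mem_R12 {P : ℂ × ℂ} (h : P ∈ R12 α β) : P ∈ Curve α β ∧
    ((P.1.im ≠ 0 ∧ P.2 = sheetRoot α β P.1) ∨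
      ∃ x : ℝ, P.1 = x ∧ (p0 α β).eval x < 0) := by
  rw [R12_eq_image] at h
  obtain ⟨⟨P, hP⟩, hint, rfl⟩ := h
  refine ⟨hP, ?_⟩
  set S' : Set (Curve α β) := {Q | Q.1.1.im ≠ 0 ∧ Q.1.2 = -sheetRoot α β Q.1.1} with hS'
  have hopen : IsOpen S' := by
    rw [isOpen_iff_mem_nhds]
    rintro Q ⟨h1, h2⟩
    have h3 := eventually_eq_sheetRoot hw (P := Q) (δ := -1) (by norm_num)
      (sheetRoot_continuousAt_of_im hw h1) (p0_aeval_ne_zero_of_im hw h1) (by simpa using h2)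
    have h4 : ∀ᶠ Q' : Curve α β in 𝓝 Q, Q'.1.1.im ≠ 0 :=
      (Complex.continuous_im.comp
        (continuous_fst.comp continuous_subtype_val)).continuousAt.eventually_ne h1
    filter_upwards [h3, h4] with Q' hQ1 hQ2 using ⟨hQ2, by simpa using hQ1⟩
  have hdisj : Disjoint S' (sheetSet α β) := by
    rw [Set.disjoint_left]
    rintro Q ⟨h1, h2⟩ h3
    obtain ⟨-, h4⟩ := mem_sheetSet.mp h3
    have h5 := p0_aeval_ne_zero_of_im hw h1
    rw [← sheetRoot_sq hw] at h5
    rw [h2] at h4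
    exact h5 (by rw [neg_eq_self.mp h4]; simp)
  have hnot : (⟨P, hP⟩ : Curve α β) ∉ closure S' := fun hcl => by
    have h1 := mem_closure_iff.mp hcl _ isOpen_interior hint
    obtain ⟨Q, hQ1, hQ2⟩ := h1
    exact Set.disjoint_left.mp (hdisj.closure_right hopen) hQ2 (interior_subset hQ1)
  obtain ⟨z, w⟩ := P
  have hsq : w ^ 2 = aeval z (p0 α β) := hP
  by_cases him : z.im = 0
  · right
    have hz : z = (z.re : ℂ) := Complex.ext rfl (by simpa using him)
    refine ⟨z.re, hz, ?_⟩
    by_contra hcon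
    push Not at hcon
    obtain ⟨y, rfl⟩ : ∃ y : ℝ, z = y := ⟨z.re, hz⟩
    rw [Complex.ofReal_re] at hcon
    rw [← sqrtP0_sq hw] at hsq
    apply hnot
    rcases sq_eq_sq_iff_eq_or_eq_neg.mp hsq with h1 | h1
    · refine mem_closure_of_real hP (σ := -1) (by norm_num) (f := sqrtP0 α β)
        (fun z => sqrtP0_sq hw z) ?_ ?_
      · have h2 := sqrtP0_tendsto_below hw (x := y)
        rw [sqrtP0_conj_of_nonneg hw hcon, ← h1] at h2
        exact h2.comp (tendsto_line_within fun τ hτ => by simpa using hτ)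
      · intro Q h3 h4
        have h5 : Q.1.1.im < 0 := by linarith
        exact ⟨h5.ne, by rw [h4, sheetRoot, if_neg (not_le.mpr h5), neg_neg]⟩
    · refine mem_closure_of_real hP (σ := 1) (by norm_num) (f := fun z => -sqrtP0 α β z)
        (fun z => by rw [neg_sq]; exact sqrtP0_sq hw z) ?_ ?_
      · have h2 := ((sqrtP0_continuousOn (α := α) (β := β)) (y : ℂ) (by simp)).tendsto.neg
        rw [← h1] at h2
        exact h2.comp (tendsto_line_within fun τ hτ => by simpa using le_of_lt hτ)
      · intro Q h3 h4
        have h5 : 0 < Q.1.1.im := by linarith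
        exact ⟨h5.ne', by rw [h4, sheetRoot, if_pos h5.le]⟩
  · left
    refine ⟨him, ?_⟩
    rw [← sheetRoot_sq hw] at hsq
    rcases sq_eq_sq_iff_eq_or_eq_neg.mp hsq with h1 | h1
    · exact h1
    · exact absurd (subset_closure (show (⟨(z, w), hP⟩ : Curve α β) ∈ S' from ⟨him, h1⟩)) hnot

end

end Aztec
end

noncomputable section

namespace Aztec

open Set

variable {k : ℕ} {α β : Fin k → ℝ}

/-! ### The eigenvalues near the negative real axis -/

/-- The branch of `p₀^{1/2}` near `a` with the value `b` at `a`. -/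
def localRoot (α β : Fin k → ℝ) (a b z : ℂ) : ℂ :=
  b * (aeval z (p0 α β) / aeval a (p0 α β)) ^ (1 / 2 : ℂ)

section LocalRoot

variable {a b : ℂ} (h0 : aeval a (p0 α β) ≠ 0)
include h0

theorem localRoot_self : localRoot α β a b a = b := by
  rw [localRoot, div_self h0, Complex.one_cpow, mul_one]

theorem localRoot_sq (hb : b ^ 2 = aeval a (p0 α β)) (z : ℂ) :
    localRoot α β a b z ^ 2 = aeval z (p0 α β) := by
  rw [localRoot, mul_pow, half_sq, hb, mul_div_cancel₀ _ h0]

theorem analyticAt_localRoot : AnalyticAt ℂ (localRoot α β a b) a := by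
  have h1 : AnalyticAt ℂ (fun z : ℂ => aeval z (p0 α β) / aeval a (p0 α β)) a :=
    (((p0 α β).differentiable_aeval.analyticAt a).div analyticAt_const h0)
  refine analyticAt_const.mul (h1.cpow analyticAt_const ?_)
  rw [div_self h0]
  exact Complex.one_mem_slitPlane

end LocalRoot

theorem conj_eq_neg_of_sq {w : ℂ} {r : ℝ} (hr : r < 0) (h : w ^ 2 = r) :
    (starRingEnd ℂ) w = -w := by
  have him := congrArg Complex.im h
  have hre := congrArg Complex.re h
  simp only [sq, Complex.mul_im, Complex.mul_re, Complex.ofReal_im, Complex.ofReal_re] at him hre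
  have hw0 : w.re = 0 := by
    by_contra hne
    have : w.im = 0 := by
      have : 2 * w.re * w.im = 0 := by linarith
      simpa [hne] using this
    rw [this] at hre
    nlinarith [mul_self_nonneg w.re]
  apply Complex.ext <;> simp [hw0]

variable (hw : Admissible α β)
include hw

theorem exists_eigenvalue_bound (x : ℝ) : ∃ K > 0, ∀ z : ℂ, 0 < z.im →
    ‖z - x‖ < min 1 (-x) → ∀ y : ℂ, y ^ 2 = z → 0 ≤ y.re → ∀ (v : Fin 2 → ℂ) (l : ℂ),
    (symbol α β z).mulVec v = l • v → K * z.im * (‖y * v 0‖ ^ 2 + ‖v 1‖ ^ 2) ≤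
      (‖l‖ ^ 2 - ‖z - 1‖ ^ (2 * k)) * indefForm y v := by
  obtain ⟨c, hc, h⟩ := exists_indefForm_symbol hw.1 hw.2 hw.3
  set R : ℝ := |x| + 1 with hR
  have hR1 : 1 ≤ R := by have := abs_nonneg x; linarith
  refine ⟨c / ((1 + R) ^ 2 * (2 * R)), by positivity, fun z hz hzx y hy hyre v l hv => ?_⟩
  have hzR : ‖z‖ ≤ R := by
    have h1 : ‖z‖ ≤ ‖z - x‖ + ‖(x : ℂ)‖ := by simpa using norm_add_le (z - x) (x : ℂ)
    rw [Complex.norm_real, Real.norm_eq_abs] at h1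
    have := hzx.trans_le (min_le_left _ _)
    linarith
  have hzre : z.re < 0 := by
    have h1 := (Complex.abs_re_le_norm (z - x)).trans_lt (hzx.trans_le (min_le_right _ _))
    rw [Complex.sub_re, Complex.ofReal_re, abs_lt] at h1
    linarith
  have hz1 : 1 ≤ ‖z - 1‖ := by
    have h1 := Complex.abs_re_le_norm (z - 1)
    rw [Complex.sub_re, Complex.one_re, abs_of_neg (by linarith)] at h1
    linarith
  have hy0 : y ≠ 0 := by
    rintro rfl
    rw [← hy] at hz
    simp at hz
  have hyR : ‖y‖ ≤ R := by
    have h1 : ‖y‖ ^ 2 ≤ R := by rw [← norm_pow, hy]; exact hzR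
    by_contra hcon
    push Not at hcon
    nlinarith
  have hye : z.im / (2 * R) ≤ y.re := by
    rw [div_le_iff₀ (by positivity)]
    have h1 : z.im = 2 * (y.re * y.im) := by
      rw [← hy, sq, Complex.mul_im]; ring
    have h2 := (le_abs_self y.im).trans ((Complex.abs_im_le_norm y).trans hyR)
    rw [h1]
    nlinarith
  have hfac : 1 / (1 + R) ^ 2 ≤ ‖y - 1‖ / (1 + ‖y‖) := by
    have h1 : ‖y - 1‖ * ‖y + 1‖ = ‖z - 1‖ := by rw [← norm_mul, ← hy]; ring_nf
    have h2 : ‖y + 1‖ ≤ 1 + ‖y‖ := by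
      have := norm_add_le y 1
      rw [norm_one] at this
      linarith
    have hyn := norm_nonneg y
    have h3 : 1 / (1 + ‖y‖) ≤ ‖y - 1‖ := by
      rw [div_le_iff₀ (by positivity)]
      calc 1 ≤ ‖y - 1‖ * ‖y + 1‖ := by rw [h1]; exact hz1
        _ ≤ _ := by gcongr
    calc 1 / (1 + R) ^ 2 ≤ 1 / (1 + ‖y‖) ^ 2 := by gcongr
      _ = 1 / (1 + ‖y‖) / (1 + ‖y‖) := by rw [sq, div_div]
      _ ≤ _ := by gcongr
  have hmain := h y hyre hy0 v
  rw [hy, hv, indefForm_smul] at hmain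
  have hn : 0 ≤ ‖y * v 0‖ ^ 2 + ‖v 1‖ ^ 2 := by positivity
  have hpow : 1 ≤ ‖z - 1‖ ^ (2 * k - 1) := one_le_pow₀ hz1
  have hstep : c / ((1 + R) ^ 2 * (2 * R)) * z.im ≤
      c * (y.re * ‖y - 1‖ / (1 + ‖y‖)) := by
    calc c / ((1 + R) ^ 2 * (2 * R)) * z.im = c * (z.im / (2 * R) * (1 / (1 + R) ^ 2)) := by
          field_simp
      _ ≤ c * (y.re * (‖y - 1‖ / (1 + ‖y‖))) := by gcongr
      _ = _ := by rw [mul_div_assoc]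
  have hge : 0 ≤ c * (y.re * ‖y - 1‖ / (1 + ‖y‖)) * (‖y * v 0‖ ^ 2 + ‖v 1‖ ^ 2) := by positivity
  have h7 := mul_le_mul_of_nonneg_right hstep hn
  have h8 := le_mul_of_one_le_left hge hpow
  linarith

omit hw in
theorem indefForm_le (y : ℂ) (v : Fin 2 → ℂ) :
    2 * |indefForm y v| ≤ ‖y * v 0‖ ^ 2 + ‖v 1‖ ^ 2 := by
  have h1 : |indefForm y v| ≤ ‖y * v 0‖ * ‖v 1‖ := by
    refine (Complex.abs_re_le_norm _).trans ?_
    rw [norm_mul, RCLike.norm_conj]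
  nlinarith [sq_nonneg (‖y * v 0‖ - ‖v 1‖)]

omit hw in
theorem exists_sqrt_re_nonneg {z : ℂ} : ∃ y : ℂ, y ^ 2 = z ∧ 0 ≤ y.re := by
  refine ⟨z ^ (1 / 2 : ℂ), half_sq z, ?_⟩
  rcases eq_or_ne z 0 with rfl | hz
  · simp
  rw [Complex.cpow_def_of_ne_zero hz, Complex.exp_re]
  refine mul_nonneg (Real.exp_pos _).le (Real.cos_nonneg_of_mem_Icc ?_)
  have h1 := Complex.neg_pi_lt_arg z
  have h2 := Complex.arg_le_pi z
  have : (Complex.log z * (1 / 2)).im = z.arg / 2 := by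
    rw [show (1 / 2 : ℂ) = ((1 / 2 : ℝ) : ℂ) by norm_num, Complex.im_mul_ofReal, Complex.log_im]
    ring
  rw [this]
  constructor <;> linarith

theorem exists_norm_lam_sq_ge (x : ℝ) : ∃ K > 0, ∀ z : ℂ, 0 < z.im →
    ‖z - x‖ < min 1 (-x) → K * z.im ≤ ‖lam α β 1 z‖ ^ 2 - ‖z - 1‖ ^ (2 * k) := by
  obtain ⟨K, hK, h⟩ := exists_eigenvalue_bound hw x
  refine ⟨2 * K, by positivity, fun z hz hzx => ?_⟩
  obtain ⟨y, hy, hyre⟩ := exists_sqrt_re_nonneg (z := z)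
  obtain ⟨v, hv0, hv⟩ := exists_eigenvector (M := symbol α β z) (a := lam α β 1 z)
    (b := lam α β (-1) z) (by rw [lam_add, trace_symbol])
    (by rw [lam_mul hw (Or.inl rfl), det_symbol hw.2 hw.3])
  have h1 := h z hz hzx y hy hyre v _ hv
  have hy0 : y ≠ 0 := by
    rintro rfl
    rw [← hy] at hz
    simp at hz
  have hn : 0 < ‖y * v 0‖ ^ 2 + ‖v 1‖ ^ 2 := by
    by_contra hcon
    push Not at hcon
    apply hv0
    have ha : ‖y * v 0‖ = 0 := by nlinarith [sq_nonneg ‖y * v 0‖, sq_nonneg ‖v 1‖]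
    have hb : ‖v 1‖ = 0 := by nlinarith [sq_nonneg ‖y * v 0‖, sq_nonneg ‖v 1‖]
    rw [norm_eq_zero] at ha hb
    ext i
    fin_cases i
    · exact (mul_eq_zero.mp ha).resolve_left hy0
    · exact hb
  have hd : 0 < ‖lam α β 1 z‖ ^ 2 - ‖z - 1‖ ^ (2 * k) := by
    have := norm_sub_one_pow_lt hw (mem_slitPlane_of_im_pos hz)
    rw [pow_mul', sub_pos]
    exact pow_lt_pow_left₀ this (by positivity) two_ne_zero
  have h2 := indefForm_le y v
  have h3 := le_abs_self (indefForm y v)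
  set n := ‖y * v 0‖ ^ 2 + ‖v 1‖ ^ 2
  have h4 : (‖lam α β 1 z‖ ^ 2 - ‖z - 1‖ ^ (2 * k)) * indefForm y v ≤
      (‖lam α β 1 z‖ ^ 2 - ‖z - 1‖ ^ (2 * k)) * (n / 2) :=
    mul_le_mul_of_nonneg_left (by linarith) hd.le
  have h5 : (2 * K * z.im) * n ≤ (‖lam α β 1 z‖ ^ 2 - ‖z - 1‖ ^ (2 * k)) * n := by linarith
  exact le_of_mul_le_mul_right h5 hn

omit hw in
/-- The eigenvalue of the polynomial symbol on a given branch of the spectral curve. -/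
def lamLoc (α β : Fin k → ℝ) (W : ℂ → ℂ) (z : ℂ) : ℂ :=
  (aeval z (tracePoly α β) + aeval z (qPoly α β) * W z) / 2

omit hw in
theorem lamLoc_eq_lam {W : ℂ → ℂ} {δ : ℝ} {z : ℂ} (h : W z = δ * sqrtP0 α β z) :
    lamLoc α β W z = lam α β δ z := by
  rw [lamLoc, lam, discRoot, h]; ring

omit hw in
theorem norm_lamLoc_sq {W : ℂ → ℂ} {y : ℝ} (hy : (p0 α β).eval y < 0)
    (hW : W y ^ 2 = aeval (y : ℂ) (p0 α β)) :
    ‖lamLoc α β W y‖ ^ 2 = ‖(y : ℂ) - 1‖ ^ (2 * k) := by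
  have hc : (starRingEnd ℂ) (W y) = -W y := conj_eq_neg_of_sq hy (by rw [hW, ofReal_aeval])
  have h1 : lamLoc α β W y * (starRingEnd ℂ) (lamLoc α β W y) = ((y : ℂ) - 1) ^ (2 * k) := by
    have hd : aeval (y : ℂ) (discPoly α β) =
        aeval (y : ℂ) (tracePoly α β) ^ 2 - 4 * ((y : ℂ) - 1) ^ (2 * k) := by
      simp [discPoly, map_ofNat]
    rw [discPoly_eq, map_mul, map_pow, ← hW] at hd
    rw [lamLoc, map_div₀, map_add, map_mul, hc, ← Polynomial.aeval_conj, ← Polynomial.aeval_conj,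
      Complex.conj_ofReal, show (starRingEnd ℂ) (2 : ℂ) = 2 from Complex.conj_ofNat 2]
    linear_combination -hd / 4
  rw [Complex.mul_conj, Complex.normSq_eq_norm_sq] at h1
  have h2 := congrArg norm h1
  rw [norm_pow, Complex.norm_real, Real.norm_of_nonneg (by positivity)] at h2
  exact h2

omit hw in
theorem analyticAt_lamLoc {W : ℂ → ℂ} {a : ℂ} (hW : AnalyticAt ℂ W a) :
    AnalyticAt ℂ (lamLoc α β W) a := by
  have h1 := (Polynomial.differentiable_aeval (𝕜 := ℂ) (tracePoly α β)).analyticAt a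
  have h2 := (Polynomial.differentiable_aeval (𝕜 := ℂ) (qPoly α β)).analyticAt a
  exact (h1.add (h2.mul hW)).div analyticAt_const two_ne_zero

omit hw in
theorem exists_abs_sub_le_mul_im {W : ℂ → ℂ} {x : ℝ} (hx : (p0 α β).eval x < 0)
    (hW : AnalyticAt ℂ W x) (hsq : ∀ z, W z ^ 2 = aeval z (p0 α β)) :
    ∃ C, ∀ᶠ z : ℂ in 𝓝 (x : ℂ),
      |‖lamLoc α β W z‖ ^ 2 - ‖z - 1‖ ^ (2 * k)| ≤ C * |z.im| := by
  have hC : ContDiffAt ℝ 1 (fun z : ℂ => ‖lamLoc α β W z‖ ^ 2 - (‖z - 1‖ ^ 2) ^ k) (x : ℂ) := by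
    have h1 : ContDiffAt ℝ 1 (lamLoc α β W) (x : ℂ) :=
      ((analyticAt_lamLoc hW).contDiffAt (n := 1)).restrict_scalars ℝ
    have h2 : ContDiffAt ℝ 1 (fun z : ℂ => z - 1) (x : ℂ) := contDiffAt_id.sub contDiffAt_const
    exact (h1.norm_sq ℝ).sub ((h2.norm_sq ℝ).pow k)
  obtain ⟨K, t, ht, hL⟩ := hC.exists_lipschitzOnWith
  refine ⟨K, ?_⟩
  have hre : Tendsto (fun z : ℂ => ((z.re : ℝ) : ℂ)) (𝓝 (x : ℂ)) (𝓝 (x : ℂ)) := by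
    have : Continuous fun z : ℂ => ((z.re : ℝ) : ℂ) := by fun_prop
    simpa using this.tendsto (x : ℂ)
  have hneg : ∀ᶠ z : ℂ in 𝓝 (x : ℂ), (p0 α β).eval z.re < 0 :=
    ((p0 α β).continuous.comp Complex.continuous_re).continuousAt.eventually
      (gt_mem_nhds (by simpa using hx))
  filter_upwards [ht, hre.eventually ht, hneg] with z h1 h2 h3
  have h4 := hL.dist_le_mul z h1 _ h2
  have h5 := norm_lamLoc_sq h3 (hsq z.re)
  rw [pow_mul] at h5
  rw [← pow_mul, h5, sub_self, Real.dist_eq, sub_zero, dist_eq_norm] at h4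
  have h6 : z - (z.re : ℂ) = (z.im : ℂ) * Complex.I := by
    apply Complex.ext <;> simp
  rwa [h6, norm_mul, Complex.norm_I, mul_one, Complex.norm_real, Real.norm_eq_abs] at h4

theorem exists_localRoot_eq {x : ℝ} (hx : (p0 α β).eval x < 0) {b : ℂ}
    (hb : b ^ 2 = aeval (x : ℂ) (p0 α β)) : ∃ δ : ℝ, (δ = 1 ∨ δ = -1) ∧
    ∀ᶠ z : ℂ in 𝓝[{z | 0 < z.im}] (x : ℂ), localRoot α β x b z = δ * sqrtP0 α β z := by
  have h0 : aeval (x : ℂ) (p0 α β) ≠ 0 := by rw [ofReal_aeval]; exact_mod_cast hx.ne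
  obtain ⟨δ, hδ, hbδ⟩ : ∃ δ : ℝ, (δ = 1 ∨ δ = -1) ∧ b = δ * sqrtP0 α β x := by
    have := sqrtP0_sq hw (x : ℂ)
    rw [← hb] at this
    rcases sq_eq_sq_iff_eq_or_eq_neg.mp this with h | h
    · exact ⟨1, Or.inl rfl, by rw [h]; simp⟩
    · exact ⟨-1, Or.inr rfl, by rw [h]; simp⟩
  refine ⟨δ, hδ, ?_⟩
  have h1 := ((analyticAt_localRoot h0 (b := b)).continuousAt.tendsto).mono_left
    (nhdsWithin_le_nhds (s := {z : ℂ | 0 < z.im}))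
  rw [localRoot_self h0] at h1
  have h2 := (((sqrtP0_continuousOn (α := α) (β := β)) (x : ℂ) (by simp)).mono
    (fun z (hz : 0 < z.im) => (hz.le : 0 ≤ z.im))).tendsto.const_mul (δ : ℂ)
  rw [← hbδ] at h2
  refine eventually_eq_of_sq_eq h1 h2 ?_ (Eventually.of_forall fun z => ?_)
  · rintro rfl
    exact h0 (by rw [← hb]; simp)
  · have : (δ : ℂ) ^ 2 = 1 := by rcases hδ with rfl | rfl <;> simp
    rw [localRoot_sq h0 hb, mul_pow, this, one_mul, sqrtP0_sq hw]

theorem symbol_mul_proj {ε : ℝ} (hε : ε = 1 ∨ ε = -1) (z : ℂ) :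
    symbol α β z * proj α β ε z = lam α β ε z • proj α β ε z := by
  have hCH := cayleyHamilton_two (symbol α β z)
  rw [trace_symbol, det_symbol hw.2 hw.3, ← lam_add ε z, ← lam_mul hw hε z] at hCH
  rw [proj, mul_smul_comm, smul_comm]
  congr 1
  rw [mul_sub, hCH, mul_smul_comm, mul_one]
  module

omit hw in
/-- Bounds for eigenvectors in terms of an indefinite form bound the spectral projections. -/
theorem norm_proj_sq_le (hw : Admissible α β) {z y : ℂ} (hS : discRoot α β z ≠ 0) (hy : y ^ 2 = z)
    (hz0 : z ≠ 0) {M : ℝ} (hM0 : 0 ≤ M)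
    (hJ1 : ∀ v : Fin 2 → ℂ, (symbol α β z).mulVec v = lam α β 1 z • v →
      ‖y * v 0‖ ^ 2 + ‖v 1‖ ^ 2 ≤ M * indefForm y v)
    (hJ2 : ∀ v : Fin 2 → ℂ, (symbol α β z).mulVec v = lam α β (-1) z • v →
      ‖y * v 0‖ ^ 2 + ‖v 1‖ ^ 2 ≤ M * -indefForm y v) (i j : Fin 2) :
    ‖proj α β 1 z i j‖ ^ 2 ≤ (M ^ 2 + M) * (1 + ‖z‖) * (1 + ‖z‖⁻¹) := by
  set n : (Fin 2 → ℂ) → ℝ := fun v => ‖y * v 0‖ ^ 2 + ‖v 1‖ ^ 2 with hn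
  have hn0 : ∀ v, 0 ≤ n v := fun v => by positivity
  have hmain : ∀ v : Fin 2 → ℂ, n ((proj α β 1 z).mulVec v) ≤ (M ^ 2 + M) * n v := by
    intro v
    set u := (proj α β 1 z).mulVec v with hu
    set u' := (proj α β (-1) z).mulVec v with hu'
    have hsum : u' = v - u := by
      have h5 := congrArg (fun Q => Q.mulVec v) (proj_add (ε := 1) (Or.inl rfl) hS)
      simp only [Matrix.add_mulVec, Matrix.one_mulVec] at h5
      rw [← h5]; simp [hu, hu']
    have e1 := hJ1 u (by
      rw [hu, Matrix.mulVec_mulVec, symbol_mul_proj hw (Or.inl rfl), Matrix.smul_mulVec])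
    have e2 := hJ2 u' (by
      rw [hu', Matrix.mulVec_mulVec, symbol_mul_proj hw (Or.inr rfl), Matrix.smul_mulVec])
    have hexp : indefForm y u - indefForm y u' =
        (y * v 0 * (starRingEnd ℂ) (u 1)).re + (y * u 0 * (starRingEnd ℂ) (v 1)).re -
          indefForm y v := by
      rw [hsum]
      simp only [indefForm, Pi.sub_apply, map_sub, mul_sub, sub_mul, Complex.sub_re]
      ring
    have f1 : (y * v 0 * (starRingEnd ℂ) (u 1)).re ≤ ‖y * v 0‖ * ‖u 1‖ := by
      refine (Complex.re_le_norm _).trans ?_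
      rw [norm_mul, RCLike.norm_conj]
    have f2 : (y * u 0 * (starRingEnd ℂ) (v 1)).re ≤ ‖y * u 0‖ * ‖v 1‖ := by
      refine (Complex.re_le_norm _).trans ?_
      rw [norm_mul, RCLike.norm_conj]
    have f3 := (neg_abs_le (indefForm y v))
    have f4 := indefForm_le y v
    have g1 : M * (‖y * v 0‖ * ‖u 1‖) ≤ (M ^ 2 * ‖y * v 0‖ ^ 2 + ‖u 1‖ ^ 2) / 2 := by
      nlinarith [sq_nonneg (M * ‖y * v 0‖ - ‖u 1‖)]
    have g2 : M * (‖y * u 0‖ * ‖v 1‖) ≤ (M ^ 2 * ‖v 1‖ ^ 2 + ‖y * u 0‖ ^ 2) / 2 := by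
      nlinarith [sq_nonneg (M * ‖v 1‖ - ‖y * u 0‖)]
    have e3 := hn0 u'
    have e4 : n u ≤ M * (indefForm y u - indefForm y u') := by linarith
    rw [hexp] at e4
    have e5 : n u ≤ M * (‖y * v 0‖ * ‖u 1‖) + M * (‖y * u 0‖ * ‖v 1‖) + M * (n v / 2) := by
      refine e4.trans ?_
      rw [← mul_add, ← mul_add]
      refine mul_le_mul_of_nonneg_left ?_ hM0
      have : -indefForm y v ≤ n v / 2 := by
        have : -indefForm y v ≤ |indefForm y v| := neg_le_abs _
        simp only [hn]; linarith
      linarith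
    simp only [hn] at e5 ⊢
    linarith
  have hy2 : ‖y‖ ^ 2 = ‖z‖ := by rw [← norm_pow, hy]
  have hz : 0 < ‖z‖ := norm_pos_iff.mpr hz0
  set B := (M ^ 2 + M) * (1 + ‖z‖) with hB
  have hB0 : 0 ≤ B := by positivity
  have hcol : n ((proj α β 1 z).mulVec (Pi.single j 1)) ≤ B := by
    refine (hmain _).trans (mul_le_mul_of_nonneg_left ?_ (by positivity))
    fin_cases j <;> simp [hn, hy2]
  simp only [hn, Matrix.mulVec_single_one, Matrix.col_apply] at hcol
  rw [norm_mul, mul_pow, hy2] at hcol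
  have hz' : 0 < ‖z‖⁻¹ := inv_pos.mpr hz
  have hBz : 0 ≤ B * ‖z‖⁻¹ := by positivity
  have h0 : 0 ≤ ‖z‖ * ‖proj α β 1 z 0 j‖ ^ 2 := by positivity
  fin_cases i
  · show ‖proj α β 1 z 0 j‖ ^ 2 ≤ _
    have h6 : ‖z‖ * ‖proj α β 1 z 0 j‖ ^ 2 ≤ B := by
      linarith [sq_nonneg ‖proj α β 1 z 1 j‖]
    have h7 : ‖proj α β 1 z 0 j‖ ^ 2 ≤ B * ‖z‖⁻¹ := by
      rw [← div_eq_mul_inv, le_div_iff₀ hz]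
      linarith
    linarith
  · show ‖proj α β 1 z 1 j‖ ^ 2 ≤ _
    linarith

/-- Near the points of the negative axis at which the eigenvalues are not real, their moduli
differ from that of the geometric mean by a multiple of the distance from the axis. -/
theorem exists_norm_lam_sq_sub_le {x : ℝ} (hx0 : x < 0) (hx : (p0 α β).eval x < 0) :
    ∃ C ≥ 0, ∀ᶠ z : ℂ in 𝓝[{z | 0 < z.im}] (x : ℂ),
      ‖lam α β 1 z‖ ^ 2 - ‖z - 1‖ ^ (2 * k) ≤ C * z.im ∧
      ‖z - 1‖ ^ (2 * k) - ‖lam α β (-1) z‖ ^ 2 ≤ C * z.im := by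
  have h0 : aeval (x : ℂ) (p0 α β) ≠ 0 := by rw [ofReal_aeval]; exact_mod_cast hx.ne
  have hb := sqrtP0_sq hw (x : ℂ)
  obtain ⟨δ, hδ, hW⟩ := exists_localRoot_eq hw hx hb
  obtain ⟨C, hC⟩ := exists_abs_sub_le_mul_im hx (analyticAt_localRoot h0)
    (localRoot_sq h0 hb)
  have hC0 : ∀ᶠ z : ℂ in 𝓝 (x : ℂ), |C| * |z.im| < 1 / 2 := by
    have : Continuous fun z : ℂ => |C| * |z.im| := by fun_prop
    exact this.continuousAt.eventually (gt_mem_nhds (by simp))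
  have hball : ∀ᶠ z : ℂ in 𝓝 (x : ℂ), ‖z - x‖ < min 1 (-x) := by
    have h1 : 0 < min 1 (-x) := lt_min one_pos (by linarith)
    filter_upwards [Metric.ball_mem_nhds (x : ℂ) h1] with z ha
    rwa [Metric.mem_ball, dist_eq_norm] at ha
  refine ⟨2 * |C|, by positivity, ?_⟩
  filter_upwards [hW, hC.filter_mono nhdsWithin_le_nhds, hC0.filter_mono nhdsWithin_le_nhds,
    hball.filter_mono nhdsWithin_le_nhds, self_mem_nhdsWithin] with z h1 h2 h3 h4 hz
  have hz' : 0 < z.im := hz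
  rw [lamLoc_eq_lam h1, abs_of_pos hz'] at h2
  rw [abs_of_pos hz'] at h3
  have hs := mem_slitPlane_of_im_pos hz'
  set D := ‖z - 1‖ ^ (2 * k) with hD
  have hD1 : 1 ≤ D := by
    refine one_le_pow₀ ?_
    have h5 := (Complex.abs_re_le_norm (z - x)).trans_lt (h4.trans_le (min_le_right _ _))
    rw [Complex.sub_re, Complex.ofReal_re, abs_lt] at h5
    have h6 := Complex.abs_re_le_norm (z - 1)
    rw [Complex.sub_re, Complex.one_re, abs_of_neg (by linarith)] at h6
    linarith
  set a := ‖lam α β 1 z‖ ^ 2 with ha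
  set b := ‖lam α β (-1) z‖ ^ 2 with hb'
  have hab : a * b = D ^ 2 := by
    rw [ha, hb', ← mul_pow, ← norm_mul, lam_mul hw (Or.inl rfl), norm_pow]
  have haD : D < a := by
    rw [hD, ha, pow_mul']
    exact pow_lt_pow_left₀ (norm_sub_one_pow_lt hw hs) (by positivity) two_ne_zero
  have hbD : b < D := by
    have : 0 < D := by linarith
    by_contra hcon
    push Not at hcon
    nlinarith
  have hCle : C * z.im ≤ |C| * z.im := mul_le_mul_of_nonneg_right (le_abs_self C) hz'.le
  have hCn : 0 ≤ |C| * z.im := by positivity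
  rcases hδ with rfl | rfl
  · rw [← ha] at h2
    have h5 : a - D ≤ |C| * z.im := (le_abs_self _).trans (h2.trans hCle)
    have h6 : D - b ≤ a - D := by
      have : 0 < a := by linarith
      nlinarith [sq_nonneg (a - D)]
    constructor <;> linarith
  · rw [← hb'] at h2
    have h5 : D - b ≤ |C| * z.im := by
      have := (neg_abs_le (b - D)); linarith
    have h6 : 1 / 2 ≤ b / D := by
      rw [le_div_iff₀ (by linarith)]
      linarith
    have h7 : a - D ≤ 2 * (D - b) := by
      have hb2 : D / 2 ≤ b := by linarith
      have : (a - D) * b = (D - b) * D := by linear_combination hab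
      have h9 : (a - D) * (D / 2) ≤ (D - b) * D := by
        rw [← this]; exact mul_le_mul_of_nonneg_left hb2 (by linarith)
      nlinarith
    constructor <;> linarith

/-- The spectral projections stay bounded near the points of the negative axis at which the
eigenvalues are not real. -/
theorem exists_norm_proj_le_of_neg {x : ℝ} (hx0 : x < 0) (hx : (p0 α β).eval x < 0) :
    ∃ C, ∀ᶠ z : ℂ in 𝓝[{z | 0 < z.im}] (x : ℂ), ∀ i j, ‖proj α β 1 z i j‖ ≤ C := by
  obtain ⟨C, hC0, hC⟩ := exists_norm_lam_sq_sub_le hw hx0 hx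
  obtain ⟨K, hK, hbound⟩ := exists_eigenvalue_bound hw x
  have hball : ∀ᶠ z : ℂ in 𝓝 (x : ℂ), ‖z - x‖ < min 1 (-x) ∧ ‖z - x‖ < -x / 2 := by
    have h1 : 0 < min 1 (-x) := lt_min one_pos (by linarith)
    have h2 : 0 < -x / 2 := by linarith
    filter_upwards [Metric.ball_mem_nhds (x : ℂ) h1, Metric.ball_mem_nhds (x : ℂ) h2] with z ha hb
    rw [Metric.mem_ball, dist_eq_norm] at ha hb
    exact ⟨ha, hb⟩
  set M := C / K with hM
  have hM0 : 0 ≤ M := by positivity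
  set B := (M ^ 2 + M) * (1 - 2 * x) with hB
  refine ⟨(1 + B) * (1 + 2 / -x), ?_⟩
  filter_upwards [hC, hball.filter_mono nhdsWithin_le_nhds, self_mem_nhdsWithin] with z hboth h4 hz
  have hz' : 0 < z.im := hz
  have hs := mem_slitPlane_of_im_pos hz'
  have hS := discRoot_ne_zero hw hs
  have hlt := norm_sub_one_pow_lt hw hs
  set D := ‖z - 1‖ ^ (2 * k) with hD
  set a := ‖lam α β 1 z‖ ^ 2 with ha
  set b := ‖lam α β (-1) z‖ ^ 2 with hb'
  have haD : D < a := by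
    rw [hD, ha, pow_mul']
    exact pow_lt_pow_left₀ hlt (by positivity) two_ne_zero
  have hbD : b < D := by
    have hab : a * b = D ^ 2 := by
      rw [ha, hb', ← mul_pow, ← norm_mul, lam_mul hw (Or.inl rfl), norm_pow]
    have : 0 < D :=
      pow_pos (norm_pos_iff.mpr (sub_ne_zero.mpr (ne_one_of_im_pos hz'))) _
    by_contra hcon
    push Not at hcon
    nlinarith
  obtain ⟨y, hy, hyre⟩ := exists_sqrt_re_nonneg (z := z)
  set n : (Fin 2 → ℂ) → ℝ := fun v => ‖y * v 0‖ ^ 2 + ‖v 1‖ ^ 2 with hn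
  have hn0 : ∀ v, 0 ≤ n v := fun v => by positivity
  have hJ1 : ∀ v : Fin 2 → ℂ, (symbol α β z).mulVec v = lam α β 1 z • v →
      n v ≤ M * indefForm y v := by
    intro v hv
    have h5 := hbound z hz' h4.1 y hy hyre v _ hv
    rw [← ha, ← hD] at h5
    have h6 : 0 ≤ indefForm y v := by
      by_contra hcon
      push Not at hcon
      have : 0 ≤ K * z.im * n v := mul_nonneg (by positivity) (hn0 v)
      have : (a - D) * indefForm y v < 0 := mul_neg_of_pos_of_neg (by linarith) hcon
      linarith
    have h7 : K * z.im * n v ≤ C * z.im * indefForm y v :=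
      h5.trans (mul_le_mul_of_nonneg_right hboth.1 h6)
    rw [hM, div_mul_eq_mul_div, le_div_iff₀ hK]
    nlinarith
  have hJ2 : ∀ v : Fin 2 → ℂ, (symbol α β z).mulVec v = lam α β (-1) z • v →
      n v ≤ M * -indefForm y v := by
    intro v hv
    have h5 := hbound z hz' h4.1 y hy hyre v _ hv
    rw [← hb', ← hD] at h5
    have h6 : 0 ≤ -indefForm y v := by
      by_contra hcon
      push Not at hcon
      have : 0 ≤ K * z.im * n v := mul_nonneg (by positivity) (hn0 v)
      have : (b - D) * indefForm y v < 0 := mul_neg_of_neg_of_pos (by linarith) (by linarith)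
      linarith
    have h7 : K * z.im * n v ≤ C * z.im * -indefForm y v := by
      have := mul_le_mul_of_nonneg_right hboth.2 h6
      linarith
    rw [hM, div_mul_eq_mul_div, le_div_iff₀ hK]
    nlinarith
  have hzn : -x / 2 ≤ ‖z‖ ∧ ‖z‖ ≤ -(2 * x) := by
    have h5 := abs_norm_sub_norm_le z x
    rw [Complex.norm_real, Real.norm_eq_abs, abs_of_neg hx0, abs_le] at h5
    constructor <;> linarith [h4.2]
  have hz0 : z ≠ 0 := by rintro rfl; simp at hz'
  have hpr := norm_proj_sq_le hw hS hy hz0 hM0 hJ1 hJ2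
  intro i j
  have hx2 : 0 < 2 / -x := div_pos two_pos (by linarith)
  have h8 : ‖z‖⁻¹ ≤ 2 / -x := by
    rw [inv_le_comm₀ (norm_pos_iff.mpr hz0) hx2, inv_div]
    linarith [hzn.1]
  have hx3 : 0 ≤ 1 - 2 * x := by linarith
  have hB0 : 0 ≤ B := by positivity
  have h9 : ‖proj α β 1 z i j‖ ^ 2 ≤ B * (1 + 2 / -x) := by
    refine (hpr i j).trans ?_
    have h11 : 1 + ‖z‖ ≤ 1 - 2 * x := by linarith [hzn.2]
    have h12 : 1 + ‖z‖⁻¹ ≤ 1 + 2 / -x := by linarith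
    rw [hB]
    exact mul_le_mul (mul_le_mul_of_nonneg_left h11 (by positivity)) h12 (by positivity) hB0
  by_contra hcon
  push Not at hcon
  have h10 : 1 ≤ (1 + B) * (1 + 2 / -x) := by nlinarith
  nlinarith

end Aztec
end

noncomputable section

namespace Aztec

open Set

variable {k : ℕ} {α β : Fin k → ℝ}

/-! ### Critical points on the spectral curve -/

/-- The eigenvalue of `Φ` on a given branch of the spectral curve. -/
def rhoLoc (α β : Fin k → ℝ) (W : ℂ → ℂ) (z : ℂ) : ℂ := lamLoc α β W z / (z - 1) ^ k

theorem logDeriv_congr {f g : ℂ → ℂ} {a : ℂ} (h : f =ᶠ[𝓝 a] g) : logDeriv f a = logDeriv g a := by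
  rw [logDeriv_apply, logDeriv_apply, h.deriv_eq, h.eq_of_nhds]

theorem logDeriv_conj (f : ℂ → ℂ) (a : ℂ) :
    logDeriv (starRingEnd ℂ ∘ f ∘ starRingEnd ℂ) a =
      (starRingEnd ℂ) (logDeriv f ((starRingEnd ℂ) a)) := by
  rw [logDeriv_apply, logDeriv_apply, deriv_conj_conj]
  simp

theorem rhoLoc_differentiableAt {W : ℂ → ℂ} {a : ℂ} (hW : AnalyticAt ℂ W a) (h1 : a ≠ 1) :
    DifferentiableAt ℂ (rhoLoc α β W) a :=
  (analyticAt_lamLoc hW).differentiableAt.div ((differentiableAt_id.sub_const 1).pow k)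
    (pow_ne_zero _ (sub_ne_zero.mpr h1))

variable (hw : Admissible α β)
include hw

theorem rhoCurve_eq {z : ℂ} (hz0 : z ≠ 0) (hz1 : z ≠ 1) (w : ℂ) :
    rhoCurve α β (z, w) =
      (aeval z (tracePoly α β) + aeval z (qPoly α β) * w) / 2 / (z - 1) ^ k := by
  have : (z - 1) ^ k ≠ 0 := pow_ne_zero _ (sub_ne_zero.mpr hz1)
  rw [rhoCurve, Phi_eq hw.2 hw.3 hz0 hz1, Matrix.trace_smul, trace_symbol, smul_eq_mul]
  field_simp

omit hw in
theorem rhoLoc_mul {W : ℂ → ℂ} {z : ℂ} (hW : W z ^ 2 = aeval z (p0 α β)) (hz1 : z ≠ 1) :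
    rhoLoc α β W z * rhoLoc α β (fun u => -W u) z = 1 := by
  have h1 : lamLoc α β W z * lamLoc α β (fun u => -W u) z = (z - 1) ^ (2 * k) := by
    have hd : aeval z (discPoly α β) = aeval z (tracePoly α β) ^ 2 - 4 * (z - 1) ^ (2 * k) := by
      simp [discPoly, map_ofNat]
    rw [discPoly_eq, map_mul, map_pow, ← hW] at hd
    rw [lamLoc, lamLoc]
    linear_combination -hd / 4
  rw [rhoLoc, rhoLoc, div_mul_div_comm, h1, ← pow_add, ← two_mul, div_self]
  exact pow_ne_zero _ (sub_ne_zero.mpr hz1)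

omit hw in
/-- The derivative of the exponent `F`, in terms of a branch of the curve. -/
def critEq (α β : Fin k → ℝ) (χ η : ℝ) (W : ℂ → ℂ) (a : ℂ) : ℂ :=
  (k : ℂ) / 4 * (η + 1) / a - (k : ℂ) / 2 / (a - 1) - (χ : ℂ) / 2 * logDeriv (rhoLoc α β W) a

theorem critEq_eq_zero {χ η : ℝ} {P : ℂ × ℂ} (h0 : aeval P.1 (p0 α β) ≠ 0)
    (hcrit : IsCriticalPoint α β χ η P) {W : ℂ → ℂ} (hW : AnalyticAt ℂ W P.1) (hWP : W P.1 = P.2)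
    (hsq : ∀ z, W z ^ 2 = aeval z (p0 α β)) : critEq α β χ η W P.1 = 0 := by
  obtain ⟨hz0, hz1, u, v, hu, hv, huv, hne, hC, heq⟩ := hcrit
  have hu0 : u 0 = P.1 := congrArg Prod.fst huv
  have hv0 : v 0 = P.2 := congrArg Prod.snd huv
  have hP2 : P.2 ≠ 0 := by
    intro h
    apply h0
    rw [← hsq, hWP, h]; simp
  have hut : Tendsto u (𝓝 0) (𝓝 P.1) := hu0 ▸ hu.continuousAt.tendsto
  have hvW : ∀ᶠ t in 𝓝 (0 : ℂ), v t = W (u t) := by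
    refine eventually_eq_of_sq_eq (a := P.2) (hv0 ▸ hv.continuousAt.tendsto) ?_ hP2 ?_
    · rw [← hWP]; exact hW.continuousAt.tendsto.comp hut
    · filter_upwards [hC] with t ht
      rw [hsq]; exact ht
  have hWd : DifferentiableAt ℂ W (u 0) := hu0 ▸ hW.differentiableAt
  have hu' : deriv u 0 ≠ 0 := by
    intro h
    have h1 : deriv v 0 = deriv W (u 0) * deriv u 0 := by
      rw [Filter.EventuallyEq.deriv_eq (f := fun t => W (u t)) hvW]
      exact deriv_comp (0 : ℂ) hWd hu.differentiableAt
    rw [h, mul_zero] at h1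
    exact hne.elim (fun h2 => h2 h) (fun h2 => h2 h1)
  have hR : logDeriv (fun t => rhoCurve α β (u t, v t)) 0 =
      logDeriv (rhoLoc α β W) P.1 * deriv u 0 := by
    have h1 : (fun t => rhoCurve α β (u t, v t)) =ᶠ[𝓝 0] rhoLoc α β W ∘ u := by
      filter_upwards [hvW, hut.eventually_ne hz0, hut.eventually_ne hz1] with t h2 h3 h4
      rw [h2, rhoCurve_eq hw h3 h4]
      rfl
    rw [logDeriv_congr h1, logDeriv_comp (hu0 ▸ rhoLoc_differentiableAt hW hz1)
      hu.differentiableAt, hu0]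
  rw [hR, logDeriv_apply, logDeriv_apply, hu0,
    show deriv (fun t => u t - 1) 0 = deriv u 0 from deriv_sub_const 1] at heq
  have h2 : critEq α β χ η W P.1 * deriv u 0 = 0 := by
    rw [critEq]; linear_combination heq
  exact (mul_eq_zero.mp h2).resolve_right hu'

theorem isCriticalPoint_of_critEq {χ η : ℝ} {a : ℂ} (hz0 : a ≠ 0) (hz1 : a ≠ 1) {W : ℂ → ℂ}
    (hW : AnalyticAt ℂ W a) (hsq : ∀ z, W z ^ 2 = aeval z (p0 α β))
    (h : critEq α β χ η W a = 0) : IsCriticalPoint α β χ η (a, W a) := by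
  have hu : AnalyticAt ℂ (fun t : ℂ => a + t) 0 := analyticAt_const.add analyticAt_id
  have hu1 : deriv (fun t : ℂ => a + t) 0 = 1 := by simp
  have hcont : Tendsto (fun t : ℂ => a + t) (𝓝 0) (𝓝 a) := by
    simpa using hu.continuousAt.tendsto
  have hWa : AnalyticAt ℂ W ((fun t : ℂ => a + t) 0) := by simpa using hW
  refine ⟨hz0, hz1, fun t => a + t, fun t => W (a + t), hu, hWa.comp hu, by simp,
    Or.inl (by rw [hu1]; exact one_ne_zero), Eventually.of_forall fun t => hsq _, ?_⟩
  have h1 : (fun t => rhoCurve α β (a + t, W (a + t))) =ᶠ[𝓝 0]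
      rhoLoc α β W ∘ fun t : ℂ => a + t := by
    filter_upwards [hcont.eventually_ne hz0, hcont.eventually_ne hz1] with t h3 h4
    rw [rhoCurve_eq hw h3 h4]
    rfl
  rw [logDeriv_congr h1, logDeriv_comp (by simpa using rhoLoc_differentiableAt hW hz1)
    hu.differentiableAt, logDeriv_apply (fun t : ℂ => a + t),
    logDeriv_apply (fun t : ℂ => a + t - 1),
    show deriv (fun t : ℂ => a + t - 1) 0 = deriv (fun t : ℂ => a + t) 0 from deriv_sub_const 1,
    hu1]
  simp only [add_zero, mul_one]
  rw [critEq] at h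
  linear_combination h

omit hw in
theorem critEq_conj {χ η : ℝ} {W : ℂ → ℂ} {a : ℂ} :
    critEq α β χ η (starRingEnd ℂ ∘ W ∘ starRingEnd ℂ) ((starRingEnd ℂ) a) =
      (starRingEnd ℂ) (critEq α β χ η W a) := by
  have h1 : rhoLoc α β (starRingEnd ℂ ∘ W ∘ starRingEnd ℂ) =
      starRingEnd ℂ ∘ rhoLoc α β W ∘ starRingEnd ℂ := by
    funext z
    simp only [rhoLoc, lamLoc, Function.comp, map_div₀, map_add, map_mul, map_pow, map_sub,
      Complex.conj_conj, map_one, ← Polynomial.aeval_conj, Complex.conj_ofNat]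
  rw [critEq, critEq, h1, logDeriv_conj, Complex.conj_conj]
  simp [Complex.conj_ofNat]

theorem IsCriticalPoint.conj {χ η : ℝ} {P : ℂ × ℂ} (hP : P ∈ Curve α β)
    (h0 : aeval P.1 (p0 α β) ≠ 0) (h : IsCriticalPoint α β χ η P) :
    IsCriticalPoint α β χ η ((starRingEnd ℂ) P.1, (starRingEnd ℂ) P.2) := by
  have hP' : P.2 ^ 2 = aeval P.1 (p0 α β) := hP
  have hWa := analyticAt_localRoot (α := α) (β := β) h0 (b := P.2)
  set W := localRoot α β P.1 P.2 with hW
  have hself : W P.1 = P.2 := localRoot_self h0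
  have hsq := localRoot_sq h0 hP'
  have h1 := critEq_eq_zero hw h0 h hWa hself hsq
  have hWc : AnalyticAt ℂ (starRingEnd ℂ ∘ W ∘ starRingEnd ℂ) ((starRingEnd ℂ) P.1) := by
    rw [Complex.analyticAt_iff_eventually_differentiableAt] at hWa ⊢
    have := (Complex.continuous_conj.tendsto ((starRingEnd ℂ) P.1)).eventually
      (p := fun z => DifferentiableAt ℂ W z) (by rwa [Complex.conj_conj])
    filter_upwards [this] with z hz
    have h3 := hz.hasDerivAt.conj_conj
    rw [Complex.conj_conj] at h3
    exact h3.differentiableAt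
  have h2 := isCriticalPoint_of_critEq hw (χ := χ) (η := η)
    ((map_ne_zero (starRingEnd ℂ)).mpr h.1)
    (fun h3 => h.2.1 (by simpa using congrArg (starRingEnd ℂ) h3)) hWc
    (fun z => by
      simp only [Function.comp]
      rw [← map_pow, hsq, Polynomial.aeval_conj, Complex.conj_conj]) (by rw [critEq_conj, h1, map_zero])
  simpa [hself] using h2

/-! ### Critical points of the height function -/

theorem hgtDeriv_eq_critEq {χ η : ℝ} {z : ℂ} (hz : z ∈ Complex.slitPlane) (hz1 : z ≠ 1) :
    hgtDeriv α β χ η z = 2 * z * critEq α β χ η (sqrtP0 α β) z := by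
  have hz0 := Complex.slitPlane_ne_zero hz
  have hs : z - 1 ≠ 0 := sub_ne_zero.mpr hz1
  have hlam : lamLoc α β (sqrtP0 α β) = lam α β 1 := by
    funext u; exact lamLoc_eq_lam (by simp)
  have hlog : logDeriv (rhoLoc α β (sqrtP0 α β)) z =
      deriv (lam α β 1) z / lam α β 1 z - k / (z - 1) := by
    have h1 : rhoLoc α β (sqrtP0 α β) = fun u => lam α β 1 u / (u - 1) ^ k := by
      funext u; rw [rhoLoc, hlam]
    rw [h1, logDeriv_div (f := lam α β 1) (g := fun u => (u - 1) ^ k) z (lam_one_ne_zero hw hz) (pow_ne_zero _ hs)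
      ((lam_differentiableOn hw 1).differentiableAt (Complex.isOpen_slitPlane.mem_nhds hz))
      (by fun_prop), logDeriv_fun_pow (by fun_prop), logDeriv_apply, logDeriv_apply]
    simp [div_eq_mul_inv]
  rw [critEq, hlog, hgtDeriv]
  field_simp
  ring

omit hw in
theorem critEq_neg {χ η : ℝ} {W : ℂ → ℂ} {a : ℂ} (hW : AnalyticAt ℂ W a) (hz1 : a ≠ 1)
    (hsq : ∀ z, W z ^ 2 = aeval z (p0 α β)) :
    critEq α β χ η (fun u => -W u) a = critEq α β (-χ) η W a := by
  have h1 : rhoLoc α β (fun u => -W u) =ᶠ[𝓝 a] fun u => (rhoLoc α β W u)⁻¹ := by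
    filter_upwards [continuousAt_id.eventually_ne hz1] with u hu
    exact eq_inv_of_mul_eq_one_right (rhoLoc_mul (hsq u) hu)
  have h2 : logDeriv (fun u => (rhoLoc α β W u)⁻¹) a = -logDeriv (rhoLoc α β W) a := by
    have hne : rhoLoc α β W a ≠ 0 := left_ne_zero_of_mul_eq_one (rhoLoc_mul (hsq a) hz1)
    have hd := (rhoLoc_differentiableAt (α := α) (β := β) hW hz1).hasDerivAt.fun_inv hne
    rw [logDeriv_apply, logDeriv_apply, hd.deriv]
    field_simp
  rw [critEq, critEq, logDeriv_congr h1, h2]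
  push_cast
  ring

theorem isSaddle_of_im_pos {χ η : ℝ} (hχ : χ ∈ Ioo (-1) 1) (hη : η ∈ Ioo (-1) 1) {z : ℂ}
    (hz : 0 < z.im) (h : hgtDeriv α β χ η z = 0) :
    0 < χ ∧ ∃ x θ : ℝ, IsSaddle α β χ η x θ ∧ polar x θ = z ∧ θ < Real.pi := by
  have hz0 : 0 < ‖z‖ := norm_pos_iff.mpr (by rintro rfl; simp at hz)
  have hB : angularSlope α β χ z = 0 := by
    have := hgtDeriv_im (α := α) (β := β) (χ := χ) (η := η) hz
    rw [h, Complex.zero_im, neg_zero] at this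
    exact (mul_eq_zero.mp this.symm).resolve_left hz.ne'
  have hU := (angularDensity_mono hw hz hz rfl le_rfl).1
  have hk : (0 : ℝ) < k := by exact_mod_cast hw.1
  have hn : 0 < ‖z - 1‖ := norm_pos_iff.mpr (sub_ne_zero.mpr (ne_one_of_im_pos hz))
  have hpos : 0 < (1 - χ) * k / ‖z - 1‖ ^ 2 := by
    have : 0 < 1 - χ := by linarith [hχ.2]
    positivity
  have hχ0 : 0 < χ := by
    by_contra hcon
    push Not at hcon
    rw [angularSlope] at hB
    nlinarith
  have hpol : polar (Real.log ‖z‖) z.arg = z := (eq_polar (Real.exp_log hz0).symm).symm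
  have harg0 : 0 < z.arg := by
    rcases (Complex.arg_nonneg_iff.mpr hz.le).lt_or_eq with h1 | h1
    · exact h1
    · rw [eq_comm, Complex.arg_eq_zero_iff] at h1
      exact absurd h1.2 hz.ne'
  have harg1 : z.arg < Real.pi := by
    refine lt_of_le_of_ne (Complex.arg_le_pi z) fun h1 => ?_
    rw [Complex.arg_eq_pi_iff] at h1
    exact hz.ne' h1.2
  exact ⟨hχ0, _, _, ⟨hχ0.le, hχ.2, hη.1, hη.2, harg0, harg1.le, fun h1 => absurd h1 harg1.ne,
    by rw [hpol]; exact h⟩, hpol, harg1⟩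

theorem hgtDeriv_conj {χ η : ℝ} {z : ℂ} (hz : z ∈ Complex.slitPlane) :
    hgtDeriv α β χ η ((starRingEnd ℂ) z) = (starRingEnd ℂ) (hgtDeriv α β χ η z) := by
  have hz' : (starRingEnd ℂ) z ∈ Complex.slitPlane := by
    rw [Complex.mem_slitPlane_iff] at hz ⊢
    simpa using hz
  have h1 : (starRingEnd ℂ ∘ lam α β 1 ∘ starRingEnd ℂ) =ᶠ[𝓝 ((starRingEnd ℂ) z)] lam α β 1 := by
    filter_upwards [Complex.isOpen_slitPlane.mem_nhds hz'] with u hu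
    have := lam_conj hw 1 (z := u) hu
    simp only [Function.comp]
    rw [this, Complex.conj_conj]
  have h2 : deriv (lam α β 1) ((starRingEnd ℂ) z) = (starRingEnd ℂ) (deriv (lam α β 1) z) := by
    rw [← h1.deriv_eq, deriv_conj_conj]
    simp
  rw [hgtDeriv, hgtDeriv, h2, lam_conj hw 1 hz]
  simp [Complex.conj_ofNat]

/-- On the real part of `ℛ₁₂` the logarithmic derivative of the eigenvalue is not real. -/
theorem im_logDeriv_rhoLoc_ne_zero {x : ℝ} (hx0 : x < 0) (hx : (p0 α β).eval x < 0) {b : ℂ}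
    (hb : b ^ 2 = aeval (x : ℂ) (p0 α β)) :
    (logDeriv (rhoLoc α β (localRoot α β x b)) x).im ≠ 0 := by
  have h0 : aeval (x : ℂ) (p0 α β) ≠ 0 := by rw [ofReal_aeval]; exact_mod_cast hx.ne
  set W := localRoot α β x b with hW
  have hWa : AnalyticAt ℂ W (x : ℂ) := analyticAt_localRoot h0
  have hsq : ∀ z, W z ^ 2 = aeval z (p0 α β) := localRoot_sq h0 hb
  have hx1 : (x : ℂ) ≠ 1 := by
    intro h
    have : x = 1 := by exact_mod_cast h
    linarith
  obtain ⟨δ, hδ, hWδ⟩ := exists_localRoot_eq hw hx hb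
  obtain ⟨K, hK, hbound⟩ := exists_norm_lam_sq_ge hw x
  have hd := (rhoLoc_differentiableAt (α := α) (β := β) hWa hx1).hasDerivAt
  have hne : rhoLoc α β W x ≠ 0 := left_ne_zero_of_mul_eq_one (rhoLoc_mul (hsq x) hx1)
  have hline : HasDerivAt (fun τ : ℝ => (x : ℂ) + (1 * τ : ℝ) * Complex.I) Complex.I 0 := by
    simpa using ((Complex.ofRealCLM.hasDerivAt (x := (0 : ℝ))).mul_const Complex.I).const_add
      (x : ℂ)
  have hcomp := hd.comp_of_eq (0 : ℝ) hline (by simp)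
  have hlog := hasDerivAt_log_norm hcomp (by simpa using hne)
  simp only [Function.comp, mul_zero, Complex.ofReal_zero, zero_mul, add_zero] at hlog
  intro him
  have hzero : (deriv (rhoLoc α β W) x * Complex.I / rhoLoc α β W x).re = 0 := by
    rw [mul_div_right_comm, ← logDeriv_apply, Complex.mul_I_re, him, neg_zero]
  rw [hzero] at hlog
  have hnorm1 : ‖rhoLoc α β W x‖ = 1 := by
    have h1 := norm_lamLoc_sq hx (hsq x)
    rw [rhoLoc, norm_div, norm_pow, div_eq_one_iff_eq]
    · rw [pow_mul'] at h1
      exact (sq_eq_sq₀ (norm_nonneg _) (by positivity)).mp h1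
    · exact pow_ne_zero _ (norm_ne_zero_iff.mpr (sub_ne_zero.mpr hx1))
  have hexp := (hlog.const_mul (2 * δ)).exp
  simp only [mul_zero, hnorm1, Real.log_one, Complex.ofReal_zero, zero_mul, add_zero] at hexp
  set c : ℝ := K / (|x| + 2) ^ (2 * k) with hc
  have hcpos : 0 < c := by positivity
  have hge : ∀ᶠ τ : ℝ in 𝓝[>] 0, 1 + c * τ ≤ Real.exp (2 * δ *
      Real.log ‖rhoLoc α β W (x + (1 * τ : ℝ) * Complex.I)‖) := by
    have ht : Tendsto (fun τ : ℝ => (x : ℂ) + (1 * τ : ℝ) * Complex.I) (𝓝[>] 0)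
        (𝓝[{z | 0 < z.im}] (x : ℂ)) := tendsto_line_within fun τ hτ => by simpa using hτ
    filter_upwards [ht.eventually hWδ, self_mem_nhdsWithin,
      Ioo_mem_nhdsGT (lt_min one_pos (neg_pos.mpr hx0))] with τ h1 h2 h3
    have hτ : 0 < τ := h2
    set z : ℂ := (x : ℂ) + (1 * τ : ℝ) * Complex.I with hz
    have hzim : z.im = τ := by simp [hz]
    have hzs := mem_slitPlane_of_im_pos (z := z) (by rw [hzim]; exact hτ)
    have hz1 : z ≠ 1 := ne_one_of_im_pos (by rw [hzim]; exact hτ)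
    have hzx : ‖z - x‖ = τ := by
      rw [hz, add_sub_cancel_left, norm_mul, Complex.norm_I, mul_one, Complex.norm_real, one_mul,
        Real.norm_of_nonneg hτ.le]
    have h4 := hbound z (by rw [hzim]; exact hτ) (by rw [hzx]; exact h3.2)
    rw [hzim] at h4
    have h5 : rhoLoc α β W z = rho α β δ z := by rw [rhoLoc, lamLoc_eq_lam h1, rho]
    have hpn : 0 < ‖z - 1‖ := norm_pos_iff.mpr (sub_ne_zero.mpr hz1)
    have h6 : 2 * δ * Real.log ‖rho α β δ z‖ = Real.log (‖rho α β 1 z‖ ^ 2) := by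
      rw [Real.log_pow]
      rcases hδ with rfl | rfl
      · push_cast; ring
      · have h7 := rho_mul hw (ε := 1) (Or.inl rfl) hz1
        rw [eq_inv_of_mul_eq_one_right h7, norm_inv, Real.log_inv]
        push_cast
        ring
    have hr1 := one_lt_norm_rho hw hzs hz1
    rw [h5, h6, Real.exp_log (by positivity), rho, norm_div, div_pow, norm_pow, ← pow_mul',
      le_div_iff₀ (by positivity)]
    have h8 : ‖z - 1‖ ≤ |x| + 2 := by
      have h9 : z - 1 = (z - x) + ((x : ℂ) - 1) := by ring
      have h10 : ‖(x : ℂ) - 1‖ ≤ |x| + 1 := by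
        have := norm_sub_le (x : ℂ) 1
        rwa [Complex.norm_real, norm_one, Real.norm_eq_abs] at this
      rw [h9]
      have h11 := norm_add_le (z - x) ((x : ℂ) - 1)
      have := h3.2.trans_le (min_le_left _ _)
      linarith
    have h12 : c * τ * ‖z - 1‖ ^ (2 * k) ≤ K * τ := by
      calc c * τ * ‖z - 1‖ ^ (2 * k) ≤ c * τ * (|x| + 2) ^ (2 * k) := by gcongr
        _ = K * τ := by rw [hc]; field_simp
    linarith
  have hslope := (hasDerivAt_iff_tendsto_slope.mp hexp).mono_left
    (nhdsWithin_mono (0 : ℝ) (fun t (ht : 0 < t) => ht.ne') : 𝓝[>] (0 : ℝ) ≤ 𝓝[≠] 0)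
  have hle : c ≤ 0 := by
    refine ge_of_tendsto hslope ?_
    filter_upwards [hge, self_mem_nhdsWithin] with τ h1 h2
    have hτ : 0 < τ := h2
    rw [slope_def_field, sub_zero, le_div_iff₀ hτ]
    simp only [mul_zero, Complex.ofReal_zero, zero_mul, add_zero, hnorm1, Real.log_one,
      Real.exp_zero]
    linarith
  linarith

/-- In the rough region, the point `L(χ, η)` comes from a saddle point of the height function. -/
theorem exists_isSaddle_L {χ η : ℝ} (h : (χ, η) ∈ roughRegion α β) :
    ∃ x₀ θ₀ : ℝ, IsSaddle α β |χ| η x₀ θ₀ ∧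
      (0 < χ → (L α β χ η).1 = polar x₀ θ₀) ∧
      (χ ≤ 0 → (L α β χ η).1 = (starRingEnd ℂ) (polar x₀ θ₀)) ∧
      ∃ C, ∀ᶠ z : ℂ in 𝓝[{z | 0 < z.im}] (polar x₀ θ₀), ∀ i j, ‖proj α β 1 z i j‖ ≤ C := by
  obtain ⟨hχ, hη, P, hP, hcrit⟩ := h
  have hex : ∃ Q : ℂ × ℂ, Q ∈ R12 α β ∧ IsCriticalPoint α β χ η Q := by
    have hPC : P.2 ^ 2 = aeval P.1 (p0 α β) := hP.1
    have hconjC : ((starRingEnd ℂ) P.1, (starRingEnd ℂ) P.2) ∈ Curve α β := by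
      show ((starRingEnd ℂ) P.2) ^ 2 = aeval ((starRingEnd ℂ) P.1) (p0 α β)
      rw [← map_pow, hPC, Polynomial.aeval_conj]
    by_cases him : P.1.im = 0
    · have hz : P.1 = (P.1.re : ℂ) := Complex.ext rfl (by simpa using him)
      have hneg := p0_eval_neg_of_notMem_realLoops hw hP hz
      have h0 : aeval P.1 (p0 α β) ≠ 0 := by
        rw [hz, ofReal_aeval]; exact_mod_cast hneg.ne
      have h1 : P.2 ^ 2 = sqrtP0 α β P.1 ^ 2 := by rw [hPC, sqrtP0_sq hw]
      rcases sq_eq_sq_iff_eq_or_eq_neg.mp h1 with h2 | h2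
      · refine ⟨P, ?_, hcrit⟩
        have := mem_R12_of_real hw (x := P.1.re) (w := P.2) (by rw [← hz]; exact hP.1) hneg
          (by rw [← hz]; exact h2)
        rwa [← hz] at this
      · refine ⟨_, ?_, hcrit.conj hw hP.1 h0⟩
        rw [hz, Complex.conj_ofReal] at hconjC ⊢
        refine mem_R12_of_real hw hconjC hneg ?_
        rw [h2, map_neg, hz, sqrtP0_conj_of_neg hw hneg, neg_neg, Complex.ofReal_re]
    · have h0 := p0_aeval_ne_zero_of_im hw him
      have h1 : P.2 ^ 2 = sheetRoot α β P.1 ^ 2 := by rw [hPC, sheetRoot_sq hw]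
      rcases sq_eq_sq_iff_eq_or_eq_neg.mp h1 with h2 | h2
      · exact ⟨P, mem_R12_of_im hw hP.1 him h2, hcrit⟩
      · refine ⟨_, mem_R12_of_im hw hconjC (by simpa using him) ?_, hcrit.conj hw hP.1 h0⟩
        have hs : P.1 ∈ Complex.slitPlane := Or.inr him
        rw [h2]
        simp only [sheetRoot, Complex.conj_im]
        rcases lt_or_gt_of_ne him with h3 | h3
        · rw [if_neg (not_le.mpr h3), if_pos (by linarith), neg_neg, sqrtP0_conj hw hs]
        · rw [if_pos h3.le, if_neg (by linarith), map_neg, sqrtP0_conj hw hs]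
  have hL : L α β χ η ∈ R12 α β ∧ IsCriticalPoint α β χ η (L α β χ η) :=
    Classical.epsilon_spec hex
  set Q := L α β χ η with hQ
  obtain ⟨hR, hc⟩ := hL
  obtain ⟨hQC, hcase⟩ := mem_R12 hw hR
  have hQC' : Q.2 ^ 2 = aeval Q.1 (p0 α β) := hQC
  have hlocal : ∀ z : ℂ, 0 < z.im →
      ∃ C, ∀ᶠ z : ℂ in 𝓝[{z | 0 < z.im}] z, ∀ i j, ‖proj α β 1 z i j‖ ≤ C := by
    intro z hz
    have hs := mem_slitPlane_of_im_pos hz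
    have ho := Complex.isOpen_slitPlane.mem_nhds hs
    have hcont : ∀ i j, ContinuousAt (fun u => proj α β 1 u i j) z := by
      intro i j
      have h1 : ContinuousAt (fun u => symbol α β u i j) z := by
        have : (fun u => symbol α β u i j) = fun u => aeval u (symbolPoly α β i j) := by
          funext u; rw [symbol, evalMatrix_apply]
        rw [this]
        exact (Polynomial.continuous_aeval _).continuousAt
      have h2 := ((lam_differentiableOn hw (-1)).differentiableAt ho).continuousAt
      have h3 := ((discRoot_differentiableOn hw).differentiableAt ho).continuousAt
      have h4 : ContinuousAt (fun u => ((1 : ℝ) * discRoot α β u)⁻¹ * (symbol α β u i j -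
          lam α β (-1) u * (1 : Matrix (Fin 2) (Fin 2) ℂ) i j)) z :=
        ((h3.const_mul _).inv₀ (by simpa using discRoot_ne_zero hw hs)).mul
          (h1.sub (h2.mul continuousAt_const))
      exact h4
    refine ⟨∑ i, ∑ j, (‖proj α β 1 z i j‖ + 1), ?_⟩
    have : ∀ᶠ u in 𝓝 z, ∀ i j, ‖proj α β 1 u i j‖ < ‖proj α β 1 z i j‖ + 1 := by
      rw [eventually_all]
      intro i
      rw [eventually_all]
      intro j
      exact (hcont i j).norm.eventually (gt_mem_nhds (lt_add_one _))
    filter_upwards [this.filter_mono nhdsWithin_le_nhds] with u hu i j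
    refine (hu i j).le.trans ?_
    refine le_trans ?_ (Finset.single_le_sum
      (f := fun i => ∑ j, (‖proj α β 1 z i j‖ + 1)) (fun i _ => by positivity) (Finset.mem_univ i))
    exact Finset.single_le_sum (f := fun j => ‖proj α β 1 z i j‖ + 1)
      (fun j _ => by positivity) (Finset.mem_univ j)
  have han : ∀ z ∈ Complex.slitPlane, AnalyticAt ℂ (sqrtP0 α β) z := fun z hz =>
    (sqrtP0_differentiableOn hw).analyticAt (Complex.isOpen_slitPlane.mem_nhds hz)
  rcases hcase with ⟨him, hsheet⟩ | ⟨x, hx, hneg⟩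
  · have hs : Q.1 ∈ Complex.slitPlane := Or.inr him
    have h0 := p0_aeval_ne_zero_of_im hw him
    rcases lt_or_gt_of_ne him with h1 | h1
    · rw [sheetRoot, if_neg (not_le.mpr h1)] at hsheet
      have h2 := critEq_eq_zero hw h0 hc (W := fun u => -sqrtP0 α β u) (han _ hs).neg hsheet.symm
        (fun z => by rw [neg_sq, sqrtP0_sq hw])
      rw [critEq_neg (han _ hs) hc.2.1 (fun z => sqrtP0_sq hw z)] at h2
      have h3 : hgtDeriv α β (-χ) η ((starRingEnd ℂ) Q.1) = 0 := by
        rw [hgtDeriv_conj hw hs, hgtDeriv_eq_critEq hw hs hc.2.1, h2, mul_zero, map_zero]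
      have h5 : 0 < ((starRingEnd ℂ) Q.1).im := by simpa using h1
      obtain ⟨h4, x₀, θ₀, hsad, hpol, hlt⟩ := isSaddle_of_im_pos hw (χ := -χ)
        ⟨by linarith [hχ.2], by linarith [hχ.1]⟩ hη h5 h3
      refine ⟨x₀, θ₀, by rwa [abs_of_neg (by linarith)], fun h6 => by linarith, fun _ => by
        rw [hpol, Complex.conj_conj], ?_⟩
      rw [hpol]
      exact hlocal _ h5
    · rw [sheetRoot, if_pos h1.le] at hsheet
      have h2 := critEq_eq_zero hw h0 hc (han _ hs) hsheet.symm (fun z => sqrtP0_sq hw z)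
      have h3 : hgtDeriv α β χ η Q.1 = 0 := by
        rw [hgtDeriv_eq_critEq hw hs hc.2.1, h2, mul_zero]
      obtain ⟨h4, x₀, θ₀, hsad, hpol, hlt⟩ := isSaddle_of_im_pos hw hχ hη h1 h3
      refine ⟨x₀, θ₀, by rwa [abs_of_pos h4], fun _ => hpol.symm, fun h6 => by linarith, ?_⟩
      rw [hpol]
      exact hlocal _ h1
  · have hx0 : x < 0 := by
      by_contra hcon
      push Not at hcon
      linarith [p0_eval_nonneg hw hcon]
    have h0 : aeval Q.1 (p0 α β) ≠ 0 := by
      rw [hx, ofReal_aeval]; exact_mod_cast hneg.ne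
    have h1 := critEq_eq_zero hw h0 hc (analyticAt_localRoot h0) (localRoot_self h0)
      (localRoot_sq h0 hQC')
    rw [hx] at h1 hQC'
    have h2 := im_logDeriv_rhoLoc_ne_zero hw hx0 hneg hQC'
    have hχ0 : χ = 0 := by
      have h3 := congrArg Complex.im h1
      have h4 : critEq α β χ η (localRoot α β x Q.2) x =
          ((k / 4 * (η + 1) / x - k / 2 / (x - 1) : ℝ) : ℂ) -
          ((χ / 2 : ℝ) : ℂ) * logDeriv (rhoLoc α β (localRoot α β x Q.2)) x := by
        rw [critEq]; push_cast; ring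
      rw [h4, Complex.sub_im, Complex.ofReal_im, Complex.im_ofReal_mul, Complex.zero_im] at h3
      have h5 : χ / 2 * (logDeriv (rhoLoc α β (localRoot α β x Q.2)) x).im = 0 := by linarith
      have := (mul_eq_zero.mp h5).resolve_right h2
      linarith
    have hpol : polar (Real.log (-x)) Real.pi = (x : ℂ) := by
      rw [polar_pi, Real.exp_log (by linarith)]; push_cast; ring
    have hcrit0 : hgtDeriv α β 0 η (x : ℂ) = 0 := by
      rw [hχ0, critEq] at h1
      have hxc : (x : ℂ) ≠ 0 := by exact_mod_cast hx0.ne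
      have hx1 : (x : ℂ) - 1 ≠ 0 := by
        have : x - 1 ≠ 0 := by linarith
        exact_mod_cast this
      simp only [Complex.ofReal_zero, zero_div, zero_mul, sub_zero] at h1
      rw [hgtDeriv]
      simp only [Complex.ofReal_zero, zero_mul, sub_zero, one_mul]
      have : (k : ℂ) * (η + 1) / 2 - k * ((x : ℂ) / (x - 1)) =
          2 * x * (k / 4 * (η + 1) / x - k / 2 / (x - 1)) := by field_simp; ring
      rw [this, h1, mul_zero]
    refine ⟨Real.log (-x), Real.pi, ?_, fun h => by linarith, fun _ => ?_, ?_⟩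
    · rw [hχ0, abs_zero]
      exact ⟨le_rfl, one_pos, hη.1, hη.2, Real.pi_pos, le_rfl, fun _ => rfl, by rwa [hpol]⟩
    · rw [hpol, Complex.conj_ofReal, hx]
    · rw [hpol]
      exact exists_norm_proj_le_of_neg hw hx0 hneg

end Aztec
end

noncomputable section

namespace Aztec

open MeasureTheory Set

/-! ### The Cauchy transform of a sequence on a circle -/

theorem continuous_circleMap_inv_sub {r : ℝ} (hr : 0 < r) {w : ℂ} (hwr : ‖w‖ ≠ r) :
    Continuous fun φ : ℝ => (circleMap 0 r φ - w)⁻¹ := by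
  refine ((continuous_circleMap 0 r).sub continuous_const).inv₀ fun φ => sub_ne_zero.mpr ?_
  rintro rfl
  exact hwr (by rw [norm_circleMap_zero, abs_of_pos hr])

theorem integral_norm_circleMap_sub_inv_sq {r : ℝ} (hr : 0 < r) {w : ℂ} (hw : w ≠ 0)
    (hwr : ‖w‖ ≠ r) : ∫ φ in (0 : ℝ)..2 * Real.pi, ‖(circleMap 0 r φ - w)⁻¹‖ ^ 2 =
      2 * Real.pi / |r ^ 2 - ‖w‖ ^ 2| := by
  have h0 : (0 : ℂ) ∉ curveImage (circ r) := fun h => hr.ne' (by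
    simpa using (norm_of_mem_curveImage_circ hr.le h).symm)
  have h1 : w ∉ curveImage (circ r) := fun h => hwr (norm_of_mem_curveImage_circ hr.le h)
  have hI := (isLoop_circ r).integral_laurent_div_sub h0 hw h1 {0, -1}
    (fun j => if j = 0 then 1 else w)
  have hf : ((({0, -1} : Finset ℤ)).filter (· < 0)) = {-1} := by decide
  rw [hf, Finset.sum_pair (by decide), Finset.sum_singleton, windingNumber_circ_of_lt (a := 0) (by simpa using hr),
    pathIntegral_circ, circleIntegral] at hI
  simp only [↓reduceIte, zpow_zero, mul_one, neg_eq_zero, one_ne_zero, zpow_neg, zpow_one,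
    mul_inv_cancel₀ hw] at hI
  have hne : ∀ φ, circleMap 0 r φ - w ≠ 0 := fun φ => sub_ne_zero.mpr (by
    rintro rfl
    exact hwr (by rw [norm_circleMap_zero, abs_of_pos hr]))
  have hz0 : ∀ φ, circleMap 0 r φ ≠ 0 := fun φ => circleMap_ne_center hr.ne'
  have hint : ∀ φ : ℝ, deriv (circleMap 0 r) φ • (∑ j ∈ ({0, -1} : Finset ℤ),
      (if j = 0 then 1 else w) * circleMap 0 r φ ^ j) / (circleMap 0 r φ - w) =
      Complex.I * ((circleMap 0 r φ + w) * (circleMap 0 r φ - w)⁻¹) := by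
    intro φ
    rw [Finset.sum_pair (by decide), deriv_circleMap]
    simp only [↓reduceIte, zpow_zero, mul_one, neg_eq_zero, one_ne_zero, zpow_neg, zpow_one,
      smul_eq_mul]
    have := hz0 φ
    have := hne φ
    field_simp
  have hre : ∀ φ : ℝ, ((circleMap 0 r φ + w) * (circleMap 0 r φ - w)⁻¹).re =
      (r ^ 2 - ‖w‖ ^ 2) * ‖(circleMap 0 r φ - w)⁻¹‖ ^ 2 := by
    intro φ
    have hn : r ^ 2 = Complex.normSq (circleMap 0 r φ) := by
      rw [Complex.normSq_eq_norm_sq, norm_circleMap_zero, sq_abs]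
    have hp : Complex.normSq (circleMap 0 r φ - w) ≠ 0 := by simpa using hne φ
    rw [norm_inv, inv_pow, ← Complex.normSq_eq_norm_sq, ← Complex.normSq_eq_norm_sq, hn,
      Complex.inv_def, ← mul_assoc, Complex.re_mul_ofReal]
    congr 1
    simp only [Complex.normSq_apply, Complex.mul_re, Complex.add_re, Complex.add_im,
      Complex.conj_re, Complex.conj_im, Complex.sub_re, Complex.sub_im]
    ring
  have hcont : Continuous fun φ : ℝ => (circleMap 0 r φ + w) * (circleMap 0 r φ - w)⁻¹ :=
    ((continuous_circleMap 0 r).add continuous_const).mul (continuous_circleMap_inv_sub hr hwr)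
  have hX : ∫ φ in (0 : ℝ)..2 * Real.pi, (circleMap 0 r φ + w) * (circleMap 0 r φ - w)⁻¹ =
      2 * Real.pi * (2 * windingNumber (circ r) w - 1) := by
    have h2 : ∫ φ in (0 : ℝ)..2 * Real.pi, Complex.I *
        ((circleMap 0 r φ + w) * (circleMap 0 r φ - w)⁻¹) =
        2 * Real.pi * Complex.I * (2 * windingNumber (circ r) w - 1) := by
      rw [← intervalIntegral.integral_congr fun φ _ => hint φ]
      refine (Eq.trans ?_ hI).trans (by ring)
      refine intervalIntegral.integral_congr fun φ _ => ?_
      simp only [smul_eq_mul, mul_div_assoc]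
    rw [intervalIntegral.integral_const_mul] at h2
    refine mul_left_cancel₀ Complex.I_ne_zero (h2.trans (by ring))
  have hXre : ∫ φ in (0 : ℝ)..2 * Real.pi, (r ^ 2 - ‖w‖ ^ 2) * ‖(circleMap 0 r φ - w)⁻¹‖ ^ 2 =
      (2 * Real.pi * (2 * windingNumber (circ r) w - 1) : ℂ).re := by
    rw [← hX, ← intervalIntegral.integral_congr fun φ _ => hre φ]
    exact Complex.reCLM.intervalIntegral_comp_comm (hcont.intervalIntegrable _ _)
  rw [intervalIntegral.integral_const_mul] at hXre
  rcases lt_or_gt_of_ne hwr with h | h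
  · have hd : 0 < r ^ 2 - ‖w‖ ^ 2 := by nlinarith [norm_nonneg w]
    rw [windingNumber_circ_of_lt h] at hXre
    rw [abs_of_pos hd, eq_div_iff hd.ne', mul_comm, hXre]
    norm_num
  · have hd : r ^ 2 - ‖w‖ ^ 2 < 0 := by nlinarith [norm_nonneg w]
    rw [windingNumber_circ_of_gt hr.le h] at hXre
    rw [abs_of_neg hd, eq_div_iff (neg_pos.mpr hd).ne', mul_neg, mul_comm, hXre]
    norm_num

theorem norm_circleIntegral_div_sub_le {r : ℝ} (hr : 0 < r) {g : ℂ → ℂ}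
    (hg : ContinuousOn g (Metric.sphere 0 r)) {w : ℂ} (hw : w ≠ 0) (hwr : ‖w‖ ≠ r) {t : ℝ}
    (ht : 0 < t) : ‖∮ z in C(0, r), g z / (z - w)‖ ≤
      r * ((∫ φ in (0 : ℝ)..2 * Real.pi, ‖g (circleMap 0 r φ)‖ ^ 2) / (2 * t) +
        t * (Real.pi / |r ^ 2 - ‖w‖ ^ 2|)) := by
  have hgc : Continuous fun φ : ℝ => g (circleMap 0 r φ) :=
    hg.comp_continuous (continuous_circleMap 0 r) fun φ => circleMap_mem_sphere 0 hr.le φ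
  have hic := continuous_circleMap_inv_sub hr hwr
  have h1 : Continuous fun φ : ℝ => ‖g (circleMap 0 r φ)‖ ^ 2 / (2 * t) :=
    (hgc.norm.pow 2).div_const _
  have h2 : Continuous fun φ : ℝ => t / 2 * ‖(circleMap 0 r φ - w)⁻¹‖ ^ 2 := by fun_prop
  have hbound : ‖∮ z in C(0, r), g z / (z - w)‖ ≤ ∫ φ in (0 : ℝ)..2 * Real.pi,
      r * (‖g (circleMap 0 r φ)‖ ^ 2 / (2 * t) + t / 2 * ‖(circleMap 0 r φ - w)⁻¹‖ ^ 2) := by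
    refine intervalIntegral.norm_integral_le_of_norm_le (by positivity)
      (Eventually.of_forall fun φ _ => ?_) ((h1.add h2).const_mul r |>.intervalIntegrable _ _)
    rw [deriv_circleMap, norm_smul, norm_mul, Complex.norm_I, mul_one, norm_circleMap_zero,
      abs_of_pos hr]
    refine mul_le_mul_of_nonneg_left ?_ hr.le
    change ‖g (circleMap 0 r φ) / (circleMap 0 r φ - w)‖ ≤ _
    rw [div_eq_mul_inv (g _), norm_mul]
    set a := ‖g (circleMap 0 r φ)‖
    set b := ‖(circleMap 0 r φ - w)⁻¹‖
    have : a ^ 2 / (2 * t) + t / 2 * b ^ 2 - a * b = (a - t * b) ^ 2 / (2 * t) := by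
      field_simp; ring
    have h3 : 0 ≤ (a - t * b) ^ 2 / (2 * t) := by positivity
    linarith
  refine hbound.trans_eq ?_
  rw [intervalIntegral.integral_const_mul, intervalIntegral.integral_add
    (h1.intervalIntegrable _ _) (h2.intervalIntegrable _ _), intervalIntegral.integral_div,
    intervalIntegral.integral_const_mul, integral_norm_circleMap_sub_inv_sq hr hw hwr]
  ring

/-- If `g n` is bounded on a circle and tends to `0` almost everywhere on it, then its Cauchy
transform is `o(|‖w‖ - r|^{-1/2})`, uniformly off the circle. -/
theorem eventually_norm_circleIntegral_div_sub_le {r : ℝ} (hr : 0 < r) {g : ℕ → ℂ → ℂ}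
    (hg : ∀ᶠ n in atTop, ContinuousOn (g n) (Metric.sphere 0 r)) {S : Set ℂ} (hS : S.Countable)
    {C : ℝ} (hC : ∀ᶠ n in atTop, ∀ z, ‖z‖ = r → z ∉ S → ‖g n z‖ ≤ C)
    (hlim : ∀ z, ‖z‖ = r → z ∉ S → Tendsto (fun n => g n z) atTop (𝓝 0)) {δ : ℝ} (hδ : 0 < δ) :
    ∀ᶠ n in atTop, ∀ w, w ≠ 0 → ‖w‖ ≠ r →
      ‖∮ z in C(0, r), g n z / (z - w)‖ ≤ δ * (√|‖w‖ - r|)⁻¹ := by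
  have hnorm : ∀ φ : ℝ, ‖circleMap 0 r φ‖ = r := fun φ => by
    rw [norm_circleMap_zero, abs_of_pos hr]
  have hae : ∀ᵐ φ : ℝ, circleMap 0 r φ ∉ S :=
    measure_eq_zero_iff_ae_notMem.mp ((hS.preimage_circleMap 0 hr.ne').measure_zero volume)
  have hJ : Tendsto (fun n => ∫ φ in (0 : ℝ)..2 * Real.pi, ‖g n (circleMap 0 r φ)‖ ^ 2) atTop
      (𝓝 (∫ φ in (0 : ℝ)..2 * Real.pi, (0 : ℝ))) := by
    refine intervalIntegral.tendsto_integral_filter_of_dominated_convergence (fun _ => C ^ 2)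
      ?_ ?_ (intervalIntegrable_const) ?_
    · filter_upwards [hg] with n hn
      have : Continuous fun φ : ℝ => g n (circleMap 0 r φ) :=
        hn.comp_continuous (continuous_circleMap 0 r) fun φ => circleMap_mem_sphere 0 hr.le φ
      exact (this.norm.pow 2).aestronglyMeasurable
    · filter_upwards [hC] with n hn
      filter_upwards [hae] with φ hφ _
      rw [Real.norm_of_nonneg (by positivity)]
      exact pow_le_pow_left₀ (norm_nonneg _) (hn _ (hnorm φ) hφ) 2
    · filter_upwards [hae] with φ hφ _
      simpa using ((hlim _ (hnorm φ) hφ).norm.pow 2)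
  rw [intervalIntegral.integral_zero] at hJ
  set τ := δ / (2 * Real.pi) with hτ
  have hτp : 0 < τ := div_pos hδ (by positivity)
  filter_upwards [hg, hJ.eventually (gt_mem_nhds (show 0 < τ * δ / r by positivity))]
    with n hn hJn w hw hwr
  set J := ∫ φ in (0 : ℝ)..2 * Real.pi, ‖g n (circleMap 0 r φ)‖ ^ 2
  have hs : 0 < |‖w‖ - r| := abs_pos.mpr (sub_ne_zero.mpr hwr)
  set s := |‖w‖ - r|
  have hq : 0 < √s := Real.sqrt_pos.mpr hs
  refine (norm_circleIntegral_div_sub_le hr hn hw hwr (t := τ * √s) (by positivity)).trans ?_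
  have hd : r * s ≤ |r ^ 2 - ‖w‖ ^ 2| := by
    have : r ^ 2 - ‖w‖ ^ 2 = -((‖w‖ - r) * (r + ‖w‖)) := by ring
    rw [this, abs_neg, abs_mul, abs_of_nonneg (a := r + ‖w‖) (by positivity), mul_comm]
    exact mul_le_mul_of_nonneg_left (by linarith [norm_nonneg w]) hs.le
  have h1 : Real.pi / |r ^ 2 - ‖w‖ ^ 2| ≤ Real.pi / (r * s) :=
    div_le_div_of_nonneg_left Real.pi_pos.le (by positivity) hd
  have h2 : J / (2 * (τ * √s)) ≤ τ * δ / r / (2 * (τ * √s)) :=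
    div_le_div_of_nonneg_right hJn.le (by positivity)
  calc r * (J / (2 * (τ * √s)) + τ * √s * (Real.pi / |r ^ 2 - ‖w‖ ^ 2|))
      ≤ r * (τ * δ / r / (2 * (τ * √s)) + τ * √s * (Real.pi / (r * s))) := by gcongr
    _ = δ * (√s)⁻¹ := by
      have hss : s = √s * √s := (Real.mul_self_sqrt hs.le).symm
      generalize √s = q at *
      rw [hss, hτ]
      field_simp
      ring

/-! ### Powers of two by two matrices -/

theorem norm_pow_apply_le {M : Matrix (Fin 2) (Fin 2) ℂ} {a b : ℂ} {D : ℝ} (hba : ‖b‖ ≤ ‖a‖)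
    (hadd : a + b = M.trace) (hmul : a * b = M.det) (hD : ∀ i j, ‖(M - b • 1) i j‖ ≤ D * ‖a‖)
    (m : ℕ) (i j : Fin 2) : ‖(M ^ m) i j‖ ≤ ‖a‖ ^ m * (1 + m * D) := by
  have hCH : M * (M - b • 1) = a • (M - b • 1) := by
    have h := cayleyHamilton_two M
    rw [← hadd, ← hmul] at h
    rw [mul_sub, h, smul_sub, mul_smul, Matrix.mul_smul, mul_one, add_smul, smul_smul]
    abel
  have hpow : ∀ m : ℕ, M ^ (m + 1) = b • M ^ m + a ^ m • (M - b • 1) := by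
    intro m
    induction m with
    | zero => simp
    | succ m ih =>
      rw [pow_succ' M (m + 1)]
      nth_rw 1 [ih]
      rw [mul_add, Matrix.mul_smul, Matrix.mul_smul, hCH, smul_smul, ← pow_succ', ← pow_succ]
  induction m with
  | zero =>
    simp only [pow_zero, Nat.cast_zero, zero_mul, add_zero, mul_one, Matrix.one_apply]
    split_ifs <;> simp
  | succ m ih =>
    rw [hpow, Matrix.add_apply, Matrix.smul_apply, Matrix.smul_apply, smul_eq_mul, smul_eq_mul]
    have h1 : ‖b * (M ^ m) i j‖ ≤ ‖a‖ * (‖a‖ ^ m * (1 + m * D)) := by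
      rw [norm_mul]; exact mul_le_mul hba ih (norm_nonneg _) (norm_nonneg _)
    have h2 : ‖a ^ m * (M - b • 1) i j‖ ≤ ‖a‖ ^ m * (D * ‖a‖) := by
      rw [norm_mul, norm_pow]
      exact mul_le_mul_of_nonneg_left (hD i j) (by positivity)
    refine (norm_add_le _ _).trans ((add_le_add h1 h2).trans_eq ?_)
    push_cast
    ring

end Aztec

end

noncomputable section

namespace Aztec

open MeasureTheory Set

/-! ### Contours through a saddle point -/

/-- The curve `y ↦ exp (x₀ + σ y + i φ(y))`. -/
def leg (x₀ σ : ℝ) (φ : ℝ → ℝ) (y : ℝ) : ℂ := polar (x₀ + σ * y) (φ y)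

/-- The arc of radius `exp x`. -/
def arc (x t : ℝ) : ℂ := polar x t

/-- The integral from `exp (x₀ - i θ 0)` to `exp (x₀ + i θ 0)` along the conjugate of the curve
`leg x₀ σ θ` on `[0, Y]`, a circular arc, and the curve itself backwards. -/
def sideIntegral (x₀ σ Y : ℝ) (θ : ℝ → ℝ) (f : ℂ → ℂ) : ℂ :=
  (∫ y in (0 : ℝ)..Y, f (leg x₀ σ (-θ) y) * deriv (leg x₀ σ (-θ)) y) +
    (∫ t in (-θ Y)..θ Y, f (arc (x₀ + σ * Y) t) * deriv (arc (x₀ + σ * Y)) t) -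
    ∫ y in (0 : ℝ)..Y, f (leg x₀ σ θ y) * deriv (leg x₀ σ θ) y

/-- The points of the contour of `sideIntegral` off the circle of radius `exp x₀`. -/
def sideSet (x₀ σ Y : ℝ) (θ : ℝ → ℝ) : Set ℂ :=
  leg x₀ σ θ '' Ioc 0 Y ∪ leg x₀ σ (-θ) '' Ioc 0 Y ∪ arc (x₀ + σ * Y) '' Icc (-θ Y) (θ Y)

/-- The contour of `sideIntegral` stays off the negative half line, and its arc does not meet `1`. -/
structure IsSidePath (x₀ σ Y : ℝ) (θ : ℝ → ℝ) : Prop where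
  sign : σ = 1 ∨ σ = -1
  pos : 0 < Y
  outer : 0 < σ * (x₀ + σ * Y)
  smooth : ContDiff ℝ 1 θ
  mem : ∀ y > 0, θ y ∈ Ioo 0 Real.pi

theorem contDiff_polar_comp {f g : ℝ → ℝ} (hf : ContDiff ℝ 1 f) (hg : ContDiff ℝ 1 g) :
    ContDiff ℝ 1 fun y => polar (f y) (g y) := by
  have h1 : ContDiff ℝ 1 fun y => ((f y : ℝ) : ℂ) := Complex.ofRealCLM.contDiff.comp hf
  have h2 : ContDiff ℝ 1 fun y => ((g y : ℝ) : ℂ) := Complex.ofRealCLM.contDiff.comp hg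
  exact Complex.contDiff_exp.comp (h1.add (h2.mul contDiff_const))

theorem contDiff_leg (x₀ σ : ℝ) {φ : ℝ → ℝ} (hφ : ContDiff ℝ 1 φ) :
    ContDiff ℝ 1 (leg x₀ σ φ) :=
  contDiff_polar_comp (by fun_prop) hφ

theorem contDiff_arc (x : ℝ) : ContDiff ℝ 1 (arc x) :=
  contDiff_polar_comp contDiff_const contDiff_id

theorem leg_neg (x₀ σ : ℝ) (θ : ℝ → ℝ) (y : ℝ) :
    leg x₀ σ (-θ) y = (starRingEnd ℂ) (leg x₀ σ θ y) := polar_neg _ _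

theorem norm_leg (x₀ σ : ℝ) (φ : ℝ → ℝ) (y : ℝ) : ‖leg x₀ σ φ y‖ = Real.exp (x₀ + σ * y) :=
  norm_polar _ _

theorem norm_arc (x t : ℝ) : ‖arc x t‖ = Real.exp x := norm_polar _ _

theorem exp_mul_le_abs_sub {x₀ σ Y y : ℝ} (hσ : σ = 1 ∨ σ = -1) (h0 : 0 ≤ y) (hy : y ≤ Y) :
    Real.exp (x₀ - Y) * y ≤ |Real.exp (x₀ + σ * y) - Real.exp x₀| := by
  rcases hσ with rfl | rfl
  · have h1 : Real.exp (x₀ + 1 * y) = Real.exp x₀ * Real.exp y := by rw [← Real.exp_add, one_mul]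
    have h2 := Real.add_one_le_exp y
    have h3 : Real.exp (x₀ - Y) ≤ Real.exp x₀ := Real.exp_le_exp.mpr (by linarith)
    have h4 := Real.exp_pos x₀
    refine le_trans ?_ (le_abs_self _)
    rw [h1]
    nlinarith
  · have h1 : Real.exp x₀ = Real.exp (x₀ + -1 * y) * Real.exp y := by
      rw [← Real.exp_add]; congr 1; ring
    have h2 := Real.add_one_le_exp y
    have h3 : Real.exp (x₀ - Y) ≤ Real.exp (x₀ + -1 * y) := Real.exp_le_exp.mpr (by linarith)
    have h4 := Real.exp_pos (x₀ + -1 * y)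
    rw [abs_sub_comm]
    refine le_trans ?_ (le_abs_self _)
    rw [h1]
    nlinarith

namespace IsSidePath

variable {x₀ σ Y : ℝ} {θ : ℝ → ℝ} (h : IsSidePath x₀ σ Y θ)
include h

theorem smooth_neg : ContDiff ℝ 1 (-θ) := h.smooth.neg

omit h in
theorem leg_mem {y : ℝ} (hy : y ∈ Ioc 0 Y) : leg x₀ σ θ y ∈ sideSet x₀ σ Y θ :=
  Or.inl (Or.inl (mem_image_of_mem _ hy))

omit h in
theorem leg_neg_mem {y : ℝ} (hy : y ∈ Ioc 0 Y) : leg x₀ σ (-θ) y ∈ sideSet x₀ σ Y θ :=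
  Or.inl (Or.inr (mem_image_of_mem _ hy))

omit h in
theorem arc_mem {t : ℝ} (ht : t ∈ Icc (-θ Y) (θ Y)) : arc (x₀ + σ * Y) t ∈ sideSet x₀ σ Y θ :=
  Or.inr (mem_image_of_mem _ ht)

theorem leg_im_pos {y : ℝ} (hy : 0 < y) : 0 < (leg x₀ σ θ y).im := polar_im_pos _ (h.mem y hy)

theorem leg_neg_im {y : ℝ} (hy : 0 < y) : (leg x₀ σ (-θ) y).im < 0 := by
  rw [leg_neg, Complex.conj_im]
  linarith [h.leg_im_pos hy]

theorem theta_end : θ Y ∈ Ioo 0 Real.pi := h.mem Y h.pos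

theorem subset_slitPlane : sideSet x₀ σ Y θ ⊆ Complex.slitPlane := by
  rintro w ((⟨y, hy, rfl⟩ | ⟨y, hy, rfl⟩) | ⟨t, ht, rfl⟩)
  · exact mem_slitPlane_of_im_pos (h.leg_im_pos hy.1)
  · exact Or.inr (h.leg_neg_im hy.1).ne
  · have hY := h.theta_end
    rcases lt_trichotomy t 0 with h0 | rfl | h0
    · refine Or.inr ?_
      have := polar_im_pos (x₀ + σ * Y) (θ := -t) ⟨by linarith, by linarith [ht.1, hY.2]⟩
      rw [polar_neg, Complex.conj_im] at this
      exact (neg_pos.mp this).ne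
    · refine Or.inl ?_
      rw [arc, polar_re, Real.cos_zero, mul_one]
      exact Real.exp_pos _
    · exact mem_slitPlane_of_im_pos (polar_im_pos _ ⟨h0, ht.2.trans_lt hY.2⟩)

/-- The outer contour avoids `(-∞, 1]`, the inner one avoids `[1, ∞)` and `(-∞, 0]`. -/
theorem mem_slitPlane {w : ℂ} (hw : w ∈ sideSet x₀ σ Y θ) : (σ : ℂ) * (w - 1) ∈ Complex.slitPlane := by
  have him : ∀ w : ℂ, w.im ≠ 0 → (σ : ℂ) * (w - 1) ∈ Complex.slitPlane := by
    intro w hw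
    refine Or.inr ?_
    rw [Complex.im_ofReal_mul, Complex.sub_im, Complex.one_im, sub_zero]
    rcases h.sign with h1 | h1 <;> rw [h1] <;> simpa using hw
  by_cases h0 : w.im = 0
  swap
  · exact him w h0
  rcases hw with (⟨y, hy, rfl⟩ | ⟨y, hy, rfl⟩) | ⟨t, ht, rfl⟩
  · exact absurd h0 (h.leg_im_pos hy.1).ne'
  · exact absurd h0 (h.leg_neg_im hy.1).ne
  · have hs := h.subset_slitPlane (arc_mem ht)
    rcases hs with hs | hs
    swap
    · exact absurd h0 hs
    refine Or.inl ?_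
    rw [Complex.re_ofReal_mul, Complex.sub_re, Complex.one_re]
    have hn : (arc (x₀ + σ * Y) t).re = Real.exp (x₀ + σ * Y) := by
      rw [← norm_arc (x₀ + σ * Y) t, ← Complex.abs_re_eq_norm.mpr h0, abs_of_pos hs]
    rw [hn]
    have ho := h.outer
    rcases h.sign with h1 | h1 <;> rw [h1] at ho ⊢
    · have := Real.one_lt_exp_iff.mpr (show 0 < x₀ + 1 * Y by linarith)
      linarith
    · have := Real.exp_lt_one_iff.mpr (show x₀ + -1 * Y < 0 by linarith)
      linarith

theorem ne_one {w : ℂ} (hw : w ∈ sideSet x₀ σ Y θ) : w ≠ 1 := by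
  rintro rfl
  have := h.mem_slitPlane hw
  simp at this

theorem norm_ne {w : ℂ} (hw : w ∈ sideSet x₀ σ Y θ) : ‖w‖ ≠ Real.exp x₀ := by
  have hy : ∀ y ∈ Ioc 0 Y, Real.exp (x₀ + σ * y) ≠ Real.exp x₀ := fun y hy he => by
    have h1 := exp_mul_le_abs_sub (x₀ := x₀) h.sign hy.1.le hy.2
    rw [he, sub_self, abs_zero] at h1
    exact absurd h1 (not_le.mpr (mul_pos (Real.exp_pos _) hy.1))
  rcases hw with (⟨y, hy', rfl⟩ | ⟨y, hy', rfl⟩) | ⟨t, ht, rfl⟩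
  · rw [norm_leg]; exact hy y hy'
  · rw [norm_leg]; exact hy y hy'
  · rw [norm_arc]; exact hy Y ⟨h.pos, le_rfl⟩

theorem tendsto_leg : Tendsto (leg x₀ σ θ) (𝓝[>] 0) (𝓝[{z | 0 < z.im}] (polar x₀ (θ 0))) := by
  refine tendsto_nhdsWithin_iff.mpr ⟨?_, ?_⟩
  · have := (contDiff_leg x₀ σ h.smooth).continuous.tendsto 0
    rw [leg, mul_zero, add_zero] at this
    exact this.mono_left nhdsWithin_le_nhds
  · filter_upwards [self_mem_nhdsWithin] with y hy using h.leg_im_pos hy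

theorem tendsto_leg_neg : Tendsto (leg x₀ σ (-θ)) (𝓝[>] 0)
    (𝓝[{z | z.im < 0}] ((starRingEnd ℂ) (polar x₀ (θ 0)))) := by
  refine tendsto_nhdsWithin_iff.mpr ⟨?_, ?_⟩
  · have := (contDiff_leg x₀ σ h.smooth_neg).continuous.tendsto 0
    rw [leg, mul_zero, add_zero, Pi.neg_apply, polar_neg] at this
    exact this.mono_left nhdsWithin_le_nhds
  · filter_upwards [self_mem_nhdsWithin] with y hy using h.leg_neg_im hy

theorem integral_eq {Ω : Set ℂ} {F f : ℂ → ℂ} (hF : ∀ z ∈ Ω, HasDerivAt F (f z) z)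
    (hf : ContinuousOn f Ω) (hΩ : sideSet x₀ σ Y θ ⊆ Ω) {M : ℝ}
    (hM : ∀ z ∈ sideSet x₀ σ Y θ, ‖f z‖ ≤ M) {la lb : ℂ}
    (hla : Tendsto F (𝓝[{z | z.im < 0}] ((starRingEnd ℂ) (polar x₀ (θ 0)))) (𝓝 la))
    (hlb : Tendsto F (𝓝[{z | 0 < z.im}] (polar x₀ (θ 0))) (𝓝 lb)) :
    sideIntegral x₀ σ Y θ f = lb - la := by
  have hY : Y ∈ Ioc 0 Y := ⟨h.pos, le_rfl⟩
  have hcl : ∀ φ : ℝ → ℝ, ContDiff ℝ 1 φ → leg x₀ σ φ Y ∈ Ω →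
      Tendsto (fun y => F (leg x₀ σ φ y)) (𝓝[<] Y) (𝓝 (F (leg x₀ σ φ Y))) := fun φ hφ hm =>
    ((hF _ hm).continuousAt.tendsto.comp ((contDiff_leg x₀ σ hφ).continuous.tendsto Y)).mono_left
      nhdsWithin_le_nhds
  have hca : ∀ t ∈ Icc (-θ Y) (θ Y), Tendsto (fun y => F (arc (x₀ + σ * Y) y)) (𝓝 t)
      (𝓝 (F (arc (x₀ + σ * Y) t))) := fun t ht =>
    (hF _ (hΩ (arc_mem ht))).continuousAt.tendsto.comp ((contDiff_arc _).continuous.tendsto t)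
  have hθY : 0 < θ Y := h.theta_end.1
  have h1 := (IsTame.of_contDiffOn (contDiff_leg x₀ σ h.smooth_neg).contDiffOn).integral_eq h.pos hF
    hf (fun y hy => hΩ (leg_neg_mem (Ioo_subset_Ioc_self hy)))
    (fun y hy => hM _ (leg_neg_mem (Ioo_subset_Ioc_self hy))) (hla.comp h.tendsto_leg_neg)
    (hcl _ h.smooth_neg (hΩ (leg_neg_mem hY)))
  have h2 := (IsTame.of_contDiffOn (contDiff_leg x₀ σ h.smooth).contDiffOn).integral_eq h.pos hF
    hf (fun y hy => hΩ (leg_mem (Ioo_subset_Ioc_self hy)))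
    (fun y hy => hM _ (leg_mem (Ioo_subset_Ioc_self hy))) (hlb.comp h.tendsto_leg)
    (hcl _ h.smooth (hΩ (leg_mem hY)))
  have h3 := (IsTame.of_contDiffOn (contDiff_arc (x₀ + σ * Y)).contDiffOn).integral_eq
    (neg_lt_self hθY) hF
    hf (fun y hy => hΩ (arc_mem (Ioo_subset_Icc_self hy)))
    (fun y hy => hM _ (arc_mem (Ioo_subset_Icc_self hy)))
    ((hca _ ⟨le_rfl, by linarith⟩).mono_left nhdsWithin_le_nhds)
    ((hca _ ⟨by linarith, le_rfl⟩).mono_left nhdsWithin_le_nhds)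
  rw [sideIntegral, h1, h2, h3]
  have e1 : leg x₀ σ (-θ) Y = arc (x₀ + σ * Y) (-θ Y) := rfl
  have e2 : leg x₀ σ θ Y = arc (x₀ + σ * Y) (θ Y) := rfl
  rw [e1, e2]
  ring

theorem integral_sub {f g : ℂ → ℂ} (hf : ContinuousOn f (sideSet x₀ σ Y θ))
    (hg : ContinuousOn g (sideSet x₀ σ Y θ)) {M M' : ℝ} (hM : ∀ z ∈ sideSet x₀ σ Y θ, ‖f z‖ ≤ M)
    (hM' : ∀ z ∈ sideSet x₀ σ Y θ, ‖g z‖ ≤ M') :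
    sideIntegral x₀ σ Y θ (fun z => f z - g z) =
      sideIntegral x₀ σ Y θ f - sideIntegral x₀ σ Y θ g := by
  have hθY : 0 < θ Y := h.theta_end.1
  have hleg : ∀ φ : ℝ → ℝ, ContDiff ℝ 1 φ → (∀ y ∈ Ioc 0 Y, leg x₀ σ φ y ∈ sideSet x₀ σ Y θ) →
      ∀ {f : ℂ → ℂ} {M : ℝ}, ContinuousOn f (sideSet x₀ σ Y θ) →
      (∀ z ∈ sideSet x₀ σ Y θ, ‖f z‖ ≤ M) →
      IntervalIntegrable (fun y => f (leg x₀ σ φ y) * deriv (leg x₀ σ φ) y) volume 0 Y := by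
    intro φ hφ hm f M hf hM
    exact (IsTame.of_contDiffOn (contDiff_leg x₀ σ hφ).contDiffOn).intervalIntegrable h.pos.le
      (g := fun y => f (leg x₀ σ φ y))
      (hf.comp (contDiff_leg x₀ σ hφ).continuous.continuousOn
        fun y hy => hm y (Ioo_subset_Ioc_self hy)) fun y hy => hM _ (hm y (Ioo_subset_Ioc_self hy))
  have harc : ∀ {f : ℂ → ℂ} {M : ℝ}, ContinuousOn f (sideSet x₀ σ Y θ) →
      (∀ z ∈ sideSet x₀ σ Y θ, ‖f z‖ ≤ M) → IntervalIntegrable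
        (fun t => f (arc (x₀ + σ * Y) t) * deriv (arc (x₀ + σ * Y)) t) volume (-θ Y) (θ Y) := by
    intro f M hf hM
    exact (IsTame.of_contDiffOn (contDiff_arc (x₀ + σ * Y)).contDiffOn).intervalIntegrable
      (by linarith) (g := fun t => f (arc (x₀ + σ * Y) t))
      (hf.comp (contDiff_arc _).continuous.continuousOn
        fun y hy => arc_mem (Ioo_subset_Icc_self hy))
      fun y hy => hM _ (arc_mem (Ioo_subset_Icc_self hy))
  have k1 : ∀ y ∈ Ioc 0 Y, leg x₀ σ θ y ∈ sideSet x₀ σ Y θ := fun y hy => leg_mem hy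
  have k2 : ∀ y ∈ Ioc 0 Y, leg x₀ σ (-θ) y ∈ sideSet x₀ σ Y θ := fun y hy => leg_neg_mem hy
  simp only [sideIntegral, sub_mul]
  rw [intervalIntegral.integral_sub (hleg _ h.smooth_neg k2 hf hM) (hleg _ h.smooth_neg k2 hg hM'),
    intervalIntegral.integral_sub (harc hf hM) (harc hg hM'),
    intervalIntegral.integral_sub (hleg _ h.smooth k1 hf hM) (hleg _ h.smooth k1 hg hM')]
  ring

/-- Integrands of size `D |‖z‖ - r|^{-1/2}` have an integral of size `O(D)`. -/
theorem exists_norm_integral_le : ∃ K : ℝ, 0 < K ∧ ∀ (f : ℂ → ℂ) (D : ℝ), 0 ≤ D →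
    (∀ z ∈ sideSet x₀ σ Y θ, ‖f z‖ ≤ D * (√|‖z‖ - Real.exp x₀|)⁻¹) →
    ‖sideIntegral x₀ σ Y θ f‖ ≤ K * D := by
  have hY : Y ∈ Icc 0 Y := ⟨h.pos.le, le_rfl⟩
  set e := Real.exp (x₀ - Y) with he
  have hepos : 0 < e := Real.exp_pos _
  have hs : ∀ y ∈ Ioc 0 Y, (√|Real.exp (x₀ + σ * y) - Real.exp x₀|)⁻¹ ≤ (√e)⁻¹ * y ^ (-(1 / 2) : ℝ) := by
    intro y hy
    have h1 := exp_mul_le_abs_sub (x₀ := x₀) h.sign hy.1.le hy.2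
    have hpos : 0 < e * y := mul_pos hepos hy.1
    rw [Real.rpow_neg hy.1.le, ← Real.sqrt_eq_rpow, ← mul_inv, ← Real.sqrt_mul hepos.le]
    exact inv_anti₀ (Real.sqrt_pos.mpr hpos) (Real.sqrt_le_sqrt h1)
  have hint : IntervalIntegrable (fun y : ℝ => y ^ (-(1 / 2) : ℝ)) volume 0 Y :=
    intervalIntegral.intervalIntegrable_rpow' (by norm_num)
  have hI : 0 ≤ ∫ y in (0 : ℝ)..Y, y ^ (-(1 / 2) : ℝ) :=
    intervalIntegral.integral_nonneg h.pos.le fun y hy => Real.rpow_nonneg hy.1 _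
  set I := ∫ y in (0 : ℝ)..Y, y ^ (-(1 / 2) : ℝ)
  have hleg : ∀ φ : ℝ → ℝ, ContDiff ℝ 1 φ → (∀ y ∈ Ioc 0 Y, leg x₀ σ φ y ∈ sideSet x₀ σ Y θ) →
      ∃ C : ℝ, 0 ≤ C ∧ ∀ (f : ℂ → ℂ) (D : ℝ), 0 ≤ D →
      (∀ z ∈ sideSet x₀ σ Y θ, ‖f z‖ ≤ D * (√|‖z‖ - Real.exp x₀|)⁻¹) →
      ‖∫ y in (0 : ℝ)..Y, f (leg x₀ σ φ y) * deriv (leg x₀ σ φ) y‖ ≤ C * D := by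
    intro φ hφ hm
    obtain ⟨C, hC⟩ := isCompact_Icc.exists_bound_of_continuousOn
      ((contDiff_leg x₀ σ hφ).continuous_deriv le_rfl).continuousOn (s := Icc 0 Y)
    have hC0 : 0 ≤ C := (norm_nonneg _).trans (hC Y hY)
    refine ⟨(√e)⁻¹ * I * C, by positivity, fun f D hD hf => ?_⟩
    refine (intervalIntegral.norm_integral_le_of_norm_le
      (g := fun y => (D * (√e)⁻¹ * C) * y ^ (-(1 / 2) : ℝ)) h.pos.le
      (Eventually.of_forall fun y hy => ?_) (hint.const_mul _)).trans_eq ?_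
    · have h1 := hf _ (hm y hy)
      rw [norm_leg] at h1
      have h2 := h1.trans (mul_le_mul_of_nonneg_left (hs y hy) hD)
      rw [norm_mul]
      refine (mul_le_mul h2 (hC y (Ioc_subset_Icc_self hy)) (norm_nonneg _)
        (mul_nonneg hD (mul_nonneg (by positivity) (Real.rpow_nonneg hy.1.le _)))).trans_eq (by ring)
    · rw [intervalIntegral.integral_const_mul]; ring
  obtain ⟨C₁, hC₁, h₁⟩ := hleg _ h.smooth fun y hy => leg_mem hy
  obtain ⟨C₂, hC₂, h₂⟩ := hleg _ h.smooth_neg fun y hy => leg_neg_mem hy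
  obtain ⟨C₃, hC₃⟩ := isCompact_Icc.exists_bound_of_continuousOn
    ((contDiff_arc (x₀ + σ * Y)).continuous_deriv le_rfl).continuousOn (s := Icc (-θ Y) (θ Y))
  have hθY := h.theta_end.1
  have hC₃' : 0 ≤ C₃ := (norm_nonneg _).trans (hC₃ (θ Y) ⟨by linarith, le_rfl⟩)
  set B := (√|Real.exp (x₀ + σ * Y) - Real.exp x₀|)⁻¹ with hB
  have hB0 : 0 ≤ B := by positivity
  refine ⟨C₂ + B * C₃ * |θ Y - -θ Y| + C₁ + 1, by positivity, fun f D hD hf => ?_⟩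
  have h₃ : ‖∫ t in (-θ Y)..θ Y, f (arc (x₀ + σ * Y) t) * deriv (arc (x₀ + σ * Y)) t‖ ≤
      D * B * C₃ * |θ Y - -θ Y| := by
    refine intervalIntegral.norm_integral_le_of_norm_le_const fun t ht => ?_
    rw [uIoc_of_le (by linarith)] at ht
    have h1 := hf _ (arc_mem (Ioc_subset_Icc_self ht))
    rw [norm_arc] at h1
    rw [norm_mul]
    exact mul_le_mul h1 (hC₃ t (Ioc_subset_Icc_self ht)) (norm_nonneg _) (by positivity)
  have h4 := h₁ f D hD hf
  have h5 := h₂ f D hD hf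
  rw [sideIntegral]
  refine (norm_sub_le _ _).trans ((add_le_add_left (norm_add_le _ _) _).trans ?_)
  nlinarith

end IsSidePath

end Aztec

end

noncomputable section

namespace Aztec

open MeasureTheory Set

/-! ### Residues by contours through a saddle point -/

theorem IsSidePath.exists_bound {x₀ σ Y : ℝ} {θ : ℝ → ℝ} (h : IsSidePath x₀ σ Y θ) {E : Type*}
    [SeminormedAddCommGroup E] {f : ℂ → E} (hf : ContinuousOn f (Complex.slitPlane \ {1})) {C : ℝ}
    (h1 : ∀ᶠ z in 𝓝[{z | 0 < z.im}] (polar x₀ (θ 0)), ‖f z‖ ≤ C)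
    (h2 : ∀ᶠ z in 𝓝[{z | z.im < 0}] ((starRingEnd ℂ) (polar x₀ (θ 0))), ‖f z‖ ≤ C) :
    ∃ M, ∀ z ∈ sideSet x₀ σ Y θ, ‖f z‖ ≤ M := by
  have hsub : sideSet x₀ σ Y θ ⊆ Complex.slitPlane \ {1} := fun z hz =>
    ⟨h.subset_slitPlane hz, h.ne_one hz⟩
  have hleg : ∀ φ : ℝ → ℝ, ContDiff ℝ 1 φ → (∀ y ∈ Ioc 0 Y, leg x₀ σ φ y ∈ sideSet x₀ σ Y θ) →
      (∀ᶠ y in 𝓝[>] 0, ‖f (leg x₀ σ φ y)‖ ≤ C) → ∃ M, ∀ y ∈ Ioc 0 Y, ‖f (leg x₀ σ φ y)‖ ≤ M := by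
    intro φ hφ hm hev
    obtain ⟨ε, hε, hsubε⟩ := mem_nhdsGT_iff_exists_Ioo_subset.mp hev
    have hε' : (0 : ℝ) < ε := hε
    obtain ⟨M, hM⟩ := isCompact_Icc.exists_bound_of_continuousOn (s := Icc ε Y)
      (f := fun y => f (leg x₀ σ φ y)) (hf.comp (contDiff_leg x₀ σ hφ).continuous.continuousOn
        fun y hy => hsub (hm y ⟨hε'.trans_le hy.1, hy.2⟩))
    refine ⟨max C M, fun y hy => ?_⟩
    rcases lt_or_ge y ε with hlt | hge
    · exact (hsubε ⟨hy.1, hlt⟩).trans (le_max_left _ _)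
    · exact (hM y ⟨hge, hy.2⟩).trans (le_max_right _ _)
  obtain ⟨M₁, hM₁⟩ := hleg θ h.smooth (fun y hy => IsSidePath.leg_mem hy) (h.tendsto_leg.eventually h1)
  obtain ⟨M₂, hM₂⟩ := hleg (-θ) h.smooth_neg (fun y hy => IsSidePath.leg_neg_mem hy)
    (h.tendsto_leg_neg.eventually h2)
  obtain ⟨M₃, hM₃⟩ := isCompact_Icc.exists_bound_of_continuousOn (s := Icc (-θ Y) (θ Y))
    (f := fun t => f (arc (x₀ + σ * Y) t)) (hf.comp (contDiff_arc _).continuous.continuousOn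
      fun t ht => hsub (IsSidePath.arc_mem ht))
  refine ⟨max M₁ (max M₂ M₃), ?_⟩
  rintro z ((⟨y, hy, rfl⟩ | ⟨y, hy, rfl⟩) | ⟨t, ht, rfl⟩)
  · exact (hM₁ y hy).trans (le_max_left _ _)
  · exact (hM₂ y hy).trans ((le_max_left _ _).trans (le_max_right _ _))
  · exact (hM₃ t ht).trans ((le_max_right _ _).trans (le_max_right _ _))

theorem convex_im_pos : Convex ℝ {z : ℂ | 0 < z.im} := convex_halfSpace_im_gt 0

theorem convex_im_neg : Convex ℝ {z : ℂ | z.im < 0} := convex_halfSpace_im_lt 0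

theorem exists_tendsto_of_eventually_bound {Ω : Set ℂ} (hΩ : Convex ℝ Ω) {F f : ℂ → ℂ} {z₀ : ℂ}
    [hz₀ : (𝓝[Ω] z₀).NeBot] (hF : ∀ z ∈ Ω, HasDerivAt F (f z) z) {C : ℝ}
    (hC : ∀ᶠ z in 𝓝[Ω] z₀, ‖f z‖ ≤ C) : ∃ l, Tendsto F (𝓝[Ω] z₀) (𝓝 l) := by
  obtain ⟨ε, hε, hball⟩ := Metric.mem_nhdsWithin_iff.mp hC
  exact exists_tendsto_of_bounded_deriv hε (hΩ.inter (convex_ball z₀ ε)) hF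
    (fun z hz => hball ⟨hz.2, hz.1⟩) (mem_closure_iff_nhdsWithin_neBot.mpr hz₀)

theorem log_sub_one_of_im_pos {z : ℂ} (hz : 0 < z.im) :
    Complex.log (z - 1) = Complex.log (1 - z) + Real.pi * Complex.I := by
  have h : (1 - z).im < 0 := by simpa using hz
  rw [← neg_sub 1 z, Complex.log, Complex.log, norm_neg, Complex.arg_neg_eq_arg_add_pi_of_im_neg h]
  push_cast
  ring

theorem log_sub_one_of_im_neg {z : ℂ} (hz : z.im < 0) :
    Complex.log (z - 1) = Complex.log (1 - z) - Real.pi * Complex.I := by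
  have h : 0 < (1 - z).im := by simpa using hz
  rw [← neg_sub 1 z, Complex.log, Complex.log, norm_neg, Complex.arg_neg_eq_arg_sub_pi_of_im_pos h]
  push_cast
  ring

theorem mem_slitPlane_of_im_ne {z : ℂ} (hz : z.im ≠ 0) : z ∈ Complex.slitPlane := Or.inr hz

/-- The integral around `1` as a difference of integrals over the two contours through a saddle. -/
theorem IsContourOne.integral_eq_sub {x₀ θ₀ Y Y' : ℝ} {θ θ' : ℝ → ℝ} (hp : IsSidePath x₀ 1 Y θ)
    (hm : IsSidePath x₀ (-1) Y' θ') (h0 : θ 0 = θ₀) (h0' : θ' 0 = θ₀) {γ : ℝ → ℂ}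
    (hγ : IsContourOne γ) {H f : ℂ → ℂ} (hH : DifferentiableOn ℂ H Complex.slitPlane) (m : ℕ)
    (hf : ∀ z ∈ Complex.slitPlane, z ≠ 1 → f z = H z / (z - 1) ^ m) {C : ℝ}
    (h1 : ∀ᶠ z in 𝓝[{z | 0 < z.im}] (polar x₀ θ₀), ‖f z‖ ≤ C)
    (h2 : ∀ᶠ z in 𝓝[{z | z.im < 0}] ((starRingEnd ℂ) (polar x₀ θ₀)), ‖f z‖ ≤ C) :
    pathIntegral γ f = sideIntegral x₀ 1 Y θ f - sideIntegral x₀ (-1) Y' θ' f := by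
  subst h0
  have hfc : ContinuousOn f (Complex.slitPlane \ {1}) := by
    have : ContinuousOn (fun z => H z / (z - 1) ^ m) (Complex.slitPlane \ {1}) :=
      (hH.continuousOn.mono sdiff_subset).div (by fun_prop) fun z hz =>
        pow_ne_zero _ (sub_ne_zero.mpr hz.2)
    exact this.congr fun z hz => hf z hz.1 hz.2
  obtain ⟨c, F, hF⟩ := exists_residue_primitive Complex.isOpen_slitPlane (z₀ := 1)
    Complex.starConvex_one_slitPlane Complex.one_mem_slitPlane m hH
  have hF' : ∀ z ∈ Complex.slitPlane, z ≠ 1 → HasDerivAt F (f z - c / (z - 1)) z := fun z hz hz1 => by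
    rw [hf z hz hz1]; exact hF z hz hz1
  set Fa : ℂ → ℂ := fun z => F z + c * Complex.log (z - 1) with hFa
  set Fb : ℂ → ℂ := fun z => F z + c * Complex.log (1 - z) with hFb
  have hFad : ∀ z ∈ Complex.slitPlane, z - 1 ∈ Complex.slitPlane → HasDerivAt Fa (f z) z := by
    intro z hz hz1
    have hne : z ≠ 1 := fun h => by simp [h] at hz1
    have h3 := (hF' z hz hne).add
      ((((hasDerivAt_id z).sub_const (1 : ℂ)).clog hz1).const_mul c)
    refine h3.congr_deriv ?_
    simp only [id]
    ring
  have hFbd : ∀ z ∈ Complex.slitPlane, 1 - z ∈ Complex.slitPlane → HasDerivAt Fb (f z) z := by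
    intro z hz hz1
    have hne : z ≠ 1 := fun h => by simp [h] at hz1
    have h3 := (hF' z hz hne).add
      ((((hasDerivAt_id z).const_sub (1 : ℂ)).clog hz1).const_mul c)
    refine h3.congr_deriv ?_
    simp only [id]
    rw [← neg_sub z 1, neg_div_neg_eq]
    ring
  have hU : ∀ z : ℂ, z.im ≠ 0 → HasDerivAt Fa (f z) z := fun z hz =>
    hFad z (mem_slitPlane_of_im_ne hz) (mem_slitPlane_of_im_ne (by simpa using hz))
  have : (𝓝[{z : ℂ | 0 < z.im}] (polar x₀ (θ 0))).NeBot := hp.tendsto_leg.neBot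
  have : (𝓝[{z : ℂ | z.im < 0}] ((starRingEnd ℂ) (polar x₀ (θ 0)))).NeBot :=
    hp.tendsto_leg_neg.neBot
  obtain ⟨lp, hlp⟩ := exists_tendsto_of_eventually_bound convex_im_pos
    (fun z (hz : 0 < z.im) => hU z hz.ne') h1
  obtain ⟨lm, hlm⟩ := exists_tendsto_of_eventually_bound convex_im_neg
    (fun z (hz : z.im < 0) => hU z hz.ne) h2
  have hlp' : Tendsto Fb (𝓝[{z | 0 < z.im}] (polar x₀ (θ 0))) (𝓝 (lp - c * (Real.pi * Complex.I))) := by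
    refine (hlp.sub_const _).congr' ?_
    filter_upwards [self_mem_nhdsWithin] with z hz
    simp only [hFa, hFb, log_sub_one_of_im_pos hz]
    ring
  have hlm' : Tendsto Fb (𝓝[{z | z.im < 0}] ((starRingEnd ℂ) (polar x₀ (θ 0))))
      (𝓝 (lm + c * (Real.pi * Complex.I))) := by
    refine (hlm.add_const _).congr' ?_
    filter_upwards [self_mem_nhdsWithin] with z hz
    simp only [hFa, hFb, log_sub_one_of_im_neg hz]
    ring
  obtain ⟨Mp, hMp⟩ := hp.exists_bound hfc h1 h2
  obtain ⟨Mm, hMm⟩ := hm.exists_bound hfc (h0' ▸ h1) (h0' ▸ h2)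
  have e1 := hp.integral_eq (Ω := {z | z ∈ Complex.slitPlane ∧ z - 1 ∈ Complex.slitPlane})
    (fun z hz => hFad z hz.1 hz.2) (hfc.mono fun z hz => ⟨hz.1, fun h => by
      have h' : z = 1 := h
      have := hz.2
      simp [h'] at this⟩)
    (fun z hz => ⟨hp.subset_slitPlane hz, by simpa using hp.mem_slitPlane hz⟩) hMp hlm hlp
  have e2 := hm.integral_eq (Ω := {z | z ∈ Complex.slitPlane ∧ 1 - z ∈ Complex.slitPlane})
    (fun z hz => hFbd z hz.1 hz.2) (hfc.mono fun z hz => ⟨hz.1, fun h => by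
      have h' : z = 1 := h
      have := hz.2
      simp [h'] at this⟩)
    (fun z hz => ⟨hm.subset_slitPlane hz, by simpa using hm.mem_slitPlane hz⟩) hMm
    (h0'.symm ▸ hlm') (h0'.symm ▸ hlp')
  have hsub := hγ.subset_slitPlane
  have hn1 := hγ.around_one.1
  have e3 := hγ.simple.isLoop.integral_eq_residue hn1
    (hfc.mono fun z hz => ⟨hsub hz, fun h => hn1 (by rw [← mem_singleton_iff.mp h]; exact hz)⟩)
    (fun z hz => hF' z (hsub hz) fun h => hn1 (h ▸ hz))
  rw [e1, e2, e3, hγ.around_one.2]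
  ring

/-- The integral along an arc ending at a saddle point. -/
theorem IsArc.integral_eq {z₁ : ℂ} {γ : ℝ → ℂ} (hγ : IsArc z₁ γ) {F f : ℂ → ℂ}
    (hF : ∀ z : ℂ, z - 1 ∈ Complex.slitPlane → HasDerivAt F (f z) z)
    (hf : ContinuousOn f {z | z - 1 ∈ Complex.slitPlane}) {A B : Set ℂ}
    (hA : ∀ᶠ t in 𝓝[>] (0 : ℝ), γ t ∈ A) (hB : ∀ᶠ t in 𝓝[<] (1 : ℝ), γ t ∈ B) {C : ℝ}
    (hCA : ∀ᶠ z in 𝓝[A] ((starRingEnd ℂ) z₁), ‖f z‖ ≤ C) (hCB : ∀ᶠ z in 𝓝[B] z₁, ‖f z‖ ≤ C)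
    {la lb : ℂ} (hla : Tendsto F (𝓝[A] ((starRingEnd ℂ) z₁)) (𝓝 la))
    (hlb : Tendsto F (𝓝[B] z₁) (𝓝 lb)) : pathIntegral γ f = lb - la := by
  have ht := hγ.piecewiseC1.isTame
  have hmem : MapsTo γ (Ioo 0 1) {z | z - 1 ∈ Complex.slitPlane} := by
    intro t ht
    by_cases h : (γ t).im = 0
    · exact Or.inl (by simpa using hγ.real_points t ht h)
    · exact mem_slitPlane_of_im_ne (by simpa using h)
  have h0 : Tendsto γ (𝓝[>] 0) (𝓝[A] ((starRingEnd ℂ) z₁)) := by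
    refine tendsto_nhdsWithin_iff.mpr ⟨?_, hA⟩
    rw [← hγ.start]
    exact (ht.continuousOn 0 (by simp)).mono_left (nhdsWithin_le_of_mem (by
      filter_upwards [Ioo_mem_nhdsGT (zero_lt_one' ℝ)] with t ht using Ioo_subset_Icc_self ht))
  have h1 : Tendsto γ (𝓝[<] 1) (𝓝[B] z₁) := by
    refine tendsto_nhdsWithin_iff.mpr ⟨?_, hB⟩
    rw [← hγ.finish]
    exact (ht.continuousOn 1 (by simp)).mono_left (nhdsWithin_le_of_mem (by
      filter_upwards [Ioo_mem_nhdsLT (zero_lt_one' ℝ)] with t ht using Ioo_subset_Icc_self ht))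
  obtain ⟨a, ha, hsa⟩ := mem_nhdsGT_iff_exists_Ioo_subset.mp (h0.eventually hCA)
  obtain ⟨b, hb, hsb⟩ := mem_nhdsLT_iff_exists_Ioo_subset.mp (h1.eventually hCB)
  have ha' : (0 : ℝ) < a := ha
  have hb' : b < (1 : ℝ) := hb
  obtain ⟨M, hM⟩ := isCompact_Icc.exists_bound_of_continuousOn (s := Icc a b)
    (f := fun t => f (γ t)) (hf.comp (ht.continuousOn.mono fun t ht =>
      ⟨ha'.le.trans ht.1, ht.2.trans hb'.le⟩) fun t ht => hmem ⟨ha'.trans_le ht.1, ht.2.trans_lt hb'⟩)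
  refine ht.integral_eq zero_lt_one hF hf hmem (M := max C M) (fun t ht => ?_) (hla.comp h0)
    (hlb.comp h1)
  rcases lt_or_ge t a with hta | hta
  · exact le_max_of_le_left (hsa ⟨ht.1, hta⟩)
  · rcases lt_or_ge b t with htb | htb
    · exact le_max_of_le_left (hsb ⟨htb, ht.2⟩)
    · exact le_max_of_le_right (hM t ⟨hta, htb⟩)

theorem starConvex_sub_one_mem_slitPlane :
    StarConvex ℝ (2 : ℂ) {z : ℂ | z - 1 ∈ Complex.slitPlane} := by
  intro w hw a b ha hb hab
  have h := Complex.starConvex_one_slitPlane (show w - 1 ∈ Complex.slitPlane from hw) ha hb hab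
  have hab' : (a : ℂ) + b = 1 := by exact_mod_cast hab
  have e : a • (2 : ℂ) + b • w - 1 = a • (1 : ℂ) + b • (w - 1) := by
    simp only [Complex.real_smul]
    linear_combination hab'
  show a • (2 : ℂ) + b • w - 1 ∈ Complex.slitPlane
  rwa [e]

theorem isOpen_sub_one_mem_slitPlane : IsOpen {z : ℂ | z - 1 ∈ Complex.slitPlane} :=
  Complex.isOpen_slitPlane.preimage (continuous_id.sub continuous_const)

theorem sub_one_mem_slitPlane_subset :
    {z : ℂ | z - 1 ∈ Complex.slitPlane} ⊆ Complex.slitPlane \ {1} := by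
  rintro z (hz | hz)
  · rw [Complex.sub_re, Complex.one_re, sub_pos] at hz
    exact ⟨Or.inl (by linarith), fun h => by simp [mem_singleton_iff.mp h] at hz⟩
  · exact ⟨Or.inr (by simpa using hz), fun h => by simp [mem_singleton_iff.mp h] at hz⟩

section

variable {x₀ Y : ℝ} {θ : ℝ → ℝ} (hp : IsSidePath x₀ 1 Y θ) {f : ℂ → ℂ}
  (hf : DifferentiableOn ℂ f (Complex.slitPlane \ {1})) {C : ℝ}
  (h1 : ∀ᶠ z in 𝓝[{z | 0 < z.im}] (polar x₀ (θ 0)), ‖f z‖ ≤ C)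
  (h2 : ∀ᶠ z in 𝓝[{z | z.im < 0}] ((starRingEnd ℂ) (polar x₀ (θ 0))), ‖f z‖ ≤ C)
include hp hf h1 h2

theorem IsSidePath.exists_primitive : ∃ (F : ℂ → ℂ) (la lb : ℂ),
    (∀ z : ℂ, z - 1 ∈ Complex.slitPlane → HasDerivAt F (f z) z) ∧
    Tendsto F (𝓝[{z | z.im < 0}] ((starRingEnd ℂ) (polar x₀ (θ 0)))) (𝓝 la) ∧
    Tendsto F (𝓝[{z | 0 < z.im}] (polar x₀ (θ 0))) (𝓝 lb) ∧
    sideIntegral x₀ 1 Y θ f = lb - la := by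
  have hf' := hf.mono sub_one_mem_slitPlane_subset
  obtain ⟨F, hF⟩ := exists_primitive_of_starConvex isOpen_sub_one_mem_slitPlane
    starConvex_sub_one_mem_slitPlane hf'
  have hU : ∀ z : ℂ, z.im ≠ 0 → HasDerivAt F (f z) z := fun z hz =>
    hF z (mem_slitPlane_of_im_ne (by simpa using hz))
  have : (𝓝[{z : ℂ | 0 < z.im}] (polar x₀ (θ 0))).NeBot := hp.tendsto_leg.neBot
  have : (𝓝[{z : ℂ | z.im < 0}] ((starRingEnd ℂ) (polar x₀ (θ 0)))).NeBot :=
    hp.tendsto_leg_neg.neBot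
  obtain ⟨lp, hlp⟩ := exists_tendsto_of_eventually_bound convex_im_pos
    (fun z (hz : 0 < z.im) => hU z hz.ne') h1
  obtain ⟨lm, hlm⟩ := exists_tendsto_of_eventually_bound convex_im_neg
    (fun z (hz : z.im < 0) => hU z hz.ne) h2
  obtain ⟨M, hM⟩ := hp.exists_bound hf.continuousOn h1 h2
  exact ⟨F, lm, lp, hF, hlm, hlp, hp.integral_eq hF hf'.continuousOn
    (fun z hz => by simpa using hp.mem_slitPlane hz) hM hlm hlp⟩

theorem IsArc.integral_eq_sideIntegral (hθ : θ 0 ∈ Ioo 0 Real.pi) {γ : ℝ → ℂ}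
    (hγ : IsArc (polar x₀ (θ 0)) γ) : pathIntegral γ f = sideIntegral x₀ 1 Y θ f := by
  obtain ⟨F, la, lb, hF, hla, hlb, hside⟩ := hp.exists_primitive hf h1 h2
  have him := polar_im_pos x₀ hθ
  have ht := hγ.piecewiseC1.isTame.continuousOn
  have hA : ∀ᶠ t in 𝓝[>] (0 : ℝ), (γ t).im < 0 := by
    have h3 : Tendsto (fun t => (γ t).im) (𝓝[>] 0) (𝓝 (γ 0).im) :=
      (Complex.continuous_im.tendsto _).comp ((ht 0 (by simp)).mono_left (nhdsWithin_le_of_mem (by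
        filter_upwards [Ioo_mem_nhdsGT (zero_lt_one' ℝ)] with t ht using Ioo_subset_Icc_self ht)))
    exact h3.eventually (gt_mem_nhds (by rw [hγ.start, Complex.conj_im]; linarith))
  have hB : ∀ᶠ t in 𝓝[<] (1 : ℝ), 0 < (γ t).im := by
    have h3 : Tendsto (fun t => (γ t).im) (𝓝[<] 1) (𝓝 (γ 1).im) :=
      (Complex.continuous_im.tendsto _).comp ((ht 1 (by simp)).mono_left (nhdsWithin_le_of_mem (by
        filter_upwards [Ioo_mem_nhdsLT (zero_lt_one' ℝ)] with t ht using Ioo_subset_Icc_self ht)))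
    exact h3.eventually (lt_mem_nhds (by rw [hγ.finish]; exact him))
  rw [hside]
  exact hγ.integral_eq hF (hf.continuousOn.mono sub_one_mem_slitPlane_subset) hA hB h2 h1 hla hlb

theorem IsArc.integral_eq_neg_sideIntegral (hθ : θ 0 ∈ Ioc 0 Real.pi) {γ : ℝ → ℂ}
    (hγ : IsArc ((starRingEnd ℂ) (polar x₀ (θ 0))) γ) :
    pathIntegral γ f = -sideIntegral x₀ 1 Y θ f := by
  obtain ⟨F, la, lb, hF, hla, hlb, hside⟩ := hp.exists_primitive hf h1 h2
  have ht := hγ.piecewiseC1.isTame.continuousOn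
  have hAB : (∀ᶠ t in 𝓝[>] (0 : ℝ), 0 < (γ t).im) ∧ ∀ᶠ t in 𝓝[<] (1 : ℝ), (γ t).im < 0 := by
    rcases hθ.2.lt_or_eq with hlt | heq
    · have him := polar_im_pos x₀ ⟨hθ.1, hlt⟩
      refine ⟨?_, ?_⟩
      · have h3 : Tendsto (fun t => (γ t).im) (𝓝[>] 0) (𝓝 (γ 0).im) :=
          (Complex.continuous_im.tendsto _).comp ((ht 0 (by simp)).mono_left
            (nhdsWithin_le_of_mem (by
              filter_upwards [Ioo_mem_nhdsGT (zero_lt_one' ℝ)] with t ht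
                using Ioo_subset_Icc_self ht)))
        exact h3.eventually (lt_mem_nhds (by rw [hγ.start, Complex.conj_conj]; exact him))
      · have h3 : Tendsto (fun t => (γ t).im) (𝓝[<] 1) (𝓝 (γ 1).im) :=
          (Complex.continuous_im.tendsto _).comp ((ht 1 (by simp)).mono_left
            (nhdsWithin_le_of_mem (by
              filter_upwards [Ioo_mem_nhdsLT (zero_lt_one' ℝ)] with t ht
                using Ioo_subset_Icc_self ht)))
        exact h3.eventually (gt_mem_nhds (by rw [hγ.finish, Complex.conj_im]; linarith))
    · refine hγ.clockwise ?_
      rw [heq, polar_pi, Complex.conj_im, Complex.neg_im, Complex.ofReal_im, neg_zero, neg_zero]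
  rw [hside, neg_sub]
  refine hγ.integral_eq (A := {z | 0 < z.im}) (B := {z | z.im < 0}) hF
    (hf.continuousOn.mono sub_one_mem_slitPlane_subset) hAB.1 hAB.2 ?_ h2 ?_
    hla
  · rwa [Complex.conj_conj]
  · rwa [Complex.conj_conj]

end

end Aztec

end

noncomputable section

namespace Aztec

open Set

variable {k : ℕ} {α β : Fin k → ℝ}

/-! ### Sizes of the factors of the integrand -/

/-- The logarithm of the modulus of the larger eigenvalue. -/
def logRho (α β : Fin k → ℝ) (z : ℂ) : ℝ := Real.log ‖rho α β 1 z‖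

theorem norm_zpow_mul_pow {z : ℂ} (hz0 : z ≠ 0) (hz1 : z ≠ 1) (s : ℤ) (N : ℕ) :
    ‖z ^ s * (1 - z⁻¹) ^ N‖ =
      Real.exp (s * Real.log ‖z‖ + N * (Real.log ‖z - 1‖ - Real.log ‖z‖)) := by
  have h1 : 0 < ‖z‖ := norm_pos_iff.mpr hz0
  have h2 : 0 < ‖z - 1‖ := norm_pos_iff.mpr (sub_ne_zero.mpr hz1)
  have e : 1 - z⁻¹ = (z - 1) / z := by field_simp
  rw [norm_mul, norm_zpow, norm_pow, e, norm_div, Real.exp_add, mul_comm (s : ℝ), ← Real.rpow_def_of_pos h1,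
    Real.rpow_intCast, ← Real.log_div h2.ne' h1.ne', mul_comm (N : ℝ),
    ← Real.rpow_def_of_pos (div_pos h2 h1), Real.rpow_natCast]

/-- At `z` the moduli of the factors of the integrand are bounded in terms of `B`. -/
structure IsMild (α β : Fin k → ℝ) (B : ℝ) (z : ℂ) : Prop where
  log_le : |Real.log ‖z‖| ≤ B
  logRho_le : logRho α β z ≤ B
  proj_le : ∀ i j, ‖proj α β 1 z i j‖ ≤ B
  proj_neg_le : ∀ i j, ‖proj α β (-1) z i j‖ ≤ B

theorem IsMild.mono {B B' : ℝ} {z : ℂ} (h : IsMild α β B z) (hB : B ≤ B') : IsMild α β B' z :=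
  ⟨h.log_le.trans hB, h.logRho_le.trans hB, fun i j => (h.proj_le i j).trans hB,
    fun i j => (h.proj_neg_le i j).trans hB⟩

theorem norm_one_apply_le (i j : Fin 2) : ‖(1 : Matrix (Fin 2) (Fin 2) ℂ) i j‖ ≤ 1 := by
  rw [Matrix.one_apply]
  split_ifs <;> simp

theorem exists_localTime_eq (χ : ℝ) (n : ℕ) (κ : ℤ) :
    ∃ e ∈ Ico (0 : ℝ) 1, (localTime χ n κ : ℝ) = n * (χ + 1) + e + κ := by
  refine ⟨⌈(n : ℝ) * (χ + 1)⌉ - n * (χ + 1), ⟨sub_nonneg.mpr (Int.le_ceil _), ?_⟩, ?_⟩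
  · linarith [Int.ceil_lt_add_one ((n : ℝ) * (χ + 1))]
  · rw [localTime]; push_cast; ring

theorem exists_localHeight_eq (k : ℕ) (η : ℝ) (n : ℕ) (ζ : ℤ) :
    ∃ e ∈ Ico (0 : ℝ) 1, (localHeight k η n ζ : ℝ) = k * n * (η - 1) / 2 + e + ζ := by
  refine ⟨⌈(k : ℝ) * n * (η - 1) / 2⌉ - k * n * (η - 1) / 2, ⟨sub_nonneg.mpr (Int.le_ceil _), ?_⟩, ?_⟩
  · linarith [Int.ceil_lt_add_one ((k : ℝ) * n * (η - 1) / 2)]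
  · rw [localHeight]; push_cast; ring

section

variable (hw : Admissible α β)
include hw

theorem logRho_pos {z : ℂ} (hz : z ∈ Complex.slitPlane) (hz1 : z ≠ 1) : 0 < logRho α β z :=
  Real.log_pos (one_lt_norm_rho hw hz hz1)

theorem norm_rho {ε : ℝ} (hε : ε = 1 ∨ ε = -1) {z : ℂ} (hz : z ∈ Complex.slitPlane) (hz1 : z ≠ 1) :
    ‖rho α β ε z‖ = Real.exp (ε * logRho α β z) := by
  have h1 : 0 < ‖rho α β 1 z‖ := zero_lt_one.trans (one_lt_norm_rho hw hz hz1)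
  rcases hε with rfl | rfl
  · rw [one_mul, logRho, Real.exp_log h1]
  · have h := congrArg norm (rho_mul hw (Or.inl rfl) hz1)
    rw [norm_mul, norm_one] at h
    rw [neg_one_mul, Real.exp_neg, logRho, Real.exp_log h1]
    exact eq_inv_of_mul_eq_one_right h

theorem norm_rho_zpow {ε : ℝ} (hε : ε = 1 ∨ ε = -1) {z : ℂ} (hz : z ∈ Complex.slitPlane)
    (hz1 : z ≠ 1) (j : ℤ) : ‖rho α β ε z ^ j‖ = Real.exp (j * (ε * logRho α β z)) := by
  rw [norm_zpow, norm_rho hw hε hz hz1, ← Real.rpow_intCast, ← Real.exp_mul, mul_comm]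

theorem rho_ne_zero {ε : ℝ} (hε : ε = 1 ∨ ε = -1) {z : ℂ} (hz1 : z ≠ 1) : rho α β ε z ≠ 0 :=
  div_ne_zero (lam_ne_zero_of_ne hw hε hz1) (pow_ne_zero _ (sub_ne_zero.mpr hz1))

theorem logRho_eq {z : ℂ} (hz1 : z ≠ 1) :
    logRho α β z = Real.log ‖lam α β 1 z‖ - k * Real.log ‖z - 1‖ := by
  have h2 : ‖z - 1‖ ≠ 0 := norm_ne_zero_iff.mpr (sub_ne_zero.mpr hz1)
  rw [logRho, rho, norm_div, norm_pow, Real.log_div (norm_ne_zero_iff.mpr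
    (lam_ne_zero_of_ne hw (Or.inl rfl) hz1)) (pow_ne_zero _ h2), Real.log_pow]

theorem hgt_eq {χ η : ℝ} {z : ℂ} (hz1 : z ≠ 1) : hgt α β χ η z =
    k * (η + 1) / 2 * Real.log ‖z‖ - k * Real.log ‖z - 1‖ - χ * logRho α β z := by
  rw [hgt, logRho_eq hw hz1]
  ring

theorem rho_conj (ε : ℝ) {z : ℂ} (hz : z ∈ Complex.slitPlane) :
    rho α β ε ((starRingEnd ℂ) z) = (starRingEnd ℂ) (rho α β ε z) := by
  simp [rho, lam_conj hw ε hz]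

theorem proj_conj (ε : ℝ) {z : ℂ} (hz : z ∈ Complex.slitPlane) (i j : Fin 2) :
    proj α β ε ((starRingEnd ℂ) z) i j = (starRingEnd ℂ) (proj α β ε z i j) := by
  simp only [proj, Matrix.smul_apply, Matrix.sub_apply, discRoot_conj hw hz, symbol_conj,
    lam_conj hw _ hz, smul_eq_mul, map_mul, map_sub, map_inv₀, Complex.conj_ofReal, Matrix.one_apply]
  split_ifs <;> simp

theorem hgt_conj {χ η : ℝ} {z : ℂ} (hz : z ∈ Complex.slitPlane) :
    hgt α β χ η ((starRingEnd ℂ) z) = hgt α β χ η z := by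
  have e : (starRingEnd ℂ) z - 1 = (starRingEnd ℂ) (z - 1) := by simp
  rw [hgt, hgt, lam_conj hw _ hz, e, Complex.norm_conj, Complex.norm_conj, Complex.norm_conj]

theorem IsMild.conj {B : ℝ} {z : ℂ} (hz : z ∈ Complex.slitPlane) (h : IsMild α β B z) :
    IsMild α β B ((starRingEnd ℂ) z) := by
  refine ⟨?_, ?_, fun i j => ?_, fun i j => ?_⟩
  · rw [Complex.norm_conj]; exact h.log_le
  · rw [logRho, rho_conj hw _ hz, Complex.norm_conj]; exact h.logRho_le
  · rw [proj_conj hw _ hz, Complex.norm_conj]; exact h.proj_le i j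
  · rw [proj_conj hw _ hz, Complex.norm_conj]; exact h.proj_neg_le i j

omit hw in
theorem continuousOn_lam : ContinuousOn (lam α β 1) {z | 0 ≤ z.im} := by
  have h : ContinuousOn (discRoot α β) {z | 0 ≤ z.im} :=
    (Polynomial.differentiable_aeval _).continuous.continuousOn.mul sqrtP0_continuousOn
  exact ((Polynomial.differentiable_aeval _).continuous.continuousOn.add
    (continuousOn_const.mul h)).div_const _

theorem lam_one_ne_zero_of_ne_zero {z : ℂ} (hz : z ≠ 0) : lam α β 1 z ≠ 0 := by
  rcases eq_or_ne z 1 with rfl | h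
  · exact lam_one_ne_zero hw Complex.one_mem_slitPlane
  · exact lam_ne_zero_of_ne hw (Or.inl rfl) h

theorem eventually_isMild {x₀ θ₀ : ℝ} (h0 : 0 < θ₀) (h1 : θ₀ ≤ Real.pi)
    (hC : ∃ C, ∀ᶠ z : ℂ in 𝓝[{z | 0 < z.im}] (polar x₀ θ₀), ∀ i j, ‖proj α β 1 z i j‖ ≤ C) :
    ∃ B, 0 ≤ B ∧ (∀ᶠ z : ℂ in 𝓝[{z | 0 < z.im}] (polar x₀ θ₀), IsMild α β B z) ∧
      ∀ᶠ z : ℂ in 𝓝[{z | z.im < 0}] ((starRingEnd ℂ) (polar x₀ θ₀)), IsMild α β B z := by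
  obtain ⟨C, hC⟩ := hC
  set z₀ := polar x₀ θ₀ with hz₀
  have hz0 : z₀ ≠ 0 := Complex.exp_ne_zero _
  have hz1 : z₀ ≠ 1 := polar_ne_one h0 h1
  have him : 0 ≤ z₀.im := by
    rw [polar_im]; exact mul_nonneg (Real.exp_pos _).le (Real.sin_nonneg_of_nonneg_of_le_pi h0.le h1)
  have hlog : ∀ᶠ z : ℂ in 𝓝[{z | 0 < z.im}] z₀, |Real.log ‖z‖| ≤ |Real.log ‖z₀‖| + 1 := by
    have : ContinuousAt (fun z : ℂ => |Real.log ‖z‖|) z₀ :=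
      (continuous_norm.continuousAt.log (norm_ne_zero_iff.mpr hz0)).abs
    exact (this.tendsto.mono_left nhdsWithin_le_nhds).eventually (ge_mem_nhds (by linarith))
  have hrho : ∀ᶠ z : ℂ in 𝓝[{z | 0 < z.im}] z₀, logRho α β z ≤ logRho α β z₀ + 1 := by
    have hl : Tendsto (lam α β 1) (𝓝[{z | 0 < z.im}] z₀) (𝓝 (lam α β 1 z₀)) :=
      (continuousOn_lam z₀ him).mono_left (nhdsWithin_mono _ fun z (hz : 0 < z.im) => hz.le)
    have hd : Tendsto (fun z : ℂ => (z - 1) ^ k) (𝓝[{z | 0 < z.im}] z₀) (𝓝 ((z₀ - 1) ^ k)) :=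
      (Continuous.tendsto (by fun_prop) z₀).mono_left nhdsWithin_le_nhds
    have hr : Tendsto (fun z => logRho α β z) (𝓝[{z | 0 < z.im}] z₀) (𝓝 (logRho α β z₀)) :=
      ((hl.div hd (pow_ne_zero _ (sub_ne_zero.mpr hz1))).norm.log
        (norm_ne_zero_iff.mpr (rho_ne_zero hw (Or.inl rfl) hz1)))
    exact hr.eventually (ge_mem_nhds (by linarith))
  set B := max (max (|Real.log ‖z₀‖| + 1) (logRho α β z₀ + 1)) (C + 1) with hB
  have hup : ∀ᶠ z : ℂ in 𝓝[{z | 0 < z.im}] z₀, IsMild α β B z := by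
    filter_upwards [hlog, hrho, hC, self_mem_nhdsWithin] with z h2 h3 h4 h5
    have hsl := mem_slitPlane_of_im_pos h5
    have hadd := proj_add (α := α) (β := β) (Or.inl rfl) (discRoot_ne_zero hw hsl)
    refine ⟨h2.trans ((le_max_left _ _).trans (le_max_left _ _)),
      h3.trans ((le_max_right _ _).trans (le_max_left _ _)),
      fun i j => ((h4 i j).trans (by linarith)).trans (le_max_right _ _), fun i j => ?_⟩
    have : proj α β (-1) z i j = (1 : Matrix (Fin 2) (Fin 2) ℂ) i j - proj α β 1 z i j := by
      rw [← hadd, Matrix.add_apply]; ring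
    rw [this]
    refine (norm_sub_le _ _).trans (le_trans ?_ (le_max_right _ _))
    linarith [norm_one_apply_le i j, h4 i j]
  refine ⟨B, le_trans (by positivity) ((le_max_left _ _).trans (le_max_left _ _)), hup, ?_⟩
  have hconj : Tendsto (starRingEnd ℂ) (𝓝[{z | z.im < 0}] ((starRingEnd ℂ) z₀))
      (𝓝[{z | 0 < z.im}] z₀) := by
    refine tendsto_nhdsWithin_iff.mpr ⟨?_, ?_⟩
    · have := (Complex.continuous_conj.tendsto ((starRingEnd ℂ) z₀))
      rw [Complex.conj_conj] at this
      exact this.mono_left nhdsWithin_le_nhds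
    · filter_upwards [self_mem_nhdsWithin] with z hz
      have : z.im < 0 := hz
      simpa using this
  filter_upwards [hconj.eventually hup, self_mem_nhdsWithin] with z hz hneg
  have hneg' : z.im < 0 := hneg
  have := IsMild.conj hw (mem_slitPlane_of_im_pos (by simpa using hneg')) hz
  rwa [Complex.conj_conj] at this

theorem continuousOn_proj {ε : ℝ} (hε : ε = 1 ∨ ε = -1) (i j : Fin 2) :
    DifferentiableOn ℂ (fun z => proj α β ε z i j) Complex.slitPlane := by
  have hε0 : (ε : ℂ) ≠ 0 := by rcases hε with rfl | rfl <;> simp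
  have h1 : DifferentiableOn ℂ (fun z => (ε * discRoot α β z)⁻¹) Complex.slitPlane :=
    ((discRoot_differentiableOn hw).const_mul _).inv fun z hz =>
      mul_ne_zero hε0 (discRoot_ne_zero hw hz)
  have h2 : DifferentiableOn ℂ (fun z => symbol α β z i j -
      lam α β (-ε) z * (1 : Matrix (Fin 2) (Fin 2) ℂ) i j) Complex.slitPlane :=
    (Polynomial.differentiable_aeval _).differentiableOn.sub
      ((lam_differentiableOn hw _).mul_const _)
  exact h1.mul h2

theorem IsSidePath.exists_isMild {x₀ σ Y B : ℝ} {θ : ℝ → ℝ} (h : IsSidePath x₀ σ Y θ)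
    (h1 : ∀ᶠ z : ℂ in 𝓝[{z | 0 < z.im}] (polar x₀ (θ 0)), IsMild α β B z)
    (h2 : ∀ᶠ z : ℂ in 𝓝[{z | z.im < 0}] ((starRingEnd ℂ) (polar x₀ (θ 0))), IsMild α β B z) :
    ∃ B', ∀ z ∈ sideSet x₀ σ Y θ, IsMild α β B' z := by
  have hlog : ContinuousOn (fun z : ℂ => |Real.log ‖z‖|) (Complex.slitPlane \ {1}) := fun z hz =>
    (continuous_norm.continuousAt.log
      (norm_ne_zero_iff.mpr (Complex.slitPlane_ne_zero hz.1))).abs.continuousWithinAt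
  have hrho : ContinuousOn (logRho α β) (Complex.slitPlane \ {1}) := by
    have : ContinuousOn (rho α β 1) (Complex.slitPlane \ {1}) :=
      ((lam_differentiableOn hw 1).continuousOn.mono sdiff_subset).div (by fun_prop) fun z hz =>
        pow_ne_zero _ (sub_ne_zero.mpr hz.2)
    exact this.norm.log fun z hz => norm_ne_zero_iff.mpr (rho_ne_zero hw (Or.inl rfl) hz.2)
  have hproj : ∀ ε : ℝ, ε = 1 ∨ ε = -1 → ∀ i j,
      ContinuousOn (fun z => proj α β ε z i j) (Complex.slitPlane \ {1}) := fun ε hε i j =>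
    (continuousOn_proj hw hε i j).continuousOn.mono sdiff_subset
  have hmem : ∀ᶠ z : ℂ in 𝓝[{z | 0 < z.im}] (polar x₀ (θ 0)), z ∈ Complex.slitPlane ∧ z ≠ 1 := by
    filter_upwards [self_mem_nhdsWithin] with z hz
      using ⟨mem_slitPlane_of_im_pos hz, ne_one_of_im_pos hz⟩
  have hmem' : ∀ᶠ z : ℂ in 𝓝[{z | z.im < 0}] ((starRingEnd ℂ) (polar x₀ (θ 0))),
      z ∈ Complex.slitPlane ∧ z ≠ 1 := by
    filter_upwards [self_mem_nhdsWithin] with z hz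
    have hz' : z.im < 0 := hz
    exact ⟨mem_slitPlane_of_im_ne hz'.ne, fun h => by simp [h] at hz'⟩
  have habs : ∀ z : ℂ, z ∈ Complex.slitPlane ∧ z ≠ 1 → IsMild α β B z → ‖logRho α β z‖ ≤ B :=
    fun z hz hm => by
      rw [Real.norm_of_nonneg (logRho_pos hw hz.1 hz.2).le]; exact hm.logRho_le
  obtain ⟨B₁, hB₁⟩ := h.exists_bound hlog (C := B)
    (h1.mono fun z hz => by simpa using hz.log_le) (h2.mono fun z hz => by simpa using hz.log_le)
  obtain ⟨B₂, hB₂⟩ := h.exists_bound hrho (C := B)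
    ((hmem.and h1).mono fun z hz => habs z hz.1 hz.2)
    ((hmem'.and h2).mono fun z hz => habs z hz.1 hz.2)
  have hB₃ := fun i j => h.exists_bound (hproj 1 (Or.inl rfl) i j) (C := B)
    (h1.mono fun z hz => hz.proj_le i j) (h2.mono fun z hz => hz.proj_le i j)
  have hB₄ := fun i j => h.exists_bound (hproj (-1) (Or.inr rfl) i j) (C := B)
    (h1.mono fun z hz => hz.proj_neg_le i j) (h2.mono fun z hz => hz.proj_neg_le i j)
  choose B₃ hB₃ using hB₃
  choose B₄ hB₄ using hB₄
  have hle : ∀ (b : Fin 2 → Fin 2 → ℝ) (i j : Fin 2), b i j ≤ ∑ i, ∑ j, |b i j| := fun b i j =>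
    (le_abs_self _).trans ((Finset.single_le_sum (f := fun j => |b i j|)
      (fun j _ => abs_nonneg _) (Finset.mem_univ j)).trans
      (Finset.single_le_sum (f := fun i => ∑ j, |b i j|)
        (fun i _ => Finset.sum_nonneg fun j _ => abs_nonneg _) (Finset.mem_univ i)))
  refine ⟨max (max B₁ B₂) (max (∑ i, ∑ j, |B₃ i j|) (∑ i, ∑ j, |B₄ i j|)), fun z hz =>
    ⟨?_, ?_, fun i j => ?_, fun i j => ?_⟩⟩
  · exact le_max_of_le_left (le_max_of_le_left (by simpa using hB₁ z hz))
  · exact le_max_of_le_left (le_max_of_le_right ((le_abs_self _).trans (hB₂ z hz)))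
  · exact le_max_of_le_right (le_max_of_le_left ((hB₃ i j z hz).trans (hle _ i j)))
  · exact le_max_of_le_right (le_max_of_le_right ((hB₄ i j z hz).trans (hle _ i j)))

theorem IsSaddle.exists_isSidePath {χ η x₀ θ₀ σ : ℝ} (hs : IsSaddle α β χ η x₀ θ₀)
    (hσ : σ = 1 ∨ σ = -1) : ∃ (θ : ℝ → ℝ) (Y : ℝ), IsSidePath x₀ σ Y θ ∧ θ 0 = θ₀ ∧
      ∀ z ∈ sideSet x₀ σ Y θ, hgt α β χ η z ≤ hgt α β χ η (polar x₀ θ₀) := by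
  obtain ⟨θ, hθ, hθ0, hθy⟩ := hs.exists_angle hw (σ := σ) (by rcases hσ with rfl | rfl <;> norm_num)
  obtain ⟨X, hX⟩ := Aztec.eventually_hgt_lt hw hs.nonneg hs.eta_gt hs.eta_lt
    (hgt α β χ η (polar x₀ θ₀))
  have ha := le_abs_self x₀
  have hb := neg_abs_le x₀
  have hc := abs_nonneg X
  have hd := le_abs_self X
  have hY : 0 < |x₀| + |X| + 1 := by positivity
  have hside : IsSidePath x₀ σ (|x₀| + |X| + 1) θ := by
    refine ⟨hσ, hY, ?_, hθ, fun y hy => (hθy y hy).1⟩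
    rcases hσ with rfl | rfl <;> linarith
  refine ⟨θ, |x₀| + |X| + 1, hside, hθ0, ?_⟩
  rintro z ((⟨y, hy, rfl⟩ | ⟨y, hy, rfl⟩) | ⟨t, ht, rfl⟩)
  · exact (hθy y hy.1).2.le
  · rw [leg_neg, hgt_conj hw (mem_slitPlane_of_im_pos (hside.leg_im_pos hy.1))]
    exact (hθy y hy.1).2.le
  · have hpi := hside.theta_end.2
    refine (hX _ ?_ t ⟨by linarith [ht.1], by linarith [ht.2]⟩).le
    rcases hσ with rfl | rfl
    · exact le_trans (by linarith) (le_abs_self _)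
    · exact le_trans (by linarith) (neg_le_abs _)

end

end Aztec

end

noncomputable section

namespace Aztec

open Set

variable {k : ℕ} {α β : Fin k → ℝ}

/-! ### The two factors of the double integral -/

/-- The factor of the integrand which depends on the inner variable, on the sheet `ε`. -/
def innerTerm (α β : Fin k → ℝ) (χ η ε : ℝ) (κ' ζ' : ℤ) (n : ℕ) (w : ℂ) :
    Matrix (Fin 2) (Fin 2) ℂ :=
  (w ^ localHeight k η n ζ' / (1 - w⁻¹) ^ (k * n) *
    rho α β ε w ^ ((n : ℤ) - localTime χ n κ')) • proj α β ε w

/-- The factor of the integrand which depends on the outer variable. -/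
def outerTerm (α β : Fin k → ℝ) (χ η : ℝ) (κ ζ : ℤ) (n : ℕ) (z : ℂ) : Matrix (Fin 2) (Fin 2) ℂ :=
  ((z ^ (localHeight k η n ζ + 1))⁻¹ * (1 - z⁻¹) ^ (k * n)) •
    Phi α β z ^ (localTime χ n κ - (n : ℤ))

theorem mul_le_abs_mul (a b : ℝ) : a * b ≤ |a| * |b| := (le_abs_self _).trans (abs_mul a b).le

theorem abs_localTime_sub_le (χ : ℝ) (n : ℕ) (κ : ℤ) :
    |((localTime χ n κ - (n : ℤ) : ℤ) : ℝ)| ≤ n * |χ| + (1 + |(κ : ℝ)|) := by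
  obtain ⟨e, he, h⟩ := exists_localTime_eq χ n κ
  push_cast
  rw [h, show n * (χ + 1) + e + κ - n = n * χ + (e + κ) by ring]
  refine (abs_add_le _ _).trans (add_le_add ?_ ((abs_add_le _ _).trans (add_le_add ?_ le_rfl)))
  · rw [abs_mul, Nat.abs_cast]
  · rw [abs_of_nonneg he.1]; exact he.2.le

section

variable (hw : Admissible α β)
include hw

theorem norm_innerTerm_le {χ η ε B : ℝ} (hε : ε = 1 ∨ ε = -1) (hχ : ε * χ = |χ|) (κ' ζ' : ℤ) (n : ℕ)
    {w : ℂ} (hs : w ∈ Complex.slitPlane) (h1 : w ≠ 1) (hB : IsMild α β B w) (i j : Fin 2) :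
    ‖innerTerm α β χ η ε κ' ζ' n w i j‖ ≤ Real.exp (n * hgt α β |χ| η w) *
      (Real.exp ((1 + |(ζ' : ℝ)|) * B + (1 + |(κ' : ℝ)|) * B) * B) := by
  have h0 := Complex.slitPlane_ne_zero hs
  have hL := logRho_pos hw hs h1
  have hB0 : 0 ≤ B := (abs_nonneg _).trans hB.log_le
  obtain ⟨e₁, he₁, ht⟩ := exists_localTime_eq χ n κ'
  obtain ⟨e₂, he₂, hh⟩ := exists_localHeight_eq k η n ζ'
  set m := localTime χ n κ'
  set ξ := localHeight k η n ζ'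
  have hfac : ‖w ^ ξ / (1 - w⁻¹) ^ (k * n) * rho α β ε w ^ ((n : ℤ) - m)‖ =
      Real.exp (n * hgt α β |χ| η w + ((e₂ + ζ') * Real.log ‖w‖ -
        ε * (e₁ + κ') * logRho α β w)) := by
    have e : w ^ ξ / (1 - w⁻¹) ^ (k * n) = (w ^ (-ξ) * (1 - w⁻¹) ^ (k * n))⁻¹ := by
      rw [zpow_neg, mul_inv, inv_inv, div_eq_mul_inv]
    rw [norm_mul, e, norm_inv, norm_zpow_mul_pow h0 h1, norm_rho_zpow hw hε hs h1, ← Real.exp_neg,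
      ← Real.exp_add]
    congr 1
    rw [hgt_eq hw h1]
    push_cast
    rw [ht, hh, ← hχ]
    have hε2 : ε * ε = 1 := by rcases hε with rfl | rfl <;> norm_num
    ring
  rw [innerTerm, Matrix.smul_apply, smul_eq_mul, norm_mul, hfac, Real.exp_add, mul_assoc]
  refine mul_le_mul_of_nonneg_left ?_ (Real.exp_pos _).le
  have hproj : ‖proj α β ε w i j‖ ≤ B := by
    rcases hε with rfl | rfl
    · exact hB.proj_le i j
    · exact hB.proj_neg_le i j
  refine mul_le_mul (Real.exp_le_exp.mpr ?_) hproj (norm_nonneg _) (Real.exp_pos _).le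
  have k1 : (e₂ + ζ') * Real.log ‖w‖ ≤ (1 + |(ζ' : ℝ)|) * B := by
    refine (mul_le_abs_mul _ _).trans (mul_le_mul ((abs_add_le _ _).trans ?_) hB.log_le
      (abs_nonneg _) (by positivity))
    rw [abs_of_nonneg he₂.1]; linarith [he₂.2]
  have k2 : -(ε * (e₁ + κ')) * logRho α β w ≤ (1 + |(κ' : ℝ)|) * B := by
    refine (mul_le_abs_mul _ _).trans (mul_le_mul ?_ ?_ (abs_nonneg _) (by positivity))
    · have hε1 : |ε| = 1 := by rcases hε with rfl | rfl <;> simp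
      rw [abs_neg, abs_mul, hε1, one_mul]
      refine (abs_add_le _ _).trans ?_
      rw [abs_of_nonneg he₁.1]; linarith [he₁.2]
    · rw [abs_of_pos hL]; exact hB.logRho_le
  linarith

theorem norm_outerTerm_le {χ η R : ℝ} (κ ζ : ℤ) (n : ℕ) {z : ℂ} (hs : z ∈ Complex.slitPlane)
    (h1 : z ≠ 1) {i j : Fin 2} (hR : ‖(Phi α β z ^ (localTime χ n κ - (n : ℤ))) i j‖ ≤
      Real.exp (|((localTime χ n κ - (n : ℤ) : ℤ) : ℝ)| * logRho α β z) * R) :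
    ‖outerTerm α β χ η κ ζ n z i j‖ ≤ Real.exp (-(n * hgt α β |χ| η z) +
      ((2 + |(ζ : ℝ)|) * |Real.log ‖z‖| + (1 + |(κ : ℝ)|) * logRho α β z)) * R := by
  have h0 := Complex.slitPlane_ne_zero hs
  have hL := logRho_pos hw hs h1
  have hR0 : 0 ≤ R := nonneg_of_mul_nonneg_right ((norm_nonneg _).trans hR) (Real.exp_pos _)
  have ha := abs_localTime_sub_le χ n κ
  set a := localTime χ n κ - (n : ℤ)
  obtain ⟨e₂, he₂, hh⟩ := exists_localHeight_eq k η n ζ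
  have hfac : ‖(z ^ (localHeight k η n ζ + 1))⁻¹ * (1 - z⁻¹) ^ (k * n)‖ =
      Real.exp (-(n * hgt α β |χ| η z) + (-(e₂ + ζ + 1) * Real.log ‖z‖ -
        n * |χ| * logRho α β z)) := by
    rw [← zpow_neg, norm_zpow_mul_pow h0 h1]
    congr 1
    rw [hgt_eq hw h1]
    push_cast
    rw [hh]
    ring
  rw [outerTerm, Matrix.smul_apply, smul_eq_mul, norm_mul, hfac]
  refine (mul_le_mul_of_nonneg_left hR (Real.exp_pos _).le).trans ?_
  rw [← mul_assoc, ← Real.exp_add]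
  refine mul_le_mul_of_nonneg_right (Real.exp_le_exp.mpr ?_) hR0
  have k1 : -(e₂ + ζ + 1) * Real.log ‖z‖ ≤ (2 + |(ζ : ℝ)|) * |Real.log ‖z‖| := by
    refine (mul_le_abs_mul _ _).trans (mul_le_mul_of_nonneg_right ?_ (abs_nonneg _))
    rw [abs_neg, abs_le]
    constructor <;> linarith [neg_abs_le (ζ : ℝ), le_abs_self (ζ : ℝ), he₂.1, he₂.2]
  have k2 := mul_le_mul_of_nonneg_right ha hL.le
  linarith

theorem norm_Phi_zpow_le_of_isMild {B : ℝ} {z : ℂ} (hs : z ∈ Complex.slitPlane) (h1 : z ≠ 1)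
    (hB : IsMild α β B z) (a : ℤ) (i j : Fin 2) :
    ‖(Phi α β z ^ a) i j‖ ≤ Real.exp (|(a : ℝ)| * logRho α β z) * (2 * B) := by
  have hL := logRho_pos hw hs h1
  have hB0 : 0 ≤ B := (abs_nonneg _).trans hB.log_le
  rw [Phi_zpow hw (Or.inl rfl) (discRoot_ne_zero hw hs) (Complex.slitPlane_ne_zero hs) h1,
    Matrix.add_apply, Matrix.smul_apply, Matrix.smul_apply, smul_eq_mul, smul_eq_mul]
  have key : ∀ ε : ℝ, ε = 1 ∨ ε = -1 → ‖proj α β ε z i j‖ ≤ B →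
      ‖rho α β ε z ^ a * proj α β ε z i j‖ ≤ Real.exp (|(a : ℝ)| * logRho α β z) * B := by
    intro ε hε hp
    rw [norm_mul, norm_rho_zpow hw hε hs h1]
    refine mul_le_mul (Real.exp_le_exp.mpr ?_) hp (norm_nonneg _) (Real.exp_pos _).le
    rw [← mul_assoc]
    refine mul_le_mul_of_nonneg_right ((le_abs_self _).trans ?_) hL.le
    rw [abs_mul]
    rcases hε with rfl | rfl <;> simp
  refine (norm_add_le _ _).trans ((add_le_add (key 1 (Or.inl rfl) (hB.proj_le i j))
    (key (-1) (Or.inr rfl) (hB.proj_neg_le i j))).trans_eq (by ring))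

theorem Phi_inv {z : ℂ} (hz0 : z ≠ 0) (hz1 : z ≠ 1) :
    (Phi α β z)⁻¹ = (Phi α β z).adjugate := by
  rw [Matrix.inv_def, det_Phi hw hz0 hz1]
  simp

theorem norm_Phi_zpow_le {D : ℝ} {z : ℂ} (hs : z ∈ Complex.slitPlane) (h1 : z ≠ 1)
    (hD : ∀ i j, ‖symbol α β z i j‖ ≤ D * ‖lam α β 1 z‖) (a : ℤ) (i j : Fin 2) :
    ‖(Phi α β z ^ a) i j‖ ≤ Real.exp (|(a : ℝ)| * logRho α β z) * (1 + |(a : ℝ)| * (D + 1)) := by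
  have h0 := Complex.slitPlane_ne_zero hs
  have hL := logRho_pos hw hs h1
  have hle : ‖rho α β (-1) z‖ ≤ ‖rho α β 1 z‖ := by
    rw [norm_rho hw (Or.inr rfl) hs h1, norm_rho hw (Or.inl rfl) hs h1]
    exact Real.exp_le_exp.mpr (by linarith)
  have hPhi : ∀ i j, ‖Phi α β z i j‖ ≤ D * ‖rho α β 1 z‖ := by
    intro i j
    rw [Phi_eq hw.2 hw.3 h0 h1, Matrix.smul_apply, smul_eq_mul, norm_mul, rho, norm_div, norm_inv,
      ← mul_div_assoc, inv_mul_eq_div]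
    exact div_le_div_of_nonneg_right (hD i j) (norm_nonneg _)
  have hsub : ∀ M : Matrix (Fin 2) (Fin 2) ℂ, (∀ i j, ‖M i j‖ ≤ D * ‖rho α β 1 z‖) →
      ∀ i j, ‖(M - rho α β (-1) z • 1) i j‖ ≤ (D + 1) * ‖rho α β 1 z‖ := by
    intro M hM i j
    rw [Matrix.sub_apply, Matrix.smul_apply, smul_eq_mul]
    refine (norm_sub_le _ _).trans ?_
    rw [norm_mul]
    have h2 := mul_le_mul hle (norm_one_apply_le i j) (norm_nonneg _) (norm_nonneg _)
    linarith [hM i j]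
  have hadd := rho_add hw 1 h0 h1
  have hmul := rho_mul hw (Or.inl rfl) h1
  have hpow : ∀ M : Matrix (Fin 2) (Fin 2) ℂ, (∀ i j, ‖M i j‖ ≤ D * ‖rho α β 1 z‖) →
      M.trace = (Phi α β z).trace → M.det = 1 → ∀ m : ℕ,
      ‖(M ^ m) i j‖ ≤ Real.exp (|(m : ℝ)| * logRho α β z) * (1 + |(m : ℝ)| * (D + 1)) := by
    intro M hM htr hdet m
    have := norm_pow_apply_le hle (hadd.trans htr.symm) (hmul.trans hdet.symm) (hsub M hM) m i j
    rwa [norm_rho hw (Or.inl rfl) hs h1, one_mul, ← Real.exp_nat_mul, ← Nat.abs_cast m] at this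
  obtain ⟨m, rfl | rfl⟩ := a.eq_nat_or_neg
  · rw [zpow_natCast, Int.cast_natCast]
    exact hpow _ hPhi rfl (det_Phi hw h0 h1) m
  · rw [Matrix.zpow_neg_natCast, ← Matrix.inv_pow', Phi_inv hw h0 h1, Int.cast_neg, abs_neg,
      Int.cast_natCast]
    refine hpow _ (fun i j => ?_) ?_ ?_ m
    · rw [Matrix.adjugate_fin_two]
      fin_cases i <;> fin_cases j <;> simp [hPhi]
    · rw [Matrix.adjugate_fin_two, Matrix.trace_fin_two, Matrix.trace_fin_two]
      simp [add_comm]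
    · rw [Matrix.det_adjugate, det_Phi hw h0 h1, one_pow]

/-- Uniform comparison of the symbol with its larger eigenvalue on circles. -/
theorem exists_symbol_le_on_circle {r : ℝ} (hr : 0 < r) : ∃ D B : ℝ, 0 ≤ D ∧ 0 ≤ B ∧
    ∀ z ∈ Complex.slitPlane, ‖z‖ = r →
      (∀ i j, ‖symbol α β z i j‖ ≤ D * ‖lam α β 1 z‖) ∧ |Real.log ‖lam α β 1 z‖| ≤ B := by
  set K : Set ℂ := Metric.sphere 0 r ∩ {z | 0 ≤ z.im} with hK
  have hKc : IsCompact K := (isCompact_sphere 0 r).inter_right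
    (isClosed_le continuous_const Complex.continuous_im)
  have hKne : ∀ z ∈ K, lam α β 1 z ≠ 0 := fun z hz =>
    lam_one_ne_zero_of_ne_zero hw (norm_pos_iff.mp (by
      have := hz.1; rw [mem_sphere_zero_iff_norm] at this; rw [this]; exact hr))
  have hlam : ContinuousOn (lam α β 1) K := continuousOn_lam.mono inter_subset_right
  have hs : ∀ i j, ContinuousOn (fun z => symbol α β z i j / lam α β 1 z) K := fun i j =>
    (Polynomial.differentiable_aeval _).continuous.continuousOn.div hlam hKne
  have hD := fun i j => hKc.exists_bound_of_continuousOn (hs i j)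
  choose D hD using hD
  obtain ⟨B, hB⟩ := hKc.exists_bound_of_continuousOn
    (hlam.norm.log fun z hz => norm_ne_zero_iff.mpr (hKne z hz))
  set D' := ∑ i, ∑ j, |D i j| with hD'
  have hle : ∀ i j, D i j ≤ D' := fun i j =>
    (le_abs_self _).trans ((Finset.single_le_sum (f := fun j => |D i j|)
      (fun j _ => abs_nonneg _) (Finset.mem_univ j)).trans
      (Finset.single_le_sum (f := fun i => ∑ j, |D i j|)
        (fun i _ => Finset.sum_nonneg fun j _ => abs_nonneg _) (Finset.mem_univ i)))
  have hup : ∀ z ∈ K, (∀ i j, ‖symbol α β z i j‖ ≤ D' * ‖lam α β 1 z‖) ∧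
      |Real.log ‖lam α β 1 z‖| ≤ |B| := fun z hz => by
    refine ⟨fun i j => ?_, (hB z hz).trans (le_abs_self B)⟩
    have := (hD i j z hz).trans (hle i j)
    rwa [norm_div, div_le_iff₀ (norm_pos_iff.mpr (hKne z hz))] at this
  refine ⟨D', |B|, Finset.sum_nonneg fun i _ => Finset.sum_nonneg fun j _ => abs_nonneg _,
    abs_nonneg _, fun z hz hzr => ?_⟩
  rcases le_or_gt 0 z.im with him | him
  · exact hup z ⟨by simpa using hzr, him⟩
  · have := hup ((starRingEnd ℂ) z) ⟨by simpa using hzr, by simpa using him.le⟩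
    simpa only [symbol_conj, lam_conj hw _ hz, Complex.norm_conj] using this

end

end Aztec

end

noncomputable section

namespace Aztec

open Set

variable {k : ℕ} {α β : Fin k → ℝ}

/-! ### The outer factor as a Laurent polynomial -/

theorem exists_laurent_of_polynomial (Q : ℂ[X]) (t : ℤ) : ∃ (s : Finset ℤ) (c : ℤ → ℂ),
    ∀ z : ℂ, z ≠ 0 → z ^ t * Q.eval z = ∑ j ∈ s, c j * z ^ j := by
  refine ⟨(Finset.range (Q.natDegree + 1)).image fun i : ℕ => (i : ℤ) + t,
    fun j => Q.coeff (j - t).toNat, fun z hz => ?_⟩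
  rw [Finset.sum_image (fun a _ b _ h => by simpa using h), Polynomial.eval_eq_sum_range,
    Finset.mul_sum]
  refine Finset.sum_congr rfl fun i _ => ?_
  simp only [add_sub_cancel_right, Int.toNat_natCast]
  rw [zpow_add₀ hz, zpow_natCast]
  ring

section

variable (hw : Admissible α β)
include hw

theorem exists_polynomial_Phi_zpow (a : ℤ) : ∃ P : Fin 2 → Fin 2 → ℂ[X], ∀ z : ℂ, z ≠ 0 → z ≠ 1 →
    ∀ i j, (Phi α β z ^ a) i j = (P i j).eval z / (z - 1) ^ (k * a.natAbs) := by
  have key : ∀ (S : Matrix (Fin 2) (Fin 2) ℝ[X]) (m : ℕ), ∃ P : Fin 2 → Fin 2 → ℂ[X],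
      ∀ z : ℂ, ∀ i j, ((((z - 1) ^ k)⁻¹ • evalMatrix z S) ^ m) i j =
        (P i j).eval z / (z - 1) ^ (k * m) := by
    intro S m
    refine ⟨fun i j => ((S ^ m) i j).map (algebraMap ℝ ℂ), fun z i j => ?_⟩
    rw [_root_.smul_pow, ← map_pow, Matrix.smul_apply, evalMatrix_apply, smul_eq_mul, inv_pow, ← pow_mul,
      Polynomial.eval_map_algebraMap, inv_mul_eq_div]
  obtain ⟨m, rfl | rfl⟩ := a.eq_nat_or_neg
  · obtain ⟨P, hP⟩ := key (symbolPoly α β) m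
    refine ⟨P, fun z h0 h1 i j => ?_⟩
    rw [zpow_natCast, Phi_eq hw.2 hw.3 h0 h1, Int.natAbs_natCast]
    exact hP z i j
  · obtain ⟨P, hP⟩ := key (symbolPoly α β).adjugate m
    refine ⟨P, fun z h0 h1 i j => ?_⟩
    rw [Matrix.zpow_neg_natCast, ← Matrix.inv_pow', Phi_inv hw h0 h1, Phi_eq hw.2 hw.3 h0 h1,
      Matrix.adjugate_smul, Int.natAbs_neg, Int.natAbs_natCast, Fintype.card_fin, ← hP z i j]
    have : (symbol α β z).adjugate = evalMatrix z (symbolPoly α β).adjugate :=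
      ((aeval (R := ℝ) z).toRingHom.map_adjugate _).symm
    rw [this]
    simp

omit hw in
theorem one_sub_inv_pow_mul {z : ℂ} (h0 : z ≠ 0) (N : ℕ) :
    (1 - z⁻¹) ^ N = z ^ (-(N : ℤ)) * (z - 1) ^ N := by
  have e : 1 - z⁻¹ = (z - 1) / z := by field_simp
  rw [e, div_pow, zpow_neg, zpow_natCast, div_eq_inv_mul]

omit hw in
theorem eventually_abs_localTime_le {χ : ℝ} (hχ : |χ| < 1) (κ : ℤ) :
    ∀ᶠ n : ℕ in atTop, (localTime χ n κ - (n : ℤ)).natAbs ≤ n := by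
  have h : Tendsto (fun n : ℕ => (1 - |χ|) * (n : ℝ)) atTop atTop :=
    tendsto_natCast_atTop_atTop.const_mul_atTop (by linarith)
  filter_upwards [h.eventually_ge_atTop (1 + |(κ : ℝ)|)] with n hn
  have h1 := abs_localTime_sub_le χ n κ
  have h2 : ((localTime χ n κ - (n : ℤ)).natAbs : ℝ) ≤ n := by
    rw [Nat.cast_natAbs, Int.cast_abs]; linarith
  exact_mod_cast h2

theorem exists_laurent_outerTerm {χ η : ℝ} (hχ : |χ| < 1) (κ ζ : ℤ) (i j : Fin 2) :
    ∃ (s : ℕ → Finset ℤ) (c : ℕ → ℤ → ℂ), ∀ᶠ n in atTop, ∀ z : ℂ, z ≠ 0 → z ≠ 1 →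
      outerTerm α β χ η κ ζ n z i j = ∑ m ∈ s n, c n m * z ^ m := by
  have h : ∀ n : ℕ, ∃ (s : Finset ℤ) (c : ℤ → ℂ), (localTime χ n κ - (n : ℤ)).natAbs ≤ n →
      ∀ z : ℂ, z ≠ 0 → z ≠ 1 → outerTerm α β χ η κ ζ n z i j = ∑ m ∈ s, c m * z ^ m := by
    intro n
    set a := localTime χ n κ - (n : ℤ) with ha
    obtain ⟨P, hP⟩ := exists_polynomial_Phi_zpow hw a
    obtain ⟨s, c, hsc⟩ := exists_laurent_of_polynomial ((X - 1) ^ (k * n - k * a.natAbs) * P i j)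
      (-(localHeight k η n ζ + 1) + -((k * n : ℕ) : ℤ))
    refine ⟨s, c, fun hle z h0 h1 => ?_⟩
    have h2 : (z - 1) ^ (k * a.natAbs) ≠ 0 := pow_ne_zero _ (sub_ne_zero.mpr h1)
    have h3 : (z - 1) ^ (k * n) = (z - 1) ^ (k * n - k * a.natAbs) * (z - 1) ^ (k * a.natAbs) := by
      rw [← pow_add, Nat.sub_add_cancel (Nat.mul_le_mul_left k hle)]
    rw [← hsc z h0, outerTerm, Matrix.smul_apply, hP z h0 h1, one_sub_inv_pow_mul h0, h3,
      ← zpow_neg, zpow_add₀ h0, Polynomial.eval_mul, Polynomial.eval_pow]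
    simp only [Polynomial.eval_sub, Polynomial.eval_X, Polynomial.eval_one, smul_eq_mul]
    field_simp
  choose s c h using h
  exact ⟨s, c, (eventually_abs_localTime_le hχ κ).mono fun n hn => h n hn⟩

/-! ### The outer factor on the circle through the saddle point -/

theorem exists_norm_outerTerm_le {χ η x₀ : ℝ} (hχ : |χ| < 1) (κ ζ : ℤ) : ∃ n₀ C : ℝ, 0 ≤ n₀ ∧
    0 ≤ C ∧ ∀ (n : ℕ), ∀ z ∈ Complex.slitPlane, z ≠ 1 → ‖z‖ = Real.exp x₀ → ∀ i j,
      ‖outerTerm α β χ η κ ζ n z i j‖ ≤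
        C * ((1 + n) * Real.exp (-((n - n₀) * hgt α β |χ| η z))) := by
  obtain ⟨D, B, hD, hB, hDB⟩ := exists_symbol_le_on_circle hw (Real.exp_pos x₀)
  have hE : 1 ≤ 1 + |(κ : ℝ)| := by linarith [abs_nonneg (κ : ℝ)]
  set E := 1 + |(κ : ℝ)|
  set n₀ := E / (1 - |χ|) with hn₀
  have hpos : 0 < 1 - |χ| := by linarith
  have hn₀0 : 0 ≤ n₀ := by positivity
  have hn₀E : n₀ * (1 - |χ|) = E := div_mul_cancel₀ _ hpos.ne'
  set C₁ := (2 + |(ζ : ℝ)|) * |x₀| + (E + n₀ * |χ|) * B + |n₀ * (k * (η + 1) / 2 * x₀)| with hC₁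
  refine ⟨n₀, Real.exp C₁ * (1 + E * (D + 1)), hn₀0, by positivity, fun n z hs h1 hz i j => ?_⟩
  obtain ⟨hsym, hlam⟩ := hDB z hs hz
  have hlog : Real.log ‖z‖ = x₀ := by rw [hz, Real.log_exp]
  have ha := abs_localTime_sub_le χ n κ
  have hn0 : (0 : ℝ) ≤ n := Nat.cast_nonneg n
  have haE : |((localTime χ n κ - (n : ℤ) : ℤ) : ℝ)| ≤ (1 + n) * E := by
    refine ha.trans ?_
    have := mul_le_mul_of_nonneg_left hχ.le hn0
    have := mul_le_mul_of_nonneg_left hE hn0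
    linarith
  have hnorm := norm_outerTerm_le hw (χ := χ) (η := η) κ ζ n hs h1 (i := i) (j := j)
    (norm_Phi_zpow_le hw hs h1 hsym _ i j)
  refine hnorm.trans ?_
  rw [hlog]
  have hexp : -(n * hgt α β |χ| η z) + ((2 + |(ζ : ℝ)|) * |x₀| + E * logRho α β z) ≤
      -((n - n₀) * hgt α β |χ| η z) + C₁ := by
    have h2 : E * logRho α β z - n₀ * hgt α β |χ| η z =
        (E + n₀ * |χ|) * Real.log ‖lam α β 1 z‖ - n₀ * (k * (η + 1) / 2 * x₀) := by
      rw [logRho_eq hw h1, hgt, hlog, ← hn₀E]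
      ring
    have h3 : (E + n₀ * |χ|) * Real.log ‖lam α β 1 z‖ ≤ (E + n₀ * |χ|) * B :=
      mul_le_mul_of_nonneg_left ((le_abs_self _).trans hlam) (by positivity)
    have h4 := neg_abs_le (n₀ * (k * (η + 1) / 2 * x₀))
    rw [hC₁]
    linarith
  have hR : 1 + |((localTime χ n κ - (n : ℤ) : ℤ) : ℝ)| * (D + 1) ≤ (1 + n) * (1 + E * (D + 1)) := by
    have := mul_le_mul_of_nonneg_right haE (show 0 ≤ D + 1 by linarith)
    linarith
  refine (mul_le_mul (Real.exp_le_exp.mpr hexp) hR (by positivity) (Real.exp_pos _).le).trans_eq ?_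
  rw [Real.exp_add]
  ring

omit hw in
theorem tendsto_one_add_mul_exp {δ : ℝ} (hδ : 0 < δ) :
    Tendsto (fun n : ℕ => (1 + (n : ℝ)) * Real.exp (-(n * δ))) atTop (𝓝 0) := by
  have h1 := tendsto_self_mul_const_pow_of_lt_one (Real.exp_pos (-δ)).le
    (Real.exp_lt_one_iff.mpr (neg_lt_zero.mpr hδ))
  have h2 := tendsto_pow_atTop_nhds_zero_of_lt_one (Real.exp_pos (-δ)).le
    (Real.exp_lt_one_iff.mpr (neg_lt_zero.mpr hδ))
  have := h2.add h1
  rw [add_zero] at this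
  refine this.congr fun n => ?_
  rw [← Real.exp_nat_mul, mul_neg]
  ring

section Circle

variable {χ η x₀ θ₀ : ℝ} (hs : IsSaddle α β |χ| η x₀ θ₀)
  (hproj : ∃ C, ∀ᶠ z : ℂ in 𝓝[{z | 0 < z.im}] (polar x₀ θ₀), ∀ i j, ‖proj α β 1 z i j‖ ≤ C)

omit hw in
theorem exists_polar_of_norm_eq {z : ℂ} (hz : ‖z‖ = Real.exp x₀) (him : z.im ≠ 0) :
    ∃ φ ∈ Ioo 0 Real.pi, z = polar x₀ φ ∨ z = (starRingEnd ℂ) (polar x₀ φ) := by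
  have key : ∀ z : ℂ, ‖z‖ = Real.exp x₀ → 0 < z.im → ∃ φ ∈ Ioo 0 Real.pi, z = polar x₀ φ := by
    intro z hz him
    refine ⟨z.arg, ⟨lt_of_le_of_ne (Complex.arg_nonneg_iff.mpr him.le) fun h => ?_,
      Complex.arg_lt_pi_iff.mpr (Or.inr him.ne')⟩, eq_polar hz⟩
    exact him.ne' (Complex.arg_eq_zero_iff.mp h.symm).2
  rcases lt_or_gt_of_ne him with h | h
  · obtain ⟨φ, hφ, he⟩ := key ((starRingEnd ℂ) z) (by simpa using hz) (by simpa using h)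
    exact ⟨φ, hφ, Or.inr (by rw [← he, Complex.conj_conj])⟩
  · obtain ⟨φ, hφ, he⟩ := key z hz h
    exact ⟨φ, hφ, Or.inl he⟩

include hs in
theorem tendsto_exp_mul_outerTerm (κ ζ : ℤ) {φ : ℝ} (hφ : φ ∈ Ioo 0 Real.pi) (hne : φ ≠ θ₀) {z : ℂ}
    (hz : z = polar x₀ φ ∨ z = (starRingEnd ℂ) (polar x₀ φ)) (i j : Fin 2) :
    Tendsto (fun n : ℕ => (Real.exp (n * hgt α β |χ| η (polar x₀ θ₀)) : ℂ) *
      outerTerm α β χ η κ ζ n z i j) atTop (𝓝 0) := by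
  obtain ⟨n₀, C, hn₀, hC, hb⟩ := exists_norm_outerTerm_le hw (η := η) (x₀ := x₀) hs.lt_one κ ζ
  set c := hgt α β |χ| η (polar x₀ θ₀)
  have hup := polar_im_pos x₀ hφ
  have hzr : ‖z‖ = Real.exp x₀ := by
    rcases hz with rfl | rfl
    · exact norm_polar _ _
    · rw [Complex.norm_conj, norm_polar]
  have hsl : z ∈ Complex.slitPlane ∧ z ≠ 1 ∧ hgt α β |χ| η z = hgt α β |χ| η (polar x₀ φ) := by
    rcases hz with rfl | rfl
    · exact ⟨mem_slitPlane_of_im_pos hup, ne_one_of_im_pos hup, rfl⟩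
    · exact ⟨mem_slitPlane_of_im_ne (by simpa using hup.ne'), fun h => by
        have := congrArg Complex.im h
        simp only [Complex.conj_im, Complex.one_im] at this
        linarith, hgt_conj hw (mem_slitPlane_of_im_pos hup)⟩
  have hlt : c < _ := hs.lt_hgt hw hφ hne
  set h := hgt α β |χ| η (polar x₀ φ)
  have hT := (tendsto_one_add_mul_exp (sub_pos.mpr hlt)).const_mul (C * Real.exp (n₀ * h))
  rw [mul_zero] at hT
  refine squeeze_zero_norm (fun n => ?_) hT
  rw [norm_mul, Complex.norm_real, Real.norm_of_nonneg (Real.exp_pos _).le]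
  refine (mul_le_mul_of_nonneg_left (hb n z hsl.1 hsl.2.1 hzr i j) (Real.exp_pos _).le).trans_eq ?_
  rw [hsl.2.2, show -(((n : ℝ) - n₀) * h) = n₀ * h + (-(n * c) + -(n * (h - c))) by ring,
    Real.exp_add, Real.exp_add, Real.exp_neg (n * c)]
  field_simp

include hs hproj in
theorem exists_exp_mul_outerTerm_le (κ ζ : ℤ) (i j : Fin 2) : ∃ C : ℝ, ∀ᶠ n : ℕ in atTop,
    ∀ φ ∈ Ioo 0 Real.pi, ∀ z : ℂ, (z = polar x₀ φ ∨ z = (starRingEnd ℂ) (polar x₀ φ)) →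
      ‖(Real.exp (n * hgt α β |χ| η (polar x₀ θ₀)) : ℂ) * outerTerm α β χ η κ ζ n z i j‖ ≤ C := by
  obtain ⟨n₀, C, hn₀, hC, hb⟩ := exists_norm_outerTerm_le hw (η := η) (x₀ := x₀) hs.lt_one κ ζ
  obtain ⟨B, hB0, hB, -⟩ := eventually_isMild hw hs.theta_pos hs.theta_le hproj
  obtain ⟨ε, hε, hball⟩ := Metric.mem_nhdsWithin_iff.mp hB
  have hcont : ContinuousAt (polar x₀) θ₀ := by
    have : Continuous (polar x₀) := (contDiff_arc x₀).continuous
    exact this.continuousAt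
  obtain ⟨ε', hε', hball'⟩ := Metric.continuousAt_iff.mp hcont ε hε
  obtain ⟨δ, hδ, hgap⟩ := hs.exists_gap hw hε'
  set c := hgt α β |χ| η (polar x₀ θ₀) with hc
  set C' := Real.exp ((2 + |(ζ : ℝ)|) * B + (1 + |(κ : ℝ)|) * B) * (2 * B) with hC'
  have hT := (tendsto_one_add_mul_exp hδ).const_mul (C * Real.exp (n₀ * (c + δ)))
  rw [mul_zero] at hT
  refine ⟨max 1 C', ?_⟩
  filter_upwards [hT.eventually (ge_mem_nhds zero_lt_one),
    tendsto_natCast_atTop_atTop.eventually_ge_atTop n₀] with n hn hnn₀ φ hφ z hz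
  have hup := polar_im_pos x₀ hφ
  have hzr : ‖z‖ = Real.exp x₀ := by
    rcases hz with rfl | rfl
    · exact norm_polar _ _
    · rw [Complex.norm_conj, norm_polar]
  have hsl : z ∈ Complex.slitPlane ∧ z ≠ 1 ∧ hgt α β |χ| η z = hgt α β |χ| η (polar x₀ φ) := by
    rcases hz with rfl | rfl
    · exact ⟨mem_slitPlane_of_im_pos hup, ne_one_of_im_pos hup, rfl⟩
    · exact ⟨mem_slitPlane_of_im_ne (by simpa using hup.ne'), fun h => by
        have := congrArg Complex.im h
        simp only [Complex.conj_im, Complex.one_im] at this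
        linarith, hgt_conj hw (mem_slitPlane_of_im_pos hup)⟩
  have hle := hs.le_hgt hw hφ
  rw [norm_mul, Complex.norm_real, Real.norm_of_nonneg (Real.exp_pos _).le]
  rcases lt_or_ge |φ - θ₀| ε' with hnear | hfar
  · refine le_max_of_le_right ?_
    have hm : IsMild α β B (polar x₀ φ) := hball ⟨hball' (by rwa [Real.dist_eq]), hup⟩
    have hmz : IsMild α β B z := by
      rcases hz with rfl | rfl
      · exact hm
      · exact hm.conj hw (mem_slitPlane_of_im_pos hup)
    have h1 := norm_outerTerm_le hw (χ := χ) (η := η) κ ζ n hsl.1 hsl.2.1 (i := i) (j := j)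
      (norm_Phi_zpow_le_of_isMild hw hsl.1 hsl.2.1 hmz _ i j)
    refine (mul_le_mul_of_nonneg_left h1 (Real.exp_pos _).le).trans ?_
    rw [← mul_assoc, ← Real.exp_add, hsl.2.2]
    refine mul_le_mul_of_nonneg_right (Real.exp_le_exp.mpr ?_) (by linarith)
    have h2 := mul_le_mul_of_nonneg_left hmz.log_le (show 0 ≤ 2 + |(ζ : ℝ)| by positivity)
    have h3 := mul_le_mul_of_nonneg_left hmz.logRho_le (show 0 ≤ 1 + |(κ : ℝ)| by positivity)
    have h4 := mul_le_mul_of_nonneg_left hle (Nat.cast_nonneg (α := ℝ) n)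
    linarith
  · refine le_max_of_le_left (le_trans ?_ hn)
    refine (mul_le_mul_of_nonneg_left (hb n z hsl.1 hsl.2.1 hzr i j) (Real.exp_pos _).le).trans ?_
    rw [hsl.2.2]
    have h5 := hgap φ hφ hfar
    have h6 : n * c + -((n - n₀) * hgt α β |χ| η (polar x₀ φ)) ≤ n₀ * (c + δ) + -(n * δ) := by
      have := mul_le_mul_of_nonneg_left h5 (sub_nonneg.mpr hnn₀)
      linarith
    calc Real.exp (n * c) * (C * ((1 + n) * Real.exp (-((n - n₀) * hgt α β |χ| η (polar x₀ φ)))))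
        = C * (1 + n) * Real.exp (n * c + -((n - n₀) * hgt α β |χ| η (polar x₀ φ))) := by
          rw [Real.exp_add]; ring
      _ ≤ C * (1 + n) * Real.exp (n₀ * (c + δ) + -(n * δ)) := by gcongr
      _ = _ := by rw [Real.exp_add]; ring

end Circle

end

end Aztec

end

noncomputable section

namespace Aztec

open Set

variable {k : ℕ} {α β : Fin k → ℝ}

/-! ### The outer integral -/

/-- The polynomial part of a Laurent polynomial. -/
def regularPart (s : Finset ℤ) (c : ℤ → ℂ) (w : ℂ) : ℂ := ∑ m ∈ s with ¬ m < 0, c m * w ^ m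

theorem sum_eq_add_regularPart (s : Finset ℤ) (c : ℤ → ℂ) (w : ℂ) :
    ∑ m ∈ s, c m * w ^ m = (∑ m ∈ s with m < 0, c m * w ^ m) + regularPart s c w :=
  (Finset.sum_filter_add_sum_filter_not s (· < 0) _).symm

theorem differentiableOn_regularPart (s : Finset ℤ) (c : ℤ → ℂ) :
    DifferentiableOn ℂ (regularPart s c) {0}ᶜ :=
  DifferentiableOn.fun_sum fun _ _ => (differentiableOn_id.zpow (Or.inl fun _ hz => hz)).const_mul _

theorem IsLoop.integral_eq_regularPart {γ : ℝ → ℂ} (hγ : IsLoop γ) (h0 : Encircles γ 0) {w : ℂ}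
    (hw0 : w ≠ 0) (hw : Encircles γ w) (s : Finset ℤ) (c : ℤ → ℂ) :
    pathIntegral γ (fun z => (∑ m ∈ s, c m * z ^ m) / (z - w)) =
      2 * Real.pi * Complex.I * regularPart s c w := by
  rw [hγ.integral_laurent_div_sub h0.1 hw0 hw.1, h0.2, hw.2, sum_eq_add_regularPart]
  ring

theorem circleIntegral_eq_regularPart {r : ℝ} (hr : 0 < r) {w : ℂ} (hw0 : w ≠ 0) (hwr : ‖w‖ < r)
    (s : Finset ℤ) (c : ℤ → ℂ) : (∮ z in C(0, r), (∑ m ∈ s, c m * z ^ m) / (z - w)) =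
      2 * Real.pi * Complex.I * regularPart s c w := by
  rw [← pathIntegral_circ]
  refine (isLoop_circ r).integral_eq_regularPart ⟨fun h => ?_, windingNumber_circ_of_lt (by simpa)⟩
    hw0 ⟨fun h => ?_, windingNumber_circ_of_lt hwr⟩ s c
  · have := norm_of_mem_curveImage_circ hr.le h
    rw [norm_zero] at this
    exact hr.ne this
  · exact hwr.ne (norm_of_mem_curveImage_circ hr.le h)

theorem circleIntegral_eq_regularPart_sub {r : ℝ} (hr : 0 < r) {w : ℂ} (hw0 : w ≠ 0)
    (hwr : r < ‖w‖) (s : Finset ℤ) (c : ℤ → ℂ) :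
    (∮ z in C(0, r), (∑ m ∈ s, c m * z ^ m) / (z - w)) =
      2 * Real.pi * Complex.I * (regularPart s c w - ∑ m ∈ s, c m * w ^ m) := by
  rw [← pathIntegral_circ, (isLoop_circ r).integral_laurent_div_sub (fun h => ?_) hw0 (fun h => ?_),
    windingNumber_circ_of_lt (a := 0) (by simpa), windingNumber_circ_of_gt hr.le hwr,
    sum_eq_add_regularPart]
  · ring
  · have := norm_of_mem_curveImage_circ hr.le h
    rw [norm_zero] at this
    exact hr.ne this
  · exact hwr.ne' (norm_of_mem_curveImage_circ hr.le h)

section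

variable (hw : Admissible α β)
include hw

section Circle

variable {χ η x₀ θ₀ : ℝ} (hs : IsSaddle α β |χ| η x₀ θ₀)
  (hproj : ∃ C, ∀ᶠ z : ℂ in 𝓝[{z | 0 < z.im}] (polar x₀ θ₀), ∀ i j, ‖proj α β 1 z i j‖ ≤ C)

include hs hproj in
theorem eventually_norm_circleIntegral_outerTerm_le (κ ζ : ℤ) (i j : Fin 2) {s : ℕ → Finset ℤ}
    {c : ℕ → ℤ → ℂ} (hsc : ∀ᶠ n in atTop, ∀ z : ℂ, z ≠ 0 → z ≠ 1 →
      outerTerm α β χ η κ ζ n z i j = ∑ m ∈ s n, c n m * z ^ m) {δ : ℝ} (hδ : 0 < δ) :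
    ∀ᶠ n : ℕ in atTop, ∀ w : ℂ, w ≠ 0 → ‖w‖ ≠ Real.exp x₀ →
      ‖∮ z in C(0, Real.exp x₀), (∑ m ∈ s n, c n m * z ^ m) / (z - w)‖ ≤
        Real.exp (-(n * hgt α β |χ| η (polar x₀ θ₀))) * (δ * (√|‖w‖ - Real.exp x₀|)⁻¹) := by
  set r := Real.exp x₀ with hr
  have hr0 : 0 < r := Real.exp_pos _
  set h₀ := hgt α β |χ| η (polar x₀ θ₀)
  set S : Set ℂ := {(r : ℂ), -(r : ℂ), polar x₀ θ₀, (starRingEnd ℂ) (polar x₀ θ₀)} with hS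
  have hcase : ∀ z : ℂ, ‖z‖ = r → z ∉ S → z ≠ 0 ∧ z ≠ 1 ∧ ∃ φ ∈ Ioo 0 Real.pi, φ ≠ θ₀ ∧
      (z = polar x₀ φ ∨ z = (starRingEnd ℂ) (polar x₀ φ)) := by
    intro z hz hzS
    simp only [hS, mem_insert_iff, mem_singleton_iff, not_or] at hzS
    have him : z.im ≠ 0 := by
      intro him
      have h1 : |z.re| = r := by rw [Complex.abs_re_eq_norm.mpr him, hz]
      rcases (abs_eq hr0.le).mp h1 with h2 | h2
      · exact hzS.1 (Complex.ext (by simpa using h2) (by simpa using him))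
      · exact hzS.2.1 (Complex.ext (by simpa using h2) (by simpa using him))
    obtain ⟨φ, hφ, hzφ⟩ := exists_polar_of_norm_eq hz him
    refine ⟨fun h => him (by simp [h]), fun h => him (by simp [h]), φ, hφ, ?_, hzφ⟩
    rintro rfl
    rcases hzφ with h | h
    · exact hzS.2.2.1 h
    · exact hzS.2.2.2 h
  obtain ⟨C, hC⟩ := exists_exp_mul_outerTerm_le hw hs hproj κ ζ i j
  have hmain := eventually_norm_circleIntegral_div_sub_le hr0
    (g := fun n z => (Real.exp (n * h₀) : ℂ) * ∑ m ∈ s n, c n m * z ^ m) (S := S) (C := C)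
    (Eventually.of_forall fun n => continuousOn_const.mul (continuousOn_finsetSum _ fun m _ =>
      continuousOn_const.mul (continuousOn_id.zpow₀ m fun z hz => Or.inl fun h => by
        have h' : z = 0 := h
        simp [h', hr0.ne] at hz)))
    ((Set.toFinite S).countable) (by
      filter_upwards [hsc, hC] with n h1 h2 z hz hzS
      obtain ⟨h3, h4, φ, hφ, -, hzφ⟩ := hcase z hz hzS
      rw [← h1 z h3 h4]
      exact h2 φ hφ z hzφ)
    (fun z hz hzS => by
      obtain ⟨h3, h4, φ, hφ, hne, hzφ⟩ := hcase z hz hzS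
      refine (tendsto_exp_mul_outerTerm hw hs κ ζ hφ hne hzφ i j).congr' ?_
      filter_upwards [hsc] with n h1
      rw [h1 z h3 h4]) hδ
  filter_upwards [hmain] with n hn w hw0 hwr
  have h1 := hn w hw0 hwr
  have h2 : (∮ z in C(0, r), (Real.exp (n * h₀) : ℂ) * (∑ m ∈ s n, c n m * z ^ m) / (z - w)) =
      (Real.exp (n * h₀) : ℂ) * ∮ z in C(0, r), (∑ m ∈ s n, c n m * z ^ m) / (z - w) := by
    rw [← circleIntegral.integral_const_mul]
    simp only [mul_div_assoc]
  rw [h2, norm_mul, Complex.norm_real, Real.norm_of_nonneg (Real.exp_pos _).le] at h1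
  rw [Real.exp_neg, ← div_eq_inv_mul, le_div_iff₀ (Real.exp_pos _), mul_comm]
  exact h1

end Circle

/-! ### Local boundedness and poles of the inner factor -/

theorem exists_eventually_hgt_le {χ η x₀ θ₀ B : ℝ} (hχ : 0 ≤ χ) (h0 : 0 < θ₀) (h1 : θ₀ ≤ Real.pi) :
    ∃ H : ℝ, (∀ᶠ z : ℂ in 𝓝[{z | 0 < z.im}] (polar x₀ θ₀), IsMild α β B z → hgt α β χ η z ≤ H) ∧
      ∀ᶠ z : ℂ in 𝓝[{z | z.im < 0}] ((starRingEnd ℂ) (polar x₀ θ₀)),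
        IsMild α β B z → hgt α β χ η z ≤ H := by
  set z₀ := polar x₀ θ₀ with hz₀
  have hz1 : z₀ ≠ 1 := polar_ne_one h0 h1
  have hz1' : (starRingEnd ℂ) z₀ ≠ 1 := fun h => hz1 (by
    rw [← Complex.conj_conj z₀, h, map_one])
  have key : ∀ a : ℂ, a ≠ 1 → ‖a - 1‖ = ‖z₀ - 1‖ →
      ∀ᶠ z : ℂ in 𝓝 a, -Real.log ‖z - 1‖ ≤ |Real.log ‖z₀ - 1‖| + 1 := by
    intro a ha hn
    have hc : ContinuousAt (fun z : ℂ => -Real.log ‖z - 1‖) a := by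
      have : ContinuousAt (fun z : ℂ => ‖z - 1‖) a := by fun_prop
      exact (this.log (norm_ne_zero_iff.mpr (sub_ne_zero.mpr ha))).neg
    refine hc.eventually (ge_mem_nhds ?_)
    show -Real.log ‖a - 1‖ < _
    rw [hn]
    linarith [neg_le_abs (Real.log ‖z₀ - 1‖)]
  have hle : ∀ z : ℂ, z ∈ Complex.slitPlane → z ≠ 1 →
      -Real.log ‖z - 1‖ ≤ |Real.log ‖z₀ - 1‖| + 1 → IsMild α β B z →
      hgt α β χ η z ≤ |k * (η + 1) / 2| * B + k * (|Real.log ‖z₀ - 1‖| + 1) := by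
    intro z hs hz hl hm
    rw [hgt_eq hw hz]
    have e1 := (mul_le_abs_mul (k * (η + 1) / 2) (Real.log ‖z‖)).trans
      (mul_le_mul_of_nonneg_left hm.log_le (abs_nonneg _))
    have e2 := mul_le_mul_of_nonneg_left hl (Nat.cast_nonneg (α := ℝ) k)
    have e3 := mul_nonneg hχ (logRho_pos hw hs hz).le
    linarith
  refine ⟨|k * (η + 1) / 2| * B + k * (|Real.log ‖z₀ - 1‖| + 1), ?_, ?_⟩
  · filter_upwards [(key z₀ hz1 rfl).filter_mono nhdsWithin_le_nhds, self_mem_nhdsWithin] with z hz him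
    exact hle z (mem_slitPlane_of_im_pos him) (ne_one_of_im_pos him) hz
  · filter_upwards [(key ((starRingEnd ℂ) z₀) hz1' (by
      rw [← Complex.norm_conj, map_sub, Complex.conj_conj, map_one])).filter_mono nhdsWithin_le_nhds,
      self_mem_nhdsWithin] with z hz him
    have him' : z.im < 0 := him
    exact hle z (mem_slitPlane_of_im_ne him'.ne) (fun h => by simp [h] at him') hz

theorem exists_rho_zpow_eq {ε : ℝ} (hε : ε = 1 ∨ ε = -1) (a : ℤ) : ∃ (H : ℂ → ℂ) (m : ℕ),
    DifferentiableOn ℂ H Complex.slitPlane ∧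
      ∀ z : ℂ, z ≠ 1 → rho α β ε z ^ a = H z / (z - 1) ^ m := by
  obtain ⟨m, rfl | rfl⟩ := a.eq_nat_or_neg
  · refine ⟨fun z => lam α β ε z ^ m, k * m, (lam_differentiableOn hw ε).pow m, fun z _ => ?_⟩
    rw [zpow_natCast, rho, div_pow, ← pow_mul]
  · refine ⟨fun z => lam α β (-ε) z ^ m, k * m, (lam_differentiableOn hw _).pow m, fun z hz => ?_⟩
    rw [zpow_neg, zpow_natCast, ← inv_pow, ← eq_inv_of_mul_eq_one_right (rho_mul hw hε hz), rho,
      div_pow, ← pow_mul]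

theorem exists_innerTerm_eq {χ η ε : ℝ} (hε : ε = 1 ∨ ε = -1) (κ' ζ' : ℤ) (n : ℕ) :
    ∃ m : ℕ, ∀ i j, ∃ H : ℂ → ℂ, DifferentiableOn ℂ H Complex.slitPlane ∧
      ∀ z ∈ Complex.slitPlane, z ≠ 1 →
        innerTerm α β χ η ε κ' ζ' n z i j = H z / (z - 1) ^ m := by
  obtain ⟨H, m, hH, h⟩ := exists_rho_zpow_eq hw hε ((n : ℤ) - localTime χ n κ')
  refine ⟨k * n + m, fun i j => ⟨fun z => z ^ (localHeight k η n ζ' + (k * n : ℕ)) * H z *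
    proj α β ε z i j, ((differentiableOn_id.zpow (Or.inl fun z hz => Complex.slitPlane_ne_zero hz)).mul hH).mul
      (continuousOn_proj hw hε i j), fun z hz h1 => ?_⟩⟩
  have h0 := Complex.slitPlane_ne_zero hz
  have h2 : z - 1 ≠ 0 := sub_ne_zero.mpr h1
  have e : z ^ (localHeight k η n ζ' + (k * n : ℕ)) =
      z ^ localHeight k η n ζ' * z ^ (k * n) := by rw [zpow_add₀ h0, zpow_natCast]
  show _ = z ^ (localHeight k η n ζ' + (k * n : ℕ)) * H z * proj α β ε z i j / _
  rw [innerTerm, Matrix.smul_apply, smul_eq_mul, h z h1, one_sub_inv_pow_mul h0, zpow_neg,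
    zpow_natCast, e, pow_add]
  field_simp

theorem innerTerm_mul_outerTerm {χ η ε : ℝ} (hε : ε = 1 ∨ ε = -1) (κ ζ κ' ζ' : ℤ) (n : ℕ) {z : ℂ}
    (hz : z ∈ Complex.slitPlane) (h1 : z ≠ 1) :
    innerTerm α β χ η ε κ' ζ' n z * outerTerm α β χ η κ ζ n z =
      (z ^ (ζ' - ζ - 1) * rho α β ε z ^ (κ - κ')) • proj α β ε z := by
  have h0 := Complex.slitPlane_ne_zero hz
  have h2 : (1 - z⁻¹) ^ (k * n) ≠ 0 := by
    refine pow_ne_zero _ (sub_ne_zero.mpr fun h => h1 ?_)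
    rw [← inv_inv z, ← h, inv_one]
  have hr := rho_ne_zero hw hε h1
  rw [innerTerm, outerTerm, Matrix.smul_mul, Matrix.mul_smul,
    proj_mul_Phi_zpow hw hε (discRoot_ne_zero hw hz) h0 h1, smul_smul, smul_smul]
  congr 1
  have e1 : z ^ (ζ' - ζ - 1) =
      z ^ localHeight k η n ζ' * (z ^ (localHeight k η n ζ + 1))⁻¹ := by
    rw [← zpow_neg, ← zpow_add₀ h0, localHeight, localHeight]
    congr 1
    ring
  have e2 : rho α β ε z ^ (κ - κ') = rho α β ε z ^ ((n : ℤ) - localTime χ n κ') *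
      rho α β ε z ^ (localTime χ n κ - (n : ℤ)) := by
    rw [← zpow_add₀ hr, localTime, localTime]
    congr 1
    ring
  rw [e1, e2]
  field_simp

end

end Aztec

end

noncomputable section

namespace Aztec

open Set

variable {k : ℕ} {α β : Fin k → ℝ}

/-! ### Convergence of the double integral -/

theorem IsSidePath.lt_norm {x₀ Y : ℝ} {θ : ℝ → ℝ} (h : IsSidePath x₀ 1 Y θ) {w : ℂ}
    (hw : w ∈ sideSet x₀ 1 Y θ) : Real.exp x₀ < ‖w‖ := by
  rcases hw with (⟨y, hy, rfl⟩ | ⟨y, hy, rfl⟩) | ⟨t, ht, rfl⟩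
  · rw [norm_leg]; exact Real.exp_lt_exp.mpr (by linarith [hy.1])
  · rw [norm_leg]; exact Real.exp_lt_exp.mpr (by linarith [hy.1])
  · rw [norm_arc]; exact Real.exp_lt_exp.mpr (by linarith [h.pos])

theorem IsSidePath.norm_lt {x₀ Y : ℝ} {θ : ℝ → ℝ} (h : IsSidePath x₀ (-1) Y θ) {w : ℂ}
    (hw : w ∈ sideSet x₀ (-1) Y θ) : ‖w‖ < Real.exp x₀ := by
  rcases hw with (⟨y, hy, rfl⟩ | ⟨y, hy, rfl⟩) | ⟨t, ht, rfl⟩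
  · rw [norm_leg]; exact Real.exp_lt_exp.mpr (by linarith [hy.1])
  · rw [norm_leg]; exact Real.exp_lt_exp.mpr (by linarith [hy.1])
  · rw [norm_arc]; exact Real.exp_lt_exp.mpr (by linarith [h.pos])

/-- The limit of the product of the inner and the outer factor at coinciding points. -/
def limitTerm (α β : Fin k → ℝ) (ε : ℝ) (κ ζ κ' ζ' : ℤ) (z : ℂ) : Matrix (Fin 2) (Fin 2) ℂ :=
  (z ^ (ζ' - ζ - 1) * rho α β ε z ^ (κ - κ')) • proj α β ε z

section

variable (hw : Admissible α β)
include hw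

theorem norm_limitTerm_le {ε B : ℝ} (hε : ε = 1 ∨ ε = -1) (κ ζ κ' ζ' : ℤ) {z : ℂ}
    (hz : z ∈ Complex.slitPlane) (h1 : z ≠ 1) (hB : IsMild α β B z) (i j : Fin 2) :
    ‖limitTerm α β ε κ ζ κ' ζ' z i j‖ ≤ Real.exp (|((ζ' - ζ - 1 : ℤ) : ℝ)| * B +
      |((κ - κ' : ℤ) : ℝ)| * B) * B := by
  have hL := logRho_pos hw hz h1
  have hproj : ‖proj α β ε z i j‖ ≤ B := by
    rcases hε with rfl | rfl
    · exact hB.proj_le i j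
    · exact hB.proj_neg_le i j
  have h0 : 0 < ‖z‖ := norm_pos_iff.mpr (Complex.slitPlane_ne_zero hz)
  rw [limitTerm, Matrix.smul_apply, smul_eq_mul, norm_mul, norm_mul, norm_rho_zpow hw hε hz h1,
    norm_zpow, ← Real.rpow_intCast, Real.rpow_def_of_pos h0, ← Real.exp_add]
  refine mul_le_mul (Real.exp_le_exp.mpr (add_le_add ?_ ?_)) hproj (norm_nonneg _)
    (Real.exp_pos _).le
  · rw [mul_comm]
    exact (mul_le_abs_mul _ _).trans (mul_le_mul_of_nonneg_left hB.log_le (abs_nonneg _))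
  · refine (mul_le_abs_mul _ _).trans (mul_le_mul_of_nonneg_left ?_ (abs_nonneg _))
    have hε1 : |ε| = 1 := by rcases hε with rfl | rfl <;> simp
    rw [abs_mul, hε1, one_mul, abs_of_pos hL]
    exact hB.logRho_le

theorem differentiableOn_limitTerm {ε : ℝ} (hε : ε = 1 ∨ ε = -1) (κ ζ κ' ζ' : ℤ) (i j : Fin 2) :
    DifferentiableOn ℂ (fun z => limitTerm α β ε κ ζ κ' ζ' z i j) (Complex.slitPlane \ {1}) := by
  have h1 : DifferentiableOn ℂ (fun z : ℂ => z ^ (ζ' - ζ - 1)) (Complex.slitPlane \ {1}) :=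
    differentiableOn_id.zpow (Or.inl fun z hz => Complex.slitPlane_ne_zero hz.1)
  have h2 : DifferentiableOn ℂ (rho α β ε) (Complex.slitPlane \ {1}) :=
    ((lam_differentiableOn hw ε).mono sdiff_subset).div (by fun_prop) fun z hz =>
      pow_ne_zero _ (sub_ne_zero.mpr hz.2)
  exact (h1.mul (h2.zpow (Or.inl fun z hz => rho_ne_zero hw hε hz.2))).mul
    ((continuousOn_proj hw hε i j).mono sdiff_subset)

section Saddle

variable {χ η ε x₀ θ₀ : ℝ} (hε : ε = 1 ∨ ε = -1) (hχ : ε * χ = |χ|)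
  (hs : IsSaddle α β |χ| η x₀ θ₀)
  (hproj : ∃ C, ∀ᶠ z : ℂ in 𝓝[{z | 0 < z.im}] (polar x₀ θ₀), ∀ i j, ‖proj α β 1 z i j‖ ≤ C)

/-- The integrand of the inner integral, once the outer integral has been evaluated. -/
def innerIntegrand (α β : Fin k → ℝ) (χ η ε : ℝ) (κ' ζ' : ℤ) (n : ℕ) (i : Fin 2)
    (s : Fin 2 → Finset ℤ) (c : Fin 2 → ℤ → ℂ) (w : ℂ) : ℂ :=
  ∑ l, innerTerm α β χ η ε κ' ζ' n w i l * regularPart (s l) (c l) w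

include hε in
theorem exists_innerIntegrand_eq (κ' ζ' : ℤ) (n : ℕ) (i : Fin 2) (s : Fin 2 → Finset ℤ)
    (c : Fin 2 → ℤ → ℂ) : ∃ (H : ℂ → ℂ) (m : ℕ), DifferentiableOn ℂ H Complex.slitPlane ∧
      ∀ z ∈ Complex.slitPlane, z ≠ 1 →
        innerIntegrand α β χ η ε κ' ζ' n i s c z = H z / (z - 1) ^ m := by
  obtain ⟨m, hm⟩ := exists_innerTerm_eq hw (χ := χ) (η := η) hε κ' ζ' n
  choose H hH hHe using hm i
  refine ⟨fun z => ∑ l, H l z * regularPart (s l) (c l) z, m,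
    DifferentiableOn.fun_sum fun l _ => (hH l).mul ((differentiableOn_regularPart _ _).mono
      fun z hz => Complex.slitPlane_ne_zero hz), fun z hz h1 => ?_⟩
  rw [innerIntegrand, Finset.sum_div]
  refine Finset.sum_congr rfl fun l _ => ?_
  rw [hHe l z hz h1]
  ring

include hε hχ in
theorem exists_eventually_innerIntegrand_le {B : ℝ} (hB0 : 0 ≤ B) (h0 : 0 < θ₀) (h1 : θ₀ ≤ Real.pi)
    (hBp : ∀ᶠ z : ℂ in 𝓝[{z | 0 < z.im}] (polar x₀ θ₀), IsMild α β B z)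
    (hBm : ∀ᶠ z : ℂ in 𝓝[{z | z.im < 0}] ((starRingEnd ℂ) (polar x₀ θ₀)), IsMild α β B z)
    (κ' ζ' : ℤ) (n : ℕ) (i : Fin 2) (s : Fin 2 → Finset ℤ) (c : Fin 2 → ℤ → ℂ) : ∃ C,
    (∀ᶠ z : ℂ in 𝓝[{z | 0 < z.im}] (polar x₀ θ₀),
      ‖innerIntegrand α β χ η ε κ' ζ' n i s c z‖ ≤ C) ∧
    ∀ᶠ z : ℂ in 𝓝[{z | z.im < 0}] ((starRingEnd ℂ) (polar x₀ θ₀)),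
      ‖innerIntegrand α β χ η ε κ' ζ' n i s c z‖ ≤ C := by
  obtain ⟨H, hHp, hHm⟩ := exists_eventually_hgt_le hw (η := η) (B := B) (abs_nonneg χ) h0 h1
    (x₀ := x₀)
  set A := Real.exp (n * H) *
    (Real.exp ((1 + |(ζ' : ℝ)|) * B + (1 + |(κ' : ℝ)|) * B) * B) with hA
  have hA0 : 0 ≤ A := by positivity
  have key : ∀ a : ℂ, a ≠ 0 → ∀ᶠ z in 𝓝 a, z ∈ Complex.slitPlane → z ≠ 1 → IsMild α β B z →
      hgt α β |χ| η z ≤ H → ‖innerIntegrand α β χ η ε κ' ζ' n i s c z‖ ≤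
        ∑ l, A * (‖regularPart (s l) (c l) a‖ + 1) := by
    intro a ha
    have hreg : ∀ l, ∀ᶠ z in 𝓝 a, ‖regularPart (s l) (c l) z‖ ≤ ‖regularPart (s l) (c l) a‖ + 1 :=
      fun l => (((differentiableOn_regularPart (s l) (c l)).differentiableAt
        (isOpen_compl_singleton.mem_nhds ha)).continuousAt.norm.tendsto).eventually
          (ge_mem_nhds (by linarith))
    filter_upwards [eventually_all.mpr hreg] with z hz hsl hz1 hm hH
    refine (norm_sum_le _ _).trans (Finset.sum_le_sum fun l _ => ?_)
    rw [norm_mul]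
    refine mul_le_mul ((norm_innerTerm_le hw hε hχ κ' ζ' n hsl hz1 hm i l).trans ?_) (hz l)
      (norm_nonneg _) hA0
    exact mul_le_mul_of_nonneg_right (Real.exp_le_exp.mpr
      (mul_le_mul_of_nonneg_left hH (Nat.cast_nonneg _))) (by positivity)
  have ha0 : polar x₀ θ₀ ≠ 0 := Complex.exp_ne_zero _
  refine ⟨max (∑ l, A * (‖regularPart (s l) (c l) (polar x₀ θ₀)‖ + 1))
    (∑ l, A * (‖regularPart (s l) (c l) ((starRingEnd ℂ) (polar x₀ θ₀))‖ + 1)), ?_, ?_⟩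
  · filter_upwards [(key _ ha0).filter_mono nhdsWithin_le_nhds, hBp, hHp, self_mem_nhdsWithin]
      with z h2 h3 h4 h5
    exact le_max_of_le_left (h2 (mem_slitPlane_of_im_pos h5) (ne_one_of_im_pos h5) h3 (h4 h3))
  · filter_upwards [(key _ (by simp)).filter_mono nhdsWithin_le_nhds, hBm, hHm,
      self_mem_nhdsWithin] with z h2 h3 h4 h5
    have h5' : z.im < 0 := h5
    exact le_max_of_le_right (h2 (mem_slitPlane_of_im_ne h5'.ne) (fun h => by simp [h] at h5') h3
      (h4 h3))

include hε hχ hs hproj in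
theorem tendsto_integral_innerIntegrand {Y : ℝ} {θ : ℝ → ℝ} (hp : IsSidePath x₀ 1 Y θ)
    (hθ : θ 0 = θ₀) (hle : ∀ z ∈ sideSet x₀ 1 Y θ,
      hgt α β |χ| η z ≤ hgt α β |χ| η (polar x₀ θ₀)) {γ : ℝ → ℂ} (hγ : IsContourOne γ)
    (κ ζ κ' ζ' : ℤ) (i j : Fin 2) {s : ℕ → Fin 2 → Finset ℤ} {c : ℕ → Fin 2 → ℤ → ℂ}
    (hsc : ∀ l, ∀ᶠ n in atTop, ∀ z : ℂ, z ≠ 0 → z ≠ 1 →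
      outerTerm α β χ η κ ζ n z l j = ∑ m ∈ s n l, c n l m * z ^ m) :
    Tendsto (fun n => pathIntegral γ (innerIntegrand α β χ η ε κ' ζ' n i (s n) (c n))) atTop
      (𝓝 (sideIntegral x₀ 1 Y θ fun z => limitTerm α β ε κ ζ κ' ζ' z i j)) := by
  subst hθ
  obtain ⟨θ', Y', hm, hθ', hle'⟩ := hs.exists_isSidePath hw (σ := -1) (Or.inr rfl)
  obtain ⟨B, hB0, hBp, hBm⟩ := eventually_isMild hw hs.theta_pos hs.theta_le hproj
  obtain ⟨B₁, hB₁⟩ := hp.exists_isMild hw hBp hBm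
  obtain ⟨B₂, hB₂⟩ := hm.exists_isMild hw (hθ'.symm ▸ hBp) (hθ'.symm ▸ hBm)
  set B' := max 0 (max B₁ B₂) with hB'
  have hB'0 : 0 ≤ B' := le_max_left _ _
  set h₀ := hgt α β |χ| η (polar x₀ (θ 0)) with hh₀
  set A := Real.exp ((1 + |(ζ' : ℝ)|) * B' + (1 + |(κ' : ℝ)|) * B') * B' with hA
  have hA0 : 0 ≤ A := by positivity
  set S := fun n => innerIntegrand α β χ η ε κ' ζ' n i (s n) (c n) with hS
  set g := fun z => limitTerm α β ε κ ζ κ' ζ' z i j with hg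
  have hgd := differentiableOn_limitTerm hw hε κ ζ κ' ζ' i j
  obtain ⟨K₁, hK₁, hI₁⟩ := hp.exists_norm_integral_le
  obtain ⟨K₂, hK₂, hI₂⟩ := hm.exists_norm_integral_le
  -- the sum over the intermediate index
  have hsum : ∀ (n : ℕ) (w : ℂ) (δ q : ℝ), 0 ≤ δ * q → w ∈ Complex.slitPlane → w ≠ 1 → IsMild α β B' w →
      hgt α β |χ| η w ≤ h₀ → ∀ P : Fin 2 → ℂ, (∀ l, ‖P l‖ ≤ Real.exp (-(n * h₀)) * (δ * q)) →
      ‖∑ l, innerTerm α β χ η ε κ' ζ' n w i l * P l‖ ≤ 2 * A * δ * q := by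
    intro n w δ q hδq hsl hw1 hmild hh P hP
    refine (norm_sum_le _ _).trans ?_
    have : ∀ l ∈ Finset.univ, ‖innerTerm α β χ η ε κ' ζ' n w i l * P l‖ ≤ A * (δ * q) := by
      intro l _
      rw [norm_mul]
      have h1 := (norm_innerTerm_le hw (η := η) hε hχ κ' ζ' n hsl hw1 hmild i l).trans
        (mul_le_mul_of_nonneg_right (Real.exp_le_exp.mpr
          (mul_le_mul_of_nonneg_left hh (Nat.cast_nonneg n))) hA0)
      refine (mul_le_mul h1 (hP l) (norm_nonneg _) (by positivity)).trans_eq ?_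
      have h2 : Real.exp (n * h₀) * Real.exp (-(n * h₀)) = 1 := by
        rw [← Real.exp_add, add_neg_cancel, Real.exp_zero]
      linear_combination A * (δ * q) * h2
    refine (Finset.sum_le_sum this).trans_eq ?_
    simp only [Finset.sum_const, Finset.card_univ, Fintype.card_fin, nsmul_eq_mul]
    push_cast
    ring
  have hsplit : ∀ n, pathIntegral γ (S n) =
      sideIntegral x₀ 1 Y θ g + sideIntegral x₀ 1 Y θ (fun z => S n z - g z) -
        sideIntegral x₀ (-1) Y' θ' (S n) := by
    intro n
    obtain ⟨H, m, hH, hHe⟩ := exists_innerIntegrand_eq hw (χ := χ) (η := η) hε κ' ζ' n i (s n) (c n)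
    obtain ⟨C, hCp, hCm⟩ := exists_eventually_innerIntegrand_le hw (η := η) hε hχ hB0 hs.theta_pos
      hs.theta_le hBp hBm κ' ζ' n i (s n) (c n)
    have hSc : ContinuousOn (S n) (Complex.slitPlane \ {1}) := by
      have : ContinuousOn (fun z => H z / (z - 1) ^ m) (Complex.slitPlane \ {1}) :=
        (hH.continuousOn.mono sdiff_subset).div (by fun_prop) fun z hz =>
          pow_ne_zero _ (sub_ne_zero.mpr hz.2)
      exact this.congr fun z hz => hHe z hz.1 hz.2
    have hsub : sideSet x₀ 1 Y θ ⊆ Complex.slitPlane \ {1} := fun z hz =>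
      ⟨hp.subset_slitPlane hz, hp.ne_one hz⟩
    obtain ⟨M, hM⟩ := hp.exists_bound hSc hCp hCm
    rw [hp.integral_sub (hSc.mono hsub) (hgd.continuousOn.mono hsub) hM fun z hz =>
      norm_limitTerm_le hw hε κ ζ κ' ζ' (hp.subset_slitPlane hz) (hp.ne_one hz) (hB₁ z hz) i j,
      hγ.integral_eq_sub hp hm rfl hθ' hH m hHe hCp hCm]
    ring
  rw [Metric.tendsto_nhds]
  intro e he
  set δ := e / (2 * (K₁ + K₂) * A + 1) with hδ
  have hden : 0 < 2 * (K₁ + K₂) * A + 1 := by positivity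
  have hδ0 : 0 < δ := div_pos he hden
  have hev := fun l => eventually_norm_circleIntegral_outerTerm_le hw hs hproj κ ζ l j
    (s := fun n => s n l) (c := fun n => c n l) (hsc l) hδ0
  filter_upwards [eventually_all.mpr hsc, eventually_all.mpr hev] with n hn hcirc
  have hpi : (0 : ℝ) < ‖(2 * Real.pi * Complex.I : ℂ)‖ := norm_pos_iff.mpr Complex.two_pi_I_ne_zero
  have hpi1 : 1 ≤ ‖(2 * Real.pi * Complex.I : ℂ)‖ := by
    rw [norm_mul, norm_mul, Complex.norm_I, mul_one, Complex.norm_ofNat, Complex.norm_real,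
      Real.norm_of_nonneg Real.pi_pos.le]
    linarith [Real.pi_gt_three]
  have hdrop : ∀ x : ℂ, ‖x‖ ≤ ‖2 * Real.pi * Complex.I * x‖ := fun x => by
    rw [norm_mul]
    exact le_mul_of_one_le_left (norm_nonneg _) hpi1
  have hb₁ : ‖sideIntegral x₀ 1 Y θ (fun z => S n z - g z)‖ ≤ K₁ * (2 * A * δ) := by
    refine hI₁ _ _ (by positivity) fun w hwm => ?_
    have hsl := hp.subset_slitPlane hwm
    have hw1 := hp.ne_one hwm
    have hw0 := Complex.slitPlane_ne_zero hsl
    have hd : S n w - g w = ∑ l, innerTerm α β χ η ε κ' ζ' n w i l *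
        (regularPart (s n l) (c n l) w - ∑ m ∈ s n l, c n l m * w ^ m) := by
      have h1 : g w = ∑ l, innerTerm α β χ η ε κ' ζ' n w i l * ∑ m ∈ s n l, c n l m * w ^ m := by
        have h2 := congrFun (congrFun (innerTerm_mul_outerTerm hw (χ := χ) (η := η) hε κ ζ κ' ζ' n
          hsl hw1) i) j
        rw [Matrix.mul_apply] at h2
        rw [hg]
        refine (Eq.trans ?_ h2.symm).trans ?_
        · rfl
        · exact Finset.sum_congr rfl fun l _ => by rw [hn l w hw0 hw1]
      rw [h1, hS]
      simp only [innerIntegrand, mul_sub, Finset.sum_sub_distrib]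
    rw [hd]
    refine hsum n w δ _ (by positivity) hsl hw1 ((hB₁ w hwm).mono
      ((le_max_left _ _).trans (le_max_right _ _))) (hle w hwm) _ fun l => ?_
    refine (hdrop _).trans ?_
    rw [← circleIntegral_eq_regularPart_sub (Real.exp_pos _) hw0 (hp.lt_norm hwm)]
    exact hcirc l w hw0 (hp.norm_ne hwm)
  have hb₂ : ‖sideIntegral x₀ (-1) Y' θ' (S n)‖ ≤ K₂ * (2 * A * δ) := by
    refine hI₂ _ _ (by positivity) fun w hwm => ?_
    have hsl := hm.subset_slitPlane hwm
    have hw1 := hm.ne_one hwm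
    have hw0 := Complex.slitPlane_ne_zero hsl
    refine hsum n w δ _ (by positivity) hsl hw1 ((hB₂ w hwm).mono
      ((le_max_right _ _).trans (le_max_right _ _))) (hle' w hwm) _ fun l => ?_
    refine (hdrop _).trans ?_
    rw [← circleIntegral_eq_regularPart (Real.exp_pos _) hw0 (hm.norm_lt hwm)]
    exact hcirc l w hw0 (hm.norm_ne hwm)
  rw [dist_eq_norm]
  show ‖pathIntegral γ (S n) - sideIntegral x₀ 1 Y θ g‖ < e
  rw [hsplit, add_sub_assoc, add_sub_cancel_left]
  refine ((norm_sub_le _ _).trans (add_le_add hb₁ hb₂)).trans_lt ?_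
  have : e = δ * (2 * (K₁ + K₂) * A + 1) := (div_mul_cancel₀ _ hden.ne').symm
  rw [this]
  linarith

end Saddle

end

end Aztec

end

noncomputable section

namespace Aztec

open Set

variable {k : ℕ} {α β : Fin k → ℝ}

/-! ### The residue term for non-positive times -/

theorem exists_polynomial_of_laurent (s : Finset ℤ) (c : ℤ → ℂ) {T : ℕ}
    (hT : ∀ m ∈ s, -(T : ℤ) ≤ m) :
    ∃ Q : ℂ[X], ∀ z : ℂ, z ≠ 0 → ∑ m ∈ s, c m * z ^ m = Q.eval z / z ^ T := by
  refine ⟨∑ m ∈ s, C (c m) * X ^ (m + T).toNat, fun z hz => ?_⟩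
  rw [Polynomial.eval_finsetSum, Finset.sum_div]
  refine Finset.sum_congr rfl fun m hm => ?_
  have h : ((m + T).toNat : ℤ) = m + T := Int.toNat_of_nonneg (by linarith [hT m hm])
  rw [Polynomial.eval_mul, Polynomial.eval_C, Polynomial.eval_pow, Polynomial.eval_X, mul_div_assoc,
    ← zpow_natCast, h, zpow_add₀ hz, zpow_natCast, mul_div_cancel_right₀ _ (pow_ne_zero _ hz)]

/-- The sum of the inner factors over the two sheets. -/
def fullTerm (α β : Fin k → ℝ) (χ η : ℝ) (κ' ζ' : ℤ) (n : ℕ) (w : ℂ) : Matrix (Fin 2) (Fin 2) ℂ :=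
  (w ^ localHeight k η n ζ' / (1 - w⁻¹) ^ (k * n)) • Phi α β w ^ ((n : ℤ) - localTime χ n κ')

theorem integral_eq_zero_of_two_poles {P : ℂ[X]} {a b : ℂ} (hab : a ≠ b) {m n : ℕ}
    (hlim : Tendsto (fun z : ℂ => z * (P.eval z / ((z - a) ^ m * (z - b) ^ n)))
      (Bornology.cobounded ℂ) (𝓝 0)) {γ : ℝ → ℂ} (hγ : IsLoop γ) (ha : Encircles γ a)
    (hb : Encircles γ b) :
    pathIntegral γ (fun z => P.eval z / ((z - a) ^ m * (z - b) ^ n)) = 0 := by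
  obtain ⟨c, c', h⟩ := exists_integral_eq_of_two_poles P hab m n
  rw [h γ hγ ha.1 hb.1, ha.2, hb.2]
  refine norm_le_zero_iff.mp (le_of_forall_pos_le_add fun e he => ?_)
  have he' : 0 < e / (2 * Real.pi) := by positivity
  have hev := hlim.norm.eventually (ge_mem_nhds (by rw [norm_zero]; exact he'))
  rw [← comap_norm_atTop, eventually_comap] at hev
  obtain ⟨r, hr, hra⟩ := (hev.and (eventually_gt_atTop (max ‖a‖ ‖b‖))).exists
  have hra' := (le_max_left _ _).trans_lt hra
  have hrb' := (le_max_right _ _).trans_lt hra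
  have hr0 : 0 < r := (norm_nonneg _).trans_lt hra'
  have hmem : ∀ z : ℂ, ‖z‖ < r → z ∉ curveImage (circ r) := fun z hz hm =>
    hz.ne (norm_of_mem_curveImage_circ hr0.le hm)
  have hc := h (circ r) (isLoop_circ r) (hmem a hra') (hmem b hrb')
  rw [windingNumber_circ_of_lt hra', windingNumber_circ_of_lt hrb', pathIntegral_circ] at hc
  rw [← hc, zero_add]
  refine (circleIntegral.norm_integral_le_of_norm_le_const hr0.le (C := e / (2 * Real.pi) / r)
    fun z hz => ?_).trans_eq (by field_simp)
  have hz' : ‖z‖ = r := by simpa using hz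
  have := hr z hz'
  rw [norm_mul, hz'] at this
  rwa [le_div_iff₀ hr0, mul_comm]

section

variable (hw : Admissible α β)
include hw

omit hw in
theorem exists_tendsto_Phi : ∃ M, Tendsto (Phi α β) (Bornology.cobounded ℂ) (𝓝 M) := by
  set Ψ : ℂ → Matrix (Fin 2) (Fin 2) ℂ := fun u => ((1 - u) ^ k)⁻¹ •
    ((List.finRange k).map fun m => !![1, (α m : ℂ) * u; (α m : ℂ)⁻¹, 1] *
      !![1, (β m : ℂ) * u; (β m : ℂ)⁻¹, 1]).prod with hΨ
  have hc : ∀ a : ℂ, Continuous fun u : ℂ => !![1, a * u; a⁻¹, 1] := fun a => by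
    refine continuous_matrix fun i j => ?_
    fin_cases i <;> fin_cases j <;> simp <;> fun_prop
  have h1 : ContinuousAt Ψ 0 := by
    refine ContinuousAt.smul (f := fun u : ℂ => ((1 - u) ^ k)⁻¹)
      (ContinuousAt.inv₀ (by fun_prop) (by simp)) (Continuous.continuousAt ?_)
    exact continuous_list_prod _ fun m _ => (hc _).mul (hc _)
  refine ⟨Ψ 0, (h1.tendsto.comp tendsto_inv₀_cobounded).congr fun z => ?_⟩
  simp only [hΨ, Function.comp_apply, Phi, List.ofFn_eq_map]

theorem exists_tendsto_Phi_zpow (a : ℤ) (i j : Fin 2) :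
    ∃ l, Tendsto (fun z => (Phi α β z ^ a) i j) (Bornology.cobounded ℂ) (𝓝 l) := by
  obtain ⟨M, hM⟩ := exists_tendsto_Phi (α := α) (β := β)
  have hev : ∀ᶠ z : ℂ in Bornology.cobounded ℂ, z ≠ 0 ∧ z ≠ 1 := by
    rw [← comap_norm_atTop]
    filter_upwards [tendsto_comap.eventually_gt_atTop (1 : ℝ)] with z hz
    constructor <;> rintro rfl <;> norm_num at hz
  have happ : ∀ {F : ℂ → Matrix (Fin 2) (Fin 2) ℂ} {L}, Tendsto F (Bornology.cobounded ℂ) (𝓝 L) →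
      Tendsto (fun z => F z i j) (Bornology.cobounded ℂ) (𝓝 (L i j)) := fun h =>
    ((continuous_apply_apply i j).tendsto _).comp h
  obtain ⟨m, rfl | rfl⟩ := a.eq_nat_or_neg
  · refine ⟨_, (happ (hM.pow m)).congr fun z => by rw [zpow_natCast]⟩
  · have h1 : Tendsto (fun z => (Phi α β z).adjugate ^ m) (Bornology.cobounded ℂ)
        (𝓝 (M.adjugate ^ m)) :=
      (((continuous_id.matrix_adjugate).tendsto M).comp hM).pow m
    refine ⟨_, (happ h1).congr' ?_⟩
    filter_upwards [hev] with z hz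
    rw [Matrix.zpow_neg_natCast, ← Matrix.inv_pow', Phi_inv hw hz.1 hz.2]

theorem exists_fullTerm_eq {χ η : ℝ} (κ' ζ' : ℤ) {n : ℕ}
    (hn : 0 ≤ localHeight k η n ζ' + (k * n : ℕ)) : ∃ (P : Fin 2 → Fin 2 → ℂ[X]) (M : ℕ),
      ∀ z : ℂ, z ≠ 0 → z ≠ 1 → ∀ i l,
        fullTerm α β χ η κ' ζ' n z i l = (P i l).eval z / (z - 1) ^ M := by
  obtain ⟨P, hP⟩ := exists_polynomial_Phi_zpow hw ((n : ℤ) - localTime χ n κ')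
  refine ⟨fun i l => X ^ (localHeight k η n ζ' + (k * n : ℕ)).toNat * P i l,
    k * n + k * ((n : ℤ) - localTime χ n κ').natAbs, fun z h0 h1 i l => ?_⟩
  have h2 : z - 1 ≠ 0 := sub_ne_zero.mpr h1
  have e : z ^ (localHeight k η n ζ' + (k * n : ℕ)).toNat =
      z ^ localHeight k η n ζ' * z ^ (k * n) := by
    rw [← zpow_natCast, Int.toNat_of_nonneg hn, zpow_add₀ h0, zpow_natCast]
  rw [fullTerm, Matrix.smul_apply, smul_eq_mul, hP z h0 h1, one_sub_inv_pow_mul h0, zpow_neg,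
    zpow_natCast, Polynomial.eval_mul, Polynomial.eval_pow, Polynomial.eval_X, e, pow_add]
  field_simp

theorem fullTerm_mul_outerTerm {χ η : ℝ} (κ ζ κ' ζ' : ℤ) (n : ℕ) {z : ℂ} (h0 : z ≠ 0) (h1 : z ≠ 1) :
    fullTerm α β χ η κ' ζ' n z * outerTerm α β χ η κ ζ n z =
      (z ^ (ζ' - ζ) / z) • Phi α β z ^ (κ - κ') := by
  have h2 : (1 - z⁻¹) ^ (k * n) ≠ 0 := by
    refine pow_ne_zero _ (sub_ne_zero.mpr fun h => h1 ?_)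
    rw [← inv_inv z, ← h, inv_one]
  have e1 : z ^ (ζ' - ζ) / z = z ^ localHeight k η n ζ' * (z ^ (localHeight k η n ζ + 1))⁻¹ := by
    rw [← zpow_neg, ← zpow_add₀ h0, div_eq_mul_inv, ← zpow_neg_one, ← zpow_add₀ h0, localHeight,
      localHeight]
    congr 1
    ring
  have e2 : Phi α β z ^ (κ - κ') = Phi α β z ^ ((n : ℤ) - localTime χ n κ') *
      Phi α β z ^ (localTime χ n κ - (n : ℤ)) := by
    rw [← Matrix.zpow_add (by rw [det_Phi hw h0 h1]; exact isUnit_one), localTime, localTime]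
    congr 1
    ring
  rw [fullTerm, outerTerm, Matrix.smul_mul, Matrix.mul_smul, smul_smul, e1, e2]
  congr 1
  field_simp

omit hw in
theorem eventually_localHeight (hk : 1 ≤ k) {η : ℝ} (hη : η ∈ Ioo (-1) 1) (ζ : ℤ) :
    ∀ᶠ n : ℕ in atTop, 0 ≤ localHeight k η n ζ + (k * n : ℕ) ∧ localHeight k η n ζ ≤ -1 := by
  have hk' : (1 : ℝ) ≤ k := by exact_mod_cast hk
  have h1 : Tendsto (fun n : ℕ => k * (η + 1) / 2 * (n : ℝ)) atTop atTop :=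
    tendsto_natCast_atTop_atTop.const_mul_atTop
      (by have := hη.1; exact div_pos (mul_pos (by linarith) (by linarith)) two_pos)
  have h2 : Tendsto (fun n : ℕ => k * (1 - η) / 2 * (n : ℝ)) atTop atTop :=
    tendsto_natCast_atTop_atTop.const_mul_atTop
      (by have := hη.2; exact div_pos (mul_pos (by linarith) (by linarith)) two_pos)
  filter_upwards [h1.eventually_ge_atTop (-(ζ : ℝ)), h2.eventually_ge_atTop (ζ + 2)] with n ha hb
  obtain ⟨e, he, h⟩ := exists_localHeight_eq k η n ζ
  constructor
  · have : (0 : ℝ) ≤ ((localHeight k η n ζ + (k * n : ℕ) : ℤ) : ℝ) := by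
      push_cast; rw [h]; linarith [he.1]
    exact_mod_cast this
  · have : (localHeight k η n ζ : ℝ) ≤ ((-1 : ℤ) : ℝ) := by push_cast; rw [h]; linarith [he.2]
    exact_mod_cast this

/-- The integral over the two sheets together is a single contour integral. -/
theorem integral_fullTerm {χ η : ℝ} (κ ζ κ' ζ' : ℤ) {n : ℕ}
    (hn : 0 ≤ localHeight k η n ζ' + (k * n : ℕ)) (hn' : localHeight k η n ζ' ≤ -1) (i j : Fin 2)
    {s : Fin 2 → Finset ℤ} {c : Fin 2 → ℤ → ℂ} (hsc : ∀ l, ∀ z : ℂ, z ≠ 0 → z ≠ 1 →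
      outerTerm α β χ η κ ζ n z l j = ∑ m ∈ s l, c l m * z ^ m) {γ₁ γ : ℝ → ℂ}
    (hγ₁ : IsLoop γ₁) (h₁0 : 0 ∉ curveImage γ₁) (h₁ : Encircles γ₁ 1) (hγ : IsLoop γ)
    (hγ0 : Encircles γ 0) (hγ1 : Encircles γ 1) :
    pathIntegral γ₁ (fun w => ∑ l, fullTerm α β χ η κ' ζ' n w i l * regularPart (s l) (c l) w) =
      pathIntegral γ (fun z => (Phi α β z ^ (κ - κ')) i j * z ^ (ζ' - ζ) / z) := by
  obtain ⟨P, M, hP⟩ := exists_fullTerm_eq hw (χ := χ) κ' ζ' hn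
  have hreg := fun l => exists_polynomial_of_laurent ((s l).filter (¬ · < 0)) (c l) (T := 0)
    fun m hm => by simpa using (Finset.mem_filter.mp hm).2
  choose Q hQ using hreg
  set T := ∑ l, ∑ m ∈ s l, m.natAbs with hT
  have hneg := fun l => exists_polynomial_of_laurent ((s l).filter (· < 0)) (c l) (T := T)
    fun m hm => by
      have h1 : m.natAbs ≤ T := (Finset.single_le_sum (f := Int.natAbs) (fun _ _ => Nat.zero_le _)
        (Finset.mem_filter.mp hm).1).trans (Finset.single_le_sum
          (f := fun l => ∑ m ∈ s l, m.natAbs) (fun _ _ => Nat.zero_le _) (Finset.mem_univ l))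
      omega
  choose Q' hQ' using hneg
  have hregular : ∀ z : ℂ, z ≠ 0 → z ≠ 1 →
      ∑ l, fullTerm α β χ η κ' ζ' n z i l * regularPart (s l) (c l) z =
        (∑ l, P i l * Q l).eval z / (z - 1) ^ M := fun z h0 h1 => by
    rw [Polynomial.eval_finsetSum, Finset.sum_div]
    refine Finset.sum_congr rfl fun l _ => ?_
    rw [hP z h0 h1, regularPart, hQ l z h0, Polynomial.eval_mul, pow_zero, div_one]
    ring
  have hnegative : ∀ z : ℂ, z ≠ 0 → z ≠ 1 →
      ∑ l, fullTerm α β χ η κ' ζ' n z i l * ∑ m ∈ s l with m < 0, c l m * z ^ m =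
        (∑ l, P i l * Q' l).eval z / ((z - 0) ^ T * (z - 1) ^ M) := fun z h0 h1 => by
    rw [Polynomial.eval_finsetSum, Finset.sum_div]
    refine Finset.sum_congr rfl fun l _ => ?_
    rw [hP z h0 h1, hQ' l z h0, Polynomial.eval_mul, sub_zero, div_mul_div_comm, mul_comm (z ^ T)]
  obtain ⟨a, F, hF⟩ := exists_residue_primitive isOpen_univ (z₀ := 0)
    ((convex_univ (𝕜 := ℝ)).starConvex (mem_univ _)) (mem_univ (1 : ℂ)) M
    (g := fun z => (∑ l, P i l * Q l).eval z) (Polynomial.differentiable _).differentiableOn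
  have hres : ∀ γ : ℝ → ℂ, IsLoop γ → 0 ∉ curveImage γ → Encircles γ 1 →
      ContinuousOn (fun z => (∑ l, P i l * Q l).eval z / (z - 1) ^ M) (curveImage γ) ∧
      pathIntegral γ (fun w => ∑ l, fullTerm α β χ η κ' ζ' n w i l * regularPart (s l) (c l) w) =
        2 * Real.pi * Complex.I * a := by
    intro γ hγ h0 h1
    have hne : ∀ z ∈ curveImage γ, z ≠ 1 := fun z hz h => h1.1 (h ▸ hz)
    have hc : ContinuousOn (fun z => (∑ l, P i l * Q l).eval z / (z - 1) ^ M) (curveImage γ) :=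
      (Polynomial.continuous _).continuousOn.div (by fun_prop) fun z hz =>
        pow_ne_zero _ (sub_ne_zero.mpr (hne z hz))
    refine ⟨hc, ?_⟩
    rw [pathIntegral_congr fun z hz => hregular z (fun h => h0 (h ▸ hz)) (hne z hz),
      hγ.integral_eq_residue h1.1 hc fun z hz => hF z (mem_univ _) (hne z hz), h1.2, mul_one]
  rw [(hres γ₁ hγ₁ h₁0 h₁).2, ← (hres γ hγ hγ0.1 hγ1).2]
  have hne : ∀ z ∈ curveImage γ, z ≠ 0 ∧ z ≠ 1 := fun z hz =>
    ⟨fun h => hγ0.1 (h ▸ hz), fun h => hγ1.1 (h ▸ hz)⟩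
  have hzero : pathIntegral γ (fun z => (∑ l, P i l * Q' l).eval z /
      ((z - 0) ^ T * (z - 1) ^ M)) = 0 := by
    refine integral_eq_zero_of_two_poles zero_ne_one ?_ hγ hγ0 hγ1
    have hinv : Tendsto (fun z : ℂ => z⁻¹) (Bornology.cobounded ℂ) (𝓝 0) := tendsto_inv₀_cobounded
    have hpow : ∀ m : ℤ, m < 0 → Tendsto (fun z : ℂ => z ^ m) (Bornology.cobounded ℂ) (𝓝 0) := by
      intro m hm
      obtain ⟨p, hp⟩ := Int.eq_ofNat_of_zero_le (show 0 ≤ -m by omega)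
      obtain rfl : m = -(p : ℤ) := by omega
      have := hinv.pow p
      rw [zero_pow (by omega)] at this
      exact this.congr fun z => by rw [zpow_neg, zpow_natCast, inv_pow]
    have hfac : Tendsto (fun z : ℂ => ((1 - z⁻¹) ^ (k * n))⁻¹) (Bornology.cobounded ℂ) (𝓝 1) := by
      have := ((tendsto_const_nhds (x := (1 : ℂ))).sub hinv).pow (k * n) |>.inv₀ (by simp)
      simpa using this
    have hsum : Tendsto (fun z : ℂ => ∑ l, z ^ (localHeight k η n ζ' + 1) *
        ((1 - z⁻¹) ^ (k * n))⁻¹ * (Phi α β z ^ ((n : ℤ) - localTime χ n κ')) i l *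
        ∑ m ∈ s l with m < 0, c l m * z ^ m) (Bornology.cobounded ℂ) (𝓝 0) := by
      rw [show 𝓝 (0 : ℂ) = 𝓝 (∑ _l : Fin 2, (0 : ℂ)) by simp]
      refine tendsto_finsetSum _ fun l _ => ?_
      obtain ⟨L, hL⟩ := exists_tendsto_Phi_zpow hw ((n : ℤ) - localTime χ n κ') i l
      have hN : Tendsto (fun z : ℂ => ∑ m ∈ s l with m < 0, c l m * z ^ m)
          (Bornology.cobounded ℂ) (𝓝 0) := by
        rw [show 𝓝 (0 : ℂ) = 𝓝 (∑ _m ∈ s l with _m < 0, (0 : ℂ)) by simp]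
        refine tendsto_finsetSum _ fun m hm => ?_
        simpa using (hpow m (Finset.mem_filter.mp hm).2).const_mul (c l m)
      have hz : ∃ l, Tendsto (fun z : ℂ => z ^ (localHeight k η n ζ' + 1))
          (Bornology.cobounded ℂ) (𝓝 l) := by
        rcases (show localHeight k η n ζ' + 1 ≤ 0 by omega).lt_or_eq with h | h
        · exact ⟨0, hpow _ h⟩
        · exact ⟨1, by simp [h]⟩
      obtain ⟨l', hl'⟩ := hz
      simpa using ((hl'.mul hfac).mul hL).mul hN
    refine hsum.congr' ?_
    rw [← comap_norm_atTop]
    filter_upwards [tendsto_comap.eventually_gt_atTop (1 : ℝ)] with z hz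
    have h0 : z ≠ 0 := by rintro rfl; norm_num at hz
    have h1 : z ≠ 1 := by rintro rfl; norm_num at hz
    rw [← hnegative z h0 h1, Finset.mul_sum]
    refine Finset.sum_congr rfl fun l _ => ?_
    rw [fullTerm, Matrix.smul_apply, smul_eq_mul, zpow_add_one₀ h0]
    ring
  have hcneg : ContinuousOn (fun z => (∑ l, P i l * Q' l).eval z / ((z - 0) ^ T * (z - 1) ^ M))
      (curveImage γ) := (Polynomial.continuous _).continuousOn.div (by fun_prop) fun z hz =>
    mul_ne_zero (pow_ne_zero _ (sub_ne_zero.mpr (hne z hz).1))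
      (pow_ne_zero _ (sub_ne_zero.mpr (hne z hz).2))
  rw [pathIntegral_congr fun z hz => hregular z (hne z hz).1 (hne z hz).2,
    ← add_zero (pathIntegral γ fun z => (∑ l, P i l * Q l).eval z / (z - 1) ^ M), ← hzero,
    ← pathIntegral_add hγ.tame (hres γ hγ hγ0.1 hγ1).1 hcneg]
  refine pathIntegral_congr fun z hz => ?_
  obtain ⟨h0, h1⟩ := hne z hz
  rw [← hregular z h0 h1, ← hnegative z h0 h1, ← Finset.sum_add_distrib]
  have h2 := congrFun (congrFun (fullTerm_mul_outerTerm hw (χ := χ) (η := η) κ ζ κ' ζ' n h0 h1) i) j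
  rw [Matrix.mul_apply, Matrix.smul_apply, smul_eq_mul] at h2
  refine (Finset.sum_congr rfl fun l _ => ?_).trans (h2.trans (by ring))
  rw [hsc l z h0 h1, sum_eq_add_regularPart (s l)]
  ring

/-- The single integral does not depend on the contour. -/
theorem integral_Phi_zpow_eq (a b : ℤ) (i j : Fin 2) {γ γ' : ℝ → ℂ} (hγ : IsLoop γ)
    (hγ0 : Encircles γ 0) (hγ1 : Encircles γ 1) (hγ' : IsLoop γ') (hγ'0 : Encircles γ' 0)
    (hγ'1 : Encircles γ' 1) :
    pathIntegral γ (fun z => (Phi α β z ^ a) i j * z ^ b / z) =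
      pathIntegral γ' (fun z => (Phi α β z ^ a) i j * z ^ b / z) := by
  obtain ⟨P, hP⟩ := exists_polynomial_Phi_zpow hw a
  obtain ⟨c, c', h⟩ := exists_integral_eq_of_two_poles (P i j * X ^ b.toNat) (zero_ne_one' ℂ)
    ((-b).toNat + 1) (k * a.natAbs)
  have key : ∀ γ : ℝ → ℂ, IsLoop γ → Encircles γ 0 → Encircles γ 1 →
      pathIntegral γ (fun z => (Phi α β z ^ a) i j * z ^ b / z) =
        2 * Real.pi * Complex.I * (c + c') := by
    intro γ hγ h0 h1
    rw [← mul_one c, ← mul_one c']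
    nth_rw 1 [← h0.2]
    rw [← h1.2, ← h γ hγ h0.1 h1.1]
    refine pathIntegral_congr fun z hz => ?_
    have hz0 : z ≠ 0 := fun h => h0.1 (h ▸ hz)
    have hz1 : z ≠ 1 := fun h => h1.1 (h ▸ hz)
    have e : z ^ b = z ^ b.toNat / z ^ (-b).toNat := by
      rw [← zpow_natCast, ← zpow_natCast, ← zpow_sub₀ hz0]
      congr 1
      omega
    rw [hP z hz0 hz1, e, Polynomial.eval_mul, Polynomial.eval_pow, Polynomial.eval_X, sub_zero,
      pow_succ]
    have := sub_ne_zero.mpr hz1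
    field_simp
  rw [key γ hγ hγ0 hγ1, key γ' hγ' hγ'0 hγ'1]

end

end Aztec

end

noncomputable section
namespace Aztec
open Set
variable {k : ℕ} {α β : Fin k → ℝ}

/-! ### The limit of the kernel -/

section

variable (hw : Admissible α β)
include hw

theorem fullTerm_eq_add {χ η : ℝ} (κ' ζ' : ℤ) (n : ℕ) {w : ℂ} (hsl : w ∈ Complex.slitPlane)
    (h1 : w ≠ 1) : fullTerm α β χ η κ' ζ' n w =
      innerTerm α β χ η 1 κ' ζ' n w + innerTerm α β χ η (-1) κ' ζ' n w := by
  rw [fullTerm, innerTerm, innerTerm, Phi_zpow hw (Or.inl rfl) (discRoot_ne_zero hw hsl)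
    (Complex.slitPlane_ne_zero hsl) h1, smul_add, smul_smul, smul_smul]

theorem integral_innerIntegrand_add {χ η : ℝ} (κ ζ κ' ζ' : ℤ) {n : ℕ}
    (hn : 0 ≤ localHeight k η n ζ' + (k * n : ℕ)) (hn' : localHeight k η n ζ' ≤ -1) (i j : Fin 2)
    {s : Fin 2 → Finset ℤ} {c : Fin 2 → ℤ → ℂ} (hsc : ∀ l, ∀ z : ℂ, z ≠ 0 → z ≠ 1 →
      outerTerm α β χ η κ ζ n z l j = ∑ m ∈ s l, c l m * z ^ m) {γ₁ γ : ℝ → ℂ}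
    (hγ₁ : IsContourOne γ₁) (hγ : IsLoop γ) (hγ0 : Encircles γ 0) (hγ1 : Encircles γ 1) :
    pathIntegral γ₁ (innerIntegrand α β χ η 1 κ' ζ' n i s c) +
        pathIntegral γ₁ (innerIntegrand α β χ η (-1) κ' ζ' n i s c) =
      pathIntegral γ (fun z => (Phi α β z ^ (κ - κ')) i j * z ^ (ζ' - ζ) / z) := by
  have hmem : ∀ z ∈ curveImage γ₁, z ∈ Complex.slitPlane ∧ z ≠ 1 := fun z hz =>
    ⟨hγ₁.subset_slitPlane hz, fun h => hγ₁.around_one.1 (h ▸ hz)⟩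
  have hc : ∀ ε : ℝ, ε = 1 ∨ ε = -1 →
      ContinuousOn (innerIntegrand α β χ η ε κ' ζ' n i s c) (curveImage γ₁) := fun ε hε => by
    obtain ⟨H, m, hH, he⟩ := exists_innerIntegrand_eq hw (χ := χ) (η := η) hε κ' ζ' n i s c
    refine ContinuousOn.congr (f := fun z => H z / (z - 1) ^ m) ?_ fun z hz =>
      he z (hmem z hz).1 (hmem z hz).2
    exact (hH.continuousOn.mono hγ₁.subset_slitPlane).div (by fun_prop) fun z hz =>
      pow_ne_zero _ (sub_ne_zero.mpr (hmem z hz).2)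
  rw [← integral_fullTerm hw κ ζ κ' ζ' hn hn' i j hsc hγ₁.simple.isLoop hγ₁.zero_outside.1
    hγ₁.around_one hγ hγ0 hγ1,
    ← pathIntegral_add hγ₁.simple.isLoop.tame (hc 1 (Or.inl rfl)) (hc (-1) (Or.inr rfl))]
  refine pathIntegral_congr fun z hz => ?_
  simp only [innerIntegrand, fullTerm_eq_add hw κ' ζ' n (hmem z hz).1 (hmem z hz).2,
    Matrix.add_apply, add_mul, Finset.sum_add_distrib]

/-- The outer integral of the double contour integral. -/
theorem integral_outer {E : ℂ → Matrix (Fin 2) (Fin 2) ℂ} {χ η : ℝ} (κ ζ κ' ζ' : ℤ) {n : ℕ}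
    (i j : Fin 2) {s : Fin 2 → Finset ℤ} {c : Fin 2 → ℤ → ℂ} (hsc : ∀ l, ∀ z : ℂ, z ≠ 0 → z ≠ 1 →
      outerTerm α β χ η κ ζ n z l j = ∑ m ∈ s l, c l m * z ^ m) {γ : ℝ → ℂ} (hγ : IsLoop γ)
    (hγ0 : Encircles γ 0) (hγ1 : Encircles γ 1) {w : ℂ} (hγw : Encircles γ w)
    (hsl : w ∈ Complex.slitPlane) (hw1 : w ≠ 1) (hE : IsUnit (E w).det ∧
      Phi α β w = E w * Matrix.diagonal ![rho1 α β w, rho2 α β w] * (E w)⁻¹) :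
    pathIntegral γ (fun z =>
        w ^ localHeight k η n ζ' / z ^ (localHeight k η n ζ + 1) *
          ((1 - z⁻¹) ^ (k * n) / (1 - w⁻¹) ^ (k * n)) * rho1 α β w ^ ((n : ℤ) - localTime χ n κ') *
          (E w * !![1, 0; 0, 0] * (E w)⁻¹ * Phi α β z ^ (localTime χ n κ - (n : ℤ)) :
            Matrix (Fin 2) (Fin 2) ℂ) i j / (z - w)) =
      2 * Real.pi * Complex.I * innerIntegrand α β χ η 1 κ' ζ' n i s c w := by
  have hw0 : w ≠ 0 := Complex.slitPlane_ne_zero hsl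
  have hsum : ∀ l, ContinuousOn (fun z => innerTerm α β χ η 1 κ' ζ' n w i l *
      ((∑ m ∈ s l, c l m * z ^ m) / (z - w))) (curveImage γ) := fun l => by
    refine continuousOn_const.mul (ContinuousOn.div ?_ (by fun_prop) fun z hz =>
      sub_ne_zero.mpr fun h => hγw.1 (h ▸ hz))
    exact continuousOn_finsetSum _ fun m _ => continuousOn_const.mul
      (continuousOn_id.zpow₀ m fun z hz => Or.inl fun h => hγ0.1 (h ▸ hz))
  rw [pathIntegral_congr (g := fun z => ∑ l, innerTerm α β χ η 1 κ' ζ' n w i l *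
      ((∑ m ∈ s l, c l m * z ^ m) / (z - w))) fun z hz => ?_,
    pathIntegral_sum hγ.tame _ fun l _ => hsum l, innerIntegrand, Finset.mul_sum]
  · refine Finset.sum_congr rfl fun l _ => ?_
    rw [pathIntegral_const_mul, hγ.integral_eq_regularPart hγ0 hw0 hγw]
    ring
  · have hz0 : z ≠ 0 := fun h => hγ0.1 (h ▸ hz)
    have hz1 : z ≠ 1 := fun h => hγ1.1 (h ▸ hz)
    rw [(eigenvectorMatrix_conj hw hsl hw1 hE.1 hE.2).1, (rho_eq hw hsl hw1).1, Matrix.mul_apply,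
      Finset.mul_sum, Finset.sum_div]
    refine Finset.sum_congr rfl fun l _ => ?_
    rw [← hsc l z hz0 hz1, innerTerm, outerTerm, Matrix.smul_apply, Matrix.smul_apply, smul_eq_mul,
      smul_eq_mul]
    ring

theorem tendsto_integral_sheet {χ η : ℝ} (hχη : (χ, η) ∈ roughRegion α β) {γ₁ γ γz : ℝ → ℂ}
    (hγ₁ : IsContourOne γ₁) (hγ : IsLoop γ) (hγ0 : Encircles γ 0) (hγ1 : Encircles γ 1)
    (hγz : IsArc (L α β χ η).1 γz) (κ ζ κ' ζ' : ℤ) (i j : Fin 2) {s : ℕ → Fin 2 → Finset ℤ}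
    {c : ℕ → Fin 2 → ℤ → ℂ} (hsc : ∀ l, ∀ᶠ n in atTop, ∀ z : ℂ, z ≠ 0 → z ≠ 1 →
      outerTerm α β χ η κ ζ n z l j = ∑ m ∈ s n l, c n l m * z ^ m) :
    Tendsto (fun n => pathIntegral γ₁ (innerIntegrand α β χ η 1 κ' ζ' n i (s n) (c n))) atTop
      (𝓝 ((if χ ≤ 0 then 1 else 0) *
          pathIntegral γ (fun z => (Phi α β z ^ (κ - κ')) i j * z ^ (ζ' - ζ) / z) +
        pathIntegral γz (fun z =>
          limitTerm α β (if χ ≤ 0 then -1 else 1) κ ζ κ' ζ' z i j))) := by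
  obtain ⟨x₀, θ₀, hs, hLpos, hLneg, hproj⟩ := exists_isSaddle_L hw hχη
  obtain ⟨θ, Y, hp, hθ, hle⟩ := hs.exists_isSidePath hw (σ := 1) (Or.inl rfl)
  obtain ⟨B, hB0, hBp, hBm⟩ := eventually_isMild hw hs.theta_pos hs.theta_le hproj
  have hlim := fun (ε : ℝ) (hε : ε = 1 ∨ ε = -1) (hχ : ε * χ = |χ|) =>
    tendsto_integral_innerIntegrand hw hε hχ hs hproj hp hθ hle hγ₁ κ ζ κ' ζ' i j hsc
  have hbp : ∀ ε : ℝ, ε = 1 ∨ ε = -1 → ∃ C,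
      (∀ᶠ z : ℂ in 𝓝[{z | 0 < z.im}] (polar x₀ θ₀), ‖limitTerm α β ε κ ζ κ' ζ' z i j‖ ≤ C) ∧
      ∀ᶠ z : ℂ in 𝓝[{z | z.im < 0}] ((starRingEnd ℂ) (polar x₀ θ₀)),
        ‖limitTerm α β ε κ ζ κ' ζ' z i j‖ ≤ C := fun ε hε => by
    refine ⟨Real.exp (|((ζ' - ζ - 1 : ℤ) : ℝ)| * B + |((κ - κ' : ℤ) : ℝ)| * B) * B, ?_, ?_⟩
    · filter_upwards [hBp, self_mem_nhdsWithin] with z h1 (h2 : 0 < z.im)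
      exact norm_limitTerm_le hw hε κ ζ κ' ζ' (mem_slitPlane_of_im_pos h2) (ne_one_of_im_pos h2) h1
        i j
    · filter_upwards [hBm, self_mem_nhdsWithin] with z h1 (h2 : z.im < 0)
      exact norm_limitTerm_le hw hε κ ζ κ' ζ' (mem_slitPlane_of_im_ne h2.ne)
        (fun h => by simp [h] at h2) h1 i j
  subst hθ
  rcases lt_or_ge 0 χ with hχ | hχ
  · obtain ⟨C, h1, h2⟩ := hbp 1 (Or.inl rfl)
    have hθ : θ 0 ∈ Ioo 0 Real.pi := ⟨hs.theta_pos, hs.theta_le.lt_of_ne fun h =>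
      hχ.ne' (abs_eq_zero.mp (hs.eq_zero_of_theta_eq h))⟩
    rw [if_neg hχ.not_ge, if_neg hχ.not_ge, zero_mul, zero_add,
      IsArc.integral_eq_sideIntegral hp (differentiableOn_limitTerm hw (Or.inl rfl) κ ζ κ' ζ' i j)
        h1 h2 hθ (hLpos hχ ▸ hγz)]
    exact hlim 1 (Or.inl rfl) (by rw [one_mul, abs_of_pos hχ])
  · obtain ⟨C, h1, h2⟩ := hbp (-1) (Or.inr rfl)
    rw [if_pos hχ, if_pos hχ, one_mul, IsArc.integral_eq_neg_sideIntegral hp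
      (differentiableOn_limitTerm hw (Or.inr rfl) κ ζ κ' ζ' i j) h1 h2 ⟨hs.theta_pos, hs.theta_le⟩
      (hLneg hχ ▸ hγz), ← sub_eq_add_neg]
    refine ((hlim (-1) (Or.inr rfl) (by rw [neg_one_mul, abs_of_nonpos hχ])).const_sub _).congr' ?_
    filter_upwards [eventually_localHeight hw.one_le hχη.2.1 ζ', eventually_all.mpr hsc]
      with n hn hscn
    exact sub_eq_of_eq_add (integral_innerIntegrand_add hw κ ζ κ' ζ' hn.1 hn.2 i j hscn hγ₁ hγ hγ0
      hγ1).symm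

theorem integral_arc {E : ℂ → Matrix (Fin 2) (Fin 2) ℂ} (hE : IsEigenvectorMatrix α β E) {z₁ : ℂ}
    {γ : ℝ → ℂ} (hγ : IsArc z₁ γ) (χ : ℝ) (κ ζ κ' ζ' : ℤ) (i j : Fin 2) :
    pathIntegral γ (fun z => z ^ (ζ' - ζ) *
        (if χ ≤ 0 then rho2 α β z else rho1 α β z) ^ (κ - κ') *
          (E z * !![if 0 < χ then 1 else 0, 0; 0, if χ ≤ 0 then 1 else 0] * (E z)⁻¹ :
            Matrix (Fin 2) (Fin 2) ℂ) i j / z) =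
      pathIntegral γ (fun z => limitTerm α β (if χ ≤ 0 then -1 else 1) κ ζ κ' ζ' z i j) := by
  refine pathIntegral_congr_of_finite hγ.injOn_left hE fun t ht hS => ?_
  have hEt := not_not.mp hS
  obtain ⟨hsl, h1⟩ := sub_one_mem_slitPlane_subset (show γ t - 1 ∈ Complex.slitPlane by
    rcases eq_or_ne (γ t).im 0 with h | h
    · exact Or.inl (by simpa using hγ.real_points t ht h)
    · exact Or.inr (by simpa using h))
  have hc := eigenvectorMatrix_conj hw hsl h1 hEt.1 hEt.2
  have hr := rho_eq hw hsl h1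
  rw [limitTerm, Matrix.smul_apply, smul_eq_mul, zpow_sub_one₀ (Complex.slitPlane_ne_zero hsl)]
  rcases lt_or_ge 0 χ with hχ | hχ
  · simp only [if_neg hχ.not_ge, if_pos hχ, hc.1, hr.1]
    ring
  · simp only [if_neg hχ.not_gt, if_pos hχ, hc.2, hr.2]
    ring

end

end Aztec

end

/-- Local limit of the correlation kernel of the `2 × k`-periodic Aztec diamond in the rough
region. -/
theorem mainTheorem2 (k : ℕ) (hk : 1 ≤ k) (α β : Fin k → ℝ)
    (hα : ∀ m, 0 < α m) (hβ : ∀ m, 0 < β m) (hαβ : ∏ m, α m = ∏ m, β m)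
    (E : ℂ → Matrix (Fin 2) (Fin 2) ℂ) (hE : Aztec.IsEigenvectorMatrix α β E)
    (χ η : ℝ) (hχη : (χ, η) ∈ Aztec.roughRegion α β)
    (γ₁ γ₀₁ : ℝ → ℂ) (hγ₁ : Aztec.IsContourOne γ₁) (hγ₀₁ : Aztec.IsContourZeroOne γ₁ γ₀₁)
    (γ : ℝ → ℂ) (hγ : Aztec.IsSimpleClosed γ) (hγ0 : Aztec.Encircles γ 0)
    (hγ1 : Aztec.Encircles γ 1)
    (γz : ℝ → ℂ) (hγz : Aztec.IsArc (Aztec.L α β χ η).1 γz)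
    (κ ζ κ' ζ' : ℤ) :
    Tendsto (fun n : ℕ => Aztec.finiteKernel α β E γ₁ γ₀₁ n
        (Aztec.localTime χ n κ) (Aztec.localHeight k η n ζ)
        (Aztec.localTime χ n κ') (Aztec.localHeight k η n ζ'))
      atTop (𝓝 (Aztec.roughKernel α β E γ γz χ κ ζ κ' ζ')) := by
  have hw : Aztec.Admissible α β := ⟨hk, hα, hβ, hαβ⟩
  refine tendsto_pi_nhds.mpr fun i => tendsto_pi_nhds.mpr fun j => ?_
  have hχ : |χ| < 1 := abs_lt.mpr hχη.1
  choose s c hsc using fun l => Aztec.exists_laurent_outerTerm hw (η := η) hχ κ ζ l j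
  have hlim := Aztec.tendsto_integral_sheet hw hχη hγ₁ hγ.isLoop hγ0 hγ1 hγz κ ζ κ' ζ' i j
    (s := fun n l => s l n) (c := fun n l => c l n) hsc
  rw [← Aztec.integral_arc hw hE hγz χ κ ζ κ' ζ' i j] at hlim
  have hlim' := (hlim.const_mul (1 / (2 * Real.pi * Complex.I))).const_add
    (-((if κ' < κ then 1 else 0) / (2 * Real.pi * Complex.I)) *
      Aztec.pathIntegral γ (fun z => (Aztec.Phi α β z ^ (κ - κ')) i j * z ^ (ζ' - ζ) / z))
  refine (hlim'.congr' ?_).trans_eq (congrArg 𝓝 ?_)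
  · filter_upwards [eventually_all.mpr hsc] with n hn
    have hinner := Aztec.pathIntegral_congr_of_finite hγ₁.simple.injOn hE
      (f := fun w => Aztec.pathIntegral γ₀₁ (fun z =>
        w ^ Aztec.localHeight k η n ζ' / z ^ (Aztec.localHeight k η n ζ + 1) *
          ((1 - z⁻¹) ^ (k * n) / (1 - w⁻¹) ^ (k * n)) *
          Aztec.rho1 α β w ^ ((n : ℤ) - Aztec.localTime χ n κ') *
          (E w * !![1, 0; 0, 0] * (E w)⁻¹ * Aztec.Phi α β z ^ (Aztec.localTime χ n κ - (n : ℤ)) :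
            Matrix (Fin 2) (Fin 2) ℂ) i j / (z - w)))
      (g := fun w => 2 * Real.pi * Complex.I *
        Aztec.innerIntegrand α β χ η 1 κ' ζ' n i (fun l => s l n) (fun l => c l n) w)
      fun t ht hS => by
        have hm : γ₁ t ∈ Aztec.curveImage γ₁ := Aztec.mem_curveImage (Set.Ioo_subset_Icc_self ht)
        exact Aztec.integral_outer hw κ ζ κ' ζ' i j hn hγ₀₁.simple.isLoop hγ₀₁.around_zero
          hγ₀₁.around_one (hγ₀₁.around_curve _ hm) (hγ₁.subset_slitPlane hm)
          (fun h => hγ₁.around_one.1 (h ▸ hm)) (not_not.mp hS)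
    have e1 : Aztec.localTime χ n κ - Aztec.localTime χ n κ' = κ - κ' := by
      rw [Aztec.localTime, Aztec.localTime]; ring
    have e2 : Aztec.localHeight k η n ζ' - Aztec.localHeight k η n ζ = ζ' - ζ := by
      rw [Aztec.localHeight, Aztec.localHeight]; ring
    have e3 : (Aztec.localTime χ n κ' < Aztec.localTime χ n κ) ↔ κ' < κ := by
      rw [Aztec.localTime, Aztec.localTime]; omega
    simp only [Aztec.finiteKernel, Matrix.of_apply, hinner, Aztec.pathIntegral_const_mul, e1, e2,
      e3]
    rw [Aztec.integral_Phi_zpow_eq hw (κ - κ') (ζ' - ζ) i j hγ₀₁.simple.isLoop hγ₀₁.around_zero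
      hγ₀₁.around_one hγ.isLoop hγ0 hγ1]
    have hpi : (2 * Real.pi * Complex.I : ℂ) ≠ 0 := Complex.two_pi_I_ne_zero
    congr 1
    field_simp
  · simp only [Aztec.roughKernel, Matrix.of_apply]
    ring
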